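/- Conventions. All Hilbert spaces are complex and separable. Let $q\in\mathbb N_0$, $0\le\delta<\varrho\le1$, and $\langle\eta\rangle=(1+|\eta|^2)^{1/2}$ for $\eta\in\mathbb R^q$; $D=-i\partial$. Let $E,\tilde E$ be Hilbert spaces with strongly continuous group actions $\kappa,\tilde\kappa$ (representations $r\mapsto\kappa_r\in\mathscr L(E)$, $r\mapsto\tilde\kappa_r\in\mathscr L(\tilde E)$ of the multiplicative group $\mathbb R_+$ that are continuous in the strong operator topology). Let $\mathscr I$ be a Banach operator ideal in the category of Hilbert spaces: subsets $\mathscr I(E_0,E_1)\subset\mathscr L(E_0,E_1)$ that contain the finite-rank operators and are closed under sums and under $A\mapsto GAH$ for bounded $G,H$, each with a complete norm, such that $\|e'\otimes e\|_{\mathscr I}=\|e'\|\,\|e\|$ and $\|GAH\|_{\mathscr I}\le\|G\|\,\|A\|_{\mathscr I}\,\|H\|$. For $\mu_1,\mu_2,\mu_3\in\mathbb R$ let $S^{(\mu_1,\mu_2,\mu_3)}_{\varrho,\delta}(\mathbb R^{3q})$ be the space of all $a(y,y',\eta)\in C^\infty(\mathbb R^{q}\times\mathbb R^q\times\mathbb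 R^q,\mathscr I(E,\tilde E))$ such that for all multi-indices $\alpha,\beta,\gamma$ there is a constant $C$ with $$\|\tilde\kappa_{\langle\eta\rangle}^{-1}[D_y^\beta D_{y'}^\gamma\partial_\eta^\alpha a(y,y',\eta)]\kappa_{\langle\eta\rangle}\|_{\mathscr I(E,\tilde E)}\le C\langle y\rangle^{\mu_2}\langle y'\rangle^{\mu_3}\langle\eta\rangle^{\mu_1-\varrho|\alpha|+\delta(|\beta|+|\gamma|)}$$ for all $y,y',\eta$, and let $S^{(\mu_1,\mu_2)}_{\varrho,\delta}(\mathbb R^{2q})$ be the space of all $a(y,\eta)\in C^\infty(\mathbb R^q\times\mathbb R^q,\mathscr I(E,\tilde E))$ such that for all $\alpha,\beta$ there is a constant $C$ with $$\|\tilde\kappa_{\langle\eta\rangle}^{-1}[D_y^\beta\partial_\eta^\alpha a(y,\eta)]\kappa_{\langle\eta\rangle}\|_{\mathscr I(E,\tilde E)}\le C\langle y\rangle^{\mu_2}\langle\eta\rangle^{\mu_1-\varrho|\alpha|+\delta|\beta|}$$ for all $y,\eta$, with the topology given by the best constants $C=C_{\alpha,\beta}$ as seminorms. For a double symbol $a(y,y',\eta)$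 put $$[\mathrm{Op}(a)u](y)=(2\pi)^{-q}\int_{\mathbb R^q}\int_{\mathbb R^q}e^{i(y-y')\eta}a(y,y',\eta)u(y')\,dy'\,d\eta,\qquad u\in\mathscr S(\mathbb R^q,E),$$ an iterated integral, and for $\tau\in\mathbb R$ and a simple symbol $a(y,\eta)$ let $\mathrm{Op}_\tau(a)$ be $\mathrm{Op}$ of the double symbol $a(\tau y'+(1-\tau)y,\eta)$. An oscillatory integral $\iint e^{-ix\xi}f(x,\xi)\,dx\,d\xi$ is the limit, as $\varepsilon\to0^+$, of the absolutely convergent integrals $\iint e^{-ix\xi}\chi(\varepsilon x,\varepsilon\xi)f(x,\xi)\,dx\,d\xi$, which has to exist and to be the same for every $\chi\in\mathscr S(\mathbb R^{2q})$ with $\chi(0,0)=1$. Theorem. (1) Let $\tau\in\mathbb R$ and $a\in S^{(\mu_1,\mu_2,\mu_3)}_{\varrho,\delta}(\mathbb R^{3q})$. Then the $\mathscr I(E,\tilde E)$-valued oscillatory integral $$b(y,\eta)=(2\pi)^{-q}\iint e^{-ix\xi}a(y-\tau x,y+(1-\tau)x,\eta+\xi)\,dx\,d\xi$$ exists for all $y,\eta$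 and defines a symbol $b\in S^{(\mu_1,\mu_2+\mu_3)}_{\varrho,\delta}(\mathbb R^{2q})$. The integrals defining $\mathrm{Op}(a)u(y)$ and $\mathrm{Op}_\tau(b)u(y)$ converge absolutely (the inner ones, and then the outer ones) and define the same continuous linear operator $$\mathrm{Op}(a)=\mathrm{Op}_\tau(b):\mathscr S(\mathbb R^q,E)\to\mathscr S(\mathbb R^q,\tilde E).$$ Moreover $b$ has the asymptotic expansion $$b(y,\eta)\sim\sum_{\alpha,\beta\in\mathbb N_0^q}\frac1{\alpha!\beta!}\tau^{|\alpha|}(1-\tau)^{|\beta|}\,\partial_\eta^{\alpha+\beta}(-D_y)^\alpha D_{y'}^\beta a(y,y',\eta)\big|_{y'=y},$$ that is, for every $N\in\mathbb N_0$ the difference of $b$ and the sum of the terms with $|\alpha+\beta|<N$ belongs to $S^{(\mu_1-(\varrho-\delta)N,\,\mu_2+\mu_3)}_{\varrho,\delta}(\mathbb R^{2q})$. (2) Let $\mu_1,\mu_2\in\mathbb R$. The class $$\Psi^{(\mu_1,\mu_2)}_{\varrho,\delta}=\{\mathrm{Op}_\tau(a):\mathscr S(\mathbb R^q,E)\to\mathscr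 S(\mathbb R^q,\tilde E)\;:\;a\in S^{(\mu_1,\mu_2)}_{\varrho,\delta}(\mathbb R^{2q})\}$$ of continuous linear operators is a linear space that does not depend on $\tau\in\mathbb R$. For every $\tau\in\mathbb R$ the map $a\mapsto\mathrm{Op}_\tau(a)$ is a linear bijection of $S^{(\mu_1,\mu_2)}_{\varrho,\delta}(\mathbb R^{2q})$ onto $\Psi^{(\mu_1,\mu_2)}_{\varrho,\delta}$. The topology that this bijection transfers from the symbol space to $\Psi^{(\mu_1,\mu_2)}_{\varrho,\delta}$ does not depend on $\tau$, and it makes $\Psi^{(\mu_1,\mu_2)}_{\varrho,\delta}$ a Fréchet space. -/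

import Mathlib

open MeasureTheory Filter Topology
open scoped SchwartzMap ContDiff Nat

universe u

noncomputable section

namespace EdgePsiDO

/-! ### Separable complex Hilbert spaces, operator ideals, group actions -/

/-- A separable complex Hilbert space. -/
structure SepHilb : Type (u + 1) where
  carrier : Type u
  [normedAddCommGroup : NormedAddCommGroup carrier]
  [innerProductSpace : InnerProductSpace ℂ carrier]
  [completeSpace : CompleteSpace carrier]
  [separableSpace : TopologicalSpace.SeparableSpace carrier]

namespace SepHilb

instance : CoeSort SepHilb.{u} (Type u) := ⟨SepHilb.carrier⟩

attribute [instance] SepHilb.normedAddCommGroup SepHilb.innerProductSpace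
  SepHilb.completeSpace SepHilb.separableSpace

end SepHilb

/-- An operator ideal in the category of separable complex Hilbert spaces. -/
structure OperatorIdeal where
  carrier : ∀ E F : SepHilb.{u}, Set (E →L[ℂ] F)
  finiteRank_mem : ∀ {E F : SepHilb.{u}} (A : E →L[ℂ] F),
    FiniteDimensional ℂ (LinearMap.range (A : E →ₗ[ℂ] F)) → A ∈ carrier E F
  add_mem : ∀ {E F : SepHilb.{u}} {A B : E →L[ℂ] F},
    A ∈ carrier E F → B ∈ carrier E F → A + B ∈ carrier E F
  comp_mem : ∀ {E₀ E F F₁ : SepHilb.{u}} (G : F →L[ℂ] F₁) {A : E →L[ℂ] F} (H : E₀ →L[ℂ] E),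
    A ∈ carrier E F → G ∘L A ∘L H ∈ carrier E₀ F₁

namespace OperatorIdeal

/-- The component `𝓘(E, F)`, as a linear subspace of the bounded operators. -/
def component (J : OperatorIdeal.{u}) (E F : SepHilb.{u}) : Submodule ℂ (E →L[ℂ] F) where
  carrier := J.carrier E F
  add_mem' := J.add_mem
  zero_mem' := by
    refine J.finiteRank_mem 0 ?_
    have h : LinearMap.range (((0 : E →L[ℂ] F)) : E →ₗ[ℂ] F) = ⊥ := by
      rw [ContinuousLinearMap.toLinearMap_zero, LinearMap.range_zero]
    rw [h]
    infer_instance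
  smul_mem' := by
    intro c A hA
    have h := J.comp_mem (c • ContinuousLinearMap.id ℂ F) (ContinuousLinearMap.id ℂ E) hA
    have e : (c • ContinuousLinearMap.id ℂ F) ∘L A ∘L ContinuousLinearMap.id ℂ E = c • A := by
      ext x
      simp
    rwa [e] at h

/-- `𝓘(E, F)` as a vector space in its own right: it carries the norm of the ideal, not the
operator norm. -/
def Comp (J : OperatorIdeal.{u}) (E F : SepHilb.{u}) : Type u := ↥(J.component E F)

instance (J : OperatorIdeal.{u}) (E F : SepHilb.{u}) : AddCommGroup (J.Comp E F) :=
  inferInstanceAs (AddCommGroup ↥(J.component E F))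

instance (J : OperatorIdeal.{u}) (E F : SepHilb.{u}) : Module ℂ (J.Comp E F) :=
  inferInstanceAs (Module ℂ ↥(J.component E F))

/-- The inclusion `𝓘(E, F) → 𝓛(E, F)`. -/
def toOp (J : OperatorIdeal.{u}) {E F : SepHilb.{u}} : J.Comp E F →ₗ[ℂ] (E →L[ℂ] F) :=
  (J.component E F).subtype

/-- The element `e' ⊗ f` of `𝓘(E, F)`, i.e. `x ↦ e'(x) f`. -/
def rankOne (J : OperatorIdeal.{u}) {E F : SepHilb.{u}} (e' : E →L[ℂ] ℂ) (f : F) : J.Comp E F :=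
  ⟨e'.smulRight f, J.finiteRank_mem _ <| by
    have h : LinearMap.range ((e'.smulRight f : E →L[ℂ] F) : E →ₗ[ℂ] F)
        ≤ Submodule.span ℂ {f} := by
      rintro _ ⟨x, rfl⟩
      exact Submodule.mem_span_singleton.2 ⟨e' x, rfl⟩
    exact Submodule.finiteDimensional_of_le h⟩

/-- The map `A ↦ G A H` from `𝓘(E, F)` to `𝓘(E₀, F₁)`. -/
def sandwich (J : OperatorIdeal.{u}) {E₀ E F F₁ : SepHilb.{u}} (G : F →L[ℂ] F₁)
    (H : E₀ →L[ℂ] E) : J.Comp E F →ₗ[ℂ] J.Comp E₀ F₁ where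
  toFun A := ⟨G ∘L J.toOp A ∘L H, J.comp_mem G H A.2⟩
  map_add' A B := by
    apply Subtype.ext
    ext x
    exact G.map_add _ _
  map_smul' c A := by
    apply Subtype.ext
    ext x
    exact G.map_smul _ _

end OperatorIdeal

/-- A normed operator ideal: every component carries a norm, with the usual compatibility. -/
structure NormedOperatorIdeal extends OperatorIdeal.{u} where
  nrm : ∀ E F : SepHilb.{u}, Seminorm ℂ (toOperatorIdeal.Comp E F)
  eq_zero_of_nrm : ∀ {E F : SepHilb.{u}} (A : toOperatorIdeal.Comp E F), nrm E F A = 0 → A = 0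
  nrm_rankOne : ∀ {E F : SepHilb.{u}} (e' : E →L[ℂ] ℂ) (f : F),
    nrm E F (toOperatorIdeal.rankOne e' f) = ‖e'‖ * ‖f‖
  nrm_sandwich_le : ∀ {E₀ E F F₁ : SepHilb.{u}} (G : F →L[ℂ] F₁) (H : E₀ →L[ℂ] E)
    (A : toOperatorIdeal.Comp E F),
    nrm E₀ F₁ (toOperatorIdeal.sandwich G H A) ≤ ‖G‖ * nrm E F A * ‖H‖

namespace NormedOperatorIdeal

/-- The normed space `(𝓘(E, F), ‖·‖_𝓘)`. -/
def Comp (J : NormedOperatorIdeal.{u}) (E F : SepHilb.{u}) : Type u := J.toOperatorIdeal.Comp E F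

instance (J : NormedOperatorIdeal.{u}) (E F : SepHilb.{u}) : NormedAddCommGroup (J.Comp E F) :=
  AddGroupNorm.toNormedAddCommGroup (E := J.toOperatorIdeal.Comp E F)
    { toFun := J.nrm E F
      map_zero' := map_zero (J.nrm E F)
      add_le' := map_add_le_add (J.nrm E F)
      neg' := map_neg_eq_map (J.nrm E F)
      eq_zero_of_map_eq_zero' := J.eq_zero_of_nrm }

instance (J : NormedOperatorIdeal.{u}) (E F : SepHilb.{u}) : NormedSpace ℂ (J.Comp E F) where
  toModule := inferInstanceAs (Module ℂ (J.toOperatorIdeal.Comp E F))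
  norm_smul_le c A := (map_smul_eq_mul (J.nrm E F) c A).le

/-- The inclusion `𝓘(E, F) → 𝓛(E, F)`. -/
def toOp (J : NormedOperatorIdeal.{u}) {E F : SepHilb.{u}} : J.Comp E F →ₗ[ℂ] (E →L[ℂ] F) :=
  J.toOperatorIdeal.toOp

/-- The map `A ↦ G A H` from `𝓘(E, F)` to `𝓘(E₀, F₁)`. -/
def sandwich (J : NormedOperatorIdeal.{u}) {E₀ E F F₁ : SepHilb.{u}} (G : F →L[ℂ] F₁)
    (H : E₀ →L[ℂ] E) : J.Comp E F →ₗ[ℂ] J.Comp E₀ F₁ :=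
  J.toOperatorIdeal.sandwich G H

end NormedOperatorIdeal

/-- A Banach operator ideal: a normed operator ideal whose components are complete. -/
structure BanachOperatorIdeal extends NormedOperatorIdeal.{u} where
  complete : ∀ E F : SepHilb.{u}, CompleteSpace (toNormedOperatorIdeal.Comp E F)

instance (J : BanachOperatorIdeal.{u}) (E F : SepHilb.{u}) :
    CompleteSpace (J.toNormedOperatorIdeal.Comp E F) := J.complete E F

/-- A strongly continuous group action `{κ_r}_{r > 0}` on `E`: a representation of the
multiplicative group of the positive reals that is continuous in the strong operator topology. -/
structure GroupAction (E : SepHilb.{u}) where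
  toHom : {r : ℝ // 0 < r} →* (E →L[ℂ] E)
  continuous_apply : ∀ x : E, Continuous fun r => toHom r x

/-! ### Multi-indices and partial derivatives -/

/-- The space `ℝ^q` with its Euclidean norm. -/
abbrev V (q : ℕ) : Type := EuclideanSpace ℝ (Fin q)

/-- The length `|α|` of a multi-index. -/
def len {q : ℕ} (α : Fin q → ℕ) : ℕ := ∑ j, α j

/-- The factorial `α!` of a multi-index. -/
def mfact {q : ℕ} (α : Fin q → ℕ) : ℕ := ∏ j, (α j)!

/-- The iterated partial derivative `∂_{v 0}^{α 0} ⋯ ∂_{v (q-1)}^{α (q-1)} f` along the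
directions `v`. -/
def mderiv {q : ℕ} {X B : Type*} [NormedAddCommGroup X] [NormedSpace ℝ X]
    [NormedAddCommGroup B] [NormedSpace ℝ B] (v : Fin q → X) (α : Fin q → ℕ) (f : X → B) : X → B :=
  (List.finRange q).foldr (fun j g => (fun (h : X → B) (x : X) => fderiv ℝ h x (v j))^[α j] g) f

/-- The operators `D^α = (-i)^{|α|} ∂^α`. -/
def mD {q : ℕ} {X B : Type*} [NormedAddCommGroup X] [NormedSpace ℝ X]
    [NormedAddCommGroup B] [NormedSpace ℂ B] (v : Fin q → X) (α : Fin q → ℕ) (f : X → B) : X → B :=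
  fun x => (-Complex.I) ^ len α • mderiv v α f x

/-- The `j`-th standard basis vector of `ℝ^q`. -/
def stdv {q : ℕ} (j : Fin q) : V q := EuclideanSpace.single j 1

/-- The coordinate directions in `y` and `η`, for functions of `(y, η)`. -/
def dirY {q : ℕ} (j : Fin q) : V q × V q := (stdv j, 0)
def dirEta {q : ℕ} (j : Fin q) : V q × V q := (0, stdv j)

/-- The coordinate directions in `y`, `y'` and `η`, for functions of `(y, y', η)`. -/
def dirY3 {q : ℕ} (j : Fin q) : V q × V q × V q := (stdv j, 0, 0)
def dirYp3 {q : ℕ} (j : Fin q) : V q × V q × V q := (0, stdv j, 0)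
def dirEta3 {q : ℕ} (j : Fin q) : V q × V q × V q := (0, 0, stdv j)

/-- `⟨η⟩ = (1 + |η|²)^{1/2}`. -/
def jap {q : ℕ} (η : V q) : ℝ := Real.sqrt (1 + ‖η‖ ^ 2)

lemma jap_pos {q : ℕ} (η : V q) : 0 < jap η := Real.sqrt_pos.2 (by positivity)

/-- `⟨η⟩` as an element of the multiplicative group of the positive reals. -/
def japPos {q : ℕ} (η : V q) : {r : ℝ // 0 < r} := ⟨jap η, jap_pos η⟩

section MDeriv

variable {q : ℕ} {X B : Type*} [NormedAddCommGroup X] [NormedSpace ℝ X]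
  [NormedAddCommGroup B] [NormedSpace ℂ B]

lemma contDiff_dir {f : X → B} (hf : ContDiff ℝ ∞ f) (v : X) :
    ContDiff ℝ ∞ (fun x => fderiv ℝ f x v) :=
  (hf.fderiv_right (m := ∞) (by simp)).clm_apply contDiff_const

lemma contDiff_dir_iterate {f : X → B} (hf : ContDiff ℝ ∞ f) (v : X) (n : ℕ) :
    ContDiff ℝ ∞ ((fun (h : X → B) (x : X) => fderiv ℝ h x v)^[n] f) := by
  induction n with
  | zero => exact hf
  | succ k ih =>
    rw [Function.iterate_succ_apply']
    exact contDiff_dir ih v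

lemma dir_iterate_add {f g : X → B} (hf : ContDiff ℝ ∞ f) (hg : ContDiff ℝ ∞ g) (v : X) (n : ℕ) :
    (fun (h : X → B) (x : X) => fderiv ℝ h x v)^[n] (f + g)
      = (fun (h : X → B) (x : X) => fderiv ℝ h x v)^[n] f
        + (fun (h : X → B) (x : X) => fderiv ℝ h x v)^[n] g := by
  induction n with
  | zero => rfl
  | succ k ih =>
    rw [Function.iterate_succ_apply', Function.iterate_succ_apply', Function.iterate_succ_apply',
      ih]
    funext x
    have h1 := (contDiff_dir_iterate hf v k).differentiable (by simp) x
    have h2 := (contDiff_dir_iterate hg v k).differentiable (by simp) x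
    rw [fderiv_add h1 h2]
    rfl

lemma dir_iterate_smul {f : X → B} (hf : ContDiff ℝ ∞ f) (c : ℂ) (v : X) (n : ℕ) :
    (fun (h : X → B) (x : X) => fderiv ℝ h x v)^[n] (c • f)
      = c • (fun (h : X → B) (x : X) => fderiv ℝ h x v)^[n] f := by
  induction n with
  | zero => rfl
  | succ k ih =>
    rw [Function.iterate_succ_apply', Function.iterate_succ_apply', ih]
    funext x
    have h1 := (contDiff_dir_iterate hf v k).differentiable (by simp) x
    rw [fderiv_const_smul h1]
    rfl

lemma contDiff_foldr {f : X → B} (hf : ContDiff ℝ ∞ f) (v : Fin q → X) (α : Fin q → ℕ)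
    (l : List (Fin q)) : ContDiff ℝ ∞
      (l.foldr (fun j g => (fun (h : X → B) (x : X) => fderiv ℝ h x (v j))^[α j] g) f) := by
  induction l with
  | nil => exact hf
  | cons j l ih => exact contDiff_dir_iterate ih _ _

lemma contDiff_mderiv {f : X → B} (hf : ContDiff ℝ ∞ f) (v : Fin q → X) (α : Fin q → ℕ) :
    ContDiff ℝ ∞ (mderiv v α f) := contDiff_foldr hf v α _

lemma mderiv_add {f g : X → B} (hf : ContDiff ℝ ∞ f) (hg : ContDiff ℝ ∞ g) (v : Fin q → X)
    (α : Fin q → ℕ) : mderiv v α (f + g) = mderiv v α f + mderiv v α g := by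
  unfold mderiv
  induction List.finRange q with
  | nil => rfl
  | cons j l ih =>
    simp only [List.foldr_cons]
    rw [ih, dir_iterate_add (contDiff_foldr hf v α l) (contDiff_foldr hg v α l)]

lemma mderiv_smul {f : X → B} (hf : ContDiff ℝ ∞ f) (c : ℂ) (v : Fin q → X)
    (α : Fin q → ℕ) : mderiv v α (c • f) = c • mderiv v α f := by
  unfold mderiv
  induction List.finRange q with
  | nil => rfl
  | cons j l ih =>
    simp only [List.foldr_cons]
    rw [ih, dir_iterate_smul (contDiff_foldr hf v α l)]

end MDeriv

/-! ### Twisted operator valued symbols -/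

section Symbols

variable {q : ℕ} (J : NormedOperatorIdeal.{u}) {E F : SepHilb.{u}}
  (κ : GroupAction E) (κ' : GroupAction F)

/-- Conjugation by the group actions: `A ↦ κ'_{⟨η⟩}⁻¹ A κ_{⟨η⟩}`. -/
def twist (η : V q) : J.Comp E F →ₗ[ℂ] J.Comp E F :=
  J.sandwich (κ'.toHom (japPos η)⁻¹) (κ.toHom (japPos η))

/-- `a ∈ S^{(μ₁, μ₂)}_{ϱ,δ}(ℝ^q × ℝ^q; (E, κ), (F, κ'))_𝓘`. The numbers `‖D^β ⋯‖` and `‖∂^β ⋯‖`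
agree. -/
def IsSymbol (ϱ δ μ₁ μ₂ : ℝ) (a : V q × V q → J.Comp E F) : Prop :=
  ContDiff ℝ ∞ a ∧ ∀ α β : Fin q → ℕ, ∃ C : ℝ, ∀ y η : V q,
    ‖twist J κ κ' η (mderiv dirY β (mderiv dirEta α a) (y, η))‖
      ≤ C * (jap y ^ μ₂ * jap η ^ (μ₁ - ϱ * len α + δ * len β))

/-- `a ∈ S^{(μ₁, μ₂, μ₃)}_{ϱ,δ}(ℝ^q × ℝ^q × ℝ^q; (E, κ), (F, κ'))_𝓘`. -/
def IsDoubleSymbol (ϱ δ μ₁ μ₂ μ₃ : ℝ) (a : V q × V q × V q → J.Comp E F) : Prop :=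
  ContDiff ℝ ∞ a ∧ ∀ α β γ : Fin q → ℕ, ∃ C : ℝ, ∀ y y' η : V q,
    ‖twist J κ κ' η (mderiv dirY3 β (mderiv dirYp3 γ (mderiv dirEta3 α a)) (y, y', η))‖
      ≤ C * (jap y ^ μ₂ * jap y' ^ μ₃ * jap η ^ (μ₁ - ϱ * len α + δ * (len β + len γ)))

/-- The symbol class as a linear subspace of the `𝓘(E, F)`-valued functions. -/
def symbolSubmodule (q : ℕ) (ϱ δ μ₁ μ₂ : ℝ) : Submodule ℂ (V q × V q → J.Comp E F) where
  carrier := {a | IsSymbol J κ κ' ϱ δ μ₁ μ₂ a}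
  zero_mem' := by
    refine ⟨contDiff_const, fun α β => ⟨0, fun y η => ?_⟩⟩
    have h0 : ∀ (v : Fin q → V q × V q) (α : Fin q → ℕ),
        mderiv v α (0 : V q × V q → J.Comp E F) = 0 := by
      intro v α
      have h : mderiv v α ((0 : ℂ) • (0 : V q × V q → J.Comp E F)) = _ :=
        mderiv_smul contDiff_const 0 v α
      rw [zero_smul] at h
      exact h.trans (zero_smul ℂ _)
    rw [h0, h0]
    simp
  add_mem' := by
    rintro a b ⟨ha, ha'⟩ ⟨hb, hb'⟩
    refine ⟨ha.add hb, fun α β => ?_⟩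
    obtain ⟨C, hC⟩ := ha' α β
    obtain ⟨D, hD⟩ := hb' α β
    refine ⟨C + D, fun y η => ?_⟩
    rw [mderiv_add ha hb, mderiv_add (contDiff_mderiv ha _ _) (contDiff_mderiv hb _ _),
      Pi.add_apply, map_add, add_mul]
    exact (norm_add_le _ _).trans (add_le_add (hC y η) (hD y η))
  smul_mem' := by
    rintro c a ⟨ha, ha'⟩
    refine ⟨contDiff_const.smul ha, fun α β => ?_⟩
    obtain ⟨C, hC⟩ := ha' α β
    refine ⟨‖c‖ * C, fun y η => ?_⟩
    rw [mderiv_smul ha, mderiv_smul (contDiff_mderiv ha _ _), Pi.smul_apply, map_smul, norm_smul,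
      mul_assoc]
    exact mul_le_mul_of_nonneg_left (hC y η) (norm_nonneg c)

/-- The symbol space `S^{(μ₁, μ₂)}_{ϱ,δ}(ℝ^q × ℝ^q; (E, κ), (F, κ'))_𝓘`. It carries its Fréchet
topology below, not the topology of pointwise convergence. -/
def Symb (q : ℕ) (ϱ δ μ₁ μ₂ : ℝ) : Type u := ↥(symbolSubmodule J κ κ' q ϱ δ μ₁ μ₂)

variable (ϱ δ μ₁ μ₂ : ℝ)

instance : AddCommGroup (Symb J κ κ' q ϱ δ μ₁ μ₂) :=
  inferInstanceAs (AddCommGroup ↥(symbolSubmodule J κ κ' q ϱ δ μ₁ μ₂))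

instance : Module ℂ (Symb J κ κ' q ϱ δ μ₁ μ₂) :=
  inferInstanceAs (Module ℂ ↥(symbolSubmodule J κ κ' q ϱ δ μ₁ μ₂))

variable {J κ κ' ϱ δ μ₁ μ₂}

/-- The function underlying an element of the symbol space. -/
def Symb.fn (a : Symb J κ κ' q ϱ δ μ₁ μ₂) : V q × V q → J.Comp E F := a.1

/-- The quotient of the two sides of the symbol estimate, without the constant. -/
def symbRatio (α β : Fin q → ℕ) (a : Symb J κ κ' q ϱ δ μ₁ μ₂) (p : V q × V q) : ℝ :=
  ‖twist J κ κ' p.2 (mderiv dirY β (mderiv dirEta α a.fn) p)‖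
    / (jap p.1 ^ μ₂ * jap p.2 ^ (μ₁ - ϱ * len α + δ * len β))

lemma weight_pos (y η : V q) (s t : ℝ) : 0 < jap y ^ s * jap η ^ t :=
  mul_pos (Real.rpow_pos_of_pos (jap_pos y) s) (Real.rpow_pos_of_pos (jap_pos η) t)

lemma bddAbove_symbRatio (α β : Fin q → ℕ) (a : Symb J κ κ' q ϱ δ μ₁ μ₂) :
    BddAbove (Set.range (symbRatio α β a)) := by
  obtain ⟨C, hC⟩ := a.2.2 α β
  refine ⟨C, ?_⟩
  rintro _ ⟨p, rfl⟩
  exact (div_le_iff₀ (weight_pos _ _ _ _)).2 (hC p.1 p.2)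

lemma symbRatio_add_le (α β : Fin q → ℕ) (a b : Symb J κ κ' q ϱ δ μ₁ μ₂) (p : V q × V q) :
    symbRatio α β (a + b) p ≤ symbRatio α β a p + symbRatio α β b p := by
  have h : (a + b).fn = a.fn + b.fn := rfl
  have ha : ContDiff ℝ ∞ a.fn := a.2.1
  have hb : ContDiff ℝ ∞ b.fn := b.2.1
  unfold symbRatio
  rw [h, mderiv_add ha hb, mderiv_add (contDiff_mderiv ha _ _) (contDiff_mderiv hb _ _),
    Pi.add_apply, map_add, ← add_div]
  exact div_le_div_of_nonneg_right (norm_add_le _ _) (weight_pos _ _ _ _).le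

lemma symbRatio_smul (α β : Fin q → ℕ) (c : ℂ) (a : Symb J κ κ' q ϱ δ μ₁ μ₂) (p : V q × V q) :
    symbRatio α β (c • a) p = ‖c‖ * symbRatio α β a p := by
  have h : (c • a).fn = c • a.fn := rfl
  have ha : ContDiff ℝ ∞ a.fn := a.2.1
  unfold symbRatio
  rw [h, mderiv_smul ha, mderiv_smul (contDiff_mderiv ha _ _), Pi.smul_apply, map_smul, norm_smul,
    mul_div_assoc]

variable (J κ κ' ϱ δ μ₁ μ₂)

/-- The seminorms of the symbol space: the best constants in the symbol estimates. -/
def symbSeminorm (q : ℕ) (k : (Fin q → ℕ) × (Fin q → ℕ)) :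
    Seminorm ℂ (Symb J κ κ' q ϱ δ μ₁ μ₂) :=
  Seminorm.of (fun a => ⨆ p, symbRatio k.1 k.2 a p)
    (fun a b => ciSup_le fun p => (symbRatio_add_le k.1 k.2 a b p).trans
      (add_le_add (le_ciSup (bddAbove_symbRatio k.1 k.2 a) p)
        (le_ciSup (bddAbove_symbRatio k.1 k.2 b) p)))
    (fun c a => by
      simp only [symbRatio_smul]
      exact (Real.mul_iSup_of_nonneg (norm_nonneg c) _).symm)

/-- The topology of the symbol space, generated by all the seminorms `symbSeminorm`. -/
instance : TopologicalSpace (Symb J κ κ' q ϱ δ μ₁ μ₂) :=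
  SeminormFamily.moduleFilterBasis (𝕜 := ℂ) (symbSeminorm J κ κ' ϱ δ μ₁ μ₂ q) |>.topology

end Symbols

/-! ### Pseudodifferential operators -/

section Operators

variable {q : ℕ} {J : NormedOperatorIdeal.{u}} {E F : SepHilb.{u}}

/-- The integrand `e^{i(y-y')η} a(y, y', η) u(y')`. -/
def opIntegrand (a : V q × V q × V q → J.Comp E F) (u : 𝓢(V q, E)) (y η y' : V q) : F :=
  Complex.exp (Complex.I * (inner ℝ (y - y') η : ℝ)) • J.toOp (a (y, y', η)) (u y')

/-- `A = Op(a)`: all `u` and `y` satisfy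
`(A u)(y) = (2π)^{-q} ∫ (∫ e^{i(y-y')η} a(y, y', η) u(y') dy') dη`, with absolutely convergent
inner and outer integrals. -/
def IsOp (a : V q × V q × V q → J.Comp E F) (A : 𝓢(V q, E) →L[ℂ] 𝓢(V q, F)) : Prop :=
  ∀ (u : 𝓢(V q, E)) (y : V q),
    (∀ η, Integrable (fun y' => opIntegrand a u y η y')) ∧
    Integrable (fun η => ∫ y', opIntegrand a u y η y') ∧
    A u y = ((2 * Real.pi) ^ q)⁻¹ • ∫ η, ∫ y', opIntegrand a u y η y'

/-- `A = Op_τ(a)`, i.e. `A` is the operator with the double symbol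
`(y, y', η) ↦ a(τ y' + (1 - τ) y, η)`. -/
def IsOpTau (τ : ℝ) (a : V q × V q → J.Comp E F) (A : 𝓢(V q, E) →L[ℂ] 𝓢(V q, F)) : Prop :=
  IsOp (fun p : V q × V q × V q => a (τ • p.2.1 + (1 - τ) • p.1, p.2.2)) A

/-- The class of all operators `Op_τ(a)`, for `a` in the symbol space of order `(μ₁, μ₂)`. -/
def psiClass (J : NormedOperatorIdeal.{u}) (κ : GroupAction E) (κ' : GroupAction F)
    (q : ℕ) (ϱ δ μ₁ μ₂ τ : ℝ) : Set (𝓢(V q, E) →L[ℂ] 𝓢(V q, F)) :=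
  {A | ∃ a : V q × V q → J.Comp E F, IsSymbol J κ κ' ϱ δ μ₁ μ₂ a ∧ IsOpTau τ a A}

/-- The terms of the asymptotic expansion,
`(α! β!)⁻¹ τ^{|α|} (1-τ)^{|β|} ∂_η^{α+β} (-D_y)^α D_{y'}^β a(y, y', η)` at `y' = y`. -/
def expansionTerm (τ : ℝ) (a : V q × V q × V q → J.Comp E F) (α β : Fin q → ℕ)
    (p : V q × V q) : J.Comp E F :=
  (τ ^ len α * (1 - τ) ^ len β / (mfact α * mfact β : ℝ)) •
    mderiv dirEta3 (α + β) ((-1 : ℂ) ^ len α • mD dirY3 α (mD dirYp3 β a)) (p.1, p.1, p.2)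

/-- All pairs of multi-indices with `|α + β| < N`. -/
def pairsBelow (q N : ℕ) : Finset ((Fin q → ℕ) × (Fin q → ℕ)) :=
  ((Fintype.piFinset fun _ => Finset.range N) ×ˢ (Fintype.piFinset fun _ => Finset.range N)).filter
    fun k => len (k.1 + k.2) < N

end Operators

/-- The oscillatory integral `∬ e^{-ixξ} f(x, ξ) dx dξ` exists and equals `L`: for every Schwartz
function `χ` with `χ(0) = 1`, the integrals of `χ(εx, εξ) e^{-ixξ} f(x, ξ)` converge absolutely,
and they tend to `L` as `ε → 0+`. -/
def HasOscIntegral {q : ℕ} {B : Type*} [NormedAddCommGroup B] [NormedSpace ℂ B]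
    (f : V q × V q → B) (L : B) : Prop :=
  ∀ χ : 𝓢(V q × V q, ℂ), χ 0 = 1 →
    (∀ ε : ℝ, 0 < ε → Integrable (fun p : V q × V q =>
      (χ (ε • p) * Complex.exp (-Complex.I * (inner ℝ p.1 p.2 : ℝ))) • f p)) ∧
    Tendsto (fun ε : ℝ => ∫ p : V q × V q,
      (χ (ε • p) * Complex.exp (-Complex.I * (inner ℝ p.1 p.2 : ℝ))) • f p) (𝓝[>] 0) (𝓝 L)

/-- A Fréchet space: a complete, metrizable, locally convex topological vector space. -/
structure IsFrechet (X : Type*) [AddCommGroup X] [Module ℂ X] [TopologicalSpace X] : Prop where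
  topologicalAddGroup : IsTopologicalAddGroup X
  continuousSMul : ContinuousSMul ℂ X
  locallyConvex : LocallyConvexSpace ℝ X
  metrizable : TopologicalSpace.MetrizableSpace X
  complete : @CompleteSpace X (IsTopologicalAddGroup.rightUniformSpace X)

end EdgePsiDO

end

open EdgePsiDO

/-! Everything is read off from one family of operators. For `w = (w₁, w₂, w₃)` let `E_w a(y, y',
η)` be the normalized oscillatory integral of `a(y + w₁x, y' + w₂x, η + w₃ξ)`. The symbol `b` is
`E_w a` with `w = (-τ, 1-τ, 1)`, restricted to `y' = y`.

Oscillatory integrals. An amplitude may lose `⟨ξ⟩^δ` per `x`-derivative. One integration by parts in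
`x` gains `⟨ξ⟩⁻¹`, hence `1 - δ > 0` orders net, and one in `ξ` gains a power of `⟨x⟩`. After
finitely many steps the integrand is absolutely integrable, and replacing the cutoff by its value at
the origin costs `O(ε)`. The quantitative form, `osc_bound`, needs finitely many derivatives and is
linear in their bound. Applied to Taylor remainders it yields differentiation in parameters,
`ParAmp.hasFDerivAt_osc`. Applied to `Θ_η a(p + w·)`, where `Θ_η` is conjugation by the group
actions, it yields estimates for `E_w`. The last step only needs that `Θ_η` and the weight change by
polynomial factors under translation; this is the notion of a `Frame`, and it holds because group
actions grow polynomially and Peetre's inequality controls `⟨η+ξ⟩/⟨η⟩`.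

The one-parameter family. Differentiating in `w` brings down factors `x_j`, which integration by
parts turns into `-i∂_{η_j}`. With `𝓛_σ = -i ∑ ∂_{η_j}(σ₁∂_{y_j} + σ₂∂_{y'_j})` and `E_{tσ}` for the
parameter `(tσ₁, tσ₂, 1)`, this says that `E_{tσ} a` has derivative `E_{tσ} 𝓛_σ a`, and Fourier
inversion gives `E_0 = 1`. So `E_{tσ}` is formally `exp(t𝓛_σ)`, and the expansion of `b` is Taylor's
formula at `t = 0`, evaluated at `t = 1`. Its terms take the asserted shape by the multinomial
theorem (`sum_lop_iterate`). The available bound for `E_{tσ}` loses a fixed number of orders,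
whereas each `𝓛_σ` gains `ϱ - δ > 0`. Expanding further than requested therefore absorbs the loss,
and the superfluous terms are harmless (`rem_base`, `rem_bound`).

The operators. `Op(a)u(y)` is `E_{(0,1,1)}` of the double symbol `a(y, y', η)u(y')`, taken at `(y,
y, 0)`. The oscillatory integral of `E_{tσ} a(y + (r₁-tσ₁)x, y' + (r₂-tσ₂)x, η + ξ)`, applied to a
factor `v(x)`, does not depend on `t` (`DSym.osc_deform`): the derivative of `E_{tσ}` cancels
against that of the moving argument after one integration by parts. Comparing `t = 0` with `t = 1`
proves `Op(a) = Op_τ(b)`. The same identity with `v = 1` proves `E_{-σ} E_σ = 1`.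

Part (2). A symbol with `Op_0(b) = 0` vanishes, by testing on functions with prescribed Fourier
transform. A general `τ` is reduced to this by invertibility of `E_σ`. Passing from `τ`- to
`τ'`-symbols is then a linear bijection, continuous in both directions by `rem_bound`, so all `τ`
give the same operators and the same topology. Completeness is that of the symbol space: countably
many seminorms, and termwise differentiable limits. -/

noncomputable section

namespace EdgePsiDO

/-! ### Directional derivatives along words, and weighted bounds for them -/

section Words

variable {ι X B : Type*} [NormedAddCommGroup X] [NormedSpace ℝ X]
  [NormedAddCommGroup B] [NormedSpace ℂ B]

/-- The directional derivative `∂_v f`. -/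
def dd (v : X) (f : X → B) : X → B := fun x => fderiv ℝ f x v

/-- The iterated directional derivative along a word of directions. -/
def dl (v : ι → X) : List ι → (X → B) → X → B
  | [], f => f
  | i :: l, f => dl v l (dd (v i) f)

@[simp] lemma dl_nil (v : ι → X) (f : X → B) : dl v [] f = f := rfl

lemma dl_cons (v : ι → X) (i : ι) (l : List ι) (f : X → B) :
    dl v (i :: l) f = dl v l (dd (v i) f) := rfl

lemma dl_append (v : ι → X) (l l' : List ι) (f : X → B) :
    dl v (l ++ l') f = dl v l' (dl v l f) := by
  induction l generalizing f with
  | nil => rfl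
  | cons i l ih => exact ih _

lemma contDiff_dd {f : X → B} (hf : ContDiff ℝ ∞ f) (v : X) : ContDiff ℝ ∞ (dd v f) :=
  contDiff_dir hf v

lemma contDiff_dl {f : X → B} (hf : ContDiff ℝ ∞ f) (v : ι → X) (l : List ι) :
    ContDiff ℝ ∞ (dl v l f) := by
  induction l generalizing f with
  | nil => exact hf
  | cons i l ih => exact ih (contDiff_dd hf _)

lemma smooth_diff {Y C : Type*} [NormedAddCommGroup Y] [NormedSpace ℝ Y]
    [NormedAddCommGroup C] [NormedSpace ℝ C] {f : Y → C}
    (hf : ContDiff ℝ ∞ f) (x : Y) : DifferentiableAt ℝ f x :=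
  hf.differentiable (by simp) x

lemma dd_add {f g : X → B} (hf : ContDiff ℝ ∞ f) (hg : ContDiff ℝ ∞ g) (v : X) :
    dd v (fun x => f x + g x) = fun x => dd v f x + dd v g x := by
  funext x
  unfold dd
  rw [fderiv_fun_add (smooth_diff hf x) (smooth_diff hg x)]
  rfl

lemma dd_const_smul {f : X → B} (hf : ContDiff ℝ ∞ f) (c : ℂ) (v : X) :
    dd v (fun x => c • f x) = fun x => c • dd v f x := by
  funext x
  unfold dd
  rw [fderiv_fun_const_smul (smooth_diff hf x)]
  rfl

lemma dd_sum {κ : Type*} (t : Finset κ) {f : κ → X → B} (hf : ∀ k ∈ t, ContDiff ℝ ∞ (f k))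
    (v : X) : dd v (fun x => ∑ k ∈ t, f k x) = fun x => ∑ k ∈ t, dd v (f k) x := by
  funext x
  unfold dd
  rw [fderiv_fun_sum fun k hk => smooth_diff (hf k hk) x]
  simp

lemma dd_zero (v : X) : dd v (fun _ => (0 : B)) = fun _ => 0 := by
  funext x; simp [dd]

lemma dl_add {f g : X → B} (hf : ContDiff ℝ ∞ f) (hg : ContDiff ℝ ∞ g) (v : ι → X) (l : List ι) :
    dl v l (fun x => f x + g x) = fun x => dl v l f x + dl v l g x := by
  induction l generalizing f g with
  | nil => rfl
  | cons i l ih => rw [dl_cons, dd_add hf hg, ih (contDiff_dd hf _) (contDiff_dd hg _)]; rfl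

lemma dl_const_smul {f : X → B} (hf : ContDiff ℝ ∞ f) (c : ℂ) (v : ι → X) (l : List ι) :
    dl v l (fun x => c • f x) = fun x => c • dl v l f x := by
  induction l generalizing f with
  | nil => rfl
  | cons i l ih => rw [dl_cons, dd_const_smul hf, ih (contDiff_dd hf _)]; rfl

lemma dl_sum {κ : Type*} (t : Finset κ) {f : κ → X → B} (hf : ∀ k ∈ t, ContDiff ℝ ∞ (f k))
    (v : ι → X) (l : List ι) :
    dl v l (fun x => ∑ k ∈ t, f k x) = fun x => ∑ k ∈ t, dl v l (f k) x := by
  induction l generalizing f with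
  | nil => rfl
  | cons i l ih =>
    rw [dl_cons, dd_sum t hf, ih fun k hk => contDiff_dd (hf k hk) _]; rfl

lemma dd_comm {f : X → B} (hf : ContDiff ℝ ∞ f) (v w : X) : dd v (dd w f) = dd w (dd v f) := by
  have key : ∀ v w : X, ∀ x, dd v (dd w f) x = fderiv ℝ (fderiv ℝ f) x v w := by
    intro v w x
    have h : DifferentiableAt ℝ (fderiv ℝ f) x :=
      smooth_diff (hf.fderiv_right (m := ∞) (by simp)) x
    unfold dd
    rw [fderiv_clm_apply h (differentiableAt_const w)]
    simp
  funext x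
  rw [key, key]
  have := ((contDiff_infty.1 hf 2).contDiffAt (x := x)).isSymmSndFDerivAt (by simp)
  exact this v w

lemma dl_dd_comm {f : X → B} (hf : ContDiff ℝ ∞ f) (v : ι → X) (w : X) (l : List ι) :
    dl v l (dd w f) = dd w (dl v l f) := by
  induction l generalizing f with
  | nil => rfl
  | cons i l ih => rw [dl_cons, dd_comm hf, ih (contDiff_dd hf _)]; rfl

/-- Directional derivatives of smooth functions commute. This is why estimates over arbitrary words,
which suit inductions on the first letter, are equivalent to the multi-index estimates of the symbol
classes. -/
lemma dl_perm {f : X → B} (hf : ContDiff ℝ ∞ f) (v : ι → X) {l l' : List ι} (h : l.Perm l') :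
    dl v l f = dl v l' f := by
  induction h generalizing f with
  | nil => rfl
  | cons i _ ih => exact ih (contDiff_dd hf _)
  | swap i j l => simp only [dl_cons, dd_comm hf]
  | trans _ _ ih1 ih2 => exact (ih1 hf).trans (ih2 hf)

lemma dd_add_dir {f : X → B} (v w : X) : dd (v + w) f = fun x => dd v f x + dd w f x := by
  funext x; simp [dd]

lemma dd_smul_dir {f : X → B} (c : ℝ) (v : X) : dd (c • v) f = fun x => c • dd v f x := by
  funext x; simp [dd]

lemma dd_sum_dir {κ : Type*} (t : Finset κ) {f : X → B} (v : κ → X) :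
    dd (∑ k ∈ t, v k) f = fun x => ∑ k ∈ t, dd (v k) f x := by
  funext x; simp [dd]

lemma dd_comp_clm {C : Type*} [NormedAddCommGroup C] [NormedSpace ℂ C] {f : X → B}
    (hf : ContDiff ℝ ∞ f) (T : B →L[ℂ] C) (v : X) :
    dd v (fun x => T (f x)) = fun x => T (dd v f x) := by
  funext x
  unfold dd
  have h := ((T.restrictScalars ℝ).hasFDerivAt (x := f x)).comp x (smooth_diff hf x).hasFDerivAt
  have h2 : HasFDerivAt (fun x => T (f x)) ((T.restrictScalars ℝ).comp (fderiv ℝ f x)) x := h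
  rw [h2.fderiv]
  rfl

lemma contDiff_comp_clm {C : Type*} [NormedAddCommGroup C] [NormedSpace ℂ C] {f : X → B}
    (hf : ContDiff ℝ ∞ f) (T : B →L[ℂ] C) : ContDiff ℝ ∞ (fun x => T (f x)) :=
  (T.restrictScalars ℝ).contDiff.comp hf

lemma dl_comp_clm {C : Type*} [NormedAddCommGroup C] [NormedSpace ℂ C] {f : X → B}
    (hf : ContDiff ℝ ∞ f) (T : B →L[ℂ] C) (v : ι → X) (l : List ι) :
    dl v l (fun x => T (f x)) = fun x => T (dl v l f x) := by
  induction l generalizing f with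
  | nil => rfl
  | cons i l ih => rw [dl_cons, dd_comp_clm hf, ih (contDiff_dd hf _)]; rfl

lemma dd_comp_affine {X' : Type*} [NormedAddCommGroup X'] [NormedSpace ℝ X'] {f : X → B}
    (hf : ContDiff ℝ ∞ f) (p : X) (A : X' →L[ℝ] X) (v : X') :
    dd v (fun x => f (p + A x)) = fun x => dd (A v) f (p + A x) := by
  funext x
  unfold dd
  have h1 : HasFDerivAt (fun x => p + A x) A x := A.hasFDerivAt.const_add p
  have h : HasFDerivAt (fun x => f (p + A x)) ((fderiv ℝ f (p + A x)).comp A) x :=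
    (smooth_diff hf (p + A x)).hasFDerivAt.comp x h1
  rw [h.fderiv]
  rfl

lemma contDiff_comp_affine {X' : Type*} [NormedAddCommGroup X'] [NormedSpace ℝ X'] {f : X → B}
    (hf : ContDiff ℝ ∞ f) (p : X) (A : X' →L[ℝ] X) : ContDiff ℝ ∞ (fun x => f (p + A x)) :=
  hf.comp (contDiff_const.add A.contDiff)

lemma dl_comp_linear {X' ι' : Type*} [NormedAddCommGroup X'] [NormedSpace ℝ X'] {f : X → B}
    (hf : ContDiff ℝ ∞ f) (p : X) (A : X' →L[ℝ] X) (v : ι' → X') (l : List ι') :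
    dl v l (fun x => f (p + A x)) = fun x => dl (fun i => A (v i)) l f (p + A x) := by
  induction l generalizing f with
  | nil => rfl
  | cons i l ih => rw [dl_cons, dd_comp_affine hf, ih (contDiff_dd hf _)]; rfl

lemma dd_bilin {B₁ B₂ B₃ : Type*} [NormedAddCommGroup B₁] [NormedSpace ℂ B₁]
    [NormedAddCommGroup B₂] [NormedSpace ℂ B₂] [NormedAddCommGroup B₃] [NormedSpace ℂ B₃]
    (β : B₁ →L[ℝ] B₂ →L[ℝ] B₃) {f : X → B₁} {g : X → B₂} (hf : ContDiff ℝ ∞ f)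
    (hg : ContDiff ℝ ∞ g) (v : X) :
    dd v (fun x => β (f x) (g x)) = fun x => β (f x) (dd v g x) + β (dd v f x) (g x) := by
  funext x
  unfold dd
  rw [(β.hasFDerivAt_of_bilinear (smooth_diff hf x).hasFDerivAt
    (smooth_diff hg x).hasFDerivAt).fderiv]
  simp

lemma contDiff_bilin {B₁ B₂ B₃ : Type*} [NormedAddCommGroup B₁] [NormedSpace ℂ B₁]
    [NormedAddCommGroup B₂] [NormedSpace ℂ B₂] [NormedAddCommGroup B₃] [NormedSpace ℂ B₃]
    (β : B₁ →L[ℝ] B₂ →L[ℝ] B₃) {f : X → B₁} {g : X → B₂} (hf : ContDiff ℝ ∞ f)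
    (hg : ContDiff ℝ ∞ g) : ContDiff ℝ ∞ (fun x => β (f x) (g x)) :=
  β.isBoundedBilinearMap.contDiff.comp (hf.prodMk hg)

/-- All derivatives along words of length at most `K` satisfy
`N_x(∂^l f(x)) ≤ G(x) ∏_{i ∈ l} s_i(x)`. -/
def Bd (v : ι → X) (s : ι → X → ℝ) (N : X → Seminorm ℂ B) (K : ℕ) (G : X → ℝ) (f : X → B) : Prop :=
  ∀ l : List ι, l.length ≤ K → ∀ x, N x (dl v l f x) ≤ G x * (l.map fun i => s i x).prod

variable {v : ι → X} {s : ι → X → ℝ} {N : X → Seminorm ℂ B} {K : ℕ} {G : X → ℝ} {f : X → B}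

lemma Bd.base (h : Bd v s N K G f) (x : X) : N x (f x) ≤ G x := by
  simpa using h [] (Nat.zero_le _) x

lemma Bd.nonneg (h : Bd v s N K G f) (x : X) : 0 ≤ G x := (apply_nonneg _ _).trans (h.base x)

lemma bd_zero_iff : Bd v s N 0 G f ↔ ∀ x, N x (f x) ≤ G x := by
  refine ⟨fun h => h.base, fun h l hl x => ?_⟩
  rw [List.length_eq_zero_iff.1 (Nat.le_zero.1 hl)]
  simpa using h x

/-- The recursion behind all estimates below. The first letter of a word is peeled off and its
factor is absorbed into the majorant; this is the reason to allow an arbitrary function `G`. -/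
lemma bd_succ_iff : Bd v s N (K + 1) G f ↔ (∀ x, N x (f x) ≤ G x) ∧
    ∀ i, Bd v s N K (fun x => G x * s i x) (dd (v i) f) := by
  constructor
  · refine fun h => ⟨h.base, fun i l hl x => ?_⟩
    have := h (i :: l) (by simpa using hl) x
    simpa [dl_cons, mul_assoc] using this
  · rintro ⟨h0, h1⟩ (_ | ⟨i, l⟩) hl x
    · simpa using h0 x
    · have := h1 i l (by simpa using hl) x
      simpa [dl_cons, mul_assoc] using this

lemma Bd.deriv (h : Bd v s N (K + 1) G f) (i : ι) : Bd v s N K (fun x => G x * s i x) (dd (v i) f) :=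
  (bd_succ_iff.1 h).2 i

lemma Bd.le {K' : ℕ} (h : Bd v s N K G f) (hK : K' ≤ K) : Bd v s N K' G f :=
  fun l hl x => h l (hl.trans hK) x

lemma Bd.mono {s' : ι → X → ℝ} {N' : X → Seminorm ℂ B} {G' : X → ℝ} (h : Bd v s N K G f)
    (hs : ∀ i x, 0 ≤ s i x) (hs' : ∀ i x, s i x ≤ s' i x) (hG : ∀ x, G x ≤ G' x)
    (hN : ∀ x b, N' x b ≤ N x b) : Bd v s' N' K G' f := by
  intro l hl x
  refine (hN x _).trans ((h l hl x).trans ?_)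
  have h1 : ∀ l : List ι, 0 ≤ (l.map fun i => s i x).prod := fun l =>
    List.prod_nonneg (by simpa using fun i _ => hs i x)
  have h2 : (l.map fun i => s i x).prod ≤ (l.map fun i => s' i x).prod := by
    clear hl
    induction l with
    | nil => simp
    | cons i l ih =>
      simp only [List.map_cons, List.prod_cons]
      exact mul_le_mul (hs' i x) ih (h1 l) ((hs i x).trans (hs' i x))
  exact mul_le_mul (hG x) h2 (h1 l) ((h.nonneg x).trans (hG x))

lemma Bd.mono_right {G' : X → ℝ} (h : Bd v s N K G f) (hs : ∀ i x, 0 ≤ s i x)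
    (hG : ∀ x, G x ≤ G' x) : Bd v s N K G' f :=
  h.mono hs (fun _ _ => le_rfl) hG fun _ _ => le_rfl

lemma Bd.add {G' : X → ℝ} {g : X → B} (hf : ContDiff ℝ ∞ f) (hg : ContDiff ℝ ∞ g)
    (h : Bd v s N K G f) (h' : Bd v s N K G' g) :
    Bd v s N K (fun x => G x + G' x) (fun x => f x + g x) := by
  intro l hl x
  rw [dl_add hf hg, add_mul]
  exact (map_add_le_add _ _ _).trans (add_le_add (h l hl x) (h' l hl x))

lemma Bd.const_smul (hf : ContDiff ℝ ∞ f) (h : Bd v s N K G f) (c : ℂ) :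
    Bd v s N K (fun x => ‖c‖ * G x) (fun x => c • f x) := by
  intro l hl x
  rw [dl_const_smul hf, map_smul_eq_mul, mul_assoc]
  exact mul_le_mul_of_nonneg_left (h l hl x) (norm_nonneg c)

lemma Bd.sum {κ : Type*} (t : Finset κ) {f : κ → X → B} {G : κ → X → ℝ}
    (hf : ∀ k ∈ t, ContDiff ℝ ∞ (f k)) (h : ∀ k ∈ t, Bd v s N K (G k) (f k)) :
    Bd v s N K (fun x => ∑ k ∈ t, G k x) (fun x => ∑ k ∈ t, f k x) := by
  intro l hl x
  rw [dl_sum t hf, Finset.sum_mul]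
  have h1 : N x (∑ k ∈ t, dl v l (f k) x) ≤ ∑ k ∈ t, N x (dl v l (f k) x) :=
    Finset.le_sum_of_subadditive (N x) (map_zero _).le (map_add_le_add _) _ _
  exact h1.trans (Finset.sum_le_sum fun k hk => h k hk l hl x)

lemma Bd.zero (hs : ∀ i x, 0 ≤ s i x) (hG : ∀ x, 0 ≤ G x) :
    Bd v s N K G (fun _ => (0 : B)) := by
  have := Bd.sum (v := v) (s := s) (N := N) (K := K) (∅ : Finset ℕ) (f := fun _ _ => (0 : B))
    (G := fun _ _ => 0) (by simp) (by simp)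
  simp only [Finset.sum_empty] at this
  exact this.mono_right hs hG

/-- Leibniz' rule: each derivative doubles the number of terms, whence `2 ^ K`. The seminorms may
vary with the point, as the twisted norms do. -/
lemma Bd.bilin {B₁ B₂ B₃ : Type*} [NormedAddCommGroup B₁] [NormedSpace ℂ B₁]
    [NormedAddCommGroup B₂] [NormedSpace ℂ B₂] [NormedAddCommGroup B₃] [NormedSpace ℂ B₃]
    (β : B₁ →L[ℝ] B₂ →L[ℝ] B₃) {N₁ : X → Seminorm ℂ B₁} {N₂ : X → Seminorm ℂ B₂}
    {N₃ : X → Seminorm ℂ B₃} (hβ : ∀ x b c, N₃ x (β b c) ≤ N₁ x b * N₂ x c)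
    (hs : ∀ i x, 0 ≤ s i x) {K : ℕ} {G₁ G₂ : X → ℝ} {f : X → B₁} {g : X → B₂}
    (hf : ContDiff ℝ ∞ f) (hg : ContDiff ℝ ∞ g)
    (h : Bd v s N₁ K G₁ f) (h' : Bd v s N₂ K G₂ g) :
    Bd v s N₃ K (fun x => 2 ^ K * (G₁ x * G₂ x)) (fun x => β (f x) (g x)) := by
  have base : ∀ x, N₃ x (β (f x) (g x)) ≤ G₁ x * G₂ x := fun x => (hβ x _ _).trans
    (mul_le_mul (h.base x) (h'.base x) (apply_nonneg _ _) (h.nonneg x))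
  induction K generalizing f g G₁ G₂ with
  | zero => rw [bd_zero_iff]; simpa using base
  | succ K ih =>
    rw [bd_succ_iff]
    constructor
    · intro x
      refine (base x).trans (le_mul_of_one_le_left
        (mul_nonneg (h.nonneg x) (h'.nonneg x)) (one_le_pow₀ (by norm_num)))
    · intro i
      have base' : ∀ {f : X → B₁} {g : X → B₂} {G₁ G₂ : X → ℝ}, Bd v s N₁ K G₁ f →
          Bd v s N₂ K G₂ g → ∀ x, N₃ x (β (f x) (g x)) ≤ G₁ x * G₂ x := fun h h' x =>
        (hβ x _ _).trans (mul_le_mul (h.base x) (h'.base x) (apply_nonneg _ _) (h.nonneg x))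
      rw [dd_bilin β hf hg]
      have e1 := ih hf (contDiff_dd hg (v i)) (h.le (Nat.le_succ _)) (h'.deriv i)
        (base' (h.le (Nat.le_succ _)) (h'.deriv i))
      have e2 := ih (contDiff_dd hf (v i)) hg (h.deriv i) (h'.le (Nat.le_succ _))
        (base' (h.deriv i) (h'.le (Nat.le_succ _)))
      refine (e1.add (contDiff_bilin β hf (contDiff_dd hg _))
        (contDiff_bilin β (contDiff_dd hf _) hg) e2).mono_right hs fun x => le_of_eq ?_
      ring

/-- A factor `Λ` per letter amounts to at most `Λ ^ K`, also for words shorter than `K`, because `Λ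
≥ 1`. -/
lemma Bd.rescale {Λ : ℝ} (hΛ : 1 ≤ Λ) (hs : ∀ i x, 0 ≤ s i x)
    (h : Bd v (fun i x => Λ * s i x) N K G f) : Bd v s N K (fun x => Λ ^ K * G x) f := by
  intro l hl x
  refine (h l hl x).trans ?_
  have e : (l.map fun i => Λ * s i x).prod = Λ ^ l.length * (l.map fun i => s i x).prod := by
    clear hl
    induction l with
    | nil => simp
    | cons i l ih => simp only [List.map_cons, List.prod_cons, ih, List.length_cons]; ring
  beta_reduce
  rw [e, mul_comm (Λ ^ K), mul_assoc]
  exact mul_le_mul_of_nonneg_left (mul_le_mul_of_nonneg_right (pow_le_pow_right₀ hΛ hl)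
    (List.prod_nonneg (by simpa using fun i _ => hs i x))) (h.nonneg x)

/-- Chain rule for an affine substitution: a derivative in the new variables is a combination, with
coefficients `c`, of old ones. The function `D` pays for the change of seminorm between `x` and `p +
A x`. Slices, pullbacks and restrictions to the diagonal are all instances. -/
lemma Bd.comp_affine {X' ι' : Type*} [NormedAddCommGroup X'] [NormedSpace ℝ X'] [Fintype ι]
    {v' : ι' → X'} {s' : ι' → X' → ℝ} {N' : X' → Seminorm ℂ B} (p : X) (A : X' →L[ℝ] X)
    (c : ι' → ι → ℝ) (hA : ∀ i, A (v' i) = ∑ j, c i j • v j) {Λ : ℝ} (hΛ : 1 ≤ Λ)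
    (hs : ∀ i x, 0 ≤ s' i x) (hc : ∀ i x, ∑ j, |c i j| * s j (p + A x) ≤ Λ * s' i x)
    {D : X' → ℝ} (hD : ∀ x, 0 ≤ D x) (hN : ∀ x b, N' x b ≤ D x * N (p + A x) b)
    {K : ℕ} {G : X → ℝ} {f : X → B} (hf : ContDiff ℝ ∞ f) (h : Bd v s N K G f) :
    Bd v' s' N' K (fun x => Λ ^ K * (D x * G (p + A x))) (fun x => f (p + A x)) := by
  -- With `Λ` inside the weights the constant does not change with the number of derivatives, and
  -- the induction closes.
  refine Bd.rescale hΛ hs ?_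
  induction K generalizing f G with
  | zero =>
    rw [bd_zero_iff]
    exact fun x => (hN x _).trans (mul_le_mul_of_nonneg_left (h.base _) (hD x))
  | succ K ih =>
    rw [bd_succ_iff]
    refine ⟨fun x => (hN x _).trans (mul_le_mul_of_nonneg_left (h.base _) (hD x)), fun i => ?_⟩
    have e : dd (v' i) (fun x => f (p + A x))
        = fun x => ∑ j, (c i j : ℂ) • dd (v j) f (p + A x) := by
      rw [dd_comp_affine hf, hA, dd_sum_dir]
      funext x
      simp [dd_smul_dir]
    rw [e]
    have sm : ∀ j, ContDiff ℝ ∞ (fun x => dd (v j) f (p + A x)) := fun j =>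
      contDiff_comp_affine (contDiff_dd hf _) p A
    refine (Bd.sum Finset.univ (fun j _ => contDiff_const.smul (sm j)) fun j _ =>
      (ih (contDiff_dd hf (v j)) (h.deriv j)).const_smul (sm j) (c i j : ℂ)).mono_right
      (fun i x => mul_nonneg (zero_le_one.trans hΛ) (hs i x)) fun x => ?_
    have hG := h.nonneg (p + A x)
    calc ∑ j, ‖(c i j : ℂ)‖ * (D x * (G (p + A x) * s j (p + A x)))
        = (D x * G (p + A x)) * ∑ j, |c i j| * s j (p + A x) := by
          rw [Finset.mul_sum]
          refine Finset.sum_congr rfl fun j _ => ?_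
          rw [Complex.norm_real, Real.norm_eq_abs]; ring
      _ ≤ D x * G (p + A x) * (Λ * s' i x) :=
          mul_le_mul_of_nonneg_left (hc i x) (mul_nonneg (hD x) hG)

lemma Bd.comp_clm {C : Type*} [NormedAddCommGroup C] [NormedSpace ℂ C] (T : B →L[ℂ] C)
    {N' : X → Seminorm ℂ C} (hT : ∀ x b, N' x (T b) ≤ N x b) (hf : ContDiff ℝ ∞ f)
    (h : Bd v s N K G f) : Bd v s N' K G (fun x => T (f x)) := by
  intro l hl x
  rw [dl_comp_clm hf]
  exact (hT x _).trans (h l hl x)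

/-- Functions with values in a family that is stable under directional derivatives are smooth. -/
lemma contDiff_of_family {P : Type*} [NormedAddCommGroup P] [NormedSpace ℝ P]
    [FiniteDimensional ℝ P] (S : Set (P → B)) (hS : ∀ f ∈ S, Differentiable ℝ f)
    (hd : ∀ f ∈ S, ∀ h : P, dd h f ∈ S) : ∀ f ∈ S, ContDiff ℝ ∞ f := by
  have key : ∀ n : ℕ, ∀ f ∈ S, ContDiff ℝ n f := by
    intro n
    induction n with
    | zero => exact fun f hf => contDiff_zero.2 (hS f hf).continuous
    | succ n ih =>
      intro f hf
      have : ((n + 1 : ℕ) : WithTop ℕ∞) = (n : WithTop ℕ∞) + 1 := by norm_cast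
      rw [this, contDiff_succ_iff_fderiv]
      refine ⟨hS f hf, by simp, ?_⟩
      rw [contDiff_clm_apply_iff]
      exact fun h => ih _ (hd f hf h)
  exact fun f hf => contDiff_infty.2 fun n => key n f hf

end Words

/-! ### The weight `⟨·⟩` and the amplitude classes on `ℝ^q × ℝ^q` -/

section Jap

variable {q : ℕ}

lemma jap_sq (x : V q) : jap x ^ 2 = 1 + ‖x‖ ^ 2 := Real.sq_sqrt (by positivity)

lemma one_le_jap (x : V q) : 1 ≤ jap x := by
  rw [jap, Real.one_le_sqrt]
  nlinarith [sq_nonneg ‖x‖]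

lemma norm_le_jap (x : V q) : ‖x‖ ≤ jap x := Real.le_sqrt_of_sq_le (by linarith)

lemma jap_le (x : V q) : jap x ≤ 1 + ‖x‖ := by
  rw [jap, Real.sqrt_le_left (by positivity)]
  nlinarith [norm_nonneg x]

@[simp] lemma jap_zero : jap (0 : V q) = 1 := by simp [jap]

@[simp] lemma jap_neg (x : V q) : jap (-x) = jap x := by simp [jap]

lemma jap_add_le (x y : V q) : jap (x + y) ≤ 2 * jap y * jap x := by
  have h : jap (x + y) ^ 2 ≤ (2 * jap y * jap x) ^ 2 := by
    rw [mul_pow, mul_pow, jap_sq, jap_sq, jap_sq]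
    have h1 : ‖x + y‖ ^ 2 ≤ (‖x‖ + ‖y‖) ^ 2 := pow_le_pow_left₀ (norm_nonneg _) (norm_add_le x y) 2
    nlinarith [sq_nonneg (‖x‖ - ‖y‖), sq_nonneg (‖x‖ * ‖y‖), sq_nonneg ‖x‖, sq_nonneg ‖y‖]
  exact le_of_sq_le_sq₀ h (by have := jap_pos x; have := jap_pos y; positivity)
where le_of_sq_le_sq₀ {a b : ℝ} (h : a ^ 2 ≤ b ^ 2) (hb : 0 ≤ b) : a ≤ b := abs_le_of_sq_le_sq' h hb |>.2

lemma jap_smul_le (c : ℝ) (x : V q) : jap (c • x) ≤ (1 + |c|) * jap x := by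
  have h : jap (c • x) ^ 2 ≤ ((1 + |c|) * jap x) ^ 2 := by
    rw [mul_pow, jap_sq, jap_sq, norm_smul, Real.norm_eq_abs]
    have := abs_nonneg c
    nlinarith [sq_nonneg ‖x‖, sq_nonneg (|c| * ‖x‖), mul_nonneg this (sq_nonneg ‖x‖)]
  exact (abs_le_of_sq_le_sq' h (by have := jap_pos x; positivity)).2

lemma jap_rpow_pos (x : V q) (s : ℝ) : 0 < jap x ^ s := Real.rpow_pos_of_pos (jap_pos x) s

/-- Peetre's inequality. -/
lemma jap_rpow_add_le (x y : V q) (s : ℝ) : jap (x + y) ^ s ≤ (2 * jap y) ^ |s| * jap x ^ s := by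
  have hx := jap_pos x
  have hy := jap_pos y
  rcases le_total 0 s with hs | hs
  · rw [abs_of_nonneg hs, ← Real.mul_rpow (by positivity) hx.le]
    exact Real.rpow_le_rpow (jap_pos _).le (jap_add_le x y) hs
  -- For a negative exponent the elementary inequality is applied to `x = (x + y) - y`.
  · have h1 : jap x ≤ 2 * jap y * jap (x + y) := by
      have := jap_add_le (x + y) (-y)
      rwa [add_neg_cancel_right, jap_neg] at this
    have h2 : (2 * jap y * jap (x + y)) ^ s ≤ jap x ^ s :=
      Real.rpow_le_rpow_of_nonpos hx h1 hs
    rw [Real.mul_rpow (by positivity) (jap_pos _).le] at h2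
    rw [abs_of_nonpos hs, Real.rpow_neg (by positivity), inv_mul_eq_div, le_div_iff₀ (by positivity),
      mul_comm]
    exact h2

lemma jap_rpow_mono (x : V q) {s t : ℝ} (h : s ≤ t) : jap x ^ s ≤ jap x ^ t :=
  Real.rpow_le_rpow_of_exponent_le (one_le_jap x) h

lemma one_le_jap_rpow (x : V q) {s : ℝ} (h : 0 ≤ s) : 1 ≤ jap x ^ s :=
  Real.one_le_rpow (one_le_jap x) h

lemma continuous_jap : Continuous (jap : V q → ℝ) := by
  unfold jap; fun_prop

lemma integrable_jap_rpow {s : ℝ} (hs : s < -q) : Integrable (fun x : V q => jap x ^ s) := by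
  have h := integrable_rpow_neg_one_add_norm_sq (E := V q) (μ := volume) (r := -s)
    (by simpa using by linarith)
  refine h.congr (Eventually.of_forall fun x => ?_)
  simp only [neg_neg, jap]
  rw [Real.sqrt_eq_rpow, ← Real.rpow_mul (by positivity)]
  congr 1; ring

end Jap

/-! ### Amplitude classes: order in `ξ`, growth in `x`, finitely many derivatives -/

section Amp

variable {q : ℕ} {B : Type*} [NormedAddCommGroup B] [NormedSpace ℂ B]

/-- The coordinate directions of `ℝ^q × ℝ^q`. -/
def dir2 : Fin q ⊕ Fin q → V q × V q := Sum.elim dirY dirEta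

/-- The factors `⟨ξ⟩^δ` for `x`-derivatives and `⟨ξ⟩^{-ϱ}` for `ξ`-derivatives. -/
def wt2 (ϱ δ : ℝ) (i : Fin q ⊕ Fin q) (p : V q × V q) : ℝ :=
  jap p.2 ^ (Sum.elim (fun _ => δ) (fun _ => -ϱ) i : ℝ)

lemma wt2_nonneg (ϱ δ : ℝ) (i : Fin q ⊕ Fin q) (p : V q × V q) : 0 ≤ wt2 ϱ δ i p :=
  (jap_rpow_pos _ _).le

/-- The estimates `‖∂^l f(x, ξ)‖ ≤ R ⟨x⟩^k ⟨ξ⟩^{m + δ j}`, where `j` counts the `x`-derivatives in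
the word `l`, of length at most `K`. -/
def AmpBd (δ : ℝ) (K : ℕ) (m k R : ℝ) (f : V q × V q → B) : Prop :=
  Bd dir2 (wt2 0 δ) (fun _ => normSeminorm ℂ B) K (fun p => R * (jap p.1 ^ k * jap p.2 ^ m)) f

variable {δ : ℝ} {K : ℕ} {m k R : ℝ} {f : V q × V q → B}

lemma AmpBd.nonneg (h : AmpBd δ K m k R f) : 0 ≤ R := by
  have := Bd.nonneg h 0
  simpa using this

lemma AmpBd.base (h : AmpBd δ K m k R f) (p : V q × V q) :
    ‖f p‖ ≤ R * (jap p.1 ^ k * jap p.2 ^ m) := Bd.base h p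

lemma AmpBd.le {K' : ℕ} (h : AmpBd δ K m k R f) (hK : K' ≤ K) : AmpBd δ K' m k R f := Bd.le h hK

lemma AmpBd.mono {m' k' R' : ℝ} (h : AmpBd δ K m k R f) (hm : m ≤ m') (hk : k ≤ k')
    (hR : R ≤ R') : AmpBd δ K m' k' R' f := by
  refine Bd.mono_right h (wt2_nonneg _ _) fun p => ?_
  exact mul_le_mul hR (mul_le_mul (jap_rpow_mono _ hk) (jap_rpow_mono _ hm) (jap_rpow_pos _ _).le
    (jap_rpow_pos _ _).le) (weight_pos _ _ _ _).le (h.nonneg.trans hR)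

lemma AmpBd.mono_delta {δ' : ℝ} (h : AmpBd δ K m k R f) (hδ : δ ≤ δ') : AmpBd δ' K m k R f := by
  refine Bd.mono h (wt2_nonneg _ _) (fun i p => ?_) (fun _ => le_rfl) fun _ _ => le_rfl
  rcases i with i | i
  · exact jap_rpow_mono _ hδ
  · exact le_rfl

lemma AmpBd.add {R' : ℝ} {g : V q × V q → B} (hf : ContDiff ℝ ∞ f) (hg : ContDiff ℝ ∞ g)
    (h : AmpBd δ K m k R f) (h' : AmpBd δ K m k R' g) :
    AmpBd δ K m k (R + R') (fun p => f p + g p) := by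
  refine (Bd.add hf hg h h').mono_right (wt2_nonneg _ _) fun p => le_of_eq ?_
  ring

lemma AmpBd.const_smul (hf : ContDiff ℝ ∞ f) (h : AmpBd δ K m k R f) (c : ℂ) :
    AmpBd δ K m k (‖c‖ * R) (fun p => c • f p) := by
  refine (Bd.const_smul hf h c).mono_right (wt2_nonneg _ _) fun p => le_of_eq ?_
  ring

lemma AmpBd.sum {κ : Type*} (t : Finset κ) {f : κ → V q × V q → B} {R : κ → ℝ}
    (hf : ∀ j ∈ t, ContDiff ℝ ∞ (f j)) (h : ∀ j ∈ t, AmpBd δ K m k (R j) (f j)) :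
    AmpBd δ K m k (∑ j ∈ t, R j) (fun p => ∑ j ∈ t, f j p) := by
  refine (Bd.sum t hf h).mono_right (wt2_nonneg _ _) fun p => le_of_eq ?_
  rw [Finset.sum_mul]

lemma AmpBd.dd_inl (h : AmpBd δ (K + 1) m k R f) (j : Fin q) :
    AmpBd δ K (m + δ) k R (dd (dirY j) f) := by
  refine (Bd.deriv h (Sum.inl j)).mono_right (wt2_nonneg _ _) fun p => le_of_eq ?_
  simp only [wt2, Sum.elim_inl]
  rw [Real.rpow_add (jap_pos _)]; ring

lemma AmpBd.dd_inr (h : AmpBd δ (K + 1) m k R f) (j : Fin q) :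
    AmpBd δ K m k R (dd (dirEta j) f) := by
  refine (Bd.deriv h (Sum.inr j)).mono_right (wt2_nonneg _ _) fun p => le_of_eq ?_
  simp [wt2]

/-- Sufficient condition by recursion. -/
lemma AmpBd.succ (h0 : ∀ p, ‖f p‖ ≤ R * (jap p.1 ^ k * jap p.2 ^ m))
    (h1 : ∀ j, AmpBd δ K (m + δ) k R (dd (dirY j) f))
    (h2 : ∀ j, AmpBd δ K m k R (dd (dirEta j) f)) : AmpBd δ (K + 1) m k R f := by
  refine bd_succ_iff.2 ⟨h0, ?_⟩
  rintro (j | j)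
  · refine (h1 j).mono_right (wt2_nonneg _ _) fun p => le_of_eq ?_
    simp only [wt2, Sum.elim_inl]
    rw [Real.rpow_add (jap_pos _)]; ring
  · refine (h2 j).mono_right (wt2_nonneg _ _) fun p => le_of_eq ?_
    simp [wt2]

lemma AmpBd.bilin {B₁ B₂ B₃ : Type*} [NormedAddCommGroup B₁] [NormedSpace ℂ B₁]
    [NormedAddCommGroup B₂] [NormedSpace ℂ B₂] [NormedAddCommGroup B₃] [NormedSpace ℂ B₃]
    (β : B₁ →L[ℝ] B₂ →L[ℝ] B₃) (hβ : ∀ b c, ‖β b c‖ ≤ ‖b‖ * ‖c‖) {m₁ k₁ R₁ m₂ k₂ R₂ : ℝ}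
    {f : V q × V q → B₁} {g : V q × V q → B₂} (hf : ContDiff ℝ ∞ f) (hg : ContDiff ℝ ∞ g)
    (h : AmpBd δ K m₁ k₁ R₁ f) (h' : AmpBd δ K m₂ k₂ R₂ g) :
    AmpBd δ K (m₁ + m₂) (k₁ + k₂) (2 ^ K * (R₁ * R₂)) (fun p => β (f p) (g p)) := by
  refine (Bd.bilin β (fun _ => hβ) (wt2_nonneg _ _) hf hg h h').mono_right (wt2_nonneg _ _)
    fun p => le_of_eq ?_
  rw [Real.rpow_add (jap_pos _), Real.rpow_add (jap_pos _)]
  ring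

lemma AmpBd.smul {m₁ k₁ R₁ : ℝ} {c : V q × V q → ℂ} (hc : ContDiff ℝ ∞ c) (hf : ContDiff ℝ ∞ f)
    (h : AmpBd δ K m₁ k₁ R₁ c) (h' : AmpBd δ K m k R f) :
    AmpBd δ K (m₁ + m) (k₁ + k) (2 ^ K * (R₁ * R)) (fun p => c p • f p) :=
  AmpBd.bilin (ContinuousLinearMap.lsmul ℝ ℂ) (fun b c => by simp [norm_smul]) hc hf h h'

lemma AmpBd.zero (hR : 0 ≤ R) : AmpBd δ K m k R (fun _ : V q × V q => (0 : B)) :=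
  Bd.zero (wt2_nonneg _ _) fun _ => mul_nonneg hR (weight_pos _ _ _ _).le

lemma AmpBd.const (c : B) : AmpBd δ K 0 0 ‖c‖ (fun _ : V q × V q => c) := by
  induction K with
  | zero => exact bd_zero_iff.2 fun p => by simp
  | succ K ih =>
    have : ∀ v : V q × V q, dd v (fun _ => c) = fun _ => 0 := fun v => by funext x; simp [dd]
    refine AmpBd.succ (fun p => by simp) (fun j => ?_) fun j => ?_
    all_goals rw [this]; exact AmpBd.zero (norm_nonneg _)

lemma norm_stdv (j : Fin q) : ‖(stdv j : V q)‖ = 1 := by simp [stdv]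

/-- Linear functions are amplitudes. -/
lemma AmpBd.linear (hδ : 0 ≤ δ) (A : V q × V q →L[ℝ] B) : AmpBd δ K 1 1 (2 * ‖A‖) (fun p => A p) := by
  have hb : ∀ p, ‖A p‖ ≤ 2 * ‖A‖ * (jap p.1 ^ (1 : ℝ) * jap p.2 ^ (1 : ℝ)) := by
    intro p
    refine (A.le_opNorm p).trans ?_
    have h1 : ‖p‖ ≤ 2 * (jap p.1 * jap p.2) := by
      have := norm_fst_le p
      rw [Prod.norm_def]
      have a1 := one_le_jap p.1
      have a2 := one_le_jap p.2
      have b1 := norm_le_jap p.1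
      have b2 := norm_le_jap p.2
      refine max_le ?_ ?_ <;> nlinarith
    rw [Real.rpow_one, Real.rpow_one, mul_comm 2, mul_assoc]
    exact mul_le_mul_of_nonneg_left h1 (norm_nonneg _)
  have hd : ∀ v : V q × V q, dd v (fun p => A p) = fun _ => A v := fun v => by
    funext x
    unfold dd
    rw [ContinuousLinearMap.fderiv]
  have hn : ∀ v : V q × V q, ‖v‖ ≤ 1 → ‖A v‖ ≤ 2 * ‖A‖ := fun v hv => by
    have := A.le_opNorm v
    nlinarith [norm_nonneg A]
  cases K with
  | zero => exact bd_zero_iff.2 hb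
  | succ K =>
    refine AmpBd.succ hb (fun j => ?_) fun j => ?_
    · rw [hd]
      exact (AmpBd.const _).mono (by linarith) zero_le_one (hn _ (by simp [dirY, norm_stdv]))
    · rw [hd]
      exact (AmpBd.const _).mono zero_le_one zero_le_one (hn _ (by simp [dirEta, norm_stdv]))

lemma AmpBd.comp_clm {C : Type*} [NormedAddCommGroup C] [NormedSpace ℂ C] (T : B →L[ℂ] C)
    (hf : ContDiff ℝ ∞ f) (h : AmpBd δ K m k R f) : AmpBd δ K m k (‖T‖ * R) (fun p => T (f p)) := by
  intro l hl p
  rw [dl_comp_clm hf, mul_assoc, mul_assoc]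
  refine (T.le_opNorm _).trans (mul_le_mul_of_nonneg_left ?_ (norm_nonneg _))
  rw [← mul_assoc]
  exact h l hl p

end Amp

/-! ### The coefficients of the integrations by parts -/

section Coef

variable {q : ℕ}

/-- `⟨x⟩^{-2}` and `x_j ⟨x⟩^{-2}`. -/
def japCoef : Option (Fin q) → V q → ℂ
  | none, x => ((1 + ‖x‖ ^ 2)⁻¹ : ℝ)
  | some j, x => (x j * (1 + ‖x‖ ^ 2)⁻¹ : ℝ)

lemma contDiff_japCoef (i : Option (Fin q)) : ContDiff ℝ ∞ (japCoef i) := by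
  have h : ContDiff ℝ ∞ (fun x : V q => (1 + ‖x‖ ^ 2)⁻¹) :=
    (contDiff_const.add (contDiff_norm_sq ℝ)).inv fun x => by positivity
  cases i with
  | none => exact Complex.ofRealCLM.contDiff.comp h
  | some j =>
    have h2 : ContDiff ℝ ∞ (fun x : V q => x j) := (EuclideanSpace.proj (𝕜 := ℝ) j).contDiff
    exact Complex.ofRealCLM.contDiff.comp (h2.mul h)

/-- The identity `1 = ⟨x⟩⁻²(1 + ∑ x_j x_j)`. With each `x_j` produced by differentiating the phase,
it exhibits the phase as the image of itself under a first order operator with decaying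
coefficients. -/
lemma japCoef_sum (x : V q) : japCoef none x + ∑ j, (x j : ℂ) * japCoef (some j) x = 1 := by
  simp only [japCoef]
  have h : (1 + ‖x‖ ^ 2) ≠ 0 := by positivity
  have e : ‖x‖ ^ 2 = ∑ j, x j ^ 2 := by
    rw [EuclideanSpace.norm_sq_eq]; simp
  rw [← Complex.ofReal_one]
  simp only [← Complex.ofReal_mul, ← Complex.ofReal_sum, ← Complex.ofReal_add]
  congr 1
  have : ∑ j, x j * (x j * (1 + ‖x‖ ^ 2)⁻¹) = ‖x‖ ^ 2 * (1 + ‖x‖ ^ 2)⁻¹ := by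
    rw [e, Finset.sum_mul]
    exact Finset.sum_congr rfl fun j _ => by ring
  rw [this]
  field_simp

lemma abs_apply_le (x : V q) (j : Fin q) : |x j| ≤ ‖x‖ := by
  simpa using PiLp.norm_apply_le x j

lemma norm_japCoef_le (i : Option (Fin q)) (x : V q) : ‖japCoef i x‖ ≤ jap x ^ (-1 : ℝ) := by
  have h := one_le_jap x
  have hp := jap_pos x
  rw [Real.rpow_neg_one]
  cases i with
  | none =>
    rw [japCoef, Complex.norm_real, Real.norm_eq_abs, abs_of_nonneg (by positivity), ← jap_sq]
    exact inv_anti₀ hp (by nlinarith)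
  | some j =>
    rw [japCoef, Complex.norm_real, Real.norm_eq_abs, abs_mul, abs_of_nonneg (a := (_)⁻¹)
      (by positivity), ← jap_sq, sq, mul_inv, ← mul_assoc]
    have h1 : |x j| * (jap x)⁻¹ ≤ 1 := by
      rw [mul_inv_le_iff₀ hp, one_mul]
      exact (abs_apply_le x j).trans (norm_le_jap x)
    exact mul_le_of_le_one_left (by positivity) h1

/-- The derivatives of the coefficients are polynomials of degree at most two in the coefficients
themselves, so their estimates can be proved by induction without explicit formulas. -/
lemma dd_japCoef_none (i : Fin q) :
    dd (stdv i) (japCoef none) = fun x => (-2 : ℂ) • (japCoef (some i) x • japCoef none x) := by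
  funext x
  have h1 : HasFDerivAt (fun x : V q => 1 + ‖x‖ ^ 2) (2 • (innerSL ℝ x)) x :=
    (hasStrictFDerivAt_norm_sq x).hasFDerivAt.const_add 1
  have h2 := (hasDerivAt_inv (x := 1 + ‖x‖ ^ 2) (by positivity)).comp_hasFDerivAt x h1
  have h3 := Complex.ofRealCLM.hasFDerivAt.comp x h2
  have h4 : HasFDerivAt (japCoef none) _ x := h3
  unfold dd
  rw [h4.fderiv]
  simp [japCoef, stdv, EuclideanSpace.inner_single_right]
  generalize (1 + (‖x‖ : ℂ) ^ 2) = A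
  ring

lemma dd_japCoef_some (i j : Fin q) :
    dd (stdv i) (japCoef (some j)) = fun x => (if i = j then (1 : ℂ) else 0) • japCoef none x
      + (-2 : ℂ) • (japCoef (some i) x • japCoef (some j) x) := by
  funext x
  have h1 : HasFDerivAt (fun x : V q => 1 + ‖x‖ ^ 2) (2 • (innerSL ℝ x)) x :=
    (hasStrictFDerivAt_norm_sq x).hasFDerivAt.const_add 1
  have h2 := (hasDerivAt_inv (x := 1 + ‖x‖ ^ 2) (by positivity)).comp_hasFDerivAt x h1
  have h0 : HasFDerivAt (fun x : V q => x j) (EuclideanSpace.proj (𝕜 := ℝ) j) x :=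
    (EuclideanSpace.proj (𝕜 := ℝ) j).hasFDerivAt
  have h3 := Complex.ofRealCLM.hasFDerivAt.comp x (h0.mul h2)
  have h4 : HasFDerivAt (japCoef (some j)) _ x := h3
  unfold dd
  rw [h4.fderiv]
  by_cases h : i = j
  · subst h
    simp [japCoef, stdv, EuclideanSpace.inner_single_right]
    generalize (1 + (‖x‖ : ℂ) ^ 2) = A
    ring
  · have h' : ¬ j = i := fun e => h e.symm
    simp [japCoef, stdv, EuclideanSpace.inner_single_right, h, h']
    generalize (1 + (‖x‖ : ℂ) ^ 2) = A
    ring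

/-- Each derivative is again a combination of coefficients and products of two of them, and a
product decays at least as fast as one factor. The decay `⟨x⟩⁻¹` is thus kept; the additional decay
of derivatives is not needed. -/
lemma bd_japCoef (K : ℕ) : ∃ R : ℝ, ∀ i : Option (Fin q),
    Bd stdv (fun _ _ => (1 : ℝ)) (fun _ => normSeminorm ℂ ℂ) K (fun x => R * jap x ^ (-1 : ℝ))
      (japCoef i) := by
  induction K with
  | zero => exact ⟨1, fun i => bd_zero_iff.2 fun x => by simpa using norm_japCoef_le i x⟩
  | succ K ih =>
    obtain ⟨R, hR⟩ := ih
    have hR0 : 0 ≤ R := by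
      have := (hR none).nonneg 0
      simpa using this
    have h1 : ∀ (i : Fin q) (x : V q), (0 : ℝ) ≤ (fun _ _ => (1 : ℝ)) i x := fun _ _ => zero_le_one
    have hq : ∀ i j : Option (Fin q), Bd stdv (fun _ _ => (1 : ℝ)) (fun _ => normSeminorm ℂ ℂ) K
        (fun x => 2 ^ K * (R * R) * jap x ^ (-1 : ℝ)) (fun x => japCoef i x • japCoef j x) := by
      intro i j
      refine (Bd.bilin (ContinuousLinearMap.lsmul ℝ ℂ) (fun _ b c => by simp) h1
        (contDiff_japCoef i) (contDiff_japCoef j) (hR i) (hR j)).mono_right h1 fun x => ?_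
      have : jap x ^ (-1 : ℝ) ≤ 1 :=
        Real.rpow_le_one_of_one_le_of_nonpos (one_le_jap x) (by norm_num)
      have hp := jap_rpow_pos x (-1)
      have : jap x ^ (-1 : ℝ) * jap x ^ (-1 : ℝ) ≤ jap x ^ (-1 : ℝ) := mul_le_of_le_one_left hp.le this
      calc 2 ^ K * (R * jap x ^ (-1 : ℝ) * (R * jap x ^ (-1 : ℝ)))
          = 2 ^ K * (R * R) * (jap x ^ (-1 : ℝ) * jap x ^ (-1 : ℝ)) := by ring
        _ ≤ _ := mul_le_mul_of_nonneg_left this (by positivity)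
    have sm : ∀ i j : Option (Fin q), ContDiff ℝ ∞ (fun x => japCoef i x • japCoef j x) :=
      fun i j => (contDiff_japCoef i).smul (contDiff_japCoef j)
    refine ⟨1 + R + 2 * (2 ^ K * (R * R)), fun i => bd_succ_iff.2 ⟨fun x => ?_, fun a => ?_⟩⟩
    · refine (norm_japCoef_le i x).trans (le_mul_of_one_le_left (jap_rpow_pos _ _).le ?_)
      have : 0 ≤ 2 ^ K * (R * R) := by positivity
      linarith
    · have hc := (hq (some a) i).const_smul (sm _ _) (-2)
      cases i with
      | none =>
        rw [dd_japCoef_none]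
        refine hc.mono_right h1 fun x => ?_
        have hp := jap_rpow_pos x (-1)
        simp only [norm_neg, Complex.norm_ofNat, mul_one]
        nlinarith [mul_nonneg hR0 hp.le]
      | some j =>
        rw [dd_japCoef_some]
        have s1 : ContDiff ℝ ∞ (fun x : V q => (if a = j then (1 : ℂ) else 0) • japCoef none x) :=
          (contDiff_japCoef none).const_smul _
        have s2 : ContDiff ℝ ∞ (fun x => (-2 : ℂ) • (japCoef (some a) x • japCoef (some j) x)) :=
          (sm (some a) (some j)).const_smul _
        refine (Bd.add s1 s2 ((hR none).const_smul (contDiff_japCoef none) _)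
          hc).mono_right h1 fun x => ?_
        have hp := jap_rpow_pos x (-1)
        have : ‖(if a = j then (1 : ℂ) else 0)‖ ≤ 1 := by split_ifs <;> simp
        simp only [norm_neg, Complex.norm_ofNat, mul_one]
        nlinarith [mul_nonneg hR0 hp.le, mul_le_of_le_one_left (mul_nonneg hR0 hp.le) this]

variable {δ : ℝ}

lemma ampBd_japCoef_snd (K : ℕ) : ∃ R : ℝ, ∀ i : Option (Fin q),
    AmpBd δ K (-1) 0 R (fun p => japCoef i p.2) := by
  obtain ⟨R, hR⟩ := bd_japCoef (q := q) K
  refine ⟨R, fun i => ?_⟩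
  have := Bd.comp_affine (v' := dir2 (q := q)) (s' := wt2 0 δ) (N' := fun _ => normSeminorm ℂ ℂ)
    (0 : V q) (ContinuousLinearMap.snd ℝ (V q) (V q))
    (Sum.elim (fun _ _ => 0) (fun i j => if i = j then 1 else 0))
    (by rintro (i | i) <;> simp [dir2, dirY, dirEta]) le_rfl (wt2_nonneg _ _)
    (by
      rintro (i | i) x
      · simpa using wt2_nonneg _ _ _ _
      · simp [wt2, Finset.sum_ite_eq, apply_ite abs]) (D := fun _ => 1) (fun _ => zero_le_one)
    (by simp) (contDiff_japCoef i) (hR i)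
  simpa [AmpBd] using this

lemma ampBd_japCoef_fst (hδ : 0 ≤ δ) (K : ℕ) : ∃ R : ℝ, ∀ i : Option (Fin q),
    AmpBd δ K 0 (-1) R (fun p => japCoef i p.1) := by
  obtain ⟨R, hR⟩ := bd_japCoef (q := q) K
  refine ⟨R, fun i => ?_⟩
  have := Bd.comp_affine (v' := dir2 (q := q)) (s' := wt2 0 δ) (N' := fun _ => normSeminorm ℂ ℂ)
    (0 : V q) (ContinuousLinearMap.fst ℝ (V q) (V q))
    (Sum.elim (fun i j => if i = j then 1 else 0) (fun _ _ => 0))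
    (by rintro (i | i) <;> simp [dir2, dirY, dirEta]) le_rfl (wt2_nonneg _ _)
    (by
      rintro (i | i) x
      · simpa [wt2, Finset.sum_ite_eq, apply_ite abs] using one_le_jap_rpow x.2 hδ
      · simpa using wt2_nonneg _ _ _ _) (D := fun _ => 1) (fun _ => zero_le_one)
    (by simp) (contDiff_japCoef i) (hR i)
  simpa [AmpBd] using this

end Coef

/-! ### Integration by parts -/

section Osc

variable {q : ℕ} {B : Type*} [NormedAddCommGroup B] [NormedSpace ℂ B]

/-- The phase `e^{-ixξ}`. -/
def ph (p : V q × V q) : ℂ := Complex.exp (-Complex.I * (inner ℝ p.1 p.2 : ℝ))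

lemma norm_ph (p : V q × V q) : ‖ph p‖ = 1 := by
  rw [ph, Complex.norm_exp]; simp

lemma continuous_ph : Continuous (ph : V q × V q → ℂ) := by
  unfold ph; fun_prop

lemma ph_swap (p : V q × V q) : ph p.swap = ph p := by
  rw [ph, ph, Prod.fst_swap, Prod.snd_swap, real_inner_comm]

lemma hasFDerivAt_ph_fst (ξ x : V q) (j : Fin q) :
    DifferentiableAt ℝ (fun x => ph (x, ξ)) x ∧
      fderiv ℝ (fun x => ph (x, ξ)) x (stdv j) = (-Complex.I * ξ j) * ph (x, ξ) := by
  have h1 : HasFDerivAt (fun x : V q => (inner ℝ x ξ : ℝ)) (innerSL ℝ ξ) x := by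
    have := (innerSL ℝ ξ).hasFDerivAt (x := x)
    refine this.congr_of_eventuallyEq (Eventually.of_forall fun y => ?_)
    simp [real_inner_comm]
  have h2 := ((Complex.ofRealCLM.hasFDerivAt.comp x h1).const_mul (-Complex.I)).cexp
  have h3 : HasFDerivAt (fun x => ph (x, ξ)) _ x := h2
  refine ⟨h3.differentiableAt, ?_⟩
  rw [h3.fderiv]
  simp [ph, stdv, EuclideanSpace.inner_single_right]
  ring

lemma integrable_ph_smul {μ : Measure (V q)} {f : V q → B} (ξ : V q) (hf : Integrable f μ) :
    Integrable (fun x => ph (x, ξ) • f x) μ := by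
  refine hf.bdd_smul 1 ?_ (Eventually.of_forall fun x => (norm_ph _).le)
  exact (continuous_ph.comp (by fun_prop)).aestronglyMeasurable

lemma integral_ph_smul_dd {f : V q → B} (hf : ContDiff ℝ ∞ f) (ξ : V q) (j : Fin q)
    (h0 : Integrable f) (h1 : Integrable (dd (stdv j) f)) :
    ∫ x, ph (x, ξ) • dd (stdv j) f x = (Complex.I * ξ j) • ∫ x, ph (x, ξ) • f x := by
  have e : ∀ x : V q, fderiv ℝ (fun x => ph (x, ξ)) x (stdv j) • f x
      = (-Complex.I * ξ j) • (ph (x, ξ) • f x) := fun x => by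
    rw [(hasFDerivAt_ph_fst ξ x j).2, mul_smul]
  have := integral_smul_fderiv_eq_neg_fderiv_smul_of_integrable (μ := volume)
    (f := fun x => ph (x, ξ)) (g := f) (v := stdv j) (by
      simp only [e]
      exact (integrable_ph_smul ξ h0).smul _) (integrable_ph_smul ξ h1)
    (integrable_ph_smul ξ h0) (fun x _ => (hasFDerivAt_ph_fst ξ x j).1) fun x _ => smooth_diff hf x
  unfold dd
  rw [this]
  simp only [e]
  rw [integral_smul, ← neg_smul]
  congr 1
  ring

/-- The transposed first order operator `⟨ξ⟩^{-2}(1 - i ∑ ξ_j ∂_j)`, with frozen coefficients. -/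
def ibp (g : Option (Fin q) → V q × V q → ℂ) (w : Fin q → V q × V q) (f : V q × V q → B) :
    V q × V q → B :=
  fun p => g none p • f p + (-Complex.I) • ∑ j, g (some j) p • dd (w j) f p

lemma contDiff_ibp {g : Option (Fin q) → V q × V q → ℂ} (hg : ∀ i, ContDiff ℝ ∞ (g i))
    (w : Fin q → V q × V q) {f : V q × V q → B} (hf : ContDiff ℝ ∞ f) :
    ContDiff ℝ ∞ (ibp g w f) :=
  ((hg none).smul hf).add (contDiff_const.smul (ContDiff.sum fun j _ =>
    (hg (some j)).smul (contDiff_dd hf _)))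

lemma ibp_add (g : Option (Fin q) → V q × V q → ℂ) (w : Fin q → V q × V q) {f h : V q × V q → B}
    (hf : ContDiff ℝ ∞ f) (hh : ContDiff ℝ ∞ h) :
    ibp g w (fun p => f p + h p) = fun p => ibp g w f p + ibp g w h p := by
  funext p
  simp only [ibp, dd_add hf hh, smul_add, Finset.sum_add_distrib]
  abel

lemma ibp_smul (g : Option (Fin q) → V q × V q → ℂ) (w : Fin q → V q × V q) {f : V q × V q → B}
    (hf : ContDiff ℝ ∞ f) (c : ℂ) :
    ibp g w (fun p => c • f p) = fun p => c • ibp g w f p := by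
  funext p
  simp only [ibp, dd_const_smul hf, smul_add, Finset.smul_sum, smul_comm c]

/-- Integration by parts in `x`, with gain `⟨ξ⟩^{-1}`. -/
def ibpX (f : V q × V q → B) : V q × V q → B := ibp (fun i p => japCoef i p.2) dirY f

/-- Integration by parts in `ξ`, with gain `⟨x⟩^{-1}`. -/
def ibpXi (f : V q × V q → B) : V q × V q → B := ibp (fun i p => japCoef i p.1) dirEta f

lemma contDiff_ibpX {f : V q × V q → B} (hf : ContDiff ℝ ∞ f) : ContDiff ℝ ∞ (ibpX f) :=
  contDiff_ibp (fun i => (contDiff_japCoef i).comp contDiff_snd) _ hf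

lemma contDiff_ibpXi {f : V q × V q → B} (hf : ContDiff ℝ ∞ f) : ContDiff ℝ ∞ (ibpXi f) :=
  contDiff_ibp (fun i => (contDiff_japCoef i).comp contDiff_fst) _ hf

/-- `l` integrations by parts in `x`, followed by `l'` in `ξ`. -/
def ibpN (l l' : ℕ) (f : V q × V q → B) : V q × V q → B := ibpXi^[l'] (ibpX^[l] f)

lemma contDiff_iter {T : (V q × V q → B) → V q × V q → B}
    (hT : ∀ f, ContDiff ℝ ∞ f → ContDiff ℝ ∞ (T f)) (l : ℕ) {f : V q × V q → B}
    (hf : ContDiff ℝ ∞ f) : ContDiff ℝ ∞ (T^[l] f) := by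
  induction l with
  | zero => exact hf
  | succ l ih => rw [Function.iterate_succ_apply']; exact hT _ ih

lemma contDiff_ibpN (l l' : ℕ) {f : V q × V q → B} (hf : ContDiff ℝ ∞ f) :
    ContDiff ℝ ∞ (ibpN l l' f) :=
  contDiff_iter (fun _ => contDiff_ibpXi) _ (contDiff_iter (fun _ => contDiff_ibpX) _ hf)

lemma iter_add {T : (V q × V q → B) → V q × V q → B}
    (hT : ∀ f, ContDiff ℝ ∞ f → ContDiff ℝ ∞ (T f))
    (ha : ∀ f g, ContDiff ℝ ∞ f → ContDiff ℝ ∞ g →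
      T (fun p => f p + g p) = fun p => T f p + T g p) (l : ℕ) {f g : V q × V q → B}
    (hf : ContDiff ℝ ∞ f) (hg : ContDiff ℝ ∞ g) :
    T^[l] (fun p => f p + g p) = fun p => T^[l] f p + T^[l] g p := by
  induction l with
  | zero => rfl
  | succ l ih =>
    simp only [Function.iterate_succ_apply', ih]
    rw [ha _ _ (contDiff_iter hT l hf) (contDiff_iter hT l hg)]

lemma iter_smul {T : (V q × V q → B) → V q × V q → B}
    (hT : ∀ f, ContDiff ℝ ∞ f → ContDiff ℝ ∞ (T f)) (c : ℂ)
    (ha : ∀ f, ContDiff ℝ ∞ f → T (fun p => c • f p) = fun p => c • T f p) (l : ℕ)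
    {f : V q × V q → B} (hf : ContDiff ℝ ∞ f) :
    T^[l] (fun p => c • f p) = fun p => c • T^[l] f p := by
  induction l with
  | zero => rfl
  | succ l ih =>
    simp only [Function.iterate_succ_apply', ih]
    rw [ha _ (contDiff_iter hT l hf)]

lemma ibpN_add (l l' : ℕ) {f g : V q × V q → B} (hf : ContDiff ℝ ∞ f) (hg : ContDiff ℝ ∞ g) :
    ibpN l l' (fun p => f p + g p) = fun p => ibpN l l' f p + ibpN l l' g p := by
  have hX : ∀ f : V q × V q → B, ContDiff ℝ ∞ f → ContDiff ℝ ∞ (ibpX f) := fun _ => contDiff_ibpX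
  unfold ibpN
  rw [iter_add hX (fun _ _ => ibp_add _ _) l hf hg,
    iter_add (fun _ => contDiff_ibpXi) (fun _ _ => ibp_add _ _) l' (contDiff_iter hX l hf)
      (contDiff_iter hX l hg)]

lemma ibpN_smul (l l' : ℕ) {f : V q × V q → B} (hf : ContDiff ℝ ∞ f) (c : ℂ) :
    ibpN l l' (fun p => c • f p) = fun p => c • ibpN l l' f p := by
  have hX : ∀ f : V q × V q → B, ContDiff ℝ ∞ f → ContDiff ℝ ∞ (ibpX f) := fun _ => contDiff_ibpX
  unfold ibpN
  rw [iter_smul hX c (fun _ hf => ibp_smul _ _ hf c) l hf,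
    iter_smul (fun _ => contDiff_ibpXi) c (fun _ hf => ibp_smul _ _ hf c) l'
      (contDiff_iter hX l hf)]

variable {δ : ℝ}

/-- The operator has `q + 1` terms, and in each of them a coefficient multiplies `f` or a first
derivative. The number `δ'` is the loss of one derivative: `δ` for `x`-derivatives, `0` for
`ξ`-derivatives. -/
lemma AmpBd.ibp {K : ℕ} {m k R m₀ k₀ R₀ δ' : ℝ} {g : Option (Fin q) → V q × V q → ℂ}
    {w : Fin q → V q × V q} {f : V q × V q → B} (hg : ∀ i, ContDiff ℝ ∞ (g i))
    (hgb : ∀ i, AmpBd δ K m₀ k₀ R₀ (g i)) (hf : ContDiff ℝ ∞ f) (hδ' : 0 ≤ δ')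
    (h0 : AmpBd δ K m k R f) (h1 : ∀ j, AmpBd δ K (m + δ') k R (dd (w j) f)) :
    AmpBd δ K (m₀ + (m + δ')) (k₀ + k) ((q + 1) * (2 ^ K * (R₀ * R))) (ibp g w f) := by
  have e1 := (AmpBd.smul (hg none) hf (hgb none) h0).mono (m' := m₀ + (m + δ')) (by linarith) le_rfl
    le_rfl
  have e2 := AmpBd.const_smul (ContDiff.sum fun j _ => (hg (some j)).smul (contDiff_dd hf (w j)))
    (AmpBd.sum Finset.univ (fun j _ => (hg (some j)).smul (contDiff_dd hf (w j)))
    fun j _ => AmpBd.smul (hg (some j)) (contDiff_dd hf (w j)) (hgb (some j)) (h1 j)) (-Complex.I)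
  refine (AmpBd.add ((hg none).smul hf) (contDiff_const.smul (ContDiff.sum fun j _ =>
    (hg (some j)).smul (contDiff_dd hf (w j)))) e1 e2).mono le_rfl le_rfl (le_of_eq ?_)
  simp
  ring

lemma AmpBd.ibpX_step (hδ : 0 ≤ δ) (K : ℕ) : ∃ C : ℝ, ∀ (m k R : ℝ) (f : V q × V q → B),
    ContDiff ℝ ∞ f → AmpBd δ (K + 1) m k R f → AmpBd δ K (m - (1 - δ)) k (C * R) (ibpX f) := by
  obtain ⟨R₀, hR₀⟩ := ampBd_japCoef_snd (q := q) (δ := δ) K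
  refine ⟨(q + 1) * (2 ^ K * R₀), fun m k R f hf h => ?_⟩
  refine (AmpBd.ibp (fun i => (contDiff_japCoef i).comp contDiff_snd) hR₀ hf hδ
    (h.le (Nat.le_succ _)) fun j => h.dd_inl j).mono (by linarith) (by linarith) (le_of_eq ?_)
  ring

lemma AmpBd.ibpXi_step (hδ : 0 ≤ δ) (K : ℕ) : ∃ C : ℝ, ∀ (m k R : ℝ) (f : V q × V q → B),
    ContDiff ℝ ∞ f → AmpBd δ (K + 1) m k R f → AmpBd δ K m (k - 1) (C * R) (ibpXi f) := by
  obtain ⟨R₀, hR₀⟩ := ampBd_japCoef_fst (q := q) hδ K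
  refine ⟨(q + 1) * (2 ^ K * R₀), fun m k R f hf h => ?_⟩
  refine (AmpBd.ibp (fun i => (contDiff_japCoef i).comp contDiff_fst) hR₀ hf le_rfl
    (h.le (Nat.le_succ _)) fun j => by simpa using h.dd_inr j).mono (by linarith) (by linarith)
    (le_of_eq ?_)
  ring

/-- Each step consumes one derivative of the amplitude, hence `K + l + l'`. A step in `x` gains
`⟨ξ⟩⁻¹` from the coefficients and loses `⟨ξ⟩^δ` from the derivative. The constant depends on neither
`f` nor its orders. -/
lemma AmpBd.ibpN (hδ : 0 ≤ δ) (K l l' : ℕ) : ∃ C : ℝ, ∀ (m k R : ℝ) (f : V q × V q → B),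
    ContDiff ℝ ∞ f → AmpBd δ (K + l + l') m k R f →
      AmpBd δ K (m - l * (1 - δ)) (k - l') (C * R) (ibpN l l' f) := by
  induction l' generalizing K with
  | zero =>
    induction l generalizing K with
    | zero => exact ⟨1, fun m k R f _ h => by simpa [EdgePsiDO.ibpN] using h⟩
    | succ l ih =>
      obtain ⟨C₁, h₁⟩ := ih (K + 1)
      obtain ⟨C₂, h₂⟩ := AmpBd.ibpX_step (q := q) (B := B) hδ K
      refine ⟨C₂ * C₁, fun m k R f hf h => ?_⟩
      have e := h₂ _ _ _ _ (contDiff_ibpN l 0 hf) (h₁ m k R f hf (h.le (by omega)))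
      have e' : EdgePsiDO.ibpN (l + 1) 0 f = ibpX (EdgePsiDO.ibpN l 0 f) := by
        simp [EdgePsiDO.ibpN, Function.iterate_succ_apply']
      rw [e']
      exact e.mono (by push_cast; linarith) le_rfl (by rw [mul_assoc])
  | succ l' ih =>
    obtain ⟨C₁, h₁⟩ := ih (K + 1)
    obtain ⟨C₂, h₂⟩ := AmpBd.ibpXi_step (q := q) (B := B) hδ K
    refine ⟨C₂ * C₁, fun m k R f hf h => ?_⟩
    have e := h₂ _ _ _ _ (contDiff_ibpN l l' hf) (h₁ m k R f hf (h.le (by omega)))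
    have e' : EdgePsiDO.ibpN l (l' + 1) f = ibpXi (EdgePsiDO.ibpN l l' f) := by
      simp [EdgePsiDO.ibpN, Function.iterate_succ_apply']
    rw [e']
    exact e.mono le_rfl (by push_cast; linarith) (by rw [mul_assoc])

/-- The total mass of the integrable weight `⟨x⟩^{-(q+1)}⟨ξ⟩^{-(q+1)}`. -/
def japMass (q : ℕ) : ℝ :=
  ∫ p : V q × V q, jap p.1 ^ (-(q + 1 : ℝ)) * jap p.2 ^ (-(q + 1 : ℝ))

lemma integrable_japProd :
    Integrable (fun p : V q × V q => jap p.1 ^ (-(q + 1 : ℝ)) * jap p.2 ^ (-(q + 1 : ℝ))) :=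
  (integrable_jap_rpow (by linarith)).mul_prod (integrable_jap_rpow (by linarith))

lemma AmpBd.integrable {K : ℕ} {m k R : ℝ} {f : V q × V q → B} (hf : Continuous f)
    (h : AmpBd δ K m k R f) (hm : m ≤ -(q + 1)) (hk : k ≤ -(q + 1)) : Integrable f := by
  refine (integrable_japProd.const_mul R).mono' hf.aestronglyMeasurable
    (Eventually.of_forall fun p => ?_)
  exact (h.mono hm hk le_rfl).base p

lemma integrable_ph_smul_prod {f : V q × V q → B} (hf : Integrable f) :
    Integrable (fun p => ph p • f p) :=
  hf.bdd_smul 1 continuous_ph.aestronglyMeasurable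
    (Eventually.of_forall fun _ => (norm_ph _).le)

lemma AmpBd.norm_integral_le {K : ℕ} {m k R : ℝ} {f : V q × V q → B}
    (h : AmpBd δ K m k R f) (hm : m ≤ -(q + 1)) (hk : k ≤ -(q + 1)) :
    ‖∫ p, ph p • f p‖ ≤ R * japMass q := by
  rw [japMass, ← integral_const_mul]
  refine norm_integral_le_of_norm_le (integrable_japProd.const_mul R)
    (Eventually.of_forall fun p => ?_)
  rw [norm_smul, norm_ph, one_mul]
  exact (h.mono hm hk le_rfl).base p

lemma AmpBd.integrable_fst {K : ℕ} {m k R : ℝ} {f : V q × V q → B} (hf : Continuous f)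
    (h : AmpBd δ K m k R f) (hk : k ≤ -(q + 1)) (ξ : V q) : Integrable (fun x => f (x, ξ)) := by
  have h1 : Integrable (fun x : V q => R * jap ξ ^ m * jap x ^ (-(q + 1 : ℝ))) :=
    (integrable_jap_rpow (by linarith)).const_mul _
  refine h1.mono' (hf.comp (by fun_prop)).aestronglyMeasurable (Eventually.of_forall fun x => ?_)
  refine ((h.mono le_rfl hk le_rfl).base (x, ξ)).trans (le_of_eq ?_)
  ring

lemma AmpBd.integrable_snd {K : ℕ} {m k R : ℝ} {f : V q × V q → B} (hf : Continuous f)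
    (h : AmpBd δ K m k R f) (hm : m ≤ -(q + 1)) (x : V q) : Integrable (fun ξ => f (x, ξ)) := by
  have h1 : Integrable (fun ξ : V q => R * jap x ^ k * jap ξ ^ (-(q + 1 : ℝ))) :=
    (integrable_jap_rpow (by linarith)).const_mul _
  refine h1.mono' (hf.comp (by fun_prop)).aestronglyMeasurable (Eventually.of_forall fun ξ => ?_)
  refine ((h.mono hm le_rfl le_rfl).base (x, ξ)).trans (le_of_eq ?_)
  ring

lemma dd_slice_fst {f : V q × V q → B} (hf : ContDiff ℝ ∞ f) (ξ : V q) (j : Fin q) :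
    dd (stdv j) (fun x => f (x, ξ)) = fun x => dd (dirY j) f (x, ξ) := by
  have := dd_comp_affine hf (0, ξ) (ContinuousLinearMap.inl ℝ (V q) (V q)) (stdv j)
  simpa [dirY] using this

lemma dd_slice_snd {f : V q × V q → B} (hf : ContDiff ℝ ∞ f) (x : V q) (j : Fin q) :
    dd (stdv j) (fun ξ => f (x, ξ)) = fun ξ => dd (dirEta j) f (x, ξ) := by
  have := dd_comp_affine hf (x, 0) (ContinuousLinearMap.inr ℝ (V q) (V q)) (stdv j)
  simpa [dirEta] using this

lemma contDiff_slice_fst {f : V q × V q → B} (hf : ContDiff ℝ ∞ f) (ξ : V q) :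
    ContDiff ℝ ∞ (fun x => f (x, ξ)) := hf.comp (contDiff_id.prodMk contDiff_const)

lemma contDiff_slice_snd {f : V q × V q → B} (hf : ContDiff ℝ ∞ f) (x : V q) :
    ContDiff ℝ ∞ (fun ξ => f (x, ξ)) := hf.comp (contDiff_const.prodMk contDiff_id)

/-- Moving `∂_j` to the phase produces `iξ_j`, so the coefficients combine to the sum in
`japCoef_sum`, which is `1`. -/
lemma integral_slice_ibp {f : V q → B} (hf : ContDiff ℝ ∞ f) (ξ : V q)
    (h0 : Integrable f) (h1 : ∀ j, Integrable (dd (stdv j) f)) :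
    ∫ x, ph (x, ξ) • (japCoef none ξ • f x
      + (-Complex.I) • ∑ j, japCoef (some j) ξ • dd (stdv j) f x) = ∫ x, ph (x, ξ) • f x := by
  have hi := integrable_ph_smul ξ h0
  have hj := fun j => integrable_ph_smul ξ (h1 j)
  have e : ∀ x, ph (x, ξ) • (japCoef none ξ • f x
      + (-Complex.I) • ∑ j, japCoef (some j) ξ • dd (stdv j) f x)
      = japCoef none ξ • (ph (x, ξ) • f x)
        + ∑ j, (-Complex.I * japCoef (some j) ξ) • (ph (x, ξ) • dd (stdv j) f x) := by
    intro x
    rw [smul_add, smul_comm, Finset.smul_sum, Finset.smul_sum]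
    congr 1
    refine Finset.sum_congr rfl fun j _ => ?_
    simp only [smul_smul]
    congr 1
    ring
  simp only [e]
  have hi' : Integrable (fun x => japCoef none ξ • (ph (x, ξ) • f x)) := hi.smul _
  have hj' : ∀ j, Integrable (fun x =>
    (-Complex.I * japCoef (some j) ξ) • (ph (x, ξ) • dd (stdv j) f x)) := fun j => (hj j).smul _
  rw [integral_add hi' (integrable_finsetSum _ fun j _ => hj' j),
    integral_finsetSum _ fun j _ => hj' j]
  simp only [integral_smul]
  simp only [integral_ph_smul_dd hf ξ _ h0 (h1 _), smul_smul, ← Finset.sum_smul, ← add_smul]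
  have : japCoef none ξ + ∑ j, -Complex.I * japCoef (some j) ξ * (Complex.I * ξ j) = 1 := by
    rw [← japCoef_sum ξ]
    congr 1
    refine Finset.sum_congr rfl fun j _ => ?_
    linear_combination (-japCoef (some j) ξ * ξ j) * Complex.I_sq
  rw [this, one_smul]

lemma integral_fst_ibpX {f : V q × V q → B} (hf : ContDiff ℝ ∞ f) {m k R : ℝ} {K : ℕ}
    (h : AmpBd δ (K + 1) m k R f) (hk : k ≤ -(q + 1)) (ξ : V q) :
    ∫ x, ph (x, ξ) • ibpX f (x, ξ) = ∫ x, ph (x, ξ) • f (x, ξ) := by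
  rw [← integral_slice_ibp (contDiff_slice_fst hf ξ) ξ
    (h.integrable_fst hf.continuous hk ξ) fun j => ?_]
  · simp only [dd_slice_fst hf]; rfl
  · rw [dd_slice_fst hf]
    exact (h.dd_inl j).integrable_fst (contDiff_dd hf _).continuous hk ξ

lemma integral_snd_ibpXi {f : V q × V q → B} (hf : ContDiff ℝ ∞ f) {m k R : ℝ} {K : ℕ}
    (h : AmpBd δ (K + 1) m k R f) (hm : m ≤ -(q + 1)) (x : V q) :
    ∫ ξ, ph (x, ξ) • ibpXi f (x, ξ) = ∫ ξ, ph (x, ξ) • f (x, ξ) := by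
  have := integral_slice_ibp (contDiff_slice_snd hf x) x
    (h.integrable_snd hf.continuous hm x) fun j => by
      rw [dd_slice_snd hf]
      exact (h.dd_inr j).integrable_snd (contDiff_dd hf _).continuous hm x
  have e : ∀ ξ, ph (ξ, x) = ph (x, ξ) := fun ξ => ph_swap (x, ξ)
  simp only [e, dd_slice_snd hf] at this
  exact this

/-- Amplitudes that decay rapidly, with all derivatives. -/
def Rapid (δ : ℝ) (f : V q × V q → B) : Prop :=
  ContDiff ℝ ∞ f ∧ ∀ (K : ℕ) (m k : ℝ), ∃ R, AmpBd δ K m k R f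

lemma Rapid.ibpX (hδ : 0 ≤ δ) {f : V q × V q → B} (h : Rapid δ f) : Rapid δ (ibpX f) := by
  refine ⟨contDiff_ibpX h.1, fun K m k => ?_⟩
  obtain ⟨C, hC⟩ := AmpBd.ibpX_step (q := q) (B := B) hδ K
  obtain ⟨R, hR⟩ := h.2 (K + 1) (m + (1 - δ)) k
  exact ⟨_, (hC _ _ _ _ h.1 hR).mono (by linarith) le_rfl le_rfl⟩

lemma Rapid.ibpXi (hδ : 0 ≤ δ) {f : V q × V q → B} (h : Rapid δ f) : Rapid δ (ibpXi f) := by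
  refine ⟨contDiff_ibpXi h.1, fun K m k => ?_⟩
  obtain ⟨C, hC⟩ := AmpBd.ibpXi_step (q := q) (B := B) hδ K
  obtain ⟨R, hR⟩ := h.2 (K + 1) m (k + 1)
  exact ⟨_, (hC _ _ _ _ h.1 hR).mono le_rfl (by linarith) le_rfl⟩

lemma Rapid.integrable {f : V q × V q → B} (h : Rapid δ f) : Integrable f := by
  obtain ⟨R, hR⟩ := h.2 0 (-(q + 1)) (-(q + 1))
  exact hR.integrable h.1.continuous le_rfl le_rfl

lemma Rapid.integral_ibpX (hδ : 0 ≤ δ) {f : V q × V q → B} (h : Rapid δ f) :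
    ∫ p, ph p • EdgePsiDO.ibpX f p = ∫ p, ph p • f p := by
  obtain ⟨R, hR⟩ := h.2 1 0 (-(q + 1))
  change ∫ p, ph p • EdgePsiDO.ibpX f p ∂(volume.prod volume)
    = ∫ p, ph p • f p ∂(volume.prod volume)
  rw [integral_prod_symm _ (integrable_ph_smul_prod (h.ibpX hδ).integrable),
    integral_prod_symm _ (integrable_ph_smul_prod h.integrable)]
  exact integral_congr_ae (Eventually.of_forall fun ξ => integral_fst_ibpX h.1 hR le_rfl ξ)

lemma Rapid.integral_ibpXi (hδ : 0 ≤ δ) {f : V q × V q → B} (h : Rapid δ f) :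
    ∫ p, ph p • EdgePsiDO.ibpXi f p = ∫ p, ph p • f p := by
  obtain ⟨R, hR⟩ := h.2 1 (-(q + 1)) 0
  change ∫ p, ph p • EdgePsiDO.ibpXi f p ∂(volume.prod volume)
    = ∫ p, ph p • f p ∂(volume.prod volume)
  rw [integral_prod _ (integrable_ph_smul_prod (h.ibpXi hδ).integrable),
    integral_prod _ (integrable_ph_smul_prod h.integrable)]
  exact integral_congr_ae (Eventually.of_forall fun x => integral_snd_ibpXi h.1 hR le_rfl x)

/-- Rapid decay is preserved by both kinds of steps, so Fubini's theorem applies at every stage and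
reduces each step to integration by parts on slices. -/
lemma Rapid.integral_ibpN (hδ : 0 ≤ δ) (l l' : ℕ) {f : V q × V q → B} (h : Rapid δ f) :
    ∫ p, ph p • EdgePsiDO.ibpN l l' f p = ∫ p, ph p • f p := by
  have h1 : Rapid δ (EdgePsiDO.ibpX^[l] f) ∧
      ∫ p, ph p • (EdgePsiDO.ibpX^[l] f) p = ∫ p, ph p • f p := by
    induction l with
    | zero => exact ⟨h, rfl⟩
    | succ l ih =>
      rw [Function.iterate_succ_apply']
      exact ⟨ih.1.ibpX hδ, (ih.1.integral_ibpX hδ).trans ih.2⟩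
  have h2 : ∀ f : V q × V q → B, Rapid δ f → Rapid δ (EdgePsiDO.ibpXi^[l'] f) ∧
      ∫ p, ph p • (EdgePsiDO.ibpXi^[l'] f) p = ∫ p, ph p • f p := by
    intro f h
    induction l' with
    | zero => exact ⟨h, rfl⟩
    | succ l ih =>
      rw [Function.iterate_succ_apply']
      exact ⟨ih.1.ibpXi hδ, (ih.1.integral_ibpXi hδ).trans ih.2⟩
  exact (h2 _ h1.1).2.trans h1.2

end Osc

/-! ### Cutoffs -/

section Cutoff

variable {q : ℕ} {B : Type*} [NormedAddCommGroup B] [NormedSpace ℂ B] {δ : ℝ}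

lemma AmpBd.succ_exists {K : ℕ} {m k : ℝ} {f : V q × V q → B}
    (h0 : ∃ R, ∀ p, ‖f p‖ ≤ R * (jap p.1 ^ k * jap p.2 ^ m))
    (h1 : ∀ j, ∃ R, AmpBd δ K (m + δ) k R (dd (dirY j) f))
    (h2 : ∀ j, ∃ R, AmpBd δ K m k R (dd (dirEta j) f)) : ∃ R, AmpBd δ (K + 1) m k R f := by
  obtain ⟨R₀, h0⟩ := h0
  choose R₁ h1 using h1
  choose R₂ h2 using h2
  have n1 := fun j => (h1 j).nonneg
  have n2 := fun j => (h2 j).nonneg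
  have n0 : 0 ≤ R₀ := by simpa using (norm_nonneg _).trans (h0 0)
  have s1 : 0 ≤ ∑ j, R₁ j := Finset.sum_nonneg fun j _ => n1 j
  have s2 : 0 ≤ ∑ j, R₂ j := Finset.sum_nonneg fun j _ => n2 j
  refine ⟨R₀ + ∑ j, R₁ j + ∑ j, R₂ j, AmpBd.succ (fun p => (h0 p).trans
    (mul_le_mul_of_nonneg_right (by linarith) (weight_pos _ _ _ _).le)) (fun j => ?_) fun j => ?_⟩
  · have := Finset.single_le_sum (fun j _ => n1 j) (Finset.mem_univ j)
    exact (h1 j).mono le_rfl le_rfl (by linarith)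
  · have := Finset.single_le_sum (fun j _ => n2 j) (Finset.mem_univ j)
    exact (h2 j).mono le_rfl le_rfl (by linarith)

lemma exists_schwartz_dd {X : Type*} [NormedAddCommGroup X] [NormedSpace ℝ X] (ψ : 𝓢(X, B))
    (v : X) : ∃ ψ' : 𝓢(X, B), ⇑ψ' = dd v ψ :=
  ⟨LineDeriv.lineDerivOp v ψ, by
    funext x
    rw [SchwartzMap.lineDerivOp_apply_eq_fderiv]
    rfl⟩

lemma exists_schwartz_scale {X : Type*} [NormedAddCommGroup X] [NormedSpace ℝ X] (ψ : 𝓢(X, ℂ))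
    {ε : ℝ} (hε : ε ≠ 0) : ∃ ψ' : 𝓢(X, ℂ), ⇑ψ' = fun p => ψ (ε • p) :=
  ⟨SchwartzMap.compCLMOfContinuousLinearEquiv ℂ
    (ContinuousLinearEquiv.smulLeft (Units.mk0 ε hε) : X ≃L[ℝ] X) ψ, by
      funext x
      simp⟩

lemma schwartz_ampBd (K : ℕ) (m k : ℝ) (ψ : 𝓢(V q × V q, B)) :
    ∃ R, AmpBd δ K m k R ψ := by
  have base : ∀ (m k : ℝ) (ψ : 𝓢(V q × V q, B)),
      ∃ R, ∀ p, ‖ψ p‖ ≤ R * (jap p.1 ^ k * jap p.2 ^ m) := by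
    intro m k ψ
    obtain ⟨n, hn⟩ := exists_nat_ge (max |m| |k|)
    refine ⟨2 ^ (n + n) * ((Finset.Iic (n + n, 0)).sup
      fun m => SchwartzMap.seminorm ℝ m.1 m.2) ψ, fun p => ?_⟩
    have h := SchwartzMap.one_add_le_sup_seminorm_apply (𝕜 := ℝ) (m := (n + n, 0)) (k := n + n)
      (n := 0) le_rfl le_rfl ψ p
    rw [norm_iteratedFDeriv_zero] at h
    set S := 2 ^ (n + n) * ((Finset.Iic (n + n, 0)).sup fun m => SchwartzMap.seminorm ℝ m.1 m.2) ψ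
    have hw : ∀ (x : V q) (s : ℝ), ‖x‖ ≤ ‖p‖ → |s| ≤ n → 1 ≤ (1 + ‖p‖) ^ n * jap x ^ s := by
      intro x s hx hs
      have h1 : jap x ^ (-s) ≤ (1 + ‖p‖) ^ n := by
        calc jap x ^ (-s) ≤ jap x ^ (n : ℝ) := jap_rpow_mono x ((neg_le_abs s).trans hs)
          _ = jap x ^ n := Real.rpow_natCast _ _
          _ ≤ (1 + ‖p‖) ^ n := pow_le_pow_left₀ (jap_pos x).le ((jap_le x).trans (by linarith)) n
      calc (1 : ℝ) = jap x ^ (-s) * jap x ^ s := by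
            rw [← Real.rpow_add (jap_pos x)]; simp
        _ ≤ _ := mul_le_mul_of_nonneg_right h1 (jap_rpow_pos _ _).le
    have hS : 0 ≤ S := le_trans (by positivity) h
    have w1 := hw p.1 k (norm_fst_le p) ((le_max_right _ _).trans hn)
    have w2 := hw p.2 m (norm_snd_le p) ((le_max_left _ _).trans hn)
    have hp : 0 < (1 + ‖p‖) ^ n := by positivity
    calc ‖ψ p‖ = 1 * 1 * ‖ψ p‖ := by ring
      _ ≤ ((1 + ‖p‖) ^ n * jap p.1 ^ k) * ((1 + ‖p‖) ^ n * jap p.2 ^ m) * ‖ψ p‖ :=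
          mul_le_mul_of_nonneg_right (mul_le_mul w1 w2 zero_le_one (by linarith)) (norm_nonneg _)
      _ = ((1 + ‖p‖) ^ (n + n) * ‖ψ p‖) * (jap p.1 ^ k * jap p.2 ^ m) := by rw [pow_add]; ring
      _ ≤ _ := mul_le_mul_of_nonneg_right h (weight_pos _ _ _ _).le
  induction K generalizing ψ m with
  | zero =>
    obtain ⟨R, hR⟩ := base m k ψ
    exact ⟨R, bd_zero_iff.2 hR⟩
  | succ K ih =>
    refine AmpBd.succ_exists (base m k ψ) (fun j => ?_) fun j => ?_
    · obtain ⟨ψ', hψ'⟩ := exists_schwartz_dd ψ (dirY j)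
      rw [← hψ']; exact ih _ ψ'
    · obtain ⟨ψ', hψ'⟩ := exists_schwartz_dd ψ (dirEta j)
      rw [← hψ']; exact ih _ ψ'

lemma dd_scale {X : Type*} [NormedAddCommGroup X] [NormedSpace ℝ X] {f : X → B}
    (hf : ContDiff ℝ ∞ f) (ε : ℝ) (v : X) :
    dd v (fun p => f (ε • p)) = fun p => (ε : ℂ) • dd v f (ε • p) := by
  have := dd_comp_affine hf 0 (ε • ContinuousLinearMap.id ℝ X) v
  simp only [zero_add, smul_apply, ContinuousLinearMap.id_apply,
    dd_smul_dir] at this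
  simpa using this

lemma contDiff_scale {X : Type*} [NormedAddCommGroup X] [NormedSpace ℝ X] {f : X → B}
    (hf : ContDiff ℝ ∞ f) (ε : ℝ) : ContDiff ℝ ∞ (fun p => f (ε • p)) :=
  hf.comp (contDiff_const_smul ε)

/-- Every derivative of the scaled function brings out a factor `ε ≤ 1`, so the bounds are uniform
as `ε → 0`. -/
lemma schwartz_ampBd_scale (hδ : 0 ≤ δ) (K : ℕ) (ψ : 𝓢(V q × V q, B)) :
    ∃ C, ∀ ε : ℝ, 0 < ε → ε ≤ 1 → AmpBd δ K 0 0 C (fun p => ψ (ε • p)) := by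
  induction K generalizing ψ with
  | zero =>
    obtain ⟨R, hR⟩ := schwartz_ampBd (δ := δ) 0 0 0 ψ
    exact ⟨R, fun ε _ _ => bd_zero_iff.2 fun p => by simpa using hR.base (ε • p)⟩
  | succ K ih =>
    obtain ⟨R, hR⟩ := schwartz_ampBd (δ := δ) 0 0 0 ψ
    have hY : ∀ v : V q × V q, ∃ C, ∀ ε : ℝ, 0 < ε → ε ≤ 1 →
        AmpBd δ K 0 0 C (dd v fun p => ψ (ε • p)) := by
      intro v
      obtain ⟨ψ', hψ'⟩ := exists_schwartz_dd ψ v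
      obtain ⟨C, hC⟩ := ih ψ'
      refine ⟨C, fun ε h0 h1 => ?_⟩
      rw [dd_scale (ψ.smooth ⊤), ← hψ']
      refine ((hC ε h0 h1).const_smul (contDiff_scale (ψ'.smooth ⊤) ε) ε).mono le_rfl le_rfl ?_
      rw [Complex.norm_real, Real.norm_eq_abs, abs_of_pos h0]
      exact mul_le_of_le_one_left (hC ε h0 h1).nonneg h1
    choose C₁ h₁ using fun j : Fin q => hY (dirY j)
    choose C₂ h₂ using fun j : Fin q => hY (dirEta j)
    have nR := hR.nonneg
    have n1 := fun j => (h₁ j 1 one_pos le_rfl).nonneg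
    have n2 := fun j => (h₂ j 1 one_pos le_rfl).nonneg
    have s1 : 0 ≤ ∑ j, C₁ j := Finset.sum_nonneg fun j _ => n1 j
    have s2 : 0 ≤ ∑ j, C₂ j := Finset.sum_nonneg fun j _ => n2 j
    refine ⟨R + ∑ j, C₁ j + ∑ j, C₂ j, fun ε h0 h1 => AmpBd.succ (fun p => ?_) (fun j => ?_)
      fun j => ?_⟩
    · have := hR.base (ε • p)
      simp only [Real.rpow_zero, mul_one] at this ⊢
      linarith
    · have := Finset.single_le_sum (fun j _ => n1 j) (Finset.mem_univ j)
      exact (h₁ j ε h0 h1).mono (by linarith) le_rfl (by linarith)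
    · have := Finset.single_le_sum (fun j _ => n2 j) (Finset.mem_univ j)
      exact (h₂ j ε h0 h1).mono le_rfl le_rfl (by linarith)

lemma norm_le_two_jap (p : V q × V q) : ‖p‖ ≤ 2 * (jap p.1 ^ (1 : ℝ) * jap p.2 ^ (1 : ℝ)) := by
  rw [Prod.norm_def, Real.rpow_one, Real.rpow_one]
  have a1 := one_le_jap p.1
  have a2 := one_le_jap p.2
  have b1 := norm_le_jap p.1
  have b2 := norm_le_jap p.2
  refine max_le ?_ ?_ <;> nlinarith

/-- One order in each variable is given up for a factor `ε`. For the function itself this is the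
mean value inequality with `‖p‖ ≤ 2⟨x⟩⟨ξ⟩`; for derivatives the factor comes from the chain rule. It
is the source of convergence of cut-off integrals. -/
lemma schwartz_ampBd_sub (hδ : 0 ≤ δ) (K : ℕ) (ψ : 𝓢(V q × V q, B)) :
    ∃ C, ∀ ε : ℝ, 0 < ε → ε ≤ 1 → AmpBd δ K 1 1 (C * ε) (fun p => ψ 0 - ψ (ε • p)) := by
  have hbase : ∃ C, 0 ≤ C ∧ ∀ ε : ℝ, 0 < ε → ∀ p,
      ‖ψ 0 - ψ (ε • p)‖ ≤ C * ε * (jap p.1 ^ (1 : ℝ) * jap p.2 ^ (1 : ℝ)) := by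
    obtain ⟨C, hC0, hC⟩ := ψ.decay 0 1
    refine ⟨C * 2, by positivity, fun ε hε p => ?_⟩
    have := (convex_univ (𝕜 := ℝ)).norm_image_sub_le_of_norm_fderiv_le (f := ψ) (C := C)
      (fun x _ => ψ.differentiableAt) (fun x _ => by
        have := hC x
        rw [norm_iteratedFDeriv_one] at this
        simpa using this) (Set.mem_univ (ε • p)) (Set.mem_univ 0)
    refine this.trans ?_
    rw [zero_sub, norm_neg, norm_smul, Real.norm_eq_abs, abs_of_pos hε]
    calc C * (ε * ‖p‖) = C * ε * ‖p‖ := by ring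
      _ ≤ C * ε * (2 * (jap p.1 ^ (1 : ℝ) * jap p.2 ^ (1 : ℝ))) :=
          mul_le_mul_of_nonneg_left (norm_le_two_jap p) (by positivity)
      _ = _ := by ring
  obtain ⟨C₀, hC₀, h0⟩ := hbase
  cases K with
  | zero => exact ⟨C₀, fun ε h _ => bd_zero_iff.2 (h0 ε h)⟩
  | succ K =>
    have hY : ∀ v : V q × V q, ∃ C, 0 ≤ C ∧ ∀ ε : ℝ, 0 < ε → ε ≤ 1 →
        AmpBd δ K 0 0 (C * ε) (dd v fun p => ψ 0 - ψ (ε • p)) := by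
      intro v
      obtain ⟨ψ', hψ'⟩ := exists_schwartz_dd ψ v
      obtain ⟨C, hC⟩ := schwartz_ampBd_scale hδ K ψ'
      refine ⟨C, (hC 1 one_pos le_rfl).nonneg, fun ε h0 h1 => ?_⟩
      have e : dd v (fun p => ψ 0 - ψ (ε • p)) = fun p => (-ε : ℂ) • ψ' (ε • p) := by
        have e1 := dd_scale (ψ.smooth ⊤) ε v
        funext p
        have e2 := congrFun e1 p
        unfold dd at e2 ⊢
        rw [fderiv_const_sub, neg_apply, e2, hψ', neg_smul]
        rfl
      rw [e]
      refine ((hC ε h0 h1).const_smul (contDiff_scale (ψ'.smooth ⊤) ε) (-ε)).mono le_rfl le_rfl ?_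
      rw [norm_neg, Complex.norm_real, Real.norm_eq_abs, abs_of_pos h0, mul_comm]
    choose C₁ n1 h₁ using fun j : Fin q => hY (dirY j)
    choose C₂ n2 h₂ using fun j : Fin q => hY (dirEta j)
    have s1 : 0 ≤ ∑ j, C₁ j := Finset.sum_nonneg fun j _ => n1 j
    have s2 : 0 ≤ ∑ j, C₂ j := Finset.sum_nonneg fun j _ => n2 j
    refine ⟨C₀ + ∑ j, C₁ j + ∑ j, C₂ j, fun ε he h1 => AmpBd.succ (fun p => ?_) (fun j => ?_)
      fun j => ?_⟩
    · refine (h0 ε he p).trans (mul_le_mul_of_nonneg_right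
        (mul_le_mul_of_nonneg_right (by linarith) he.le) (weight_pos _ _ _ _).le)
    · have := Finset.single_le_sum (fun j _ => n1 j) (Finset.mem_univ j)
      exact (h₁ j ε he h1).mono (by linarith) zero_le_one
        (mul_le_mul_of_nonneg_right (by linarith) he.le)
    · have := Finset.single_le_sum (fun j _ => n2 j) (Finset.mem_univ j)
      exact (h₂ j ε he h1).mono zero_le_one zero_le_one
        (mul_le_mul_of_nonneg_right (by linarith) he.le)

lemma exists_schwartz_one (X : Type*) [NormedAddCommGroup X] [NormedSpace ℝ X]
    [FiniteDimensional ℝ X] : ∃ χ : 𝓢(X, ℂ), χ 0 = 1 := by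
  let b : ContDiffBump (0 : X) := ⟨1, 2, one_pos, one_lt_two⟩
  have hs : HasCompactSupport (fun x => (b x : ℂ)) :=
    b.hasCompactSupport.comp_left (g := fun t : ℝ => (t : ℂ)) Complex.ofReal_zero
  have hc : ContDiff ℝ ∞ (fun x => (b x : ℂ)) := Complex.ofRealCLM.contDiff.comp b.contDiff
  refine ⟨hs.toSchwartzMap hc, ?_⟩
  change ((b 0 : ℝ) : ℂ) = 1
  rw [b.one_of_mem_closedBall (by simpa using b.rIn_pos.le), Complex.ofReal_one]

end Cutoff

/-! ### Existence and basic properties of oscillatory integrals -/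

section Osc

variable {q : ℕ} {B : Type*} [NormedAddCommGroup B] [NormedSpace ℂ B] {δ : ℝ}

/-- Amplitudes: smooth functions all whose derivatives satisfy polynomial bounds of type `δ`. -/
def IsAmp (δ : ℝ) (f : V q × V q → B) : Prop :=
  ContDiff ℝ ∞ f ∧ ∃ m k : ℝ, ∀ K : ℕ, ∃ R, AmpBd δ K m k R f

/-- The oscillatory integral, or `0` if it does not exist. -/
def osc (f : V q × V q → B) : B :=
  open scoped Classical in if h : ∃ L, HasOscIntegral f L then h.choose else 0

lemma hasOsc_unique {f : V q × V q → B} {L L' : B} (h : HasOscIntegral f L)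
    (h' : HasOscIntegral f L') : L = L' := by
  obtain ⟨χ, hχ⟩ := exists_schwartz_one (V q × V q)
  exact tendsto_nhds_unique (h χ hχ).2 (h' χ hχ).2

lemma HasOscIntegral.osc_eq {f : V q × V q → B} {L : B} (h : HasOscIntegral f L) : osc f = L := by
  have hex : ∃ L, HasOscIntegral f L := ⟨L, h⟩
  rw [osc, dif_pos hex]
  exact hasOsc_unique hex.choose_spec h

lemma cutoff_rapid {f : V q × V q → B} (hf : IsAmp δ f) (ψ : 𝓢(V q × V q, ℂ)) :
    Rapid δ (fun p => ψ p • f p) := by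
  obtain ⟨hs, m, k, hb⟩ := hf
  refine ⟨(ψ.smooth ⊤).smul hs, fun K m' k' => ?_⟩
  obtain ⟨R, hR⟩ := hb K
  obtain ⟨R', hR'⟩ := schwartz_ampBd (δ := δ) K (m' - m) (k' - k) ψ
  exact ⟨_, (AmpBd.smul (ψ.smooth ⊤) hs hR' hR).mono (by linarith) (by linarith) le_rfl⟩

lemma cutoff_scale_rapid {f : V q × V q → B} (hf : IsAmp δ f)
    (ψ : 𝓢(V q × V q, ℂ)) {ε : ℝ} (hε : 0 < ε) : Rapid δ (fun p => ψ (ε • p) • f p) := by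
  obtain ⟨ψ', hψ'⟩ := exists_schwartz_scale ψ hε.ne'
  have := cutoff_rapid hf ψ'
  rwa [hψ'] at this

lemma cutoff_integrand (ψ : 𝓢(V q × V q, ℂ)) (ε : ℝ) (f : V q × V q → B) :
    (fun p : V q × V q => (ψ (ε • p) * Complex.exp (-Complex.I * (inner ℝ p.1 p.2 : ℝ))) • f p)
      = fun p => ph p • (ψ (ε • p) • f p) := by
  funext p
  rw [mul_comm, mul_smul]
  rfl

/-- After `l` and `l'` integrations by parts the amplitude is integrable with one order to spare in
each variable, and the spare orders pay for the `O(ε)` estimate of `ψ(0) - ψ(ε·)`. The value `ψ(0)`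
is left arbitrary since derivatives of cutoffs will occur as `ψ`. -/
lemma tendsto_cutoff_aux (hδ : 0 ≤ δ) {f : V q × V q → B} (hf : IsAmp δ f)
    {m k R : ℝ} {l l' : ℕ} (hm : m + 1 - l * (1 - δ) ≤ -(q + 1)) (hk : k + 1 - l' ≤ -(q + 1 : ℝ))
    (hR : AmpBd δ (l + l') m k R f) (ψ : 𝓢(V q × V q, ℂ)) :
    Tendsto (fun ε : ℝ => ∫ p, ph p • (ψ (ε • p) • f p)) (𝓝[>] 0)
      (𝓝 (ψ 0 • ∫ p, ph p • ibpN l l' f p)) := by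
  obtain ⟨C, hC⟩ := AmpBd.ibpN (q := q) (B := B) hδ 0 l l'
  obtain ⟨D, hD⟩ := schwartz_ampBd_sub hδ (l + l') ψ
  rw [tendsto_iff_norm_sub_tendsto_zero]
  set M := C * (2 ^ (l + l') * (D * R)) * japMass q
  have key : ∀ ε : ℝ, 0 < ε → ε ≤ 1 →
      ‖(∫ p, ph p • (ψ (ε • p) • f p)) - ψ 0 • ∫ p, ph p • ibpN l l' f p‖ ≤ M * ε := by
    intro ε h0 h1
    have s1 : ContDiff ℝ ∞ (fun p => ψ (ε • p) • f p) :=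
      (contDiff_scale (ψ.smooth ⊤) ε).smul hf.1
    have s2 : ContDiff ℝ ∞ (fun p => (ψ 0 - ψ (ε • p)) • f p) :=
      (contDiff_const.sub (contDiff_scale (ψ.smooth ⊤) ε)).smul hf.1
    have rap := cutoff_scale_rapid hf ψ h0
    have b1 := hC _ _ _ _ hf.1 (by simpa using hR)
    have b2 := hC _ _ _ _ s2 (by
      simpa using AmpBd.smul (contDiff_const.sub (contDiff_scale (ψ.smooth ⊤) ε)) hf.1
        (hD ε h0 h1) hR)
    have i1 : Integrable (ibpN l l' f) := b1.integrable (contDiff_ibpN l l' hf.1).continuous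
      (by linarith) (by linarith)
    have i2 : Integrable (ibpN l l' (fun p => (ψ 0 - ψ (ε • p)) • f p)) :=
      b2.integrable (contDiff_ibpN l l' s2).continuous (by linarith) (by linarith)
    have e := ibpN_add l l' s1 s2
    have e' : (fun p => ψ (ε • p) • f p + (ψ 0 - ψ (ε • p)) • f p) = fun p => ψ 0 • f p := by
      funext p
      rw [← add_smul]; congr 1; ring
    rw [e', ibpN_smul l l' hf.1] at e
    have i3 : Integrable (ibpN l l' (fun p => ψ (ε • p) • f p)) := by
      have : ibpN l l' (fun p => ψ (ε • p) • f p) = fun p => ψ 0 • ibpN l l' f p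
          - ibpN l l' (fun p => (ψ 0 - ψ (ε • p)) • f p) p := by
        funext p
        rw [eq_sub_iff_add_eq]
        exact (congrFun e p).symm
      rw [this]
      exact (i1.smul (ψ 0)).sub i2
    -- Integration by parts takes place under the cutoff, where the amplitude decays rapidly.
    rw [← rap.integral_ibpN hδ l l', ← integral_smul]
    have e2 : ∀ p, ψ 0 • ph p • ibpN l l' f p = ph p • ibpN l l' (fun p => ψ (ε • p) • f p) p
        + ph p • ibpN l l' (fun p => (ψ 0 - ψ (ε • p)) • f p) p := by
      intro p
      rw [smul_comm, ← smul_add]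
      congr 1
      exact congrFun e p
    simp only [e2]
    rw [integral_add (integrable_ph_smul_prod i3) (integrable_ph_smul_prod i2), sub_add_cancel_left,
      norm_neg]
    refine (b2.norm_integral_le (by linarith) (by linarith)).trans (le_of_eq ?_)
    simp only [M]
    ring
  refine squeeze_zero' (g := fun ε => M * ε) (Eventually.of_forall fun _ => norm_nonneg _) ?_ ?_
  · filter_upwards [Ioc_mem_nhdsGT one_pos] with ε hε using key ε hε.1 hε.2
  · have : Tendsto (fun ε : ℝ => M * ε) (𝓝 0) (𝓝 (M * 0)) := (continuous_const_mul M).tendsto 0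
    rw [mul_zero] at this
    exact this.mono_left nhdsWithin_le_nhds

lemma hasOsc_aux (hδ : 0 ≤ δ) {f : V q × V q → B} (hf : IsAmp δ f)
    {m k R : ℝ} {l l' : ℕ} (hm : m + 1 - l * (1 - δ) ≤ -(q + 1)) (hk : k + 1 - l' ≤ -(q + 1 : ℝ))
    (hR : AmpBd δ (l + l') m k R f) : HasOscIntegral f (∫ p, ph p • ibpN l l' f p) := by
  intro χ hχ
  refine ⟨fun ε hε => ?_, ?_⟩
  · rw [cutoff_integrand]
    exact integrable_ph_smul_prod (cutoff_scale_rapid hf χ hε).integrable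
  · simp only [cutoff_integrand]
    have := tendsto_cutoff_aux hδ hf hm hk hR χ
    rwa [hχ, one_smul] at this

/-- The net gain `1 - δ` per step in `x` is positive, so finitely many steps suffice. The `+ 1`
reserves the order that `schwartz_ampBd_sub` spends. -/
lemma exists_steps (hδ1 : δ < 1) (q : ℕ) (m k : ℝ) : ∃ l l' : ℕ,
    m + 1 - l * (1 - δ) ≤ -(q + 1) ∧ k + 1 - l' ≤ -(q + 1 : ℝ) := by
  obtain ⟨l, hl⟩ := exists_nat_ge ((m + 1 + (q + 1)) / (1 - δ))
  obtain ⟨l', hl'⟩ := exists_nat_ge (k + 1 + (q + 1))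
  refine ⟨l, l', ?_, by linarith⟩
  rw [div_le_iff₀ (by linarith)] at hl
  linarith

lemma IsAmp.hasOsc (hδ : 0 ≤ δ) (hδ1 : δ < 1) {f : V q × V q → B} (hf : IsAmp δ f) :
    HasOscIntegral f (osc f) := by
  obtain ⟨m, k, hb⟩ := hf.2
  obtain ⟨l, l', hm, hk⟩ := exists_steps hδ1 q m k
  obtain ⟨R, hR⟩ := hb (l + l')
  have := hasOsc_aux hδ hf hm hk hR
  rwa [this.osc_eq]

lemma IsAmp.tendsto_cutoff (hδ : 0 ≤ δ) (hδ1 : δ < 1) {f : V q × V q → B} (hf : IsAmp δ f)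
    (ψ : 𝓢(V q × V q, ℂ)) :
    Tendsto (fun ε : ℝ => ∫ p, ph p • (ψ (ε • p) • f p)) (𝓝[>] 0) (𝓝 (ψ 0 • osc f)) := by
  obtain ⟨m, k, hb⟩ := hf.2
  obtain ⟨l, l', hm, hk⟩ := exists_steps hδ1 q m k
  obtain ⟨R, hR⟩ := hb (l + l')
  rw [(hasOsc_aux hδ hf hm hk hR).osc_eq]
  exact tendsto_cutoff_aux hδ hf hm hk hR ψ

variable (q B) in
/-- Oscillatory integrals are controlled by finitely many derivatives of the amplitude. -/
theorem osc_bound (hδ : 0 ≤ δ) (hδ1 : δ < 1) (m k : ℝ) : ∃ (K : ℕ) (C : ℝ), 0 ≤ C ∧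
    ∀ (f : V q × V q → B) (R : ℝ), IsAmp δ f → AmpBd δ K m k R f → ‖osc f‖ ≤ C * R := by
  obtain ⟨l, l', hm, hk⟩ := exists_steps hδ1 q m k
  obtain ⟨C, hC⟩ := AmpBd.ibpN (q := q) (B := B) hδ 0 l l'
  refine ⟨l + l', |C * japMass q|, abs_nonneg _, fun f R hf hR => ?_⟩
  rw [(hasOsc_aux hδ hf hm hk hR).osc_eq]
  have b := hC _ _ _ _ hf.1 (by simpa using hR)
  refine (b.norm_integral_le (by linarith) (by linarith)).trans ?_
  calc C * R * japMass q = C * japMass q * R := by ring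
    _ ≤ _ := mul_le_mul_of_nonneg_right (le_abs_self _) hR.nonneg

end Osc

/-! ### Calculus of oscillatory integrals -/

section OscCalc

variable {q : ℕ} {B : Type*} [NormedAddCommGroup B] [NormedSpace ℂ B] {δ : ℝ}

lemma IsAmp.add {f g : V q × V q → B} (hf : IsAmp δ f) (hg : IsAmp δ g) :
    IsAmp δ (fun p => f p + g p) := by
  obtain ⟨smf, m, k, hf⟩ := hf
  obtain ⟨sg, m', k', hg⟩ := hg
  refine ⟨smf.add sg, max m m', max k k', fun K => ?_⟩
  obtain ⟨R, hR⟩ := hf K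
  obtain ⟨R', hR'⟩ := hg K
  exact ⟨_, AmpBd.add smf sg (hR.mono (le_max_left _ _) (le_max_left _ _) le_rfl)
    (hR'.mono (le_max_right _ _) (le_max_right _ _) le_rfl)⟩

lemma IsAmp.const_smul {f : V q × V q → B} (hf : IsAmp δ f) (c : ℂ) :
    IsAmp δ (fun p => c • f p) := by
  obtain ⟨smf, m, k, hf⟩ := hf
  refine ⟨contDiff_const.smul smf, m, k, fun K => ?_⟩
  obtain ⟨R, hR⟩ := hf K
  exact ⟨_, hR.const_smul smf c⟩

lemma IsAmp.zero : IsAmp δ (fun _ : V q × V q => (0 : B)) :=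
  ⟨contDiff_const, 0, 0, fun _ => ⟨0, AmpBd.zero le_rfl⟩⟩

lemma IsAmp.sum {κ : Type*} (t : Finset κ) {f : κ → V q × V q → B} (hf : ∀ j ∈ t, IsAmp δ (f j)) :
    IsAmp δ (fun p => ∑ j ∈ t, f j p) := by
  classical
  induction t using Finset.induction_on with
  | empty => simpa using IsAmp.zero
  | insert a t ha ih =>
    simp only [Finset.sum_insert ha]
    exact (hf a (Finset.mem_insert_self _ _)).add
      (ih fun j hj => hf j (Finset.mem_insert_of_mem hj))

lemma IsAmp.dd_inl {f : V q × V q → B} (hf : IsAmp δ f) (j : Fin q) : IsAmp δ (dd (dirY j) f) := by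
  obtain ⟨smf, m, k, hf⟩ := hf
  refine ⟨contDiff_dd smf _, m + δ, k, fun K => ?_⟩
  obtain ⟨R, hR⟩ := hf (K + 1)
  exact ⟨_, hR.dd_inl j⟩

lemma IsAmp.dd_inr {f : V q × V q → B} (hf : IsAmp δ f) (j : Fin q) :
    IsAmp δ (dd (dirEta j) f) := by
  obtain ⟨smf, m, k, hf⟩ := hf
  refine ⟨contDiff_dd smf _, m, k, fun K => ?_⟩
  obtain ⟨R, hR⟩ := hf (K + 1)
  exact ⟨_, hR.dd_inr j⟩

lemma IsAmp.linear_smul (hδ : 0 ≤ δ) {f : V q × V q → B} (hf : IsAmp δ f)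
    (A : V q × V q →L[ℝ] ℂ) : IsAmp δ (fun p => A p • f p) := by
  obtain ⟨smf, m, k, hf⟩ := hf
  refine ⟨A.contDiff.smul smf, 1 + m, 1 + k, fun K => ?_⟩
  obtain ⟨R, hR⟩ := hf K
  exact ⟨_, AmpBd.smul A.contDiff smf (AmpBd.linear hδ A) hR⟩

lemma IsAmp.comp_clm {C : Type*} [NormedAddCommGroup C] [NormedSpace ℂ C] (T : B →L[ℂ] C)
    {f : V q × V q → B} (hf : IsAmp δ f) : IsAmp δ (fun p => T (f p)) := by
  obtain ⟨smf, m, k, hf⟩ := hf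
  refine ⟨contDiff_comp_clm smf T, m, k, fun K => ?_⟩
  obtain ⟨R, hR⟩ := hf K
  exact ⟨_, hR.comp_clm T smf⟩

lemma osc_add (hδ : 0 ≤ δ) (hδ1 : δ < 1) {f g : V q × V q → B} (hf : IsAmp δ f)
    (hg : IsAmp δ g) : osc (fun p => f p + g p) = osc f + osc g := by
  refine HasOscIntegral.osc_eq fun χ hχ => ?_
  have h1 := hf.hasOsc hδ hδ1 χ hχ
  have h2 := hg.hasOsc hδ hδ1 χ hχ
  simp only [smul_add]
  refine ⟨fun ε hε => (h1.1 ε hε).add (h2.1 ε hε), ?_⟩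
  refine (h1.2.add h2.2).congr' ?_
  filter_upwards [self_mem_nhdsWithin] with ε hε
  rw [integral_add (h1.1 ε hε) (h2.1 ε hε)]

lemma osc_const_smul (hδ : 0 ≤ δ) (hδ1 : δ < 1) {f : V q × V q → B} (hf : IsAmp δ f) (c : ℂ) :
    osc (fun p => c • f p) = c • osc f := by
  refine HasOscIntegral.osc_eq fun χ hχ => ?_
  have h1 := hf.hasOsc hδ hδ1 χ hχ
  simp only [smul_comm _ c]
  refine ⟨fun ε hε => (h1.1 ε hε).smul c, ?_⟩
  simp only [integral_smul]
  exact h1.2.const_smul c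

lemma osc_zero : osc (fun _ : V q × V q => (0 : B)) = 0 := by
  refine HasOscIntegral.osc_eq fun χ hχ => ?_
  simp

lemma osc_sum (hδ : 0 ≤ δ) (hδ1 : δ < 1) {κ : Type*} (t : Finset κ) {f : κ → V q × V q → B}
    (hf : ∀ j ∈ t, IsAmp δ (f j)) : osc (fun p => ∑ j ∈ t, f j p) = ∑ j ∈ t, osc (f j) := by
  classical
  induction t using Finset.induction_on with
  | empty => simpa using osc_zero
  | insert a t ha ih =>
    have h2 : ∀ j ∈ t, IsAmp δ (f j) := fun j hj => hf j (Finset.mem_insert_of_mem hj)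
    simp only [Finset.sum_insert ha]
    rw [osc_add hδ hδ1 (hf a (Finset.mem_insert_self _ _)) (IsAmp.sum t h2), ih h2]

lemma osc_clm [CompleteSpace B] {C : Type*} [NormedAddCommGroup C] [NormedSpace ℂ C]
    [CompleteSpace C] (hδ : 0 ≤ δ)
    (hδ1 : δ < 1) (T : B →L[ℂ] C) {f : V q × V q → B} (hf : IsAmp δ f) :
    osc (fun p => T (f p)) = T (osc f) := by
  refine HasOscIntegral.osc_eq fun χ hχ => ?_
  have h1 := hf.hasOsc hδ hδ1 χ hχ
  simp only [← map_smul T]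
  refine ⟨fun ε hε => T.integrable_comp (h1.1 ε hε), ?_⟩
  refine ((T.continuous.tendsto _).comp h1.2).congr' ?_
  filter_upwards [self_mem_nhdsWithin] with ε hε
  exact (T.integral_comp_comm (h1.1 ε hε)).symm

lemma Rapid.dd_inl {f : V q × V q → B} (h : Rapid δ f) (j : Fin q) : Rapid δ (dd (dirY j) f) := by
  refine ⟨contDiff_dd h.1 _, fun K m k => ?_⟩
  obtain ⟨R, hR⟩ := h.2 (K + 1) (m - δ) k
  exact ⟨R, (hR.dd_inl j).mono (by linarith) le_rfl le_rfl⟩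

lemma Rapid.dd_inr {f : V q × V q → B} (h : Rapid δ f) (j : Fin q) : Rapid δ (dd (dirEta j) f) := by
  refine ⟨contDiff_dd h.1 _, fun K m k => ?_⟩
  obtain ⟨R, hR⟩ := h.2 (K + 1) m k
  exact ⟨R, hR.dd_inr j⟩

lemma Rapid.linear_smul (hδ : 0 ≤ δ) {f : V q × V q → B} (hf : Rapid δ f)
    (A : V q × V q →L[ℝ] ℂ) : Rapid δ (fun p => A p • f p) := by
  refine ⟨A.contDiff.smul hf.1, fun K m k => ?_⟩
  obtain ⟨R, hR⟩ := hf.2 K (m - 1) (k - 1)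
  exact ⟨_, (AmpBd.smul A.contDiff hf.1 (AmpBd.linear hδ A) hR).mono (by linarith) (by linarith)
    le_rfl⟩

/-- The coordinate functions `x_j` and `ξ_j`, with values in `ℂ`. -/
def coX (j : Fin q) : V q × V q →L[ℝ] ℂ :=
  Complex.ofRealCLM ∘L (EuclideanSpace.proj j : V q →L[ℝ] ℝ) ∘L ContinuousLinearMap.fst ℝ (V q) (V q)
def coXi (j : Fin q) : V q × V q →L[ℝ] ℂ :=
  Complex.ofRealCLM ∘L (EuclideanSpace.proj j : V q →L[ℝ] ℝ) ∘L ContinuousLinearMap.snd ℝ (V q) (V q)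

@[simp] lemma coX_apply (j : Fin q) (p : V q × V q) : coX j p = (p.1 j : ℂ) := rfl
@[simp] lemma coXi_apply (j : Fin q) (p : V q × V q) : coXi j p = (p.2 j : ℂ) := rfl

lemma Rapid.integral_dd_inl (hδ : 0 ≤ δ) {f : V q × V q → B} (h : Rapid δ f) (j : Fin q) :
    ∫ p, ph p • dd (dirY j) f p = Complex.I • ∫ p, ph p • (coXi j p • f p) := by
  obtain ⟨R, hR⟩ := h.2 1 0 (-(q + 1))
  have hc := h.linear_smul hδ (coXi j)
  have hi : Integrable (fun p => Complex.I • (ph p • (coXi j p • f p))) (volume.prod volume) :=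
    (integrable_ph_smul_prod hc.integrable).smul Complex.I
  rw [← integral_smul]
  change ∫ p, ph p • dd (dirY j) f p ∂(volume.prod volume)
    = ∫ p, Complex.I • (ph p • (coXi j p • f p)) ∂(volume.prod volume)
  rw [integral_prod_symm _ (integrable_ph_smul_prod (h.dd_inl j).integrable),
    integral_prod_symm _ hi]
  refine integral_congr_ae (Eventually.of_forall fun ξ => ?_)
  have h0 := hR.integrable_fst h.1.continuous le_rfl ξ
  have h1 := (hR.dd_inl j).integrable_fst (contDiff_dd h.1 _).continuous le_rfl ξ
  rw [← dd_slice_fst h.1] at h1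
  have := integral_ph_smul_dd (contDiff_slice_fst h.1 ξ) ξ j h0 h1
  rw [dd_slice_fst h.1, ← integral_smul] at this
  refine this.trans (integral_congr_ae (Eventually.of_forall fun x => ?_))
  simp only [coXi_apply, smul_smul]
  congr 1; ring

lemma Rapid.integral_dd_inr (hδ : 0 ≤ δ) {f : V q × V q → B} (h : Rapid δ f) (j : Fin q) :
    ∫ p, ph p • dd (dirEta j) f p = Complex.I • ∫ p, ph p • (coX j p • f p) := by
  obtain ⟨R, hR⟩ := h.2 1 (-(q + 1)) 0
  have hc := h.linear_smul hδ (coX j)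
  have hi : Integrable (fun p => Complex.I • (ph p • (coX j p • f p))) (volume.prod volume) :=
    (integrable_ph_smul_prod hc.integrable).smul Complex.I
  rw [← integral_smul]
  change ∫ p, ph p • dd (dirEta j) f p ∂(volume.prod volume)
    = ∫ p, Complex.I • (ph p • (coX j p • f p)) ∂(volume.prod volume)
  rw [integral_prod _ (integrable_ph_smul_prod (h.dd_inr j).integrable),
    integral_prod _ hi]
  refine integral_congr_ae (Eventually.of_forall fun x => ?_)
  have h0 := hR.integrable_snd h.1.continuous le_rfl x
  have h1 := (hR.dd_inr j).integrable_snd (contDiff_dd h.1 _).continuous le_rfl x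
  rw [← dd_slice_snd h.1] at h1
  have := integral_ph_smul_dd (contDiff_slice_snd h.1 x) x j h0 h1
  have e : ∀ ξ, ph (ξ, x) = ph (x, ξ) := fun ξ => ph_swap (x, ξ)
  rw [dd_slice_snd h.1, ← integral_smul] at this
  simp only [e] at this
  refine this.trans (integral_congr_ae (Eventually.of_forall fun ξ => ?_))
  simp only [coX_apply, smul_smul]
  congr 1; ring

/-- The identity is integrated by parts under the cutoff `χ(ε·)`. Differentiating the cutoff gives
`ε` times a cut-off integral with `ψ = ∂_v χ`; the latter converges, so the product tends to zero.
-/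
lemma osc_dd_aux (hδ : 0 ≤ δ) (hδ1 : δ < 1) {f : V q × V q → B} (hf : IsAmp δ f)
    {v : V q × V q} {A : V q × V q →L[ℝ] ℂ}
    (hA : ∀ g : V q × V q → B, Rapid δ g →
      ∫ p, ph p • dd v g p = Complex.I • ∫ p, ph p • (A p • g p))
    (hd : IsAmp δ (dd v f)) :
    osc (dd v f) = Complex.I • osc (fun p => A p • f p) := by
  obtain ⟨χ, hχ⟩ := exists_schwartz_one (V q × V q)
  obtain ⟨ψ, hψ⟩ := exists_schwartz_dd χ v
  have t1 := hd.tendsto_cutoff hδ hδ1 χ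
  have t2 := hf.tendsto_cutoff hδ hδ1 ψ
  have t3 := ((hf.linear_smul hδ A).tendsto_cutoff hδ hδ1 χ).const_smul Complex.I
  have t4 : Tendsto (fun ε : ℝ => (ε : ℂ)) (𝓝[>] 0) (𝓝 0) := by
    have : Tendsto (fun ε : ℝ => (ε : ℂ)) (𝓝 0) (𝓝 ((0 : ℝ) : ℂ)) :=
      Complex.continuous_ofReal.tendsto 0
    rw [Complex.ofReal_zero] at this
    exact this.mono_left nhdsWithin_le_nhds
  rw [hχ, one_smul] at t1 t3
  have t5 := t1.add (t4.smul t2)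
  rw [zero_smul, add_zero] at t5
  refine tendsto_nhds_unique t5 (t3.congr' ?_)
  filter_upwards [self_mem_nhdsWithin] with ε hε
  have rap := cutoff_scale_rapid hf χ hε
  have r1 := cutoff_scale_rapid hd χ hε
  have r2 := cutoff_scale_rapid hf ψ hε
  have e1 : dd v (fun p => χ (ε • p) • f p)
      = fun p => χ (ε • p) • dd v f p + (ε : ℂ) • (ψ (ε • p) • f p) := by
    have := dd_bilin (ContinuousLinearMap.lsmul ℝ ℂ : ℂ →L[ℝ] B →L[ℝ] B)
      (contDiff_scale (χ.smooth ⊤) ε) hf.1 v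
    simp only [ContinuousLinearMap.lsmul_apply] at this
    rw [this, dd_scale (χ.smooth ⊤), hψ]
    funext p
    simp only [smul_assoc]
  have key := hA _ rap
  rw [e1] at key
  simp only [smul_add, smul_comm _ (ε : ℂ)] at key
  have i2 : Integrable (fun p => (ε : ℂ) • (ph p • (ψ (ε • p) • f p))) :=
    (integrable_ph_smul_prod r2.integrable).smul (ε : ℂ)
  rw [integral_add (integrable_ph_smul_prod r1.integrable) i2, integral_smul] at key
  rw [key]
  simp only [smul_comm (A _)]

lemma osc_dd_inl (hδ : 0 ≤ δ) (hδ1 : δ < 1) {f : V q × V q → B} (hf : IsAmp δ f) (j : Fin q) :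
    osc (dd (dirY j) f) = Complex.I • osc (fun p => coXi j p • f p) :=
  osc_dd_aux hδ hδ1 hf (fun _ h => h.integral_dd_inl hδ j) (hf.dd_inl j)

lemma osc_dd_inr (hδ : 0 ≤ δ) (hδ1 : δ < 1) {f : V q × V q → B} (hf : IsAmp δ f) (j : Fin q) :
    osc (dd (dirEta j) f) = Complex.I • osc (fun p => coX j p • f p) :=
  osc_dd_aux hδ hδ1 hf (fun _ h => h.integral_dd_inr hδ j) (hf.dd_inr j)

lemma neg_I_smul_I_smul (b : B) : (-Complex.I) • (Complex.I • b) = b := by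
  rw [smul_smul]; simp

lemma osc_coX (hδ : 0 ≤ δ) (hδ1 : δ < 1) {f : V q × V q → B} (hf : IsAmp δ f) (j : Fin q) :
    osc (fun p => coX j p • f p) = (-Complex.I) • osc (dd (dirEta j) f) := by
  rw [osc_dd_inr hδ hδ1 hf, neg_I_smul_I_smul]

lemma osc_coXi (hδ : 0 ≤ δ) (hδ1 : δ < 1) {f : V q × V q → B} (hf : IsAmp δ f) (j : Fin q) :
    osc (fun p => coXi j p • f p) = (-Complex.I) • osc (dd (dirY j) f) := by
  rw [osc_dd_inl hδ hδ1 hf, neg_I_smul_I_smul]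

/-- For amplitudes that decay in `x`, the oscillatory integral is an iterated integral. -/
theorem osc_eq_iterated (hδ : 0 ≤ δ) (hδ1 : δ < 1) {f : V q × V q → B} (hf : ContDiff ℝ ∞ f)
    {m k : ℝ} (hk : k ≤ -(q + 2)) (hb : ∀ K, ∃ R, AmpBd δ K m k R f) :
    (∀ ξ, Integrable fun x => ph (x, ξ) • f (x, ξ)) ∧
      Integrable (fun ξ => ∫ x, ph (x, ξ) • f (x, ξ)) ∧
      osc f = ∫ ξ, ∫ x, ph (x, ξ) • f (x, ξ) := by
  -- Decay in `x` is already present, so only integrations by parts in `x` are needed, and these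
  -- leave the inner integral unchanged. The exponent `-(q + 2)` leaves the spare order for the
  -- cutoff.
  obtain ⟨l, -, hl, -⟩ := exists_steps hδ1 q m 0
  have hs : ∀ n : ℕ, ContDiff ℝ ∞ (ibpN n 0 f) := fun n => contDiff_ibpN n 0 hf
  have hk' : k ≤ -(q + 1) := by linarith
  have step : ∀ n ξ, ∫ x, ph (x, ξ) • ibpN n 0 f (x, ξ) = ∫ x, ph (x, ξ) • f (x, ξ) := by
    intro n ξ
    induction n with
    | zero => rfl
    | succ n ih =>
      obtain ⟨C, hC⟩ := AmpBd.ibpN (q := q) (B := B) hδ 1 n 0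
      obtain ⟨R, hR⟩ := hb (1 + n)
      have e := hC _ _ _ _ hf (by simpa using hR)
      have e' : ibpN (n + 1) 0 f = ibpX (ibpN n 0 f) := by
        simp [ibpN, Function.iterate_succ_apply']
      rw [e', integral_fst_ibpX (hs n) e (by simpa using hk'), ih]
  obtain ⟨C, hC⟩ := AmpBd.ibpN (q := q) (B := B) hδ 0 l 0
  obtain ⟨R, hR⟩ := hb l
  have hR' : AmpBd δ (l + 0) m k R f := by simpa using hR
  have e := hC _ _ _ _ hf (by simpa using hR)
  have hi : Integrable (fun p => ph p • ibpN l 0 f p) (volume.prod volume) :=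
    integrable_ph_smul_prod (e.integrable (hs l).continuous (by linarith) (by simpa using hk'))
  refine ⟨fun ξ => integrable_ph_smul ξ (hR.integrable_fst hf.continuous hk' ξ), ?_, ?_⟩
  · have := hi.integral_prod_right
    simpa only [step] using this
  · rw [(hasOsc_aux hδ ⟨hf, m, k, hb⟩ hl (by push_cast; linarith) hR').osc_eq]
    refine (integral_prod_symm _ hi).trans ?_
    simp only [step]

end OscCalc

/-! ### Oscillatory integrals depending on a parameter -/

section Param

variable {q : ℕ} {B P : Type*} [NormedAddCommGroup B] [NormedSpace ℂ B]
  [NormedAddCommGroup P] [NormedSpace ℝ P] {δ : ℝ}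

/-- Two applications of the mean value inequality; the sharp factor `1/2` is immaterial. -/
lemma norm_taylor_two_le {Φ Φ₁ Φ₂ : ℝ → B} {M : ℝ} (h : ∀ t, HasDerivAt Φ (Φ₁ t) t)
    (h₁ : ∀ t, HasDerivAt Φ₁ (Φ₂ t) t) (hM : ∀ t ∈ Set.Icc (0 : ℝ) 1, ‖Φ₂ t‖ ≤ M) :
    ‖Φ 1 - Φ 0 - Φ₁ 0‖ ≤ M := by
  have hM0 : 0 ≤ M := (norm_nonneg _).trans (hM 0 (by simp))
  have b1 : ∀ t ∈ Set.Icc (0 : ℝ) 1, ‖Φ₁ t - Φ₁ 0‖ ≤ M := by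
    intro t ht
    have := norm_image_sub_le_of_norm_deriv_le_segment' (a := 0) (b := 1) (f := Φ₁) (C := M)
      (fun x _ => (h₁ x).hasDerivWithinAt) (fun x hx => hM x ⟨hx.1, hx.2.le⟩) t ht
    refine this.trans ?_
    nlinarith [ht.2]
  have b2 := norm_image_sub_le_of_norm_deriv_le_segment' (a := 0) (b := 1)
    (f := fun t => Φ t - t • Φ₁ 0) (f' := fun t => Φ₁ t - Φ₁ 0) (C := M)
    (fun x _ => by
      have := (h x).sub ((hasDerivAt_id x).smul_const (Φ₁ 0))
      simp only [one_smul] at this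
      exact this.hasDerivWithinAt) (fun x hx => b1 x ⟨hx.1, hx.2.le⟩) 1 (by simp)
  simp only [one_smul, zero_smul, sub_zero, mul_one] at b2
  rwa [sub_right_comm]

lemma dl_slice {G : P × (V q × V q) → B} (hG : ContDiff ℝ ∞ G) (p : P) (l : List (Fin q ⊕ Fin q)) :
    dl dir2 l (fun x => G (p, x))
      = fun x => dl (fun i => ((0, dir2 i) : P × (V q × V q))) l G (p, x) := by
  have := dl_comp_linear hG (p, 0) (ContinuousLinearMap.inr ℝ P (V q × V q)) dir2 l
  simpa using this

lemma contDiff_slice {G : P × (V q × V q) → B} (hG : ContDiff ℝ ∞ G) (p : P) :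
    ContDiff ℝ ∞ (fun x => G (p, x)) := hG.comp (contDiff_const.prodMk contDiff_id)

/-- Families of amplitudes, locally uniform in the parameter. -/
def LocAmp (δ : ℝ) (G : P × (V q × V q) → B) : Prop :=
  ContDiff ℝ ∞ G ∧ ∃ m k : ℝ, ∀ (K : ℕ) (p₀ : P), ∃ R, ∀ p, ‖p - p₀‖ ≤ 1 →
    AmpBd δ K m k R (fun x => G (p, x))

/-- Families of amplitudes all whose parameter derivatives are families of amplitudes. -/
def ParAmp (δ : ℝ) (G : P × (V q × V q) → B) : Prop :=
  ∀ hs : List P, LocAmp δ (dl (fun h : P => ((h, 0) : P × (V q × V q))) hs G)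

lemma LocAmp.isAmp {G : P × (V q × V q) → B} (h : LocAmp δ G) (p : P) :
    IsAmp δ (fun x => G (p, x)) := by
  obtain ⟨hs, m, k, hb⟩ := h
  refine ⟨contDiff_slice hs p, m, k, fun K => ?_⟩
  obtain ⟨R, hR⟩ := hb K p
  exact ⟨R, hR p (by simp)⟩

lemma LocAmp.add {G H : P × (V q × V q) → B} (hG : LocAmp δ G) (hH : LocAmp δ H) :
    LocAmp δ (fun z => G z + H z) := by
  obtain ⟨s1, m, k, hG⟩ := hG
  obtain ⟨s2, m', k', hH⟩ := hH
  refine ⟨s1.add s2, max m m', max k k', fun K p₀ => ?_⟩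
  obtain ⟨R, hR⟩ := hG K p₀
  obtain ⟨R', hR'⟩ := hH K p₀
  exact ⟨R + R', fun p hp => AmpBd.add (contDiff_slice s1 p) (contDiff_slice s2 p)
    ((hR p hp).mono (le_max_left _ _) (le_max_left _ _) le_rfl)
    ((hR' p hp).mono (le_max_right _ _) (le_max_right _ _) le_rfl)⟩

lemma LocAmp.zero : LocAmp δ (fun _ : P × (V q × V q) => (0 : B)) :=
  ⟨contDiff_const, 0, 0, fun _ _ => ⟨0, fun _ _ => AmpBd.zero le_rfl⟩⟩

lemma LocAmp.sum {κ : Type*} (t : Finset κ) {G : κ → P × (V q × V q) → B}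
    (hG : ∀ j ∈ t, LocAmp δ (G j)) : LocAmp δ (fun z => ∑ j ∈ t, G j z) := by
  classical
  induction t using Finset.induction_on with
  | empty => simpa using LocAmp.zero
  | insert a t ha ih =>
    simp only [Finset.sum_insert ha]
    exact (hG a (Finset.mem_insert_self _ _)).add
      (ih fun j hj => hG j (Finset.mem_insert_of_mem hj))

lemma LocAmp.smul {G : P × (V q × V q) → B} (hG : LocAmp δ G) {c : V q × V q → ℂ}
    (hc : IsAmp δ c) : LocAmp δ (fun z => c z.2 • G z) := by
  obtain ⟨s1, m, k, hG⟩ := hG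
  obtain ⟨s2, m', k', hc⟩ := hc
  refine ⟨(s2.comp contDiff_snd).smul s1, m' + m, k' + k, fun K p₀ => ?_⟩
  obtain ⟨R, hR⟩ := hG K p₀
  obtain ⟨R', hR'⟩ := hc K
  exact ⟨_, fun p hp => AmpBd.smul s2 (contDiff_slice s1 p) hR' (hR p hp)⟩

lemma dl_smul_snd {G : P × (V q × V q) → B} (hG : ContDiff ℝ ∞ G) {c : V q × V q → ℂ}
    (hc : ContDiff ℝ ∞ c) (hs : List P) :
    dl (fun h : P => ((h, 0) : P × (V q × V q))) hs (fun z => c z.2 • G z)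
      = fun z => c z.2 • dl (fun h : P => ((h, 0) : P × (V q × V q))) hs G z := by
  induction hs generalizing G with
  | nil => rfl
  | cons h hs ih =>
    rw [dl_cons, dl_cons, ← ih (contDiff_dd hG _)]
    congr 1
    have hc' : ContDiff ℝ ∞ (fun z : P × (V q × V q) => c z.2) := hc.comp contDiff_snd
    have := dd_bilin (ContinuousLinearMap.lsmul ℝ ℂ : ℂ →L[ℝ] B →L[ℝ] B) hc' hG (h, 0)
    simp only [ContinuousLinearMap.lsmul_apply] at this
    rw [this]
    have e : dd ((h, 0) : P × (V q × V q)) (fun z : P × (V q × V q) => c z.2) = fun _ => 0 := by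
      have := dd_comp_affine hc 0 (ContinuousLinearMap.snd ℝ P (V q × V q)) (h, 0)
      simp only [zero_add, ContinuousLinearMap.coe_snd'] at this
      rw [this]
      funext z
      simp [dd]
    rw [e]
    simp

/-- A family `F_a` that is closed under parameter derivatives, up to amplitude coefficients,
consists of families of amplitudes with all their parameter derivatives. -/
lemma parAmp_of_family {𝒜 I : Type*} [Fintype I] (F : 𝒜 → P × (V q × V q) → B)
    (T : I → 𝒜 → 𝒜) (c : I → P → V q × V q → ℂ) (hF : ∀ a, LocAmp δ (F a))
    (hc : ∀ i h, IsAmp δ (c i h))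
    (hd : ∀ a h z, dd ((h, 0) : P × (V q × V q)) (F a) z = ∑ i, c i h z.2 • F (T i a) z) (a : 𝒜) :
    ParAmp δ (F a) := by
  intro hs
  induction hs generalizing a with
  | nil => exact hF a
  | cons h hs ih =>
    have e : dd ((h, 0) : P × (V q × V q)) (F a) = fun z => ∑ i, c i h z.2 • F (T i a) z :=
      funext fun z => hd a h z
    have sm : ∀ i, ContDiff ℝ ∞ (fun z : P × (V q × V q) => c i h z.2 • F (T i a) z) := fun i =>
      ContDiff.smul (f := fun z : P × (V q × V q) => c i h z.2) ((hc i h).1.comp contDiff_snd)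
        (hF (T i a)).1
    rw [dl_cons, e, dl_sum _ fun i _ => sm i]
    refine LocAmp.sum _ fun i _ => ?_
    rw [dl_smul_snd (hF _).1 (hc i h).1]
    exact (ih (T i a)).smul (hc i h)

lemma ParAmp.dd {G : P × (V q × V q) → B} (hG : ParAmp δ G) (h : P) : ParAmp δ (dd (h, 0) G) :=
  fun hs => hG (h :: hs)

lemma ParAmp.loc {G : P × (V q × V q) → B} (hG : ParAmp δ G) : LocAmp δ G := hG []

/-- The second derivatives in the parameter are bounded locally uniformly. -/
lemma ParAmp.second [FiniteDimensional ℝ P] {G : P × (V q × V q) → B} (hG : ParAmp δ G) (p₀ : P) :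
    ∃ m k : ℝ, ∀ K, ∃ R, ∀ h p, ‖p - p₀‖ ≤ 1 →
      AmpBd δ K m k (R * ‖h‖ ^ 2)
        (fun x => EdgePsiDO.dd ((h, 0) : P × (V q × V q)) (EdgePsiDO.dd (h, 0) G) (p, x)) := by
  classical
  let b := Module.finBasis ℝ P
  let H := fun i j => EdgePsiDO.dd ((b j, 0) : P × (V q × V q)) (EdgePsiDO.dd (b i, 0) G)
  have hH : ∀ i j, LocAmp δ (H i j) := fun i j => ((hG.dd (b i)).dd (b j)).loc
  choose s m k hb using hH
  have hco : ∃ C : ℝ, 0 ≤ C ∧ ∀ i (h : P), |b.repr h i| ≤ C * ‖h‖ := by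
    refine ⟨∑ i, ‖LinearMap.toContinuousLinearMap (b.coord i)‖,
      Finset.sum_nonneg fun _ _ => norm_nonneg _, fun i h => ?_⟩
    have h1 := (LinearMap.toContinuousLinearMap (b.coord i)).le_opNorm h
    refine h1.trans (mul_le_mul_of_nonneg_right ?_ (norm_nonneg _))
    exact Finset.single_le_sum (f := fun i => ‖LinearMap.toContinuousLinearMap (b.coord i)‖)
      (fun _ _ => norm_nonneg _) (Finset.mem_univ i)
  obtain ⟨C, hC0, hC⟩ := hco
  have hle : ∀ (f : Fin (Module.finrank ℝ P) → Fin (Module.finrank ℝ P) → ℝ) i j,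
      f i j ≤ ∑ i, ∑ j, |f i j| := fun f i j => (le_abs_self _).trans <|
    (Finset.single_le_sum (f := fun j => |f i j|) (fun _ _ => abs_nonneg _)
      (Finset.mem_univ j)).trans (Finset.single_le_sum (f := fun i => ∑ j, |f i j|)
      (fun _ _ => Finset.sum_nonneg fun _ _ => abs_nonneg _) (Finset.mem_univ i))
  -- The second derivative along `h` is a quadratic form in the coordinates of `h`, with second
  -- derivatives along basis vectors as coefficients. There are finitely many of these, and the sums
  -- dominate all their orders.
  refine ⟨∑ i, ∑ j, |m i j|, ∑ i, ∑ j, |k i j|, fun K => ?_⟩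
  choose R hR using fun i j => hb i j K p₀
  refine ⟨∑ i, ∑ j, C * C * R i j, fun h p hp => ?_⟩
  have e1 : ∀ G' : P × (V q × V q) → B, EdgePsiDO.dd ((h, 0) : P × (V q × V q)) G'
      = fun z => ∑ i, ((b.repr h i : ℝ) : ℂ) • EdgePsiDO.dd (b i, 0) G' z := by
    intro G'
    have : ((h, 0) : P × (V q × V q)) = ∑ i, b.repr h i • ((b i, 0) : P × (V q × V q)) := by
      refine Prod.ext ?_ ?_
      · rw [Prod.fst_sum]; exact (b.sum_repr h).symm
      · rw [Prod.snd_sum]; simp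
    rw [this, dd_sum_dir]
    funext z
    refine Finset.sum_congr rfl fun i _ => ?_
    rw [dd_smul_dir, Complex.coe_smul]
  have e2 : (fun x => EdgePsiDO.dd ((h, 0) : P × (V q × V q)) (EdgePsiDO.dd (h, 0) G) (p, x))
      = fun x => ∑ i, ∑ j, ((b.repr h i * b.repr h j : ℝ) : ℂ) • H i j (p, x) := by
    funext x
    have sm : ∀ i, ContDiff ℝ ∞ (fun z => ((b.repr h i : ℝ) : ℂ) •
        EdgePsiDO.dd ((b i, 0) : P × (V q × V q)) G z) := fun i =>
      contDiff_const.smul (hG.dd (b i)).loc.1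
    rw [e1 G, dd_sum _ fun i _ => sm i]
    refine Finset.sum_congr rfl fun i _ => ?_
    rw [dd_const_smul (hG.dd (b i)).loc.1, e1]
    simp only [Finset.smul_sum, smul_smul, Complex.ofReal_mul]
    rfl
  rw [e2]
  have sm : ∀ i j, ContDiff ℝ ∞ (fun x => H i j (p, x)) := fun i j => contDiff_slice (s i j) p
  have hb' := fun i j => ((hR i j p hp).mono (hle m i j) (hle k i j) le_rfl).const_smul
    (sm i j) ((b.repr h i * b.repr h j : ℝ) : ℂ)
  refine (AmpBd.sum _ (fun i _ => ContDiff.sum fun j _ => contDiff_const.smul (sm i j))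
    fun i _ => AmpBd.sum _ (fun j _ => contDiff_const.smul (sm i j)) fun j _ => hb' i j).mono
    le_rfl le_rfl ?_
  rw [Finset.sum_mul]
  refine Finset.sum_le_sum fun i _ => ?_
  rw [Finset.sum_mul]
  refine Finset.sum_le_sum fun j _ => ?_
  have hn := (hR i j p hp).nonneg
  rw [Complex.norm_real, Real.norm_eq_abs, abs_mul]
  have := mul_le_mul (hC i h) (hC j h) (abs_nonneg _) (by positivity)
  calc |b.repr h i| * |b.repr h j| * R i j ≤ C * ‖h‖ * (C * ‖h‖) * R i j :=
        mul_le_mul_of_nonneg_right this hn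
    _ = _ := by ring

lemma osc_sub (hδ : 0 ≤ δ) (hδ1 : δ < 1) {f g : V q × V q → B} (hf : IsAmp δ f)
    (hg : IsAmp δ g) : osc (fun p => f p - g p) = osc f - osc g := by
  have := osc_add hδ hδ1 hf (hg.const_smul (-1))
  rw [osc_const_smul hδ hδ1 hg] at this
  simpa [sub_eq_add_neg] using this

lemma IsAmp.sub {f g : V q × V q → B} (hf : IsAmp δ f) (hg : IsAmp δ g) :
    IsAmp δ (fun p => f p - g p) := by
  simpa [sub_eq_add_neg] using hf.add (hg.const_smul (-1))

/-- Derivatives in `x` commute with Taylor expansion in the parameter, so each derivative of the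
remainder is the remainder of that derivative and inherits the bound of the second parameter
derivative. -/
lemma remainder_ampBd {G : P × (V q × V q) → B} (hG : ContDiff ℝ ∞ G) {p h : P} {K : ℕ}
    {m k R : ℝ} (hb : ∀ t ∈ Set.Icc (0 : ℝ) 1, AmpBd δ K m k R
      (fun x => dd ((h, 0) : P × (V q × V q)) (dd (h, 0) G) (p + t • h, x))) :
    AmpBd δ K m k R (fun x => G (p + h, x) - G (p, x) - dd (h, 0) G (p, x)) := by
  intro l hl x
  set H := dl (fun i => ((0, dir2 i) : P × (V q × V q))) l G with hHdef
  have sH : ContDiff ℝ ∞ H := contDiff_dl hG _ _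
  have hd : ∀ (f : P × (V q × V q) → B), ContDiff ℝ ∞ f → ∀ t : ℝ,
      HasDerivAt (fun t : ℝ => f (p + t • h, x)) (dd (h, 0) f (p + t • h, x)) t := by
    intro f hf t
    have h1 : HasDerivAt (fun t : ℝ => (p + t • h, x)) ((h, 0) : P × (V q × V q)) t := by
      have := ((hasDerivAt_id t).smul_const h).const_add p
      simp only [one_smul] at this
      exact this.prodMk (hasDerivAt_const t x)
    exact (smooth_diff hf (p + t • h, x)).hasFDerivAt.comp_hasDerivAt t h1
  have e : dl dir2 l (fun x => G (p + h, x) - G (p, x) - dd (h, 0) G (p, x)) x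
      = H (p + (1 : ℝ) • h, x) - H (p + (0 : ℝ) • h, x) - dd (h, 0) H (p + (0 : ℝ) • h, x) := by
    have s1 := contDiff_slice hG (p + h)
    have s2 := contDiff_slice hG p
    have s3 := contDiff_slice (contDiff_dd hG ((h, 0) : P × (V q × V q))) p
    have : (fun x => G (p + h, x) - G (p, x) - dd ((h, 0) : P × (V q × V q)) G (p, x))
        = fun x => G (p + h, x) + ((-1 : ℂ) • G (p, x) + (-1 : ℂ) • dd (h, 0) G (p, x)) := by
      funext x; simp; abel
    have s2' : ContDiff ℝ ∞ (fun x => (-1 : ℂ) • G (p, x)) := contDiff_const.smul s2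
    have s3' : ContDiff ℝ ∞ (fun x => (-1 : ℂ) • dd ((h, 0) : P × (V q × V q)) G (p, x)) :=
      contDiff_const.smul s3
    rw [this, dl_add s1 (s2'.add s3'), dl_add s2' s3', dl_const_smul s2,
      dl_const_smul s3, dl_slice hG, dl_slice hG, dl_slice (contDiff_dd hG _), dl_dd_comm hG]
    simp only [one_smul, zero_smul, add_zero, neg_smul]
    abel
  rw [e]
  refine norm_taylor_two_le (Φ := fun t => H (p + t • h, x))
    (Φ₁ := fun t => dd (h, 0) H (p + t • h, x))
    (Φ₂ := fun t => dd (h, 0) (dd (h, 0) H) (p + t • h, x)) (hd H sH) (hd _ (contDiff_dd sH _))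
    fun t ht => ?_
  have := hb t ht l hl x
  rw [dl_slice (contDiff_dd (contDiff_dd hG _) _), dl_dd_comm (contDiff_dd hG _),
    dl_dd_comm hG] at this
  exact this

/-- Differentiation under the oscillatory integral. -/
theorem ParAmp.hasFDerivAt_osc [FiniteDimensional ℝ P] (hδ : 0 ≤ δ) (hδ1 : δ < 1)
    {G : P × (V q × V q) → B} (hG : ParAmp δ G) (p : P) :
    ∃ L : P →L[ℝ] B, (∀ h, L h = osc fun x => EdgePsiDO.dd (h, 0) G (p, x)) ∧
      HasFDerivAt (fun p => osc fun x => G (p, x)) L p := by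
  have ha : ∀ h : P, IsAmp δ fun x => EdgePsiDO.dd ((h, 0) : P × (V q × V q)) G (p, x) :=
    fun h => (hG.dd h).loc.isAmp p
  let L₀ : P →ₗ[ℝ] B :=
    { toFun := fun h => osc fun x => EdgePsiDO.dd (h, 0) G (p, x)
      map_add' := fun h h' => by
        rw [← osc_add hδ hδ1 (ha h) (ha h')]
        congr 1
        funext x
        rw [← Prod.mk_add_mk_zero, dd_add_dir]
      map_smul' := fun c h => by
        rw [RingHom.id_apply, ← Complex.coe_smul, ← osc_const_smul hδ hδ1 (ha h)]
        congr 1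
        funext x
        have : ((c • h, 0) : P × (V q × V q)) = c • (h, 0) := by simp
        rw [this, dd_smul_dir, Complex.coe_smul] }
  refine ⟨LinearMap.toContinuousLinearMap L₀, fun h => rfl, ?_⟩
  obtain ⟨m, k, hb⟩ := hG.second p
  obtain ⟨K, C, hC0, hC⟩ := osc_bound q B hδ hδ1 m k
  obtain ⟨R, hR⟩ := hb K
  rw [hasFDerivAt_iff_isLittleO_nhds_zero]
  -- The first order remainder is an amplitude of size `‖h‖²`, and `osc_bound` is linear in that
  -- size. The orders do not depend on `h`, so a single constant serves all of them.
  have hO : (fun h => (osc fun x => G (p + h, x)) - (osc fun x => G (p, x)) - L₀ h)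
      =O[𝓝 0] fun h => ‖h‖ ^ 2 := by
    refine Asymptotics.IsBigO.of_bound (C * R) ?_
    filter_upwards [Metric.closedBall_mem_nhds (0 : P) one_pos] with h hh
    rw [mem_closedBall_zero_iff] at hh
    have i1 := hG.loc.isAmp (p + h)
    have i2 := hG.loc.isAmp p
    have e : (osc fun x => G (p + h, x)) - (osc fun x => G (p, x)) - L₀ h
        = osc fun x => G (p + h, x) - G (p, x) - EdgePsiDO.dd (h, 0) G (p, x) := by
      rw [osc_sub hδ hδ1 (i1.sub i2) (ha h), osc_sub hδ hδ1 i1 i2]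
      rfl
    rw [e, norm_pow, norm_norm, mul_assoc]
    refine hC _ _ ((i1.sub i2).sub (ha h)) (remainder_ampBd hG.loc.1 fun t ht => hR h _ ?_)
    rw [add_sub_cancel_left, norm_smul, Real.norm_eq_abs, abs_of_nonneg ht.1]
    exact mul_le_one₀ ht.2 (norm_nonneg _) hh
  refine hO.trans_isLittleO ?_
  refine Asymptotics.isLittleO_iff.2 fun c hc => ?_
  filter_upwards [Metric.closedBall_mem_nhds (0 : P) hc] with h hh
  rw [mem_closedBall_zero_iff] at hh
  rw [norm_pow, norm_norm, sq]
  exact mul_le_mul_of_nonneg_right hh (norm_nonneg _)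
where
  Prod.mk_add_mk_zero {h h' : P} : ((h, 0) : P × (V q × V q)) + (h', 0) = (h + h', 0) := by simp

lemma ParAmp.dd_osc [FiniteDimensional ℝ P] (hδ : 0 ≤ δ) (hδ1 : δ < 1)
    {G : P × (V q × V q) → B} (hG : ParAmp δ G) (h : P) :
    EdgePsiDO.dd h (fun p => osc fun x => G (p, x))
      = fun p => osc fun x => EdgePsiDO.dd (h, 0) G (p, x) := by
  funext p
  obtain ⟨L, hL, hd⟩ := hG.hasFDerivAt_osc hδ hδ1 p
  rw [← hL, EdgePsiDO.dd, hd.fderiv]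

theorem ParAmp.contDiff_osc [FiniteDimensional ℝ P] (hδ : 0 ≤ δ) (hδ1 : δ < 1)
    {G : P × (V q × V q) → B} (hG : ParAmp δ G) : ContDiff ℝ ∞ (fun p => osc fun x => G (p, x)) := by
  refine contDiff_of_family {f | ∃ G : P × (V q × V q) → B, ParAmp δ G ∧
    f = fun p => osc fun x => G (p, x)} ?_ ?_ _ ⟨G, hG, rfl⟩
  · rintro _ ⟨G, hG, rfl⟩ p
    obtain ⟨L, _, hd⟩ := hG.hasFDerivAt_osc hδ hδ1 p
    exact hd.differentiableAt
  · rintro _ ⟨G, hG, rfl⟩ h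
    exact ⟨_, hG.dd h, hG.dd_osc hδ hδ1 h⟩

end Param

/-! ### Double symbols with respect to a tempered twist and a tempered weight -/

/-- The space `ℝ^{3q}` of the variables `(y, y', η)`. -/
abbrev V3 (q : ℕ) : Type := V q × V q × V q

/-- The coordinate directions in `ℝ^{3q}`. -/
def dir3 {q : ℕ} : Fin q ⊕ (Fin q ⊕ Fin q) → V3 q := Sum.elim dirY3 (Sum.elim dirYp3 dirEta3)

/-- The exponents `δ` for `y` and `y'`, and `-ϱ` for `η`. -/
def expo3 {q : ℕ} (ϱ δ : ℝ) : Fin q ⊕ (Fin q ⊕ Fin q) → ℝ :=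
  Sum.elim (fun _ => δ) (Sum.elim (fun _ => δ) fun _ => -ϱ)

/-- The factors `⟨η⟩^δ` for `y`- and `y'`-derivatives and `⟨η⟩^{-ϱ}` for `η`-derivatives. -/
def wt3 {q : ℕ} (ϱ δ : ℝ) (i : Fin q ⊕ (Fin q ⊕ Fin q)) (p : V3 q) : ℝ :=
  jap p.2.2 ^ expo3 ϱ δ i

lemma wt3_nonneg {q : ℕ} (ϱ δ : ℝ) (i : Fin q ⊕ (Fin q ⊕ Fin q)) (p : V3 q) : 0 ≤ wt3 ϱ δ i p :=
  (jap_rpow_pos _ _).le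

/-- A tempered family of operators `Θ_η` with `Θ_0 = 1`, and a tempered weight `W(y, y')`. -/
structure Frame (q : ℕ) (B : Type*) [NormedAddCommGroup B] [NormedSpace ℂ B] where
  Θ : V q → B →L[ℂ] B
  W : V q × V q → ℝ
  C : ℝ
  M : ℝ
  one_le_C : 1 ≤ C
  M_nonneg : 0 ≤ M
  Θ_zero : Θ 0 = ContinuousLinearMap.id ℂ B
  Θ_le : ∀ η ξ b, ‖Θ η b‖ ≤ C * jap ξ ^ M * ‖Θ (η + ξ) b‖
  W_pos : ∀ y, 0 < W y
  W_le : ∀ y x : V q × V q, W (y + x) ≤ C * (jap x.1 ^ M * jap x.2 ^ M) * W y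

namespace Frame

variable {q : ℕ} {B : Type*} [NormedAddCommGroup B] [NormedSpace ℂ B] (Γ : Frame q B)

lemma C_pos : 0 < Γ.C := zero_lt_one.trans_le Γ.one_le_C

/-- The seminorm `b ↦ ‖Θ_η b‖`. -/
def nrm (η : V q) : Seminorm ℂ B := (normSeminorm ℂ B).comp (Γ.Θ η).toLinearMap

lemma nrm_apply (η : V q) (b : B) : Γ.nrm η b = ‖Γ.Θ η b‖ := rfl

lemma norm_le (η : V q) (b : B) : ‖b‖ ≤ Γ.C * jap η ^ Γ.M * ‖Γ.Θ η b‖ := by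
  simpa [Γ.Θ_zero] using Γ.Θ_le 0 η b

end Frame

section DoubleSymbols

variable {q : ℕ} {B : Type*} [NormedAddCommGroup B] [NormedSpace ℂ B]

/-- The double symbol estimates of order `m`, with constant `R`, for at most `K` derivatives. -/
def DBd (Γ : Frame q B) (ϱ δ : ℝ) (K : ℕ) (m R : ℝ) (a : V3 q → B) : Prop :=
  Bd dir3 (wt3 ϱ δ) (fun p => Γ.nrm p.2.2) K
    (fun p => R * (Γ.W (p.1, p.2.1) * jap p.2.2 ^ m)) a

/-- The double symbols of order `m`. -/
def DSym (Γ : Frame q B) (ϱ δ m : ℝ) (a : V3 q → B) : Prop :=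
  ContDiff ℝ ∞ a ∧ ∀ K, ∃ R, DBd Γ ϱ δ K m R a

variable {Γ : Frame q B} {ϱ δ m R : ℝ} {K : ℕ} {a : V3 q → B}

lemma DBd.base (h : DBd Γ ϱ δ K m R a) (p : V3 q) :
    ‖Γ.Θ p.2.2 (a p)‖ ≤ R * (Γ.W (p.1, p.2.1) * jap p.2.2 ^ m) := Bd.base h p

lemma Frame.weight_pos (Γ : Frame q B) (p : V3 q) (m : ℝ) :
    0 < Γ.W (p.1, p.2.1) * jap p.2.2 ^ m := mul_pos (Γ.W_pos _) (jap_rpow_pos _ _)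

lemma DBd.nonneg (h : DBd Γ ϱ δ K m R a) : 0 ≤ R := by
  have h1 := Bd.nonneg h 0
  exact nonneg_of_mul_nonneg_left h1 (Γ.weight_pos 0 m)

lemma DBd.le {K' : ℕ} (h : DBd Γ ϱ δ K m R a) (hK : K' ≤ K) : DBd Γ ϱ δ K' m R a := Bd.le h hK

lemma DBd.mono {m' R' : ℝ} (h : DBd Γ ϱ δ K m R a) (hm : m ≤ m') (hR : R ≤ R') :
    DBd Γ ϱ δ K m' R' a := by
  refine Bd.mono_right h (wt3_nonneg _ _) fun p => ?_
  exact mul_le_mul hR (mul_le_mul_of_nonneg_left (jap_rpow_mono _ hm) (Γ.W_pos _).le)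
    (Γ.weight_pos p m).le (h.nonneg.trans hR)

lemma DBd.add {R' : ℝ} {b : V3 q → B} (ha : ContDiff ℝ ∞ a) (hb : ContDiff ℝ ∞ b)
    (h : DBd Γ ϱ δ K m R a) (h' : DBd Γ ϱ δ K m R' b) :
    DBd Γ ϱ δ K m (R + R') (fun p => a p + b p) := by
  refine (Bd.add ha hb h h').mono_right (wt3_nonneg _ _) fun p => le_of_eq ?_
  ring

lemma DBd.const_smul (ha : ContDiff ℝ ∞ a) (h : DBd Γ ϱ δ K m R a) (c : ℂ) :
    DBd Γ ϱ δ K m (‖c‖ * R) (fun p => c • a p) := by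
  refine (Bd.const_smul ha h c).mono_right (wt3_nonneg _ _) fun p => le_of_eq ?_
  ring

lemma DBd.sum {κ : Type*} (t : Finset κ) {f : κ → V3 q → B} {R : κ → ℝ}
    (hf : ∀ j ∈ t, ContDiff ℝ ∞ (f j)) (h : ∀ j ∈ t, DBd Γ ϱ δ K m (R j) (f j)) :
    DBd Γ ϱ δ K m (∑ j ∈ t, R j) (fun p => ∑ j ∈ t, f j p) := by
  refine (Bd.sum t hf h).mono_right (wt3_nonneg _ _) fun p => le_of_eq ?_
  rw [Finset.sum_mul]

lemma DBd.dd (h : DBd Γ ϱ δ (K + 1) m R a) (i : Fin q ⊕ (Fin q ⊕ Fin q)) :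
    DBd Γ ϱ δ K (m + expo3 ϱ δ i) R (dd (dir3 i) a) := by
  refine (Bd.deriv h i).mono_right (wt3_nonneg _ _) fun p => le_of_eq ?_
  simp only [wt3]
  rw [Real.rpow_add (jap_pos _)]
  ring

lemma DBd.succ (h0 : ∀ p, ‖Γ.Θ p.2.2 (a p)‖ ≤ R * (Γ.W (p.1, p.2.1) * jap p.2.2 ^ m))
    (h1 : ∀ i, DBd Γ ϱ δ K (m + expo3 ϱ δ i) R (EdgePsiDO.dd (dir3 i) a)) :
    DBd Γ ϱ δ (K + 1) m R a := by
  refine bd_succ_iff.2 ⟨h0, fun i => (h1 i).mono_right (wt3_nonneg _ _) fun p => le_of_eq ?_⟩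
  simp only [wt3]
  rw [Real.rpow_add (jap_pos _)]
  ring

lemma DBd.succ_exists (h0 : ∃ R, ∀ p, ‖Γ.Θ p.2.2 (a p)‖ ≤ R * (Γ.W (p.1, p.2.1) * jap p.2.2 ^ m))
    (h1 : ∀ i, ∃ R, DBd Γ ϱ δ K (m + expo3 ϱ δ i) R (EdgePsiDO.dd (dir3 i) a)) :
    ∃ R, DBd Γ ϱ δ (K + 1) m R a := by
  obtain ⟨R₀, h0⟩ := h0
  choose R₁ h1 using h1
  have hn : ∀ i, 0 ≤ R₁ i := fun i => (h1 i).nonneg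
  refine ⟨|R₀| + ∑ i, R₁ i, DBd.succ (fun p => (h0 p).trans (mul_le_mul_of_nonneg_right ?_
    (Γ.weight_pos p m).le)) fun i => (h1 i).mono le_rfl ?_⟩
  · exact (le_abs_self _).trans (le_add_of_nonneg_right (Finset.sum_nonneg fun i _ => hn i))
  · exact (Finset.single_le_sum (fun i _ => hn i) (Finset.mem_univ i)).trans
      (le_add_of_nonneg_left (abs_nonneg _))

/-- Symbol estimates without gain and loss. -/
lemma DBd.flat (hϱ : 0 ≤ ϱ) (hδ : 0 ≤ δ) (h : DBd Γ ϱ δ K m R a) :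
    DBd Γ 0 0 K (m + δ * K) R a := by
  induction K generalizing m R a with
  | zero =>
    refine bd_zero_iff.2 fun p => ?_
    simpa using! (show Γ.nrm p.2.2 (a p) ≤ _ from h.base p)
  | succ K ih =>
    refine DBd.succ (fun p => (h.base p).trans (mul_le_mul_of_nonneg_left
      (mul_le_mul_of_nonneg_left (jap_rpow_mono _ ?_) (Γ.W_pos _).le) h.nonneg)) fun i => ?_
    · have : 0 ≤ δ * (K + 1 : ℕ) := by positivity
      linarith
    · refine (ih (h.dd i)).mono ?_ le_rfl
      rcases i with i | i | i <;> simp only [expo3, Sum.elim_inl, Sum.elim_inr] <;> push_cast <;>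
        linarith

lemma DSym.mono {m' : ℝ} (h : DSym Γ ϱ δ m a) (hm : m ≤ m') : DSym Γ ϱ δ m' a :=
  ⟨h.1, fun K => (h.2 K).imp fun _ hR => hR.mono hm le_rfl⟩

lemma DSym.const_smul (ha : DSym Γ ϱ δ m a) (c : ℂ) : DSym Γ ϱ δ m (fun p => c • a p) := by
  refine ⟨ha.1.const_smul c, fun K => ?_⟩
  obtain ⟨R, hR⟩ := ha.2 K
  exact ⟨_, hR.const_smul ha.1 c⟩

lemma DSym.sum {κ : Type*} (t : Finset κ) {f : κ → V3 q → B}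
    (hf : ∀ j ∈ t, DSym Γ ϱ δ m (f j)) : DSym Γ ϱ δ m (fun p => ∑ j ∈ t, f j p) := by
  refine ⟨ContDiff.sum fun j hj => (hf j hj).1, fun K => ?_⟩
  have : ∀ j, ∃ R, j ∈ t → DBd Γ ϱ δ K m R (f j) := fun j => by
    by_cases hj : j ∈ t
    · exact ((hf j hj).2 K).imp fun R hR _ => hR
    · exact ⟨0, fun h => absurd h hj⟩
  choose R hR using this
  exact ⟨_, DBd.sum t (fun j hj => (hf j hj).1) hR⟩

lemma DSym.dd (h : DSym Γ ϱ δ m a) (i : Fin q ⊕ (Fin q ⊕ Fin q)) :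
    DSym Γ ϱ δ (m + expo3 ϱ δ i) (EdgePsiDO.dd (dir3 i) a) :=
  ⟨contDiff_dd h.1 _, fun K => (h.2 (K + 1)).imp fun _ hR => hR.dd i⟩

/-- The action `(x, ξ) ↦ (w₁ x, w₂ x, w₃ ξ)`. -/
def act (w : ℝ × ℝ × ℝ) : V q × V q →L[ℝ] V3 q :=
  (w.1 • ContinuousLinearMap.fst ℝ (V q) (V q)).prod
    ((w.2.1 • ContinuousLinearMap.fst ℝ (V q) (V q)).prod
      (w.2.2 • ContinuousLinearMap.snd ℝ (V q) (V q)))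

@[simp] lemma act_apply (w : ℝ × ℝ × ℝ) (x : V q × V q) :
    act w x = (w.1 • x.1, w.2.1 • x.1, w.2.2 • x.2) := rfl

lemma jap_smul_rpow_le {c S s : ℝ} (hc : |c| ≤ S) (hs : 0 ≤ s) (x : V q) :
    jap (c • x) ^ s ≤ (1 + S) ^ s * jap x ^ s := by
  have hS : 0 ≤ S := (abs_nonneg c).trans hc
  rw [← Real.mul_rpow (by positivity) (jap_pos x).le]
  refine Real.rpow_le_rpow (jap_pos _).le ((jap_smul_le c x).trans ?_) hs
  exact mul_le_mul_of_nonneg_right (by linarith) (jap_pos x).le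

lemma jap_add_smul_rpow_le {c S : ℝ} (hc : |c| ≤ S) (s : ℝ) (η ξ : V q) :
    jap (η + c • ξ) ^ s ≤ (2 * (1 + S)) ^ |s| * jap ξ ^ |s| * jap η ^ s := by
  have hS : 0 ≤ S := (abs_nonneg c).trans hc
  refine (jap_rpow_add_le η (c • ξ) s).trans ?_
  refine mul_le_mul_of_nonneg_right ?_ (jap_rpow_pos _ _).le
  rw [Real.mul_rpow two_pos.le (jap_pos _).le, Real.mul_rpow two_pos.le (by positivity), mul_assoc]
  exact mul_le_mul_of_nonneg_left (jap_smul_rpow_le hc (abs_nonneg s) ξ) (by positivity)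

/-- The slices `x ↦ a(p + w x)` of a double symbol are amplitudes. -/
lemma DBd.slice (Γ : Frame q B) (hϱ : 0 ≤ ϱ) (hδ : 0 ≤ δ) {S : ℝ} (hS : 0 ≤ S) (K : ℕ) (m : ℝ) :
    ∃ C : ℝ, 0 ≤ C ∧ ∀ (a : V3 q → B) (R : ℝ), ContDiff ℝ ∞ a → DBd Γ ϱ δ K m R a →
      ∀ (w : ℝ × ℝ × ℝ) (p : V3 q), |w.1| ≤ S → |w.2.1| ≤ S → |w.2.2| ≤ S →
        AmpBd δ K (Γ.M + |m|) (Γ.M + Γ.M)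
          (C * jap p.2.2 ^ (δ * K) * (R * (Γ.W (p.1, p.2.1) * jap p.2.2 ^ m)))
          (fun x => Γ.Θ p.2.2 (a (p + act w x))) := by
  have hM := Γ.M_nonneg
  have hCp := Γ.C_pos
  -- An `x`-derivative becomes `w₁∂_y + w₂∂_{y'}`, of total weight at most `2S`; the other factor is
  -- Peetre's constant for `⟨η + w₃ξ⟩^δ`.
  set L : ℝ := (1 + 2 * S) * (2 * (1 + S)) ^ δ with hL
  have hL1 : 1 ≤ L := by
    have h1 : (1 : ℝ) ≤ (2 * (1 + S)) ^ δ := Real.one_le_rpow (by linarith) hδ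
    nlinarith
  refine ⟨L ^ K * (Γ.C * (1 + S) ^ Γ.M * (Γ.C * ((1 + S) ^ Γ.M * (1 + S) ^ Γ.M))
    * (2 * (1 + S)) ^ |m|), by positivity, fun a R ha h w p h1 h2 h3 => ?_⟩
  have hR := h.nonneg
  have hη := one_le_jap_rpow p.2.2 hδ
  have hηp := jap_rpow_pos p.2.2 δ
  have key := Bd.comp_affine (v' := dir2 (q := q)) (s' := wt2 0 δ) (N' := fun _ => Γ.nrm p.2.2) p
    (act w)
    (Sum.elim (fun i => Sum.elim (fun j => if i = j then w.1 else 0)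
        (Sum.elim (fun j => if i = j then w.2.1 else 0) (fun _ => 0)))
      (fun i => Sum.elim (fun _ => 0) (Sum.elim (fun _ => 0) (fun j => if i = j then w.2.2 else 0))))
    (by
      rintro (i | i)
      · simp [dir2, dir3, dirY, dirY3, dirYp3, ite_smul]
      · simp [dir2, dir3, dirEta, dirEta3, ite_smul])
    -- The factor `⟨η⟩^δ` per derivative is the loss in this estimate; it vanishes for `δ = 0`, the
    -- case used in `eop_bound`.
    (Λ := L * jap p.2.2 ^ δ) (by nlinarith) (wt2_nonneg _ _)
    (by
      have hj : ∀ x : V q × V q, jap (p.2.2 + w.2.2 • x.2) ^ δ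
          ≤ (2 * (1 + S)) ^ δ * jap x.2 ^ δ * jap p.2.2 ^ δ := fun x => by
        have := jap_add_smul_rpow_le h3 δ p.2.2 x.2
        rwa [abs_of_nonneg hδ] at this
      rintro (i | i) x
      · simp only [Sum.elim_inl, Fintype.sum_sum_type, Sum.elim_inr, abs_zero, zero_mul,
          Finset.sum_const_zero, add_zero, apply_ite abs, ite_mul, Finset.sum_ite_eq,
          Finset.mem_univ, if_true, wt3, wt2, expo3, Prod.snd_add, act_apply]
        have hx := jap_rpow_pos x.2 δ
        calc _ ≤ S * ((2 * (1 + S)) ^ δ * jap x.2 ^ δ * jap p.2.2 ^ δ)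
              + S * ((2 * (1 + S)) ^ δ * jap x.2 ^ δ * jap p.2.2 ^ δ) :=
              add_le_add (mul_le_mul h1 (hj x) (jap_rpow_pos _ _).le hS)
                (mul_le_mul h2 (hj x) (jap_rpow_pos _ _).le hS)
          _ ≤ (1 + 2 * S) * ((2 * (1 + S)) ^ δ * jap x.2 ^ δ * jap p.2.2 ^ δ) := by
              have : 0 ≤ (2 * (1 + S)) ^ δ * jap x.2 ^ δ * jap p.2.2 ^ δ := by positivity
              linarith
          _ = _ := by rw [hL]; ring
      · simp only [Sum.elim_inl, Fintype.sum_sum_type, Sum.elim_inr, abs_zero, zero_mul,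
          Finset.sum_const_zero, zero_add, apply_ite abs, ite_mul, Finset.sum_ite_eq,
          Finset.mem_univ, if_true, wt3, wt2, expo3, Prod.snd_add, act_apply, neg_zero,
          Real.rpow_zero, mul_one]
        have e1 : jap (p.2.2 + w.2.2 • x.2) ^ (-ϱ) ≤ 1 :=
          Real.rpow_le_one_of_one_le_of_nonpos (one_le_jap _) (by linarith)
        have e2 : |w.2.2| * jap (p.2.2 + w.2.2 • x.2) ^ (-ϱ) ≤ S * 1 :=
          mul_le_mul h3 e1 (jap_rpow_pos _ _).le hS
        have e3 : (1 : ℝ) ≤ (2 * (1 + S)) ^ δ := Real.one_le_rpow (by linarith) hδ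
        have e4 : 1 + 2 * S ≤ L := by rw [hL]; nlinarith
        nlinarith)
    (D := fun x => Γ.C * jap (w.2.2 • x.2) ^ Γ.M)
    (fun x => mul_nonneg hCp.le (jap_rpow_pos _ _).le)
    (fun x b => Γ.Θ_le p.2.2 (w.2.2 • x.2) b) ha h
  have key2 : Bd dir2 (wt2 0 δ) (fun _ => normSeminorm ℂ B) K _
      (fun x => Γ.Θ p.2.2 (a (p + act w x))) :=
    Bd.comp_clm (Γ.Θ p.2.2) (fun x b => (Γ.nrm_apply _ _).ge)
      (contDiff_comp_affine ha p (act w)) key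
  refine key2.mono_right (wt2_nonneg _ _) fun x => ?_
  have hW : Γ.W ((p + act w x).1, (p + act w x).2.1) ≤ Γ.C * (((1 + S) ^ Γ.M * jap x.1 ^ Γ.M) *
      ((1 + S) ^ Γ.M * jap x.1 ^ Γ.M)) * Γ.W (p.1, p.2.1) := by
    refine (Γ.W_le (p.1, p.2.1) (w.1 • x.1, w.2.1 • x.1)).trans ?_
    refine mul_le_mul_of_nonneg_right (mul_le_mul_of_nonneg_left ?_ hCp.le) (Γ.W_pos _).le
    exact mul_le_mul (jap_smul_rpow_le h1 hM x.1) (jap_smul_rpow_le h2 hM x.1)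
      (jap_rpow_pos _ _).le (mul_nonneg (by positivity) (jap_rpow_pos _ _).le)
  have hm : jap (p + act w x).2.2 ^ m
      ≤ (2 * (1 + S)) ^ |m| * jap x.2 ^ |m| * jap p.2.2 ^ m := jap_add_smul_rpow_le h3 m _ _
  have hD := jap_smul_rpow_le h3 hM x.2
  have p1 := jap_rpow_pos x.1 Γ.M
  have p2 := jap_rpow_pos x.2 Γ.M
  have p3 := jap_rpow_pos x.2 |m|
  have p4 := jap_rpow_pos p.2.2 m
  have p5 := Γ.W_pos (p.1, p.2.1)
  calc (L * jap p.2.2 ^ δ) ^ K * (Γ.C * jap (w.2.2 • x.2) ^ Γ.M *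
        (R * (Γ.W ((p + act w x).1, (p + act w x).2.1) * jap (p + act w x).2.2 ^ m)))
      ≤ (L * jap p.2.2 ^ δ) ^ K * (Γ.C * ((1 + S) ^ Γ.M * jap x.2 ^ Γ.M) *
        (R * ((Γ.C * (((1 + S) ^ Γ.M * jap x.1 ^ Γ.M) *
      ((1 + S) ^ Γ.M * jap x.1 ^ Γ.M)) * Γ.W (p.1, p.2.1)) *
        ((2 * (1 + S)) ^ |m| * jap x.2 ^ |m| * jap p.2.2 ^ m)))) := by
        have q1 := (jap_rpow_pos (p + act w x).2.2 m).le
        have q2 := (Γ.W_pos ((p + act w x).1, (p + act w x).2.1)).le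
        gcongr
    _ = _ := by
        rw [mul_pow, Real.rpow_add (jap_pos _), Real.rpow_add (jap_pos _), Real.rpow_mul (jap_pos _).le,
          Real.rpow_natCast]
        ring

/-- A constant operator commutes with differentiation, so an operator bounded from below may be
removed from all derivatives at once. -/
lemma AmpBd.of_clm {k D : ℝ} {f : V q × V q → B} (hf : ContDiff ℝ ∞ f) {T : B →L[ℂ] B}
    (hT : ∀ b, ‖b‖ ≤ D * ‖T b‖) (hD : 0 ≤ D) (h : AmpBd δ K m k R (fun x => T (f x))) :
    AmpBd δ K m k (D * R) f := by
  intro l hl x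
  have h1 := h l hl x
  rw [dl_comp_clm hf] at h1
  refine (hT _).trans ((mul_le_mul_of_nonneg_left h1 hD).trans (le_of_eq ?_))
  ring

end DoubleSymbols

/-! ### The operators `E_w` -/

section EOperator

variable {q : ℕ} {B : Type*} [NormedAddCommGroup B] [NormedSpace ℂ B]

/-- The coordinate functionals dual to `dir3`. -/
def coord3 : Fin q ⊕ (Fin q ⊕ Fin q) → V3 q →L[ℝ] ℝ :=
  Sum.elim (fun j => (EuclideanSpace.proj j).comp (ContinuousLinearMap.fst ℝ _ _))
    (Sum.elim (fun j => (EuclideanSpace.proj j).comp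
        ((ContinuousLinearMap.fst ℝ _ _).comp (ContinuousLinearMap.snd ℝ _ _)))
      fun j => (EuclideanSpace.proj j).comp
        ((ContinuousLinearMap.snd ℝ _ _).comp (ContinuousLinearMap.snd ℝ _ _)))

lemma sum_stdv (v : V q) : ∑ j, v j • stdv j = v := by
  ext i
  simp [stdv, Finset.sum_apply, Pi.single_apply]

lemma sum_coord3 (v : V3 q) : ∑ i, coord3 i v • dir3 i = v := by
  simp only [Fintype.sum_sum_type, coord3, dir3, Sum.elim_inl, Sum.elim_inr]
  refine Prod.ext ?_ (Prod.ext ?_ ?_)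
  · simpa [Prod.fst_sum, dirY3, dirYp3, dirEta3] using sum_stdv v.1
  · simpa [Prod.fst_sum, Prod.snd_sum, dirY3, dirYp3, dirEta3] using sum_stdv v.2.1
  · simpa [Prod.fst_sum, Prod.snd_sum, dirY3, dirYp3, dirEta3] using sum_stdv v.2.2

lemma dd_eq_sum (v : V3 q) (a : V3 q → B) :
    dd v a = fun p => ∑ i, (coord3 i v : ℂ) • dd (dir3 i) a p := by
  conv_lhs => rw [← sum_coord3 v, dd_sum_dir]
  funext p
  refine Finset.sum_congr rfl fun i _ => ?_
  rw [dd_smul_dir, Complex.coe_smul]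

/-- A directional derivative only sees the restriction to a line. This replaces the chain rule for
expressions such as `p + act w x`, which are not affine in all variables jointly. -/
lemma dd_eq_of_line {X Y C : Type*} [NormedAddCommGroup X] [NormedSpace ℝ X]
    [NormedAddCommGroup Y] [NormedSpace ℝ Y] [NormedAddCommGroup C] [NormedSpace ℂ C]
    {f : X → C} {g : Y → C} (hf : ContDiff ℝ ∞ f) (hg : ContDiff ℝ ∞ g) {x h : X} {y v : Y}
    (e : ∀ t : ℝ, f (x + t • h) = g (y + t • v)) : dd h f x = dd v g y := by
  have key : ∀ {Z : Type _} [NormedAddCommGroup Z] [NormedSpace ℝ Z] {k : Z → C},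
      ContDiff ℝ ∞ k → ∀ z u : Z, HasDerivAt (fun t : ℝ => k (z + t • u)) (dd u k z) 0 := by
    intro Z _ _ k hk z u
    have h1 : HasDerivAt (fun t : ℝ => z + t • u) u 0 := by
      simpa using ((hasDerivAt_id (0 : ℝ)).smul_const u).const_add z
    have h2 : HasFDerivAt k (fderiv ℝ k z) (z + (0 : ℝ) • u) := by
      simpa using (smooth_diff hk z).hasFDerivAt
    exact h2.comp_hasDerivAt (0 : ℝ) h1
  have key' : ∀ {Z : Type _} [NormedAddCommGroup Z] [NormedSpace ℝ Z] {k : Z → C},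
      ContDiff ℝ ∞ k → ∀ z u : Z, HasDerivAt (fun t : ℝ => k (z + t • u)) (dd u k z) 0 := by
    intro Z _ _ k hk z u
    have h1 : HasDerivAt (fun t : ℝ => z + t • u) u 0 := by
      simpa using ((hasDerivAt_id (0 : ℝ)).smul_const u).const_add z
    have h2 : HasFDerivAt k (fderiv ℝ k z) (z + (0 : ℝ) • u) := by
      simpa using (smooth_diff hk z).hasFDerivAt
    exact h2.comp_hasDerivAt (0 : ℝ) h1
  have h1 := key hf x h
  simp only [e] at h1
  exact h1.unique (key' hg y v)

variable {Γ : Frame q B} {ϱ δ m R : ℝ} {K : ℕ} {a : V3 q → B}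

lemma DSym.dd_dir (hϱ : 0 ≤ ϱ) (hδ : 0 ≤ δ) (ha : DSym Γ ϱ δ m a) (v : V3 q) :
    DSym Γ ϱ δ (m + δ) (EdgePsiDO.dd v a) := by
  rw [dd_eq_sum]
  refine DSym.sum _ fun i _ => ((ha.dd i).mono ?_).const_smul _
  rcases i with i | i | i <;> simp [expo3]
  linarith

lemma contDiff_act_slice {a : V3 q → B} (ha : ContDiff ℝ ∞ a) :
    ContDiff ℝ ∞ (fun z : ((ℝ × ℝ × ℝ) × V3 q) × (V q × V q) => a (z.1.2 + act z.1.1 z.2)) := by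
  refine ha.comp ?_
  simp only [act_apply]
  fun_prop

lemma jap_rpow_le_of_norm_le {x : V q} {S : ℝ} (h : ‖x‖ ≤ S) (s : ℝ) :
    jap x ^ s ≤ (1 + S) ^ |s| :=
  (jap_rpow_mono x (le_abs_self s)).trans
    (Real.rpow_le_rpow (jap_pos x).le ((jap_le x).trans (by linarith)) (abs_nonneg s))

/-- When `(w, p)` stays bounded, all powers of `⟨η⟩` and all values of the weight are bounded, and
the twist can be removed at bounded cost, so `DBd.slice` becomes locally uniform. -/
lemma DSym.locAmp (hϱ : 0 ≤ ϱ) (hδ : 0 ≤ δ) (ha : DSym Γ ϱ δ m a) :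
    LocAmp δ (fun z : ((ℝ × ℝ × ℝ) × V3 q) × (V q × V q) => a (z.1.2 + act z.1.1 z.2)) := by
  refine ⟨contDiff_act_slice ha.1, Γ.M + |m|, Γ.M + Γ.M, fun K z₀ => ?_⟩
  set S := ‖z₀‖ + 1 with hS
  have hS0 : 0 ≤ S := by positivity
  obtain ⟨C, hC0, hC⟩ := DBd.slice Γ hϱ hδ hS0 K m
  obtain ⟨R, hR⟩ := ha.2 K
  have hR0 := hR.nonneg
  have hCp := Γ.C_pos
  have hW0 := Γ.W_pos 0
  refine ⟨(Γ.C * (1 + S) ^ |Γ.M|) * (C * (1 + S) ^ |δ * K| *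
    (R * ((Γ.C * ((1 + S) ^ |Γ.M| * (1 + S) ^ |Γ.M|) * Γ.W 0) * (1 + S) ^ |m|))), fun z hz => ?_⟩
  have hzS : ‖z‖ ≤ S := by
    have := norm_le_norm_add_norm_sub' z z₀
    linarith
  obtain ⟨⟨w1, w2, w3⟩, y, y', η⟩ := z
  simp only [Prod.norm_def, sup_le_iff, Real.norm_eq_abs] at hzS
  obtain ⟨⟨h1, h2, h3⟩, h4, h5, h6⟩ := hzS
  have sl := hC a R ha.1 hR (w1, w2, w3) (y, y', η) h1 h2 h3
  have sm : ContDiff ℝ ∞ (fun x : V q × V q => a ((y, y', η) + act (w1, w2, w3) x)) :=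
    contDiff_comp_affine ha.1 _ _
  refine (AmpBd.of_clm sm (Γ.norm_le η) (mul_nonneg hCp.le (jap_rpow_pos _ _).le) sl).mono
    le_rfl le_rfl ?_
  have hW : Γ.W (y, y') ≤ Γ.C * ((1 + S) ^ |Γ.M| * (1 + S) ^ |Γ.M|) * Γ.W 0 := by
    have h := Γ.W_le 0 (y, y')
    rw [zero_add] at h
    refine h.trans (mul_le_mul_of_nonneg_right (mul_le_mul_of_nonneg_left ?_ hCp.le) hW0.le)
    exact mul_le_mul (jap_rpow_le_of_norm_le h4 _) (jap_rpow_le_of_norm_le h5 _)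
      (jap_rpow_pos _ _).le (by positivity)
  have b1 := jap_rpow_le_of_norm_le h6 Γ.M
  have b2 := jap_rpow_le_of_norm_le h6 (δ * K)
  have b3 := jap_rpow_le_of_norm_le h6 m
  have c1 := (jap_rpow_pos η Γ.M).le
  have c2 := (jap_rpow_pos η (δ * K)).le
  have c3 := (jap_rpow_pos η m).le
  have c4 := (Γ.W_pos (y, y')).le
  dsimp only
  gcongr

lemma isAmp_const (c : B) : IsAmp δ (fun _ : V q × V q => c) :=
  ⟨contDiff_const, 0, 0, fun _ => ⟨_, AmpBd.const c⟩⟩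

/-- Moving `(w, p)` with velocity `h` moves the argument of `a` with velocity `h.2 + act h.1 x`. The
derivative is therefore a combination of coordinate derivatives of `a` with coefficients affine in
`x`; the symbols of all orders together are stable under this. -/
lemma DSym.parAmp (hϱ : 0 ≤ ϱ) (hδ : 0 ≤ δ) (ha : DSym Γ ϱ δ m a) :
    ParAmp δ (fun z : ((ℝ × ℝ × ℝ) × V3 q) × (V q × V q) => a (z.1.2 + act z.1.1 z.2)) := by
  refine parAmp_of_family (𝒜 := {a : V3 q → B // ∃ m, DSym Γ ϱ δ m a})
    (fun a (z : ((ℝ × ℝ × ℝ) × V3 q) × (V q × V q)) => a.1 (z.1.2 + act z.1.1 z.2))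
    (fun i a => ⟨EdgePsiDO.dd (dir3 i) a.1, by obtain ⟨m, h⟩ := a.2; exact ⟨_, h.dd i⟩⟩)
    (fun i (h : (ℝ × ℝ × ℝ) × V3 q) x => (coord3 i (h.2 + act h.1 x) : ℝ)) ?_ ?_ ?_ ⟨a, m, ha⟩
  · rintro ⟨a, m, h⟩
    exact h.locAmp hϱ hδ
  · intro i h
    have := (isAmp_const (q := q) (δ := δ) ((coord3 i h.2 : ℝ) : ℂ)).add
      ((isAmp_const (q := q) (δ := δ) (1 : ℂ)).linear_smul hδ
        (Complex.ofRealCLM.comp ((coord3 i).comp (act h.1))))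
    simpa using this
  · rintro ⟨a, m, ha⟩ h z
    have := dd_eq_of_line (contDiff_act_slice ha.1) ha.1 (x := z)
      (h := ((h, 0) : ((ℝ × ℝ × ℝ) × V3 q) × (V q × V q))) (y := z.1.2 + act z.1.1 z.2)
      (v := h.2 + act h.1 z.2) fun t => by
        congr 1
        simp only [act_apply, Prod.fst_add, Prod.snd_add, Prod.smul_fst, Prod.smul_snd, smul_zero,
          add_zero]
        ext i <;> simp <;> ring
    rw [this, dd_eq_sum]

lemma DSym.isAmp (hϱ : 0 ≤ ϱ) (hδ : 0 ≤ δ) (ha : DSym Γ ϱ δ m a) (w : ℝ × ℝ × ℝ) (p : V3 q) :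
    IsAmp δ (fun x => a (p + act w x)) := (ha.locAmp hϱ hδ).isAmp (w, p)

/-- `(E_w a)(y, y', η) = (2π)^{-q} ∬ e^{-ixξ} a(y + w₁ x, y' + w₂ x, η + w₃ ξ) dx dξ`. -/
def eop (w : ℝ × ℝ × ℝ) (a : V3 q → B) (p : V3 q) : B :=
  ((((2 * Real.pi) ^ q)⁻¹ : ℝ) : ℂ) • osc (fun x => a (p + act w x))

lemma contDiff_slice_of_joint {X Y : Type*} [NormedAddCommGroup X] [NormedSpace ℝ X]
    [NormedAddCommGroup Y] [NormedSpace ℝ Y] {f : X × Y → B} (hf : ContDiff ℝ ∞ f) (x : X) :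
    ContDiff ℝ ∞ (fun y => f (x, y)) := hf.comp (contDiff_const.prodMk contDiff_id)

section

variable (hϱ : 0 ≤ ϱ) (hδ : 0 ≤ δ) (hδ1 : δ < 1)
include hϱ hδ hδ1

lemma DSym.contDiff_eop_joint (ha : DSym Γ ϱ δ m a) :
    ContDiff ℝ ∞ (fun z : (ℝ × ℝ × ℝ) × V3 q => eop z.1 a z.2) :=
  ((ha.parAmp hϱ hδ).contDiff_osc hδ hδ1).const_smul _

lemma DSym.contDiff_eop (ha : DSym Γ ϱ δ m a) (w : ℝ × ℝ × ℝ) : ContDiff ℝ ∞ (eop w a) := by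
  have h := contDiff_slice_of_joint (ha.contDiff_eop_joint hϱ hδ hδ1) w
  exact h

lemma DSym.dd_eop_joint (ha : DSym Γ ϱ δ m a) (h z : (ℝ × ℝ × ℝ) × V3 q) :
    EdgePsiDO.dd h (fun z : (ℝ × ℝ × ℝ) × V3 q => eop z.1 a z.2) z
      = ((((2 * Real.pi) ^ q)⁻¹ : ℝ) : ℂ) •
        osc (fun x => EdgePsiDO.dd (h.2 + act h.1 x) a (z.2 + act z.1 x)) := by
  have hp := ha.parAmp hϱ hδ
  have := dd_const_smul (hp.contDiff_osc hδ hδ1) ((((2 * Real.pi) ^ q)⁻¹ : ℝ) : ℂ) h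
  refine (congrFun this z).trans ?_
  rw [hp.dd_osc hδ hδ1]
  refine congrArg _ (congrArg osc (funext fun x => ?_))
  exact dd_eq_of_line (contDiff_act_slice ha.1) ha.1 fun t => by
        congr 1
        simp only [act_apply, Prod.fst_add, Prod.snd_add, Prod.smul_fst, Prod.smul_snd, smul_zero,
          add_zero]
        ext i <;> simp <;> ring

/-- `E_w` commutes with derivatives. -/
lemma DSym.dd_eop (ha : DSym Γ ϱ δ m a) (w : ℝ × ℝ × ℝ) (v : V3 q) :
    EdgePsiDO.dd v (eop w a) = eop w (EdgePsiDO.dd v a) := by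
  funext p
  have h1 := dd_eq_of_line (ha.contDiff_eop hϱ hδ hδ1 w) (ha.contDiff_eop_joint hϱ hδ hδ1)
    (x := p) (h := v) (y := (w, p)) (v := (0, v)) fun t => by simp
  rw [h1, ha.dd_eop_joint hϱ hδ hδ1]
  simp only [eop]
  refine congrArg _ (congrArg osc (funext fun x => ?_))
  have e : act (0 : ℝ × ℝ × ℝ) x = 0 := by simp
  rw [e, add_zero]

lemma DSym.osc_coX (ha : DSym Γ ϱ δ m a) (w : ℝ × ℝ × ℝ) (p : V3 q) (j : Fin q) :
    osc (fun x => coX j x • a (p + act w x))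
      = (-Complex.I) • osc (fun x => EdgePsiDO.dd (act w (dirEta j)) a (p + act w x)) := by
  rw [EdgePsiDO.osc_coX hδ hδ1 (ha.isAmp hϱ hδ w p), dd_comp_affine ha.1]

lemma DSym.osc_coXi (ha : DSym Γ ϱ δ m a) (w : ℝ × ℝ × ℝ) (p : V3 q) (j : Fin q) :
    osc (fun x => coXi j x • a (p + act w x))
      = (-Complex.I) • osc (fun x => EdgePsiDO.dd (act w (dirY j)) a (p + act w x)) := by
  rw [EdgePsiDO.osc_coXi hδ hδ1 (ha.isAmp hϱ hδ w p), dd_comp_affine ha.1]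

end

lemma sum_dir2 (x : V q × V q) : ∑ j, x.1 j • dirY j + ∑ j, x.2 j • dirEta j = x := by
  refine Prod.ext ?_ ?_
  · simpa [Prod.fst_sum, dirY, dirEta] using sum_stdv x.1
  · simpa [Prod.snd_sum, dirY, dirEta] using sum_stdv x.2

lemma dd_act (v : ℝ × ℝ × ℝ) (a : V3 q → B) (x : V q × V q) (p : V3 q) :
    dd (act v x) a p = ∑ j, (coX j x • dd (act v (dirY j)) a p
      + coXi j x • dd (act v (dirEta j)) a p) := by
  conv_lhs => rw [← sum_dir2 x, map_add, map_sum, map_sum, dd_add_dir, dd_sum_dir, dd_sum_dir]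
  simp only [map_smul, dd_smul_dir, Finset.sum_add_distrib, coX_apply, coXi_apply, Complex.coe_smul]

/-- The derivative of `E_w a` in `w`. -/
lemma DSym.dd_eop_fst (hϱ : 0 ≤ ϱ) (hδ : 0 ≤ δ) (hδ1 : δ < 1) (ha : DSym Γ ϱ δ m a)
    (v w : ℝ × ℝ × ℝ) (p : V3 q) :
    EdgePsiDO.dd (v, 0) (fun z : (ℝ × ℝ × ℝ) × V3 q => eop z.1 a z.2) (w, p)
      = (-Complex.I) • ∑ j,
        (eop w (EdgePsiDO.dd (act w (dirEta j)) (EdgePsiDO.dd (act v (dirY j)) a)) p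
        + eop w (EdgePsiDO.dd (act w (dirY j)) (EdgePsiDO.dd (act v (dirEta j)) a)) p) := by
  rw [ha.dd_eop_joint hϱ hδ hδ1]
  have hd := fun u => ha.dd_dir hϱ hδ u
  have hi := fun u => (hd u).isAmp hϱ hδ w p
  have i1 : ∀ j, IsAmp δ (fun x => coX j x • EdgePsiDO.dd (act v (dirY j)) a (p + act w x)) :=
    fun j => (hi _).linear_smul hδ _
  have i2 : ∀ j, IsAmp δ (fun x => coXi j x • EdgePsiDO.dd (act v (dirEta j)) a (p + act w x)) :=
    fun j => (hi _).linear_smul hδ _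
  -- The velocity `act v x` is linear in `(x, ξ)`. Its coordinates are then removed by integration
  -- by parts: `x_j` becomes `-i∂_{ξ_j}` and `ξ_j` becomes `-i∂_{x_j}` of the slice.
  have e : (fun x => EdgePsiDO.dd ((0 : V3 q) + act v x) a (p + act w x)) = fun x =>
      ∑ j, (coX j x • EdgePsiDO.dd (act v (dirY j)) a (p + act w x)
        + coXi j x • EdgePsiDO.dd (act v (dirEta j)) a (p + act w x)) := by
    funext x
    rw [zero_add, dd_act]
  rw [e, osc_sum hδ hδ1 _ fun j _ => (i1 j).add (i2 j), Finset.smul_sum, Finset.smul_sum]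
  refine Finset.sum_congr rfl fun j _ => ?_
  rw [osc_add hδ hδ1 (i1 j) (i2 j), (hd _).osc_coX hϱ hδ hδ1, (hd _).osc_coXi hϱ hδ hδ1]
  simp only [eop, smul_add, smul_smul]
  simp only [mul_comm]

end EOperator

/-! ### Normalization of the oscillatory integral -/

section Normalization

variable {q : ℕ} {B : Type*} [NormedAddCommGroup B] [NormedSpace ℂ B]

lemma schwartz_jap_le (n : ℕ) (g : 𝓢(V q, B)) (x : V q) :
    ‖g x‖ ≤ (2 ^ n * ((Finset.Iic (n, 0)).sup (schwartzSeminormFamily ℂ (V q) B)) g)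
      * jap x ^ (-(n : ℝ)) := by
  have h := SchwartzMap.one_add_le_sup_seminorm_apply (𝕜 := ℂ) (m := (n, 0)) (k := n) (n := 0)
    le_rfl le_rfl g x
  rw [norm_iteratedFDeriv_zero] at h
  rw [Real.rpow_neg (jap_pos x).le, Real.rpow_natCast, ← div_eq_mul_inv,
    le_div_iff₀ (pow_pos (jap_pos x) n), mul_comm]
  exact (mul_le_mul_of_nonneg_right (pow_le_pow_left₀ (jap_pos x).le (jap_le x) n)
    (norm_nonneg _)).trans h

lemma schwartz_jap_rpow_le (k : ℝ) (g : 𝓢(V q, B)) : ∃ R, ∀ x, ‖g x‖ ≤ R * jap x ^ k := by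
  obtain ⟨n, hn⟩ := exists_nat_ge (-k)
  refine ⟨_, fun x => (schwartz_jap_le n g x).trans (mul_le_mul_of_nonneg_left
    (jap_rpow_mono x (by linarith)) ?_)⟩
  exact mul_nonneg (by positivity) (apply_nonneg _ _)

lemma schwartz_fst_ampBd {δ m : ℝ} (hδ : 0 ≤ δ) (hm : 0 ≤ m) (K : ℕ) (k : ℝ) (g : 𝓢(V q, B)) :
    ∃ R, AmpBd δ K m k R (fun p => g p.1) := by
  have base : ∀ (m : ℝ), 0 ≤ m → ∀ (g : 𝓢(V q, B)),
      ∃ R, ∀ p : V q × V q, ‖g p.1‖ ≤ R * (jap p.1 ^ k * jap p.2 ^ m) := by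
    intro m hm g
    obtain ⟨R, hR⟩ := schwartz_jap_rpow_le k g
    have hR0 : 0 ≤ R := by simpa using (norm_nonneg _).trans (hR 0)
    refine ⟨R, fun p => (hR p.1).trans (mul_le_mul_of_nonneg_left ?_ hR0)⟩
    exact le_mul_of_one_le_right (jap_rpow_pos _ _).le (one_le_jap_rpow _ hm)
  induction K generalizing g m with
  | zero =>
    obtain ⟨R, hR⟩ := base m hm g
    exact ⟨R, bd_zero_iff.2 hR⟩
  | succ K ih =>
    have hd : ∀ v : V q × V q, dd v (fun p : V q × V q => g p.1) = fun p => dd v.1 g p.1 := by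
      intro v
      have := dd_comp_affine (g.smooth ⊤) 0 (ContinuousLinearMap.fst ℝ (V q) (V q)) v
      simpa using this
    refine AmpBd.succ_exists (base m hm g) (fun j => ?_) fun j => ?_
    · obtain ⟨g', hg'⟩ := exists_schwartz_dd g (stdv j)
      rw [hd, show (dirY j : V q × V q).1 = stdv j from rfl, ← hg']
      exact ih (by linarith) g'
    · obtain ⟨g', hg'⟩ := exists_schwartz_dd g 0
      rw [hd, show (dirEta j : V q × V q).1 = 0 from rfl, ← hg']
      exact ih hm g'

/-- The trivial twist and the trivial weight. -/
def Frame.triv (q : ℕ) (B : Type*) [NormedAddCommGroup B] [NormedSpace ℂ B] : Frame q B where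
  Θ _ := ContinuousLinearMap.id ℂ B
  W _ := 1
  C := 1
  M := 0
  one_le_C := le_rfl
  M_nonneg := le_rfl
  Θ_zero := rfl
  Θ_le η ξ b := by simp
  W_pos _ := one_pos
  W_le y x := by simp

lemma dd_comp_mid {g : V q → B} (hg : ContDiff ℝ ∞ g) (v : V3 q) :
    dd v (fun p : V3 q => g p.2.1) = fun p => dd v.2.1 g p.2.1 := by
  have := dd_comp_affine hg 0 ((ContinuousLinearMap.fst ℝ (V q) (V q)).comp
    (ContinuousLinearMap.snd ℝ (V q) (V q × V q))) v
  simpa using this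

lemma dSym_schwartz_mid {δ : ℝ} (hδ : 0 ≤ δ) (g : 𝓢(V q, B)) :
    DSym (Frame.triv q B) 0 δ 0 (fun p => g p.2.1) := by
  refine ⟨(g.smooth ⊤).comp (by fun_prop), fun K => ?_⟩
  suffices h : ∀ m, 0 ≤ m → ∃ R, DBd (Frame.triv q B) 0 δ K m R (fun p => g p.2.1) from h 0 le_rfl
  intro m hm
  have base : ∀ (m : ℝ), 0 ≤ m → ∀ g : 𝓢(V q, B), ∃ R, ∀ p : V3 q,
      ‖(Frame.triv q B).Θ p.2.2 (g p.2.1)‖ ≤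
        R * ((Frame.triv q B).W (p.1, p.2.1) * jap p.2.2 ^ m) := by
    intro m hm g
    obtain ⟨R, hR⟩ := schwartz_jap_rpow_le 0 g
    simp only [Real.rpow_zero, mul_one] at hR
    refine ⟨R, fun p => ?_⟩
    simp only [Frame.triv, ContinuousLinearMap.id_apply, one_mul]
    exact (hR _).trans (le_mul_of_one_le_right ((norm_nonneg _).trans (hR 0))
      (one_le_jap_rpow _ hm))
  induction K generalizing g m with
  | zero =>
    obtain ⟨R, hR⟩ := base m hm g
    exact ⟨R, bd_zero_iff.2 hR⟩
  | succ K ih =>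
    refine DBd.succ_exists (base m hm g) fun i => ?_
    obtain ⟨g', hg'⟩ := exists_schwartz_dd g (dir3 i).2.1
    rw [dd_comp_mid (g.smooth ⊤), ← hg']
    refine ih g' _ ?_
    rcases i with i | i | i <;> simp [expo3] <;> linarith

/-- Fourier inversion at the origin. -/
lemma fourier_inversion_zero (g : 𝓢(V q, ℂ)) :
    ∫ ξ, ∫ x, ph (x, ξ) • g x = ((2 * Real.pi) ^ q : ℝ) • g 0 := by
  have h1 : ∀ ξ : V q, ∫ x, ph (x, ξ) • g x = FourierTransform.fourier (⇑g) ((2 * Real.pi)⁻¹ • ξ) := by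
    intro ξ
    rw [Real.fourier_eq']
    refine integral_congr_ae (Eventually.of_forall fun x => ?_)
    simp only [ph]
    congr 2
    rw [inner_smul_right]
    have : Real.pi ≠ 0 := Real.pi_ne_zero
    push_cast
    field_simp
  simp only [h1]
  rw [Measure.integral_comp_smul volume (fun ξ => FourierTransform.fourier (⇑g) ξ)]
  have h2 : ∫ ξ, FourierTransform.fourier (⇑g) ξ = g 0 := by
    have h3 := congrFun (Continuous.fourierInv_fourier_eq (V := V q) g.continuous g.integrable
      ((FourierTransform.fourier g).integrable)) 0
    rw [Real.fourierInv_eq'] at h3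
    simpa using h3
  rw [h2]
  congr 1
  rw [abs_of_pos (by positivity), inv_pow, inv_inv]
  simp

section

variable {Γ : Frame q B} {ϱ δ m : ℝ} {a : V3 q → B}

lemma eop_zero (w : ℝ × ℝ × ℝ) (p : V3 q) : eop w (fun _ => (0 : B)) p = 0 := by
  simp [eop, osc_zero]

lemma hasDerivAt_eop_line (hϱ : 0 ≤ ϱ) (hδ : 0 ≤ δ) (hδ1 : δ < 1) (ha : DSym Γ ϱ δ m a)
    (w v : ℝ × ℝ × ℝ) (p : V3 q) (t : ℝ) :
    HasDerivAt (fun t : ℝ => eop (w + t • v) a p) ((-Complex.I) • ∑ j,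
      (eop (w + t • v) (dd (act (w + t • v) (dirEta j)) (dd (act v (dirY j)) a)) p
        + eop (w + t • v) (dd (act (w + t • v) (dirY j)) (dd (act v (dirEta j)) a)) p)) t := by
  rw [← ha.dd_eop_fst hϱ hδ hδ1]
  have h1 : HasDerivAt (fun t : ℝ => (w + t • v, p)) (v, (0 : V3 q)) t := by
    have := ((hasDerivAt_id t).smul_const v).const_add w
    simp only [one_smul] at this
    exact this.prodMk (hasDerivAt_const t p)
  exact (smooth_diff (ha.contDiff_eop_joint hϱ hδ hδ1) (w + t • v, p)).hasFDerivAt.comp_hasDerivAt t h1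

lemma eq_of_deriv_zero {f : ℝ → B} (h : ∀ t, HasDerivAt f 0 t) (s t : ℝ) : f s = f t :=
  is_const_of_deriv_eq_zero (fun t => (h t).differentiableAt) (fun t => (h t).deriv) s t

lemma dd_zero_dir {X : Type*} [NormedAddCommGroup X] [NormedSpace ℝ X] (f : X → B) :
    dd 0 f = fun _ => 0 := by
  funext x; simp [dd]

end

/-- For a Schwartz function `g` with `g(0) = 1`, the oscillatory integral of `g(sx)` does not depend
on `s`, because `g` does not involve `η` and every term of the derivative formula contains an
`η`-derivative. At `s = 1` it is evaluated by Fourier inversion; at `s = 0` the amplitude is the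
constant `1`. -/
lemma osc_one : osc (fun _ : V q × V q => (1 : ℂ)) = ((2 * Real.pi) ^ q : ℝ) := by
  have hδ1 : (0 : ℝ) < 1 := one_pos
  obtain ⟨g, hg⟩ := exists_schwartz_one (V q)
  have ha := dSym_schwartz_mid le_rfl g
  have hc : eop (0, (1 : ℝ), (1 : ℝ)) (fun p : V3 q => g p.2.1) 0
      = eop (0, (0 : ℝ), (1 : ℝ)) (fun p : V3 q => g p.2.1) 0 := by
    have h : ∀ t : ℝ, HasDerivAt (fun t : ℝ => eop (((0 : ℝ), (0 : ℝ), (1 : ℝ)) + t • (0, 1, 0))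
        (fun p : V3 q => g p.2.1) 0) 0 t := by
      intro t
      refine (hasDerivAt_eop_line le_rfl le_rfl hδ1 ha _ _ _ _).congr_deriv ?_
      have e1 : ∀ j, act (((0 : ℝ), (0 : ℝ), (1 : ℝ)) + t • (0, 1, 0)) (dirEta j : V q × V q)
          = (0, 0, stdv j) := fun j => by simp [dirEta]
      have e2 : ∀ j, act ((0 : ℝ), (1 : ℝ), (0 : ℝ)) (dirY j : V q × V q) = (0, stdv j, 0) :=
        fun j => by simp [dirY]
      have e3 : ∀ j, act ((0 : ℝ), (1 : ℝ), (0 : ℝ)) (dirEta j : V q × V q) = 0 :=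
        fun j => by simp [dirEta]
      have e4 : ∀ j : Fin q, dd ((0, 0, stdv j) : V3 q) (dd ((0, stdv j, 0) : V3 q)
          (fun p : V3 q => g p.2.1)) = fun _ => 0 := fun j => by
        rw [dd_comp_mid (g.smooth ⊤), dd_comp_mid (contDiff_dd (g.smooth ⊤) _)]
        funext p
        simp [dd_zero_dir]
      simp only [e1, e2, e3, e4, dd_zero_dir, dd_zero, eop_zero]
      simp
    have := eq_of_deriv_zero h 1 0
    simpa using this
  simp only [eop] at hc
  have hne : ((((2 * Real.pi) ^ q)⁻¹ : ℝ) : ℂ) ≠ 0 := by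
    rw [Complex.ofReal_ne_zero]; positivity
  have h1 := smul_right_injective ℂ hne hc
  simp only [act_apply, zero_add, zero_smul, one_smul, hg] at h1
  have h2 := (osc_eq_iterated (q := q) (δ := 0) (m := 0) (k := -(q + 2)) (f := fun p => g p.1)
    le_rfl hδ1 ((g.smooth ⊤).comp contDiff_fst) le_rfl
    fun K => schwartz_fst_ampBd le_rfl le_rfl K _ g).2.2
  rw [← h1, h2, fourier_inversion_zero, hg, Complex.real_smul, mul_one]

lemma osc_const [CompleteSpace B] (c : B) :
    osc (fun _ : V q × V q => c) = (((2 * Real.pi) ^ q : ℝ) : ℂ) • c := by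
  have := osc_clm (q := q) (δ := 0) le_rfl one_pos
    (ContinuousLinearMap.toSpanSingleton ℂ c) (isAmp_const (1 : ℂ))
  simpa [osc_one] using this

/-- `E_{(0,0,1)}` is the identity. -/
lemma DSym.eop_one [CompleteSpace B] {Γ : Frame q B} {ϱ δ m : ℝ} {a : V3 q → B} (hϱ : 0 ≤ ϱ)
    (hδ : 0 ≤ δ) (hδ1 : δ < 1) (ha : DSym Γ ϱ δ m a) (p : V3 q) : eop (0, 0, 1) a p = a p := by
  -- Along `(0, 0, t)` nothing is shifted in `x`, so every term of the derivative contains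
  -- differentiation in direction `0`. At `t = 0` the amplitude is constant and `osc_const`
  -- evaluates it.
  have h : ∀ t : ℝ, HasDerivAt (fun t : ℝ => eop ((0 : ℝ × ℝ × ℝ) + t • (0, 0, 1)) a p) 0 t := by
    intro t
    refine (hasDerivAt_eop_line hϱ hδ hδ1 ha _ _ _ _).congr_deriv ?_
    have e1 : ∀ j, act ((0 : ℝ × ℝ × ℝ) + t • (0, 0, 1)) (dirY j : V q × V q) = 0 :=
      fun j => by simp [dirY]
    have e2 : ∀ j, act ((0 : ℝ), (0 : ℝ), (1 : ℝ)) (dirY j : V q × V q) = 0 :=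
      fun j => by simp [dirY]
    simp only [e1, e2, dd_zero_dir, dd_zero, eop_zero]
    simp
  have h1 := eq_of_deriv_zero h 1 0
  simp only [one_smul, zero_smul, add_zero, zero_add] at h1
  have hne : (2 * Real.pi) ^ q ≠ 0 := by positivity
  have e : (fun x : V q × V q => a (p + act 0 x)) = fun _ => a p := by
    funext x; congr 1; simp
  rw [h1, eop, e, osc_const, smul_smul, ← Complex.ofReal_mul, inv_mul_cancel₀ hne]
  simp

end Normalization

/-! ### The sharp symbol estimates for `E_w` -/

section Sharp

variable {q : ℕ} {B : Type*} [NormedAddCommGroup B] [NormedSpace ℂ B]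

/-- The derivative of a remainder of order `N + 1` is the remainder of order `N` of the shifted
sequence, so the bound follows by integrating repeatedly over `[0, 1]`. -/
lemma norm_taylor_le {Φ : ℕ → ℝ → B} {M : ℝ} (h : ∀ k t, HasDerivAt (Φ k) (Φ (k + 1) t) t) (N : ℕ)
    (hM : ∀ t ∈ Set.Icc (0 : ℝ) 1, ‖Φ N t‖ ≤ M) :
    ∀ t ∈ Set.Icc (0 : ℝ) 1, ‖Φ 0 t - ∑ k ∈ Finset.range N, (t ^ k / k ! : ℝ) • Φ k 0‖ ≤ M := by
  have hM0 : 0 ≤ M := (norm_nonneg _).trans (hM 0 (by simp))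
  induction N generalizing Φ with
  | zero => simpa using hM
  | succ N ih =>
    intro t ht
    have h1 := ih (fun k => h (k + 1)) (by simpa using hM)
    have hd : ∀ s, HasDerivAt (fun t : ℝ => Φ 0 t
        - ∑ k ∈ Finset.range (N + 1), (t ^ k / k ! : ℝ) • Φ k 0)
        (Φ 1 s - ∑ k ∈ Finset.range N, (s ^ k / k ! : ℝ) • Φ (k + 1) 0) s := by
      intro s
      simp only [Finset.sum_range_succ']
      have h2 : ∀ k ∈ Finset.range N, HasDerivAt
          (fun t : ℝ => (t ^ (k + 1) / (k + 1)! : ℝ) • Φ (k + 1) 0)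
          ((s ^ k / k ! : ℝ) • Φ (k + 1) 0) s := by
        intro k _
        refine HasDerivAt.smul_const ?_ _
        refine ((hasDerivAt_pow (k + 1) s).div_const _).congr_deriv ?_
        rw [Nat.factorial_succ]
        have : (k ! : ℝ) ≠ 0 := by positivity
        push_cast
        field_simp
      have h3 := (h 0 s).sub ((HasDerivAt.fun_sum h2).add_const
        ((1 / (0 ! : ℝ)) • Φ 0 0))
      refine h3.congr_of_eventuallyEq (Eventually.of_forall fun t => ?_)
      simp
    have h3 := norm_image_sub_le_of_norm_deriv_le_segment' (a := 0) (b := 1) (C := M)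
      (fun x _ => (hd x).hasDerivWithinAt) (fun x hx => h1 x ⟨hx.1, hx.2.le⟩) t ht
    have h0 : Φ 0 0 - ∑ k ∈ Finset.range (N + 1), ((0 : ℝ) ^ k / k ! : ℝ) • Φ k 0 = 0 := by
      simp [Finset.sum_range_succ']
    rw [h0, sub_zero] at h3
    refine h3.trans ?_
    nlinarith [ht.2]

/-- The operator `𝓛_σ = -i ∑_j ∂_{η_j} (σ₁ ∂_{y_j} + σ₂ ∂_{y'_j})`. -/
def lop (σ : ℝ × ℝ) (a : V3 q → B) (p : V3 q) : B :=
  (-Complex.I) • ∑ j, dd (dirEta3 j) (dd (σ.1 • stdv j, σ.2 • stdv j, 0) a) p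

/-- The parameters `(t σ₁, t σ₂, 1)`. -/
def pth (σ : ℝ × ℝ) (t : ℝ) : ℝ × ℝ × ℝ := (t * σ.1, t * σ.2, 1)

lemma contDiff_lop {a : V3 q → B} (ha : ContDiff ℝ ∞ a) (σ : ℝ × ℝ) : ContDiff ℝ ∞ (lop σ a) :=
  (ContDiff.sum fun _ _ => contDiff_dd (contDiff_dd ha _) _).const_smul _

lemma dd_lop {a : V3 q → B} (ha : ContDiff ℝ ∞ a) (σ : ℝ × ℝ) (v : V3 q) :
    dd v (lop σ a) = lop σ (dd v a) := by
  have h : ∀ j : Fin q, ContDiff ℝ ∞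
      (dd (dirEta3 j) (dd ((σ.1 • stdv j, σ.2 • stdv j, 0) : V3 q) a)) :=
    fun _ => contDiff_dd (contDiff_dd ha _) _
  unfold lop
  rw [dd_const_smul (ContDiff.sum fun j _ => h j), dd_sum _ fun j _ => h j]
  funext p
  congr 1
  refine Finset.sum_congr rfl fun j _ => ?_
  rw [dd_comm (contDiff_dd ha _), dd_comm ha]

lemma contDiff_lop_iterate {a : V3 q → B} (ha : ContDiff ℝ ∞ a) (σ : ℝ × ℝ) (k : ℕ) :
    ContDiff ℝ ∞ ((lop σ)^[k] a) := by
  induction k with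
  | zero => exact ha
  | succ k ih => rw [Function.iterate_succ_apply']; exact contDiff_lop ih σ

lemma dd_lop_iterate {a : V3 q → B} (ha : ContDiff ℝ ∞ a) (σ : ℝ × ℝ) (v : V3 q) (k : ℕ) :
    dd v ((lop σ)^[k] a) = (lop σ)^[k] (dd v a) := by
  induction k with
  | zero => rfl
  | succ k ih =>
    rw [Function.iterate_succ_apply', Function.iterate_succ_apply', ← ih,
      dd_lop (contDiff_lop_iterate ha σ k)]

variable {Γ : Frame q B} {ϱ δ m R : ℝ} {K : ℕ} {a : V3 q → B}

lemma dd_shift (σ : ℝ × ℝ) (j : Fin q) (a : V3 q → B) :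
    dd (σ.1 • stdv j, σ.2 • stdv j, 0) a
      = fun p => (σ.1 : ℂ) • dd (dir3 (Sum.inl j)) a p
        + (σ.2 : ℂ) • dd (dir3 (Sum.inr (Sum.inl j))) a p := by
  have e : ((σ.1 • stdv j, σ.2 • stdv j, 0) : V3 q)
      = σ.1 • dir3 (Sum.inl j) + σ.2 • dir3 (Sum.inr (Sum.inl j)) := by
    simp [dir3, dirY3, dirYp3]
  rw [e, dd_add_dir, dd_smul_dir, dd_smul_dir]
  simp only [Complex.coe_smul]

/-- Each summand pairs one `η`-derivative, gaining `ϱ`, with one `y`- or `y'`-derivative, losing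
`δ`. -/
lemma DBd.lop {S : ℝ} {σ : ℝ × ℝ} (h1 : |σ.1| ≤ S) (h2 : |σ.2| ≤ S) (ha : ContDiff ℝ ∞ a)
    (h : DBd Γ ϱ δ (K + 2) m R a) :
    DBd Γ ϱ δ K (m - (ϱ - δ)) (q * (S + S) * R) (EdgePsiDO.lop σ a) := by
  have hR := h.nonneg
  have s1 := fun i : Fin q ⊕ (Fin q ⊕ Fin q) => contDiff_dd ha (dir3 i)
  have hj : ∀ j : Fin q, DBd Γ ϱ δ K (m - (ϱ - δ)) ((S + S) * R)
      (EdgePsiDO.dd (dirEta3 j) (EdgePsiDO.dd ((σ.1 • stdv j, σ.2 • stdv j, 0) : V3 q) a)) := by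
    intro j
    have e1 := (h.dd (Sum.inl j)).const_smul (s1 _) (σ.1 : ℂ)
    have e2 := (h.dd (Sum.inr (Sum.inl j))).const_smul (s1 _) (σ.2 : ℂ)
    have e3 := e1.add ((s1 _).const_smul _) ((s1 _).const_smul _) e2
    rw [dd_shift]
    refine (e3.dd (Sum.inr (Sum.inr j))).mono ?_ ?_
    · simp only [expo3, Sum.elim_inl, Sum.elim_inr]; linarith
    · simp only [Complex.norm_real, Real.norm_eq_abs]
      nlinarith
  have := (DBd.sum Finset.univ (fun j _ => contDiff_dd (contDiff_dd ha _) _)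
    fun j _ => hj j).const_smul (ContDiff.sum fun j _ => contDiff_dd (contDiff_dd ha _) _)
      (-Complex.I)
  refine DBd.mono this le_rfl ?_
  simp [mul_assoc]

lemma DSym.lop (ha : DSym Γ ϱ δ m a) (σ : ℝ × ℝ) :
    DSym Γ ϱ δ (m - (ϱ - δ)) (EdgePsiDO.lop σ a) := by
  refine ⟨contDiff_lop ha.1 σ, fun K => ?_⟩
  obtain ⟨R, hR⟩ := ha.2 (K + 2)
  exact ⟨_, hR.lop (le_max_left |σ.1| |σ.2|) (le_max_right _ _) ha.1⟩

lemma DBd.lop_iterate {S : ℝ} {σ : ℝ × ℝ} (h1 : |σ.1| ≤ S) (h2 : |σ.2| ≤ S)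
    (ha : ContDiff ℝ ∞ a) (k : ℕ) (h : DBd Γ ϱ δ (K + 2 * k) m R a) :
    DBd Γ ϱ δ K (m - (ϱ - δ) * k) ((q * (S + S)) ^ k * R) ((EdgePsiDO.lop σ)^[k] a) := by
  induction k generalizing K with
  | zero => simpa using h
  | succ k ih =>
    rw [Function.iterate_succ_apply']
    refine ((ih (K := K + 2) (h.le (by omega))).lop h1 h2 (contDiff_lop_iterate ha σ k)).mono
      ?_ (le_of_eq ?_)
    · push_cast; linarith
    · rw [pow_succ]; ring

lemma DSym.lop_iterate (ha : DSym Γ ϱ δ m a) (σ : ℝ × ℝ) (k : ℕ) :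
    DSym Γ ϱ δ (m - (ϱ - δ) * k) ((EdgePsiDO.lop σ)^[k] a) := by
  refine ⟨contDiff_lop_iterate ha.1 σ k, fun K => ?_⟩
  obtain ⟨R, hR⟩ := ha.2 (K + 2 * k)
  exact ⟨_, hR.lop_iterate (le_max_left |σ.1| |σ.2|) (le_max_right _ _) ha.1 k⟩

section

variable (hϱ : 0 ≤ ϱ) (hδ : 0 ≤ δ) (hδ1 : δ < 1)
include hϱ hδ hδ1

lemma DSym.eop_const_smul (ha : DSym Γ ϱ δ m a) (w : ℝ × ℝ × ℝ) (c : ℂ) (p : V3 q) :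
    eop w (fun p => c • a p) p = c • eop w a p := by
  simp only [eop]
  rw [osc_const_smul hδ hδ1 (ha.isAmp hϱ hδ w p), smul_comm]

lemma DSym.eop_add {b : V3 q → B} (ha : DSym Γ ϱ δ m a) (hb : DSym Γ ϱ δ m b) (w : ℝ × ℝ × ℝ)
    (p : V3 q) : eop w (fun p => a p + b p) p = eop w a p + eop w b p := by
  simp only [eop]
  rw [osc_add hδ hδ1 (ha.isAmp hϱ hδ w p) (hb.isAmp hϱ hδ w p), smul_add]

lemma DSym.eop_sum {κ : Type*} (t : Finset κ) {f : κ → V3 q → B}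
    (hf : ∀ j ∈ t, DSym Γ ϱ δ m (f j)) (w : ℝ × ℝ × ℝ) (p : V3 q) :
    eop w (fun p => ∑ j ∈ t, f j p) p = ∑ j ∈ t, eop w (f j) p := by
  simp only [eop]
  rw [osc_sum hδ hδ1 t fun j hj => (hf j hj).isAmp hϱ hδ w p, Finset.smul_sum]

/-- The differential equation of the family: formally `E_{tσ} = exp(t𝓛_σ)`. The third parameter
stays equal to `1`, so only the half of the general derivative formula that comes from the factors
`x_j` survives. -/
lemma DSym.hasDerivAt_eop_pth (ha : DSym Γ ϱ δ m a) (σ : ℝ × ℝ) (p : V3 q) (t : ℝ) :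
    HasDerivAt (fun t => eop (pth σ t) a p) (eop (pth σ t) (EdgePsiDO.lop σ a) p) t := by
  have e : ∀ t, ((0, 0, 1) : ℝ × ℝ × ℝ) + t • (σ.1, σ.2, 0) = pth σ t := fun t => by simp [pth]
  have h := hasDerivAt_eop_line hϱ hδ hδ1 ha (0, 0, 1) (σ.1, σ.2, 0) p t
  simp only [e] at h
  refine h.congr_deriv ?_
  have e1 : ∀ j, act (pth σ t) (dirEta j : V q × V q) = dirEta3 j :=
    fun j => by simp [pth, dirEta, dirEta3]
  have e2 : ∀ j, act (σ.1, σ.2, (0 : ℝ)) (dirY j : V q × V q)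
      = (σ.1 • stdv j, σ.2 • stdv j, 0) := fun j => by simp [dirY]
  have e3 : ∀ j, act (σ.1, σ.2, (0 : ℝ)) (dirEta j : V q × V q) = 0 :=
    fun j => by simp [dirEta]
  simp only [e1, e2, e3, dd_zero_dir, dd_zero, eop_zero, add_zero]
  have hs : ∀ j : Fin q, DSym Γ ϱ δ (m + δ + δ)
      (EdgePsiDO.dd (dirEta3 j) (EdgePsiDO.dd ((σ.1 • stdv j, σ.2 • stdv j, 0) : V3 q) a)) :=
    fun j => (ha.dd_dir hϱ hδ _).dd_dir hϱ hδ _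
  have h2 := (DSym.sum Finset.univ fun j _ => hs j).eop_const_smul hϱ hδ hδ1 (pth σ t)
    (-Complex.I) p
  rw [DSym.eop_sum hϱ hδ hδ1 _ fun j _ => hs j] at h2
  exact h2.symm

/-- Bounds for `E_w` on symbols estimated without gain and loss. -/
lemma eop_bound [CompleteSpace B] (Γ : Frame q B) {S : ℝ} (hS : 0 ≤ S) (m : ℝ) :
    ∃ (K : ℕ) (C : ℝ), 0 ≤ C ∧
      ∀ (a : V3 q → B) (R m' : ℝ), DSym Γ ϱ δ m' a → DBd Γ 0 0 K m R a → ∀ (w : ℝ × ℝ × ℝ) (p : V3 q),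
        |w.1| ≤ S → |w.2.1| ≤ S → |w.2.2| ≤ S →
        ‖Γ.Θ p.2.2 (eop w a p)‖ ≤ C * R * (Γ.W (p.1, p.2.1) * jap p.2.2 ^ m) := by
  obtain ⟨K, C, hC0, hC⟩ := osc_bound q B hδ hδ1 (Γ.M + |m|) (Γ.M + Γ.M)
  -- The symbols are estimated with both exponents equal to `0`, so no positive power of `⟨η⟩` is
  -- lost in the slice. Such amplitudes are a fortiori of type `δ`.
  obtain ⟨D, hD0, hD⟩ := DBd.slice Γ le_rfl le_rfl hS K m
  refine ⟨K, ((2 * Real.pi) ^ q)⁻¹ * (C * D), by positivity, fun a R m' ha h w p h1 h2 h3 => ?_⟩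
  have hi := ha.isAmp hϱ hδ w p
  have := hC _ _ (hi.comp_clm (Γ.Θ p.2.2)) ((hD a R ha.1 h w p h1 h2 h3).mono_delta hδ)
  rw [osc_clm hδ hδ1 _ hi] at this
  rw [eop, map_smul, norm_smul, Complex.norm_real, Real.norm_eq_abs, abs_of_pos (by positivity)]
  refine (mul_le_mul_of_nonneg_left this (by positivity)).trans (le_of_eq ?_)
  simp only [zero_mul, Real.rpow_zero, mul_one]
  ring

end

/-- The remainder of the expansion of `E_σ`. -/
def rem (N : ℕ) (σ : ℝ × ℝ) (a : V3 q → B) (p : V3 q) : B :=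
  eop (pth σ 1) a p - ∑ k ∈ Finset.range N, ((k ! : ℂ)⁻¹) • (lop σ)^[k] a p

section

variable (hϱ : 0 ≤ ϱ) (hδ : 0 ≤ δ) (hδ1 : δ < 1)
include hϱ hδ hδ1

lemma DSym.contDiff_rem (ha : DSym Γ ϱ δ m a) (N : ℕ) (σ : ℝ × ℝ) : ContDiff ℝ ∞ (rem N σ a) :=
  (ha.contDiff_eop hϱ hδ hδ1 _).sub (ContDiff.sum fun k _ =>
    (contDiff_lop_iterate ha.1 σ k).const_smul _)

lemma DSym.dd_rem (ha : DSym Γ ϱ δ m a) (N : ℕ) (σ : ℝ × ℝ) (v : V3 q) :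
    EdgePsiDO.dd v (rem N σ a) = rem N σ (EdgePsiDO.dd v a) := by
  have s1 := fun k => contDiff_lop_iterate ha.1 σ k
  have s2 : ∀ k, ContDiff ℝ ∞ (fun p => (k ! : ℂ)⁻¹ • (EdgePsiDO.lop σ)^[k] a p) :=
    fun k => (s1 k).const_smul _
  have s3 : ContDiff ℝ ∞
      (fun p => ∑ k ∈ Finset.range N, (k ! : ℂ)⁻¹ • (EdgePsiDO.lop σ)^[k] a p) :=
    ContDiff.sum fun k _ => s2 k
  have s4 : ContDiff ℝ ∞
      (fun p => (-1 : ℂ) • ∑ k ∈ Finset.range N, (k ! : ℂ)⁻¹ • (EdgePsiDO.lop σ)^[k] a p) :=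
    s3.const_smul _
  have e : rem N σ a = fun p => eop (pth σ 1) a p
      + (-1 : ℂ) • ∑ k ∈ Finset.range N, (k ! : ℂ)⁻¹ • (EdgePsiDO.lop σ)^[k] a p := by
    funext p; simp [rem, sub_eq_add_neg]
  rw [e, dd_add (ha.contDiff_eop hϱ hδ hδ1 _) s4, dd_const_smul s3, dd_sum _ fun k _ => s2 k,
    ha.dd_eop hϱ hδ hδ1]
  funext p
  simp only [rem, sub_eq_add_neg, neg_smul, one_smul]
  congr 2
  refine Finset.sum_congr rfl fun k _ => ?_
  rw [dd_const_smul (s1 k), dd_lop_iterate ha.1]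

/-- The bound for `E_{tσ}` treats all derivatives alike and so loses `δK₀` orders. Since `𝓛_σ` gains
`ϱ - δ` each time, a Taylor expansion with `n` more terms than requested has a remainder of the
desired order in spite of the loss, and each additional term has at least that order of decay by
itself. -/
lemma rem_base [CompleteSpace B] (hδϱ : δ < ϱ) (Γ : Frame q B) {S : ℝ} (hS : 0 ≤ S) (N : ℕ)
    (m : ℝ) : ∃ (K : ℕ) (C : ℝ), 0 ≤ C ∧ ∀ (a : V3 q → B) (R : ℝ) (σ : ℝ × ℝ), DSym Γ ϱ δ m a →
      DBd Γ ϱ δ K m R a → |σ.1| ≤ S → |σ.2| ≤ S → ∀ p : V3 q,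
        ‖Γ.Θ p.2.2 (rem N σ a p)‖
          ≤ C * R * (Γ.W (p.1, p.2.1) * jap p.2.2 ^ (m - (ϱ - δ) * N)) := by
  obtain ⟨K₀, C₀, hC₀, hb⟩ := eop_bound hϱ hδ hδ1 Γ (S := S + 1) (by positivity) (m - (ϱ - δ) * N)
  -- Chosen so that `n(ϱ - δ) ≥ δK₀`: the additional terms make up for the loss.
  obtain ⟨n, hn⟩ := exists_nat_ge (δ * K₀ / (ϱ - δ))
  rw [div_le_iff₀ (by linarith)] at hn
  set D : ℝ := q * (S + S) with hD
  have hD0 : 0 ≤ D := by positivity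
  refine ⟨K₀ + 2 * (N + n), C₀ * D ^ (N + n) + ∑ k ∈ Finset.range (N + n), D ^ k, by positivity,
    fun a R σ ha h h1 h2 p => ?_⟩
  have hR := h.nonneg
  have hw := Γ.weight_pos p (m - (ϱ - δ) * N)
  set w := Γ.W (p.1, p.2.1) * jap p.2.2 ^ (m - (ϱ - δ) * N) with hwdef
  -- the Taylor remainder of order `N + n`
  have hT := norm_taylor_le (Φ := fun k t => Γ.Θ p.2.2 (eop (pth σ t) ((lop σ)^[k] a) p))
    (M := C₀ * D ^ (N + n) * R * w)
    (fun k t => by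
      have := (ha.lop_iterate σ k).hasDerivAt_eop_pth hϱ hδ hδ1 σ p t
      rw [← Function.iterate_succ_apply' (lop σ)] at this
      exact ((Γ.Θ p.2.2).restrictScalars ℝ).hasFDerivAt.comp_hasDerivAt t this)
    (N + n) (fun t ht => by
      have e1 := (DBd.lop_iterate h1 h2 ha.1 (N + n) h).flat hϱ hδ
      have e2 := hb _ _ _ (ha.lop_iterate σ (N + n)) (e1.mono (m' := m - (ϱ - δ) * N)
        (by push_cast; linarith) le_rfl) (pth σ t) p
        (by
          have := mul_le_mul ht.2 h1 (abs_nonneg _) zero_le_one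
          simp only [pth, abs_mul, abs_of_nonneg ht.1]; linarith)
        (by
          have := mul_le_mul ht.2 h2 (abs_nonneg _) zero_le_one
          simp only [pth, abs_mul, abs_of_nonneg ht.1]; linarith)
        (by simp only [pth, abs_one]; linarith)
      refine e2.trans (le_of_eq ?_)
      ring) 1 (by simp)
  have e0 : ∀ k, eop (pth σ 0) ((lop σ)^[k] a) p = (lop σ)^[k] a p := fun k => by
    have := (ha.lop_iterate σ k).eop_one hϱ hδ hδ1 p
    simpa [pth] using this
  -- The remainder of order `N` is the Taylor remainder of order `N + n` plus the terms with `N ≤ k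
  -- < N + n`; here `E_0 = 1` identifies the Taylor coefficients.
  have hsplit : Γ.Θ p.2.2 (rem N σ a p)
      = (Γ.Θ p.2.2 (eop (pth σ 1) a p) - ∑ k ∈ Finset.range (N + n),
          ((1 : ℝ) ^ k / k ! : ℝ) • Γ.Θ p.2.2 (eop (pth σ 0) ((lop σ)^[k] a) p))
        + ∑ k ∈ Finset.Ico N (N + n), (k ! : ℂ)⁻¹ • Γ.Θ p.2.2 ((lop σ)^[k] a p) := by
    have e3 : ∀ k : ℕ, ((1 : ℝ) ^ k / k ! : ℝ) • Γ.Θ p.2.2 (eop (pth σ 0) ((lop σ)^[k] a) p)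
        = (k ! : ℂ)⁻¹ • Γ.Θ p.2.2 ((lop σ)^[k] a p) := fun k => by
      rw [e0, ← Complex.coe_smul]
      congr 1
      push_cast
      simp
    simp only [e3, rem, map_sub, map_sum, map_smul]
    rw [← Finset.sum_range_add_sum_Ico _ (Nat.le_add_right N n)]
    abel
  rw [hsplit]
  refine (norm_add_le _ _).trans ?_
  have hS2 : ‖∑ k ∈ Finset.Ico N (N + n), (k ! : ℂ)⁻¹ • Γ.Θ p.2.2 ((lop σ)^[k] a p)‖
      ≤ (∑ k ∈ Finset.range (N + n), D ^ k) * (R * w) := by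
    refine (norm_sum_le _ _).trans ?_
    rw [Finset.sum_mul]
    refine (Finset.sum_le_sum fun k hk => ?_).trans (Finset.sum_le_sum_of_subset_of_nonneg
      (fun k hk => Finset.mem_range.2 (Finset.mem_Ico.1 hk).2) fun k _ _ => by positivity)
    have hkN := (Finset.mem_Ico.1 hk).1
    have hk2 := (Finset.mem_Ico.1 hk).2
    have e4 := (DBd.lop_iterate (K := 0) h1 h2 ha.1 k (h.le (by omega))).mono
      (m' := m - (ϱ - δ) * N) (by
        have : (N : ℝ) ≤ k := by exact_mod_cast hkN
        nlinarith) le_rfl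
    have e5 := e4.base p
    rw [norm_smul, norm_inv, Complex.norm_natCast]
    have e6 : ((k ! : ℝ))⁻¹ ≤ 1 := inv_le_one_of_one_le₀ (by exact_mod_cast Nat.factorial_pos k)
    calc _ ≤ 1 * (D ^ k * R * w) := mul_le_mul e6 e5 (norm_nonneg _) zero_le_one
      _ = _ := by ring
  refine (add_le_add hT hS2).trans (le_of_eq ?_)
  ring

/-- The remainder of the expansion is a symbol, with quantitative bounds. -/
theorem rem_bound [CompleteSpace B] (hδϱ : δ < ϱ) (Γ : Frame q B) {S : ℝ} (hS : 0 ≤ S) (N K' : ℕ)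
    (m : ℝ) : ∃ (K : ℕ) (C : ℝ), 0 ≤ C ∧ ∀ (a : V3 q → B) (R : ℝ) (σ : ℝ × ℝ), DSym Γ ϱ δ m a →
      DBd Γ ϱ δ K m R a → |σ.1| ≤ S → |σ.2| ≤ S →
        DBd Γ ϱ δ K' (m - (ϱ - δ) * N) (C * R) (rem N σ a) := by
  induction K' generalizing m with
  | zero =>
    obtain ⟨K, C, hC0, hC⟩ := rem_base hϱ hδ hδ1 hδϱ Γ hS N m
    exact ⟨K, C, hC0, fun a R σ ha h h1 h2 => bd_zero_iff.2 (hC a R σ ha h h1 h2)⟩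
  | succ K' ih =>
    obtain ⟨K, C, hC0, hC⟩ := rem_base hϱ hδ hδ1 hδϱ Γ hS N m
    choose L D hD0 hD using fun i => ih (m + expo3 ϱ δ i)
    refine ⟨K + ∑ i, (L i + 1), C + ∑ i, D i, add_nonneg hC0 (Finset.sum_nonneg fun i _ => hD0 i),
      fun a R σ ha h h1 h2 => ?_⟩
    have hR := h.nonneg
    refine DBd.succ (fun p => ?_) fun i => ?_
    · refine (hC a R σ ha (h.le (Nat.le_add_right _ _)) h1 h2 p).trans
        (mul_le_mul_of_nonneg_right (mul_le_mul_of_nonneg_right ?_ hR) (Γ.weight_pos p _).le)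
      exact le_add_of_nonneg_right (Finset.sum_nonneg fun i _ => hD0 i)
    -- Derivatives commute with forming the remainder, so they are estimated by the induction
    -- hypothesis for a symbol of the shifted order. Unlike the crude bound, this keeps the gain `ϱ`
    -- of each `η`-derivative.
    · rw [ha.dd_rem hϱ hδ hδ1]
      have hL : L i + 1 ≤ K + ∑ i, (L i + 1) :=
        (Finset.single_le_sum (f := fun i => L i + 1) (fun _ _ => Nat.zero_le _)
          (Finset.mem_univ i)).trans (Nat.le_add_left _ _)
      refine (hD i _ R σ (ha.dd i) ((h.le hL).dd i) h1 h2).mono (by linarith)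
        (mul_le_mul_of_nonneg_right ?_ hR)
      exact (Finset.single_le_sum (fun i _ => hD0 i) (Finset.mem_univ i)).trans
        (le_add_of_nonneg_left hC0)

lemma DSym.rem [CompleteSpace B] (hδϱ : δ < ϱ) (ha : DSym Γ ϱ δ m a) (N : ℕ) (σ : ℝ × ℝ) :
    DSym Γ ϱ δ (m - (ϱ - δ) * N) (EdgePsiDO.rem N σ a) := by
  refine ⟨ha.contDiff_rem hϱ hδ hδ1 N σ, fun K' => ?_⟩
  obtain ⟨K, C, -, hC⟩ := rem_bound hϱ hδ hδ1 hδϱ Γ (S := max |σ.1| |σ.2|) (by positivity) N K' m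
  obtain ⟨R, hR⟩ := ha.2 K
  exact ⟨_, hC a R σ ha hR (le_max_left _ _) (le_max_right _ _)⟩

/-- This is the remainder of order zero, from which nothing is subtracted. -/
lemma DSym.eop [CompleteSpace B] (hδϱ : δ < ϱ) (ha : DSym Γ ϱ δ m a) (σ : ℝ × ℝ) :
    DSym Γ ϱ δ m (EdgePsiDO.eop (pth σ 1) a) := by
  have := ha.rem hϱ hδ hδ1 hδϱ 0 σ
  have e : EdgePsiDO.rem 0 σ a = EdgePsiDO.eop (pth σ 1) a := by
    funext p; simp [EdgePsiDO.rem]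
  simpa [e] using this

end

end Sharp

/-! ### Deformation of double symbols -/

section Deformation

variable {q : ℕ} {B B₂ B₃ : Type*} [NormedAddCommGroup B] [NormedSpace ℂ B]
  [NormedAddCommGroup B₂] [NormedSpace ℂ B₂] [NormedAddCommGroup B₃] [NormedSpace ℂ B₃]
  {Γ : Frame q B} {ϱ δ m : ℝ} {a : V3 q → B}

lemma pth_smul (σ : ℝ × ℝ) (t : ℝ) : pth σ t = pth (t • σ) 1 := by simp [pth]

/-- The family of amplitudes `β(E_{tσ} a (p + ((r₁ - tσ₁) x, (r₂ - tσ₂) x, ξ)), v(x))`. -/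
def deform (β : B →L[ℂ] B₂ →L[ℂ] B₃) (v : V q → B₂) (σ r : ℝ × ℝ) (p : V3 q) (a : V3 q → B)
    (z : ℝ × (V q × V q)) : B₃ :=
  β (eop (pth σ z.1) a (p + act (r.1 - z.1 * σ.1, r.2 - z.1 * σ.2, 1) z.2)) (v z.2.1)

variable (hϱ : 0 ≤ ϱ) (hδ : 0 ≤ δ) (hδ1 : δ < 1) (β : B →L[ℂ] B₂ →L[ℂ] B₃)
  {v : V q → B₂} (hv : IsAmp δ (fun x : V q × V q => v x.1)) (σ r : ℝ × ℝ) (p : V3 q)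

lemma contDiff_of_isAmp_fst (hv : IsAmp δ (fun x : V q × V q => v x.1)) : ContDiff ℝ ∞ v :=
  contDiff_slice_fst hv.1 0

lemma contDiff_bilinC {X : Type*} [NormedAddCommGroup X] [NormedSpace ℝ X] {f : X → B} {g : X → B₂}
    (hf : ContDiff ℝ ∞ f) (hg : ContDiff ℝ ∞ g) : ContDiff ℝ ∞ (fun x => β (f x) (g x)) :=
  contDiff_bilin (β.bilinearRestrictScalars ℝ) hf hg

lemma contDiff_comp_pair {X Y Z : Type*} [NormedAddCommGroup X] [NormedSpace ℝ X]
    [NormedAddCommGroup Y] [NormedSpace ℝ Y] [NormedAddCommGroup Z] [NormedSpace ℝ Z]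
    {f : Y × Z → B} (hf : ContDiff ℝ ∞ f) {g : X → Y} {h : X → Z} (hg : ContDiff ℝ ∞ g)
    (hh : ContDiff ℝ ∞ h) : ContDiff ℝ ∞ (fun x => f (g x, h x)) := hf.comp (hg.prodMk hh)

include hϱ hδ hδ1

lemma DSym.contDiff_eop_comp {X : Type*} [NormedAddCommGroup X] [NormedSpace ℝ X]
    (ha : DSym Γ ϱ δ m a) {w : X → ℝ × ℝ × ℝ} {z : X → V3 q} (hw : ContDiff ℝ ∞ w)
    (hz : ContDiff ℝ ∞ z) : ContDiff ℝ ∞ (fun x => EdgePsiDO.eop (w x) a (z x)) := by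
  have h := contDiff_comp_pair (ha.contDiff_eop_joint hϱ hδ hδ1) hw hz
  exact h

include hv

lemma DSym.contDiff_deform (ha : DSym Γ ϱ δ m a) : ContDiff ℝ ∞ (deform β v σ r p a) := by
  have hv' := contDiff_of_isAmp_fst hv
  refine contDiff_bilinC β (ha.contDiff_eop_comp hϱ hδ hδ1 ?_ ?_) ?_
  · unfold pth; fun_prop
  · simp only [act_apply]; fun_prop
  · exact hv'.comp (by fun_prop)

/-- The case `N = 0` of `rem_bound` makes `E_{tσ} a` a double symbol uniformly for bounded `t`, and
its slices are then amplitudes. -/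
lemma DSym.locAmp_deform [CompleteSpace B] (hδϱ : δ < ϱ) (hβ : ∀ b c, ‖β b c‖ ≤ ‖b‖ * ‖c‖)
    (ha : DSym Γ ϱ δ m a) : LocAmp δ (deform β v σ r p a) := by
  obtain ⟨sv, mv, kv, hvb⟩ := id hv
  refine ⟨ha.contDiff_deform hϱ hδ hδ1 β hv σ r p, Γ.M + |m| + mv, Γ.M + Γ.M + kv, fun K t₀ => ?_⟩
  -- A bound for `tσ`, for `r - tσ` and for the third parameter `1`, valid as long as `|t - t₀| ≤
  -- 1`.
  set S := (|t₀| + 1) * (|σ.1| + |σ.2|) + |r.1| + |r.2| + 1 with hS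
  have hS0 : 0 ≤ S := by positivity
  obtain ⟨L, D, hD0, hD⟩ := rem_bound hϱ hδ hδ1 hδϱ Γ hS0 0 K m
  obtain ⟨C, hC0, hC⟩ := DBd.slice Γ hϱ hδ hS0 K m
  obtain ⟨R, hR⟩ := ha.2 L
  obtain ⟨R', hR'⟩ := hvb K
  refine ⟨2 ^ K * (Γ.C * jap p.2.2 ^ Γ.M * (C * jap p.2.2 ^ (δ * K) *
    (D * R * (Γ.W (p.1, p.2.1) * jap p.2.2 ^ m))) * R'), fun t ht => ?_⟩
  have ht' : |t| ≤ |t₀| + 1 := by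
    have := abs_sub_abs_le_abs_sub t t₀
    rw [Real.norm_eq_abs] at ht
    linarith
  have hmul : ∀ c : ℝ, |t * c| ≤ (|t₀| + 1) * |c| := fun c => by
    rw [abs_mul]; exact mul_le_mul_of_nonneg_right ht' (abs_nonneg c)
  have n1 := hmul σ.1
  have n2 := hmul σ.2
  have b1 := abs_nonneg r.1
  have b2 := abs_nonneg r.2
  have b3 : 0 ≤ (|t₀| + 1) * |σ.1| := by positivity
  have b4 : 0 ≤ (|t₀| + 1) * |σ.2| := by positivity
  have hexp : S = (|t₀| + 1) * |σ.1| + (|t₀| + 1) * |σ.2| + |r.1| + |r.2| + 1 := by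
    rw [hS]; ring
  have e1 : DBd Γ ϱ δ K m (D * R) (EdgePsiDO.eop (pth σ t) a) := by
    have := hD a R (t • σ) ha hR (by simp only [Prod.smul_fst, smul_eq_mul]; linarith)
      (by simp only [Prod.smul_snd, smul_eq_mul]; linarith)
    have e : EdgePsiDO.rem 0 (t • σ) a = EdgePsiDO.eop (pth σ t) a := by
      funext p; simp [EdgePsiDO.rem, pth_smul σ t]
    simpa [e] using this
  have e2 := hC _ _ (ha.contDiff_eop hϱ hδ hδ1 _) e1 (r.1 - t * σ.1, r.2 - t * σ.2, 1) p
    (by have := abs_sub r.1 (t * σ.1); dsimp only; linarith)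
    (by have := abs_sub r.2 (t * σ.2); dsimp only; linarith)
    (by simp only [abs_one]; linarith)
  have sm : ContDiff ℝ ∞ (fun x : V q × V q => EdgePsiDO.eop (pth σ t) a
      (p + act (r.1 - t * σ.1, r.2 - t * σ.2, 1) x)) :=
    contDiff_comp_affine (ha.contDiff_eop hϱ hδ hδ1 _) _ _
  have e3 := AmpBd.of_clm sm (Γ.norm_le p.2.2)
    (mul_nonneg Γ.C_pos.le (jap_rpow_pos _ _).le) e2
  exact AmpBd.bilin (β.bilinearRestrictScalars ℝ) hβ sm sv e3 hR'

/-- The parameter enters twice. Through `E_{tσ}` it produces `𝓛_σ a`; through the argument, which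
moves with velocity `-(σ₁x, σ₂x, 0)`, it produces the terms with the factors `-x_j`. -/
lemma DSym.dd_deform [CompleteSpace B] (ha : DSym Γ ϱ δ m a)
    (h : ℝ) (z : ℝ × (V q × V q)) :
    EdgePsiDO.dd ((h, 0) : ℝ × (V q × V q)) (deform β v σ r p a) z
      = (h : ℂ) • deform β v σ r p (EdgePsiDO.lop σ a) z
        + ∑ j, (-(h : ℂ) * coX j z.2) •
          deform β v σ r p (EdgePsiDO.dd (σ.1 • stdv j, σ.2 • stdv j, 0) a) z := by
  obtain ⟨t, x⟩ := z
  set w : ℝ × ℝ × ℝ := (r.1 - t * σ.1, r.2 - t * σ.2, 1) with hw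
  -- the derivative of the composition with an affine path
  have hg : ContDiff ℝ ∞ (fun s : (ℝ × ℝ × ℝ) × V3 q => β (EdgePsiDO.eop s.1 a s.2) (v x.1)) :=
    contDiff_bilinC β (ha.contDiff_eop_joint hϱ hδ hδ1) contDiff_const
  have e1 := dd_eq_of_line (ha.contDiff_deform hϱ hδ hδ1 β hv σ r p) hg (x := (t, x)) (h := (h, 0))
    (y := (pth σ t, p + act w x)) (v := (h • (σ.1, σ.2, 0), h • act (-σ.1, -σ.2, 0) x)) fun s => by
      simp only [deform, pth, hw, act_apply, Prod.mk_add_mk, Prod.smul_mk, smul_eq_mul, smul_zero,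
        add_zero]
      congr 3
      · ext <;> simp <;> ring
      · ext i <;> simp <;> ring
  have hE := ha.contDiff_eop_joint hϱ hδ hδ1
  have e2 : ∀ u s, EdgePsiDO.dd u
      (fun s : (ℝ × ℝ × ℝ) × V3 q => β (EdgePsiDO.eop s.1 a s.2) (v x.1)) s
      = β (EdgePsiDO.dd u (fun s : (ℝ × ℝ × ℝ) × V3 q => EdgePsiDO.eop s.1 a s.2) s) (v x.1) := by
    intro u s
    exact congrFun (dd_comp_clm hE (β.flip (v x.1)) u) s
  have e3 : ((h • (σ.1, σ.2, (0 : ℝ)), h • act (-σ.1, -σ.2, 0) x) : (ℝ × ℝ × ℝ) × V3 q)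
      = h • ((σ.1, σ.2, 0), 0) + (-h) • (0, act (σ.1, σ.2, 0) x) := by
    simp
  have e4 : EdgePsiDO.dd ((σ.1, σ.2, (0 : ℝ)), (0 : V3 q))
      (fun s : (ℝ × ℝ × ℝ) × V3 q => EdgePsiDO.eop s.1 a s.2) (pth σ t, p + act w x)
      = EdgePsiDO.eop (pth σ t) (EdgePsiDO.lop σ a) (p + act w x) := by
    have h1 : HasDerivAt (fun t : ℝ => (pth σ t, p + act w x)) ((σ.1, σ.2, (0 : ℝ)), (0 : V3 q)) t := by
      have d1 : HasDerivAt (fun t : ℝ => t * σ.1) σ.1 t := by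
        simpa using (hasDerivAt_id t).mul_const σ.1
      have d2 : HasDerivAt (fun t : ℝ => t * σ.2) σ.2 t := by
        simpa using (hasDerivAt_id t).mul_const σ.2
      exact (d1.prodMk (d2.prodMk (hasDerivAt_const t (1 : ℝ)))).prodMk (hasDerivAt_const t _)
    exact ((smooth_diff hE _).hasFDerivAt.comp_hasDerivAt t h1).unique
      (ha.hasDerivAt_eop_pth hϱ hδ hδ1 σ _ t)
  have e5 : EdgePsiDO.dd ((0 : ℝ × ℝ × ℝ), act (σ.1, σ.2, 0) x)
      (fun s : (ℝ × ℝ × ℝ) × V3 q => EdgePsiDO.eop s.1 a s.2) (pth σ t, p + act w x)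
      = ∑ j, coX j x • EdgePsiDO.eop (pth σ t)
        (EdgePsiDO.dd (σ.1 • stdv j, σ.2 • stdv j, 0) a) (p + act w x) := by
    have h1 := dd_eq_of_line hE (ha.contDiff_eop hϱ hδ hδ1 (pth σ t))
      (x := (pth σ t, p + act w x)) (h := (0, act (σ.1, σ.2, 0) x)) (y := p + act w x)
      (v := act (σ.1, σ.2, 0) x) fun s => by simp
    rw [h1, dd_act]
    have f1 : ∀ j, act (σ.1, σ.2, (0 : ℝ)) (dirY j : V q × V q)
        = (σ.1 • stdv j, σ.2 • stdv j, 0) := fun j => by simp [dirY]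
    have f2 : ∀ j, act (σ.1, σ.2, (0 : ℝ)) (dirEta j : V q × V q) = 0 :=
      fun j => by simp [dirEta]
    simp only [f1, f2, dd_zero_dir, ha.dd_eop hϱ hδ hδ1, eop_zero, smul_zero, add_zero]
  rw [e1, e2, e3, dd_add_dir, dd_smul_dir, dd_smul_dir]
  simp only [e4, e5, deform, ← hw]
  simp only [map_add, add_apply, ← Complex.coe_smul, map_smul, smul_apply, map_sum,
    sum_apply, Finset.smul_sum, smul_smul]
  simp

lemma DSym.parAmp_deform [CompleteSpace B] (hδϱ : δ < ϱ) (hβ : ∀ b c, ‖β b c‖ ≤ ‖b‖ * ‖c‖)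
    (ha : DSym Γ ϱ δ m a) : ParAmp δ (deform β v σ r p a) := by
  refine parAmp_of_family (𝒜 := {a : V3 q → B // ∃ m, DSym Γ ϱ δ m a}) (I := Option (Fin q))
    (fun a => deform β v σ r p a.1)
    (fun i a => i.elim ⟨EdgePsiDO.lop σ a.1, by obtain ⟨m, h⟩ := a.2; exact ⟨_, h.lop σ⟩⟩
      fun j => ⟨EdgePsiDO.dd (σ.1 • stdv j, σ.2 • stdv j, 0) a.1, by
        obtain ⟨m, h⟩ := a.2; exact ⟨_, h.dd_dir hϱ hδ _⟩⟩)
    (fun i h x => i.elim (h : ℂ) fun j => -(h : ℂ) * coX j x) ?_ ?_ ?_ ⟨a, m, ha⟩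
  · rintro ⟨a, m, h⟩
    exact h.locAmp_deform hϱ hδ hδ1 β hv σ r p hδϱ hβ
  · rintro (_ | j) h
    · exact isAmp_const _
    · have := ((isAmp_const (q := q) (δ := δ) (1 : ℂ)).linear_smul hδ (coX j)).const_smul (-(h : ℂ))
      simpa using this
  · rintro ⟨a, m, ha⟩ h z
    rw [ha.dd_deform hϱ hδ hδ1 β hv σ r p]
    simp

/-- The oscillatory integral of the deformation does not depend on the parameter. -/
theorem DSym.osc_deform [CompleteSpace B] (hδϱ : δ < ϱ) (hβ : ∀ b c, ‖β b c‖ ≤ ‖b‖ * ‖c‖)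
    (ha : DSym Γ ϱ δ m a) (s t : ℝ) :
    osc (fun x => deform β v σ r p a (s, x)) = osc (fun x => deform β v σ r p a (t, x)) := by
  have hp := ha.parAmp_deform hϱ hδ hδ1 β hv σ r p hδϱ hβ
  refine eq_of_deriv_zero (f := fun t => osc fun x => deform β v σ r p a (t, x)) (fun t => ?_) s t
  have h1 := (smooth_diff (hp.contDiff_osc hδ hδ1) t).hasDerivAt
  refine h1.congr_deriv ?_
  have h2 : deriv (fun t => osc fun x => deform β v σ r p a (t, x)) t
      = EdgePsiDO.dd (1 : ℝ) (fun t => osc fun x => deform β v σ r p a (t, x)) t := rfl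
  rw [h2, hp.dd_osc hδ hδ1]
  set T := fun j : Fin q => EdgePsiDO.dd ((σ.1 • stdv j, σ.2 • stdv j, 0) : V3 q) a with hT
  have hTs : ∀ j, DSym Γ ϱ δ (m + δ) (T j) := fun j => ha.dd_dir hϱ hδ _
  have iT : ∀ j, IsAmp δ (fun x => deform β v σ r p (T j) (t, x)) := fun j =>
    ((hTs j).locAmp_deform hϱ hδ hδ1 β hv σ r p hδϱ hβ).isAmp t
  have iU : ∀ j, IsAmp δ (fun x => deform β v σ r p (EdgePsiDO.dd (dirEta3 j) (T j)) (t, x)) :=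
    fun j => (((hTs j).dd_dir hϱ hδ _).locAmp_deform hϱ hδ hδ1 β hv σ r p hδϱ hβ).isAmp t
  have e1 : (fun x => EdgePsiDO.dd ((1, 0) : ℝ × (V q × V q)) (deform β v σ r p a) (t, x))
      = fun x => (-Complex.I) • ∑ j, deform β v σ r p (EdgePsiDO.dd (dirEta3 j) (T j)) (t, x)
        + (-1 : ℂ) • ∑ j, coX j x • deform β v σ r p (T j) (t, x) := by
    funext x
    rw [ha.dd_deform hϱ hδ hδ1 β hv σ r p]
    have hl : EdgePsiDO.lop σ a
        = fun p => (-Complex.I) • ∑ j, EdgePsiDO.dd (dirEta3 j) (T j) p := rfl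
    have hs := fun j => (hTs j).dd_dir hϱ hδ (dirEta3 j)
    have e2 : ∀ w p, EdgePsiDO.eop w (EdgePsiDO.lop σ a) p
        = (-Complex.I) • ∑ j, EdgePsiDO.eop w (EdgePsiDO.dd (dirEta3 j) (T j)) p := fun w p => by
      rw [hl, (DSym.sum Finset.univ fun j _ => hs j).eop_const_smul hϱ hδ hδ1 w,
        DSym.eop_sum hϱ hδ hδ1 _ fun j _ => hs j]
    simp only [deform, e2, map_smul, map_sum, smul_apply, sum_apply,
      Complex.ofReal_one, one_smul, mul_smul, Finset.smul_sum]
    rfl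
  -- Integration by parts turns `x_j` into `-i∂_{ξ_j}`. Since `v` depends on `x` only, this
  -- derivative falls on the symbol alone, and the result cancels the term with `𝓛_σ`.
  have e3 : ∀ j, osc (fun x => coX j x • deform β v σ r p (T j) (t, x))
      = (-Complex.I) • osc (fun x => deform β v σ r p (EdgePsiDO.dd (dirEta3 j) (T j)) (t, x)) := by
    intro j
    rw [EdgePsiDO.osc_coX hδ hδ1 (iT j)]
    congr 2
    have hE := (hTs j).contDiff_eop hϱ hδ hδ1 (pth σ t)
    have hv' := contDiff_of_isAmp_fst hv
    set w : ℝ × ℝ × ℝ := (r.1 - t * σ.1, r.2 - t * σ.2, 1)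
    have b := dd_bilin (β.bilinearRestrictScalars ℝ) (contDiff_comp_affine hE p (act w)) hv.1
      (dirEta j)
    have hz : EdgePsiDO.dd (dirEta j) (fun x : V q × V q => v x.1) = fun _ => 0 := by
      have := dd_comp_affine hv' 0 (ContinuousLinearMap.fst ℝ (V q) (V q)) (dirEta j)
      simp only [zero_add, ContinuousLinearMap.coe_fst'] at this
      rw [this]
      funext x
      simp [dirEta, EdgePsiDO.dd]
    have hA : act w (dirEta j : V q × V q) = dirEta3 j := by simp [w, dirEta, dirEta3]
    rw [hz, dd_comp_affine hE, hA, (hTs j).dd_eop hϱ hδ hδ1] at b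
    refine b.trans ?_
    funext x
    simp [deform, w]
  beta_reduce
  rw [e1, osc_add hδ hδ1 ((IsAmp.sum _ fun j _ => iU j).const_smul _)
      ((IsAmp.sum _ fun j _ => (iT j).linear_smul hδ _).const_smul _),
    osc_const_smul hδ hδ1 (IsAmp.sum _ fun j _ => iU j),
    osc_const_smul hδ hδ1 (IsAmp.sum _ fun j _ => (iT j).linear_smul hδ _),
    osc_sum hδ hδ1 _ fun j _ => iU j, osc_sum hδ hδ1 _ fun j _ => (iT j).linear_smul hδ _]
  simp only [e3, ← Finset.smul_sum]
  simp

/-- Passing from the double symbol `a` to `E_σ a` under the oscillatory integral. -/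
theorem DSym.osc_bilin_eop [CompleteSpace B] (hδϱ : δ < ϱ) (hβ : ∀ b c, ‖β b c‖ ≤ ‖b‖ * ‖c‖)
    (ha : DSym Γ ϱ δ m a) :
    osc (fun x => β (a (p + act (r.1, r.2, 1) x)) (v x.1))
      = osc (fun x => β (EdgePsiDO.eop (pth σ 1) a (p + act (r.1 - σ.1, r.2 - σ.2, 1) x))
          (v x.1)) := by
  have h := ha.osc_deform hϱ hδ hδ1 β hv σ r p hδϱ hβ 0 1
  have e0 : ∀ p, EdgePsiDO.eop (pth σ 0) a p = a p := fun p => by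
    have := ha.eop_one hϱ hδ hδ1 p
    simpa [pth] using this
  simpa only [deform, zero_mul, sub_zero, e0, one_mul] using h

omit hv in
/-- `E_{-σ}` is the inverse of `E_σ`. -/
theorem DSym.eop_neg_eop [CompleteSpace B] (hδϱ : δ < ϱ) (ha : DSym Γ ϱ δ m a) :
    EdgePsiDO.eop (pth (-σ) 1) (EdgePsiDO.eop (pth σ 1) a) p = a p := by
  -- With `v = 1` and `r = 0` the two sides are, up to normalization, `E_0 a` and `E_{-σ}` applied
  -- to `E_σ a`.
  have h := ha.osc_bilin_eop hϱ hδ hδ1 ((ContinuousLinearMap.lsmul ℂ ℂ).flip : B →L[ℂ] ℂ →L[ℂ] B)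
    (v := fun _ => (1 : ℂ)) (isAmp_const 1) σ 0 p hδϱ (fun b c => by simp [norm_smul, mul_comm])
  have hE : (0 - σ.1, 0 - σ.2, (1 : ℝ)) = pth (-σ) 1 := by simp [pth]
  simp only [ContinuousLinearMap.flip_apply, ContinuousLinearMap.lsmul_apply, one_smul,
    Prod.fst_zero, Prod.snd_zero, hE] at h
  rw [EdgePsiDO.eop, ← h]
  exact ha.eop_one hϱ hδ hδ1 p

end Deformation

/-! ### Pseudodifferential operators on the Schwartz space -/

section Schwartz

variable {q : ℕ} {B : Type*} [NormedAddCommGroup B] [NormedSpace ℂ B]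

lemma norm_dl_le {f : V q → B} (hf : ContDiff ℝ ∞ f) (l : List (Fin q)) (x : V q) :
    ‖dl stdv l f x‖ ≤ ‖iteratedFDeriv ℝ l.length f x‖ := by
  suffices h : ∀ n : ℕ, ‖iteratedFDeriv ℝ n (dl stdv l f) x‖
      ≤ ‖iteratedFDeriv ℝ (n + l.length) f x‖ by
    have := h 0
    rwa [norm_iteratedFDeriv_zero, zero_add] at this
  induction l generalizing f with
  | nil => simp
  | cons i l ih =>
    intro n
    refine (ih (contDiff_dd hf _) n).trans ?_
    have h1 : ContDiff ℝ ∞ (fderiv ℝ f) := hf.fderiv_right (m := ∞) (by simp)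
    have h2 := norm_iteratedFDeriv_clm_apply_const (c := stdv i) (n := n + l.length)
      (N := ∞) (h1.contDiffAt (x := x)) (by exact_mod_cast le_top)
    rw [norm_stdv, one_mul, norm_iteratedFDeriv_fderiv] at h2
    exact h2

/-- The derivative is the sum over the `q` coordinates of rank-one maps built from partial
derivatives, which costs a factor `q` per order. It converts bounds along words into bounds for
Schwartz seminorms. -/
lemma norm_iteratedFDeriv_le {f : V q → B} (hf : ContDiff ℝ ∞ f) (n : ℕ) {x : V q} {G : ℝ}
    (h : ∀ l : List (Fin q), l.length = n → ‖dl stdv l f x‖ ≤ G) :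
    ‖iteratedFDeriv ℝ n f x‖ ≤ q ^ n * G := by
  induction n generalizing f with
  | zero => simpa using h [] rfl
  | succ n ih =>
    have e : fderiv ℝ f = fun x => ∑ j, (ContinuousLinearMap.smulRightL ℝ (V q) B
        (EuclideanSpace.proj j : V q →L[ℝ] ℝ)) (dd (stdv j) f x) := by
      funext x
      ext v
      conv_lhs => rw [← sum_stdv v, map_sum]
      simp [dd]
    have s := fun j : Fin q => contDiff_dd hf (stdv j)
    have s2 : ∀ j, ContDiff ℝ ∞ (fun x => (ContinuousLinearMap.smulRightL ℝ (V q) B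
        (EuclideanSpace.proj j : V q →L[ℝ] ℝ)) (dd (stdv j) f x)) := fun j =>
      (ContinuousLinearMap.contDiff _).comp (s j)
    rw [← norm_iteratedFDeriv_fderiv, e, iteratedFDeriv_fun_sum_apply (fun j _ =>
      ((s2 j).of_le (by exact_mod_cast le_top)).contDiffAt)]
    refine (norm_sum_le _ _).trans ?_
    have h1 : ∀ j ∈ Finset.univ, ‖iteratedFDeriv ℝ n (fun x => (ContinuousLinearMap.smulRightL ℝ
        (V q) B (EuclideanSpace.proj j : V q →L[ℝ] ℝ)) (dd (stdv j) f x)) x‖ ≤ q ^ n * G := by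
      intro j _
      have h2 := ContinuousLinearMap.norm_iteratedFDeriv_comp_left (ContinuousLinearMap.smulRightL ℝ
        (V q) B (EuclideanSpace.proj j : V q →L[ℝ] ℝ)) (n := n) (N := ∞)
        ((s j).contDiffAt (x := x)) (by exact_mod_cast le_top)
      have h3 : ‖ContinuousLinearMap.smulRightL ℝ (V q) B
          (EuclideanSpace.proj j : V q →L[ℝ] ℝ)‖ ≤ 1 := by
        refine ContinuousLinearMap.opNorm_le_bound _ zero_le_one fun b => ?_
        rw [ContinuousLinearMap.smulRightL_apply_apply, ContinuousLinearMap.norm_smulRight_apply]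
        refine mul_le_mul_of_nonneg_right ?_ (norm_nonneg b)
        exact ContinuousLinearMap.opNorm_le_bound _ zero_le_one fun v => by
          simpa using abs_apply_le v j
      exact (h2.trans (mul_le_of_le_one_left (norm_nonneg _) h3)).trans
        (ih (s j) fun l hl => h (j :: l) (by simp [hl]))
    refine (Finset.sum_le_sum h1).trans (le_of_eq ?_)
    rw [Finset.sum_const, Finset.card_univ, Fintype.card_fin, nsmul_eq_mul, pow_succ]
    ring

/-- A Schwartz seminorm that controls `K` derivatives with weight `⟨x⟩^n`. -/
def schwNorm (n K : ℕ) (g : 𝓢(V q, B)) : ℝ :=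
  2 ^ n * ((Finset.Iic (n, K)).sup (schwartzSeminormFamily ℂ (V q) B)) g

lemma bd_schwartz (n K : ℕ) (g : 𝓢(V q, B)) :
    Bd stdv (fun _ _ => (1 : ℝ)) (fun _ => normSeminorm ℂ B) K
      (fun x => schwNorm n K g * jap x ^ (-(n : ℝ))) g := by
  intro l hl x
  have h := SchwartzMap.one_add_le_sup_seminorm_apply (𝕜 := ℂ) (m := (n, K)) (k := n)
    (n := l.length) le_rfl hl g x
  have h2 := norm_dl_le (g.smooth ⊤) l x
  simp only [coe_normSeminorm, List.map_const', List.prod_replicate, one_pow, mul_one]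
  rw [Real.rpow_neg (jap_pos x).le, Real.rpow_natCast, ← div_eq_mul_inv,
    le_div_iff₀ (pow_pos (jap_pos x) n), mul_comm]
  exact (mul_le_mul (pow_le_pow_left₀ (jap_pos x).le (jap_le x) n) h2 (norm_nonneg _)
    (by positivity)).trans h

lemma bd_schwartz_mid {ϱ δ : ℝ} (hδ : 0 ≤ δ) (n K : ℕ) (g : 𝓢(V q, B)) :
    Bd dir3 (wt3 ϱ δ) (fun _ => normSeminorm ℂ B) K
      (fun p => schwNorm n K g * jap p.2.1 ^ (-(n : ℝ))) (fun p => g p.2.1) := by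
  have := Bd.comp_affine (v' := dir3 (q := q)) (s' := wt3 ϱ δ) (N' := fun _ => normSeminorm ℂ B)
    (0 : V q) ((ContinuousLinearMap.fst ℝ (V q) (V q)).comp
    (ContinuousLinearMap.snd ℝ (V q) (V q × V q)))
    (Sum.elim (fun _ _ => 0) (Sum.elim (fun i j => if i = j then 1 else 0) fun _ _ => 0))
    (by rintro (i | i | i) <;> simp [dir3, dirY3, dirYp3, dirEta3, ite_smul])
    (Λ := 1) le_rfl (wt3_nonneg _ _)
    (by
      rintro (i | i | i) p
      · simpa using wt3_nonneg _ _ _ _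
      · simpa [apply_ite abs, wt3, expo3] using one_le_jap_rpow p.2.2 hδ
      · simpa using wt3_nonneg _ _ _ _)
    (D := fun _ => 1) (fun _ => zero_le_one) (fun _ _ => by simp) (g.smooth ⊤) (bd_schwartz n K g)
  simpa using this

/-- The trivial twist with the weight `⟨y⟩^k ⟨y'⟩^l`. -/
def Frame.weighted (q : ℕ) (B : Type*) [NormedAddCommGroup B] [NormedSpace ℂ B] (k l : ℝ) :
    Frame q B where
  Θ _ := ContinuousLinearMap.id ℂ B
  W y := jap y.1 ^ k * jap y.2 ^ l
  C := 2 ^ (|k| + |l|)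
  M := |k| + |l|
  one_le_C := Real.one_le_rpow one_le_two (by positivity)
  M_nonneg := by positivity
  Θ_zero := rfl
  Θ_le η ξ b := by
    have h1 : (1 : ℝ) ≤ 2 ^ (|k| + |l|) := Real.one_le_rpow one_le_two (by positivity)
    have h2 : 1 ≤ jap ξ ^ (|k| + |l|) := one_le_jap_rpow ξ (by positivity)
    exact le_mul_of_one_le_left (norm_nonneg _) (one_le_mul_of_one_le_of_one_le h1 h2)
  W_pos y := EdgePsiDO.weight_pos _ _ _ _
  W_le y x := by
    have h1 := jap_rpow_add_le y.1 x.1 k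
    have h2 := jap_rpow_add_le y.2 x.2 l
    have h3 := jap_rpow_mono x.1 (show |k| ≤ |k| + |l| from le_add_of_nonneg_right (abs_nonneg _))
    have h4 := jap_rpow_mono x.2 (show |l| ≤ |k| + |l| from le_add_of_nonneg_left (abs_nonneg _))
    rw [Real.mul_rpow two_pos.le (jap_pos _).le] at h1 h2
    have p1 := jap_rpow_pos y.1 k
    have p2 := jap_rpow_pos y.2 l
    have p3 := jap_rpow_pos x.1 |k|
    have p4 := jap_rpow_pos x.2 |l|
    have p5 := jap_rpow_pos x.1 (|k| + |l|)
    calc jap (y + x).1 ^ k * jap (y + x).2 ^ l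
        ≤ (2 ^ |k| * jap x.1 ^ |k| * jap y.1 ^ k) * (2 ^ |l| * jap x.2 ^ |l| * jap y.2 ^ l) :=
          mul_le_mul h1 h2 (jap_rpow_pos _ _).le (by positivity)
      _ ≤ (2 ^ |k| * jap x.1 ^ (|k| + |l|) * jap y.1 ^ k)
          * (2 ^ |l| * jap x.2 ^ (|k| + |l|) * jap y.2 ^ l) := by gcongr
      _ = _ := by rw [Real.rpow_add two_pos]; ring

end Schwartz

/-! ### Applying double symbols to Schwartz functions -/

section Action

variable {q : ℕ} {B B₂ B₃ : Type*} [NormedAddCommGroup B] [NormedSpace ℂ B]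
  [NormedAddCommGroup B₂] [NormedSpace ℂ B₂] [NormedAddCommGroup B₃] [NormedSpace ℂ B₃]
  {Γ : Frame q B} {ϱ δ m R : ℝ} {K : ℕ} {a : V3 q → B}

/-- Estimates without twist. -/
lemma DBd.untwist (h : DBd Γ ϱ δ K m R a) :
    Bd dir3 (wt3 ϱ δ) (fun _ => normSeminorm ℂ B) K
      (fun p => (Γ.C * Γ.C * Γ.W 0 * R) * (jap p.1 ^ Γ.M * jap p.2.1 ^ Γ.M * jap p.2.2 ^ (m + Γ.M)))
      a := by
  have hC := Γ.C_pos
  have hR := h.nonneg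
  intro l hl p
  have h1 := h l hl p
  have h2 : Γ.W (p.1, p.2.1) ≤ Γ.C * (jap p.1 ^ Γ.M * jap p.2.1 ^ Γ.M) * Γ.W 0 := by
    have := Γ.W_le 0 (p.1, p.2.1)
    rwa [zero_add] at this
  have h3 : 0 ≤ (l.map fun i => wt3 ϱ δ i p).prod :=
    List.prod_nonneg fun c hc => by
      obtain ⟨i, -, rfl⟩ := List.mem_map.1 hc
      exact wt3_nonneg ϱ δ i p
  have q1 := (jap_rpow_pos p.2.2 Γ.M).le
  have q2 := (jap_rpow_pos p.2.2 m).le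
  refine (Γ.norm_le p.2.2 _).trans ?_
  calc Γ.C * jap p.2.2 ^ Γ.M * ‖Γ.Θ p.2.2 (dl dir3 l a p)‖
      ≤ Γ.C * jap p.2.2 ^ Γ.M * (R * ((Γ.C * (jap p.1 ^ Γ.M * jap p.2.1 ^ Γ.M) * Γ.W 0)
        * jap p.2.2 ^ m) * (l.map fun i => wt3 ϱ δ i p).prod) := by
        refine mul_le_mul_of_nonneg_left (h1.trans ?_) (by positivity)
        dsimp only
        gcongr
    _ = _ := by dsimp only; rw [Real.rpow_add (jap_pos _)]; ring

variable (β : B →L[ℂ] B₂ →L[ℂ] B₃)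

/-- The double symbol `β(a(y, y', η), u(y'))`. -/
def actOn (a : V3 q → B) (u : 𝓢(V q, B₂)) (p : V3 q) : B₃ := β (a p) (u p.2.1)

lemma contDiff_actOn (ha : ContDiff ℝ ∞ a) (u : 𝓢(V q, B₂)) : ContDiff ℝ ∞ (actOn β a u) :=
  contDiff_bilinC β ha ((u.smooth ⊤).comp (by fun_prop))

variable (hβ : ∀ b c, ‖β b c‖ ≤ ‖b‖ * ‖c‖)
include hβ

/-- The decay of `u` of arbitrary order `n` is stored in the weight as `⟨y'⟩^{M - n}`. In exchange
the twist is discarded at the cost of `⟨η⟩^M`, which does no harm in oscillatory integrals. -/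
lemma DBd.actOn (hδ : 0 ≤ δ) (ha : ContDiff ℝ ∞ a) (h : DBd Γ ϱ δ K m R a) (n : ℕ)
    (u : 𝓢(V q, B₂)) :
    DBd (Frame.weighted q B₃ Γ.M (Γ.M - n)) ϱ δ K (m + Γ.M)
      (2 ^ K * (Γ.C * Γ.C * Γ.W 0 * R * schwNorm n K u)) (actOn β a u) := by
  have := Bd.bilin (β.bilinearRestrictScalars ℝ) (N₃ := fun _ => normSeminorm ℂ B₃)
    (fun _ b c => hβ b c) (wt3_nonneg _ _) ha
    ((u.smooth ⊤).comp (by fun_prop : ContDiff ℝ ∞ fun p : V3 q => p.2.1))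
    h.untwist (bd_schwartz_mid hδ n K u)
  refine Bd.mono this (wt3_nonneg _ _) (fun _ _ => le_rfl) (fun p => le_of_eq ?_)
    fun p b => le_rfl
  simp only [Frame.weighted]
  rw [sub_eq_add_neg, Real.rpow_add (jap_pos p.2.1)]
  ring

lemma DSym.actOn (hδ : 0 ≤ δ) (ha : DSym Γ ϱ δ m a) (n : ℕ) (u : 𝓢(V q, B₂)) :
    DSym (Frame.weighted q B₃ Γ.M (Γ.M - n)) ϱ δ (m + Γ.M) (EdgePsiDO.actOn β a u) := by
  refine ⟨contDiff_actOn β ha.1 u, fun K => ?_⟩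
  obtain ⟨R, hR⟩ := ha.2 K
  exact ⟨_, hR.actOn β hβ hδ ha.1 n u⟩

omit hβ in
/-- Restriction to the plane `y' = y`, `η = 0`. -/
lemma DBd.restrict {Γ' : Frame q B} (hΓ : ∀ η, Γ'.Θ η = ContinuousLinearMap.id ℂ B)
    (ha : ContDiff ℝ ∞ a) (h : DBd Γ' ϱ δ K m R a) :
    Bd stdv (fun _ _ => (1 : ℝ)) (fun _ => normSeminorm ℂ B) K
      (fun y => 2 ^ K * (R * Γ'.W (y, y))) (fun y => a (y, y, 0)) := by
  have := Bd.comp_affine (v' := stdv (q := q)) (s' := fun _ _ => (1 : ℝ))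
    (N' := fun _ => normSeminorm ℂ B) (0 : V3 q)
    ((ContinuousLinearMap.id ℝ (V q)).prod ((ContinuousLinearMap.id ℝ (V q)).prod 0))
    (fun i => Sum.elim (fun j => if i = j then 1 else 0)
      (Sum.elim (fun j => if i = j then 1 else 0) fun _ => 0))
    (by intro i; simp [dir3, dirY3, dirYp3, dirEta3, ite_smul])
    (Λ := 2) one_le_two (fun _ _ => zero_le_one)
    (by
      intro i x
      simp [apply_ite abs, wt3, expo3]
      norm_num)
    (D := fun _ => 1) (fun _ => zero_le_one)
    (fun x b => by simp [Frame.nrm_apply, hΓ]) ha h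
  simpa using this

/-- The operator with double symbol `a` on the Schwartz space. -/
theorem exists_op [CompleteSpace B₃] (hϱ : 0 ≤ ϱ) (hδ : 0 ≤ δ) (hδ1 : δ < 1) (hδϱ : δ < ϱ)
    (ha : DSym Γ ϱ δ m a) : ∃ A : 𝓢(V q, B₂) →L[ℂ] 𝓢(V q, B₃), ∀ u y,
      A u y = eop (0, 1, 1) (EdgePsiDO.actOn β a u) (y, y, 0) := by
  -- The operator is thus a value of some `E_σ`, so the sharp estimates apply to it.
  have hw : ((0 : ℝ), (1 : ℝ), (1 : ℝ)) = pth (0, 1) 1 := by simp [pth]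
  have sm : ∀ u : 𝓢(V q, B₂), ContDiff ℝ ∞ (eop (pth (0, 1) 1) (EdgePsiDO.actOn β a u)) :=
    fun u => (ha.actOn β hβ hδ 0 u).contDiff_eop hϱ hδ hδ1 _
  have smd : ∀ u : 𝓢(V q, B₂), ContDiff ℝ ∞
      (fun y => eop (pth (0, 1) 1) (EdgePsiDO.actOn β a u) (y, y, 0)) :=
    fun u => (sm u).comp (by fun_prop : ContDiff ℝ ∞ fun y : V q => ((y, y, 0) : V3 q))
  refine ⟨SchwartzMap.mkCLM (σ := RingHom.id ℂ)
    (fun u y => eop (pth (0, 1) 1) (EdgePsiDO.actOn β a u) (y, y, 0)) ?_ ?_ smd ?_,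
    fun u y => by rw [hw]; rfl⟩
  · intro u v y
    rw [← (ha.actOn β hβ hδ 0 u).eop_add hϱ hδ hδ1 (ha.actOn β hβ hδ 0 v)]
    congr 1
    funext p
    simp [EdgePsiDO.actOn]
  · intro c u y
    rw [RingHom.id_apply, ← (ha.actOn β hβ hδ 0 u).eop_const_smul hϱ hδ hδ1]
    congr 1
    funext p
    simp [EdgePsiDO.actOn]
  · rintro ⟨k, n⟩
    -- On the diagonal the weight is `⟨y⟩^{2M - L}`; this `L` compensates the factor `‖y‖ ^ k` of
    -- the target seminorm.
    obtain ⟨L, hL⟩ := exists_nat_ge (k + Γ.M + Γ.M)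
    obtain ⟨K, C, hC0, hC⟩ := rem_bound hϱ hδ hδ1 hδϱ (Frame.weighted q B₃ Γ.M (Γ.M - L))
      (S := 1) zero_le_one 0 n (m + Γ.M)
    obtain ⟨R, hR⟩ := ha.2 K
    have hR0 := hR.nonneg
    have hCp := Γ.C_pos
    have hWp := Γ.W_pos 0
    refine ⟨Finset.Iic (L, K), q ^ n * (2 ^ n * (C * (2 ^ K * (Γ.C * Γ.C * Γ.W 0 * R * 2 ^ L)))),
      by positivity, fun u y => ?_⟩
    have h1 := hC _ _ (0, 1) (ha.actOn β hβ hδ L u) (hR.actOn β hβ hδ ha.1 L u) (by simp) (by simp)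
    have e : rem 0 (0, 1) (EdgePsiDO.actOn β a u)
        = eop (pth (0, 1) 1) (EdgePsiDO.actOn β a u) := by
      funext p; simp [rem]
    rw [e] at h1
    have h2 := h1.restrict (fun _ => rfl) (sm u)
    have h3 := norm_iteratedFDeriv_le (smd u) n (x := y) fun l hl => by
      simpa using h2 l hl.le y
    have h4 : ‖y‖ ^ k * (jap y ^ Γ.M * jap y ^ (Γ.M - L)) ≤ 1 := by
      rw [← Real.rpow_add (jap_pos y)]
      calc ‖y‖ ^ k * jap y ^ (Γ.M + (Γ.M - L)) ≤ jap y ^ k * jap y ^ (Γ.M + (Γ.M - L)) :=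
            mul_le_mul_of_nonneg_right (pow_le_pow_left₀ (norm_nonneg _) (norm_le_jap y) k)
              (jap_rpow_pos _ _).le
        _ = jap y ^ (k + (Γ.M + (Γ.M - L))) := by rw [Real.rpow_add (jap_pos y) k, Real.rpow_natCast]
        _ ≤ 1 := Real.rpow_le_one_of_one_le_of_nonpos (one_le_jap y) (by linarith)
    set N := ((Finset.Iic (L, K)).sup (schwartzSeminormFamily ℂ (V q) B₂)) u with hN
    have hN0 : 0 ≤ N := apply_nonneg _ _
    have h5 : schwNorm L K u = 2 ^ L * N := rfl
    refine (mul_le_mul_of_nonneg_left h3 (by positivity)).trans ?_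
    rw [h5]
    calc _ = (q ^ n * (2 ^ n * (C * (2 ^ K * (Γ.C * Γ.C * Γ.W 0 * R * 2 ^ L)))) * N)
          * (‖y‖ ^ k * (jap y ^ Γ.M * jap y ^ (Γ.M - L))) := by
          simp only [Frame.weighted]; ring
      _ ≤ _ := mul_le_of_le_one_right (by positivity) h4

end Action

/-! ### The integral formula, and pulled back symbols -/

section Formula

variable {q : ℕ} {B B₂ B₃ : Type*} [NormedAddCommGroup B] [NormedSpace ℂ B]
  [NormedAddCommGroup B₂] [NormedSpace ℂ B₂] [NormedAddCommGroup B₃] [NormedSpace ℂ B₃]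
  {Γ : Frame q B} {ϱ δ m R : ℝ} {K : ℕ} {a : V3 q → B} (β : B →L[ℂ] B₂ →L[ℂ] B₃)

lemma DSym.ampBd_actOn (hϱ : 0 ≤ ϱ) (hδ : 0 ≤ δ) (ha : DSym Γ ϱ δ m a)
    (hβ : ∀ b c, ‖β b c‖ ≤ ‖b‖ * ‖c‖) (n : ℕ) (u : 𝓢(V q, B₂)) (y : V q) (K : ℕ) :
    ∃ R, AmpBd δ K (m + Γ.M) (Γ.M - n) R
      (fun x => EdgePsiDO.actOn β a u ((y, y, 0) + act (0, 1, 1) x)) := by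
  obtain ⟨R, hR⟩ := (ha.actOn β hβ hδ n u).2 K
  have hR0 := hR.nonneg
  have key := Bd.comp_affine (v' := dir2 (q := q)) (s' := wt2 0 δ)
    (N' := fun _ => normSeminorm ℂ B₃) ((y, y, 0) : V3 q) (act (0, 1, 1))
    (Sum.elim (fun i => Sum.elim (fun _ => 0) (Sum.elim (fun j => if i = j then 1 else 0)
        (fun _ => 0)))
      (fun i => Sum.elim (fun _ => 0) (Sum.elim (fun _ => 0) (fun j => if i = j then 1 else 0))))
    (by rintro (i | i) <;> simp [dir2, dir3, dirY, dirYp3, dirEta, dirEta3, ite_smul])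
    (Λ := 1) le_rfl (wt2_nonneg _ _)
    (by
      rintro (i | i) x
      · simp [apply_ite abs, wt3, expo3, wt2]
      · have := Real.rpow_le_one_of_one_le_of_nonpos (one_le_jap x.2) (neg_nonpos.2 hϱ)
        simpa [apply_ite abs, wt3, expo3, wt2] using this)
    (D := fun _ => 1) (fun _ => zero_le_one) (fun x b => by simp [Frame.nrm_apply, Frame.weighted])
    (ha.actOn β hβ hδ n u).1 hR
  refine ⟨R * (jap y ^ Γ.M * (2 * jap y) ^ |Γ.M - n|),
    Bd.mono_right key (wt2_nonneg _ _) fun x => ?_⟩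
  have h1 := jap_rpow_add_le x.1 y (Γ.M - n)
  have p1 := (jap_rpow_pos y Γ.M).le
  have p2 := (jap_rpow_pos x.2 (m + Γ.M)).le
  rw [add_comm] at h1
  simp only [Frame.weighted, act_apply, Prod.mk_add_mk, one_smul, zero_smul, add_zero, zero_add,
    one_pow, one_mul]
  calc R * (jap y ^ Γ.M * jap (y + x.1) ^ (Γ.M - n) * jap x.2 ^ (m + Γ.M))
      ≤ R * (jap y ^ Γ.M * ((2 * jap y) ^ |Γ.M - n| * jap x.1 ^ (Γ.M - n))
        * jap x.2 ^ (m + Γ.M)) := by gcongr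
    _ = _ := by ring

/-- The operator with double symbol `a` is given by iterated absolutely convergent integrals. -/
theorem DSym.op_formula [CompleteSpace B₃] (hϱ : 0 ≤ ϱ) (hδ : 0 ≤ δ) (hδ1 : δ < 1)
    (ha : DSym Γ ϱ δ m a)
    (hβ : ∀ b c, ‖β b c‖ ≤ ‖b‖ * ‖c‖) (u : 𝓢(V q, B₂)) (y : V q) :
    (∀ η, Integrable fun y' : V q =>
      Complex.exp (Complex.I * (inner ℝ (y - y') η : ℝ)) • β (a (y, y', η)) (u y')) ∧
    Integrable (fun η => ∫ y' : V q,
      Complex.exp (Complex.I * (inner ℝ (y - y') η : ℝ)) • β (a (y, y', η)) (u y')) ∧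
    EdgePsiDO.eop (0, 1, 1) (EdgePsiDO.actOn β a u) (y, y, 0) = ((2 * Real.pi) ^ q)⁻¹ • ∫ η, ∫ y' : V q,
      Complex.exp (Complex.I * (inner ℝ (y - y') η : ℝ)) • β (a (y, y', η)) (u y') := by
  -- So much decay of `u` that the order `M - n` in `x` meets the requirement of `osc_eq_iterated`.
  obtain ⟨n, hn⟩ := exists_nat_ge (Γ.M + (q + 2))
  obtain ⟨h1, h2, h3⟩ := osc_eq_iterated hδ hδ1
    (contDiff_comp_affine (contDiff_actOn β ha.1 u) (y, y, 0) (act (0, 1, 1)))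
    (k := Γ.M - n) (by linarith) (ha.ampBd_actOn β hϱ hδ hβ n u y)
  set g : V q → V q → B₃ := fun η y' =>
    Complex.exp (Complex.I * (inner ℝ (y - y') η : ℝ)) • β (a (y, y', η)) (u y') with hg
  -- The substitution `y' = y + x` turns `e^{-ixξ}` into `e^{i(y-y')ξ}`.
  have e : ∀ x ξ : V q, ph (x, ξ) • EdgePsiDO.actOn β a u ((y, y, 0) + act (0, 1, 1) (x, ξ))
      = g ξ (y + x) := by
    intro x ξ
    simp [hg, ph, EdgePsiDO.actOn, inner_neg_left]
  simp only [e] at h1 h2 h3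
  have e2 : ∀ ξ, ∫ x, g ξ (y + x) = ∫ x, g ξ x := fun ξ => integral_add_left_eq_self (g ξ) y
  simp only [e2] at h2 h3
  refine ⟨fun η => ?_, h2, ?_⟩
  · have := (h1 η).comp_add_left (-y)
    simpa using this
  · rw [EdgePsiDO.eop, h3, Complex.coe_smul]

lemma isAmp_schwartz (hδ : 0 ≤ δ) (u : 𝓢(V q, B₂)) :
    IsAmp δ (fun x : V q × V q => u x.1) :=
  ⟨(u.smooth ⊤).comp contDiff_fst, 0, 0, fun K => schwartz_fst_ampBd hδ le_rfl K 0 u⟩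

/-- The map `(y, y', η) ↦ (s y + t y', s y + t y', η)`. -/
def mix (s t : ℝ) : V3 q →L[ℝ] V3 q :=
  (s • ContinuousLinearMap.fst ℝ (V q) (V q × V q) + t • (ContinuousLinearMap.fst ℝ (V q) (V q)).comp
    (ContinuousLinearMap.snd ℝ (V q) (V q × V q))).prod
  ((s • ContinuousLinearMap.fst ℝ (V q) (V q × V q) + t • (ContinuousLinearMap.fst ℝ (V q) (V q)).comp
    (ContinuousLinearMap.snd ℝ (V q) (V q × V q))).prod
    ((ContinuousLinearMap.snd ℝ (V q) (V q)).comp (ContinuousLinearMap.snd ℝ (V q) (V q × V q))))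

@[simp] lemma mix_apply (s t : ℝ) (p : V3 q) :
    mix s t p = (s • p.1 + t • p.2.1, s • p.1 + t • p.2.1, p.2.2) := rfl

lemma jap_mix_le (s t : ℝ) (x y : V q) :
    jap (s • x + t • y) ≤ 2 * ((1 + |s|) * (1 + |t|)) * (jap x * jap y) := by
  have h1 := jap_smul_le s x
  have h2 := jap_smul_le t y
  have h3 := jap_pos x
  have h4 := jap_pos y
  refine (jap_add_le _ _).trans ?_
  calc 2 * jap (t • y) * jap (s • x) ≤ 2 * ((1 + |t|) * jap y) * ((1 + |s|) * jap x) :=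
        mul_le_mul (mul_le_mul_of_nonneg_left h2 two_pos.le) h1 (jap_pos _).le (by positivity)
    _ = _ := by ring

/-- The frame with the weight `W(s y + t y', s y + t y')`. -/
def Frame.mix (Γ : Frame q B) (s t : ℝ) : Frame q B where
  Θ := Γ.Θ
  W y := Γ.W (s • y.1 + t • y.2, s • y.1 + t • y.2)
  C := Γ.C * (2 * ((1 + |s|) * (1 + |t|))) ^ (Γ.M + Γ.M)
  M := Γ.M + Γ.M
  one_le_C := one_le_mul_of_one_le_of_one_le Γ.one_le_C (Real.one_le_rpow
    (by nlinarith [abs_nonneg s, abs_nonneg t, mul_nonneg (abs_nonneg s) (abs_nonneg t)])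
    (add_nonneg Γ.M_nonneg Γ.M_nonneg))
  M_nonneg := add_nonneg Γ.M_nonneg Γ.M_nonneg
  Θ_zero := Γ.Θ_zero
  Θ_le η ξ b := by
    refine (Γ.Θ_le η ξ b).trans (mul_le_mul_of_nonneg_right ?_ (norm_nonneg _))
    refine mul_le_mul (le_mul_of_one_le_right Γ.C_pos.le (Real.one_le_rpow
      (by nlinarith [abs_nonneg s, abs_nonneg t, mul_nonneg (abs_nonneg s) (abs_nonneg t)])
      (add_nonneg Γ.M_nonneg Γ.M_nonneg)))
      (jap_rpow_mono _ (le_add_of_nonneg_left Γ.M_nonneg)) (jap_rpow_pos _ _).le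
      (mul_nonneg Γ.C_pos.le (by positivity))
  W_pos y := Γ.W_pos _
  W_le y x := by
    have h := Γ.W_le (s • y.1 + t • y.2, s • y.1 + t • y.2)
      (s • x.1 + t • x.2, s • x.1 + t • x.2)
    have e : s • (y + x).1 + t • (y + x).2 = s • y.1 + t • y.2 + (s • x.1 + t • x.2) := by
      simp only [Prod.fst_add, Prod.snd_add, smul_add]; abel
    rw [e]
    refine h.trans (mul_le_mul_of_nonneg_right ?_ (Γ.W_pos _).le)
    have hc : 0 ≤ 2 * ((1 + |s|) * (1 + |t|)) := by positivity
    have p1 := jap_pos x.1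
    have p2 := jap_pos x.2
    rw [mul_assoc]
    refine mul_le_mul_of_nonneg_left ?_ Γ.C_pos.le
    rw [← Real.rpow_add (jap_pos _), ← Real.mul_rpow p1.le p2.le, ← Real.mul_rpow hc (by positivity)]
    exact Real.rpow_le_rpow (jap_pos _).le (jap_mix_le s t x.1 x.2)
      (add_nonneg Γ.M_nonneg Γ.M_nonneg)

/-- The substitution is linear and fixes `η`; only the weight changes, and it stays tempered. In
this way `τ`-symbols become double symbols with weight `⟨τy' + (1-τ)y⟩^μ`, which is not a product of
powers. -/
lemma DBd.mix (ha : ContDiff ℝ ∞ a) (h : DBd Γ ϱ δ K m R a) (s t : ℝ) :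
    DBd (Γ.mix s t) ϱ δ K m ((1 + 2 * |s| + 2 * |t|) ^ K * R)
      (fun p => a (EdgePsiDO.mix s t p)) := by
  have := Bd.comp_affine (v' := dir3 (q := q)) (s' := wt3 ϱ δ)
    (N' := fun p => (Γ.mix s t).nrm p.2.2) (0 : V3 q) (EdgePsiDO.mix s t)
    (Sum.elim (fun i => Sum.elim (fun j => if i = j then s else 0)
        (Sum.elim (fun j => if i = j then s else 0) (fun _ => 0)))
      (Sum.elim (fun i => Sum.elim (fun j => if i = j then t else 0)
        (Sum.elim (fun j => if i = j then t else 0) (fun _ => 0)))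
      (fun i => Sum.elim (fun _ => 0) (Sum.elim (fun _ => 0) (fun j => if i = j then 1 else 0)))))
    (by rintro (i | i | i) <;> simp [dir3, dirY3, dirYp3, dirEta3, ite_smul])
    (Λ := 1 + 2 * |s| + 2 * |t|) (by linarith [abs_nonneg s, abs_nonneg t]) (wt3_nonneg _ _)
    (by
      have b1 := abs_nonneg s
      have b2 := abs_nonneg t
      rintro (i | i | i) x
      all_goals
        have hx := jap_rpow_pos x.2.2 δ
        have hx' := jap_rpow_pos x.2.2 (-ϱ)
        simp [apply_ite abs, wt3, expo3]
        nlinarith [mul_nonneg b1 hx.le, mul_nonneg b2 hx.le, mul_nonneg b1 hx'.le,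
          mul_nonneg b2 hx'.le])
    (D := fun _ => 1) (fun _ => zero_le_one)
    (fun x b => by simp [Frame.nrm_apply, Frame.mix]) ha h
  refine Bd.mono_right (by simpa using this) (wt3_nonneg _ _) fun p => le_of_eq ?_
  simp [Frame.mix]
  ring

lemma DSym.mix (ha : DSym Γ ϱ δ m a) (s t : ℝ) :
    DSym (Γ.mix s t) ϱ δ m (fun p => a (EdgePsiDO.mix s t p)) := by
  refine ⟨ha.1.comp (EdgePsiDO.mix s t).contDiff, fun K => ?_⟩
  obtain ⟨R, hR⟩ := ha.2 K
  exact ⟨_, hR.mix ha.1 s t⟩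

/-- Reduction of a double symbol to a `τ`-symbol. -/
theorem DSym.op_eq_op_tau [CompleteSpace B] (hϱ : 0 ≤ ϱ) (hδ : 0 ≤ δ)
    (hδ1 : δ < 1) (hδϱ : δ < ϱ) (ha : DSym Γ ϱ δ m a) (hβ : ∀ b c, ‖β b c‖ ≤ ‖b‖ * ‖c‖) (τ : ℝ)
    (u : 𝓢(V q, B₂)) (y : V q) :
    EdgePsiDO.eop (0, 1, 1) (EdgePsiDO.actOn β a u) (y, y, 0)
      = EdgePsiDO.eop (0, 1, 1) (EdgePsiDO.actOn β
        (fun p => EdgePsiDO.eop (pth (-τ, 1 - τ) 1) a (EdgePsiDO.mix (1 - τ) τ p)) u)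
        (y, y, 0) := by
  have hv := isAmp_schwartz hδ (u.compSubConstCLM ℂ (-y))
  -- With `v(x) = u(y + x)`, `r = (0, 1)` and `σ = (-τ, 1-τ)`, the shifts `r - σ` in the first two
  -- variables are both `τ`. So `E_σ a` is evaluated at coinciding points `y + τx = (1-τ)y + τ(y +
  -- x)`.
  have h := ha.osc_bilin_eop hϱ hδ hδ1 β (v := fun x => u.compSubConstCLM ℂ (-y) x) hv
    (-τ, 1 - τ) (0, 1) (y, y, 0) hδϱ hβ
  rw [EdgePsiDO.eop, EdgePsiDO.eop]
  congr 1
  refine (Eq.trans ?_ h).trans ?_ <;> congr 1 <;> funext x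
  · simp [EdgePsiDO.actOn, add_comm]
  · simp only [EdgePsiDO.actOn, act_apply, SchwartzMap.compSubConstCLM_apply, mix_apply,
      Prod.mk_add_mk, sub_neg_eq_add, zero_smul, one_smul, add_zero, zero_add]
    have e1 : y + τ • x.1 = (1 - τ) • y + τ • (y + x.1) := by
      rw [smul_add, sub_smul, one_smul]; abel
    have e2 : y + ((1 : ℝ) - (1 - τ)) • x.1 = (1 - τ) • y + τ • (y + x.1) := by
      rw [sub_sub_cancel, e1]
    rw [e1, e2, add_comm x.1 y]

end Formula

/-! ### The frame of a pair of group actions -/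

section GroupActions

variable {E : SepHilb.{u}} (κ : GroupAction E)

/-- The norm of a strongly continuous group action grows at most polynomially. -/
lemma GroupAction.exists_norm_le : ∃ C M : ℝ, 1 ≤ C ∧ 0 ≤ M ∧
    ∀ r : {r : ℝ // 0 < r}, ‖κ.toHom r‖ ≤ C * Real.exp (M * |Real.log r|) := by
  set e : ℝ → {r : ℝ // 0 < r} := fun s => ⟨Real.exp s, Real.exp_pos s⟩ with he
  have ce : Continuous e := Real.continuous_exp.subtype_mk _
  -- Strong continuity bounds every orbit over the compact set `|log r| ≤ 1`, hence the operators
  -- uniformly. A general `r` is the `n`-th power of an element of this set with `n = ⌈|log r|⌉`.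
  obtain ⟨C₀, hC₀⟩ := banach_steinhaus (g := fun s : Set.Icc (-1 : ℝ) 1 => κ.toHom (e s)) fun x => by
    obtain ⟨D, hD⟩ := (isCompact_Icc (a := (-1 : ℝ)) (b := 1)).exists_bound_of_continuousOn
      ((κ.continuous_apply x).comp ce).continuousOn
    exact ⟨D, fun s => hD s s.2⟩
  set C := max C₀ 1 with hC
  have hC1 : 1 ≤ C := le_max_right _ _
  have hCp : 0 < C := zero_lt_one.trans_le hC1
  refine ⟨C, Real.log C, hC1, Real.log_nonneg hC1, fun r => ?_⟩
  set s := Real.log r with hs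
  set n := ⌈|s|⌉₊ with hn
  have hsn : |s| ≤ n := Nat.le_ceil _
  have hpow : κ.toHom r = κ.toHom (e (s / n)) ^ n := by
    rw [← map_pow]
    congr 1
    apply Subtype.ext
    have h1 : (((e (s / n)) ^ n : {r : ℝ // 0 < r}) : ℝ) = Real.exp (s / n) ^ n := rfl
    rw [h1, ← Real.exp_nat_mul]
    rcases Nat.eq_zero_or_pos n with h0 | h0
    · have : |s| ≤ 0 := by simpa [h0] using hsn
      have hs0 : s = 0 := abs_nonpos_iff.1 this
      rw [h0, ← Real.exp_log r.2, ← hs, hs0]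
      simp
    · have : (n : ℝ) ≠ 0 := by positivity
      rw [mul_div_cancel₀ _ this, hs, Real.exp_log r.2]
  have hle : ‖κ.toHom (e (s / n))‖ ≤ C := by
    refine le_trans ?_ (le_max_left _ _)
    have hm : s / n ∈ Set.Icc (-1 : ℝ) 1 := by
      rw [Set.mem_Icc, ← abs_le, abs_div, Nat.abs_cast]
      exact div_le_one_of_le₀ hsn (Nat.cast_nonneg _)
    exact hC₀ ⟨_, hm⟩
  have hpn : ‖κ.toHom r‖ ≤ C ^ n := by
    rw [hpow]
    clear hpow
    generalize κ.toHom (e (s / n)) = T at hle ⊢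
    clear_value n
    clear hsn hn
    induction n with
    | zero =>
      rw [pow_zero, pow_zero]
      exact ContinuousLinearMap.norm_id_le
    | succ k ih =>
      rw [pow_succ, pow_succ]
      exact (ContinuousLinearMap.opNorm_comp_le _ _).trans
        (mul_le_mul ih hle (norm_nonneg _) (by positivity))
  refine hpn.trans ?_
  have hn1 : (n : ℝ) ≤ 1 + |s| := by
    have := Nat.ceil_lt_add_one (abs_nonneg s)
    linarith
  calc C ^ n = C ^ (n : ℝ) := (Real.rpow_natCast _ _).symm
    _ ≤ C ^ (1 + |s|) := Real.rpow_le_rpow_of_exponent_le hC1 hn1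
    _ = _ := by
      rw [Real.rpow_add hCp, Real.rpow_one, Real.rpow_def_of_pos hCp]

/-- The elementary form of Peetre's inequality, once for `η + ξ` and once for `η = (η + ξ) - ξ`,
bounds the quotient from both sides. -/
lemma abs_log_jap_le {q : ℕ} (η ξ : V q) :
    |Real.log (jap (η + ξ) / jap η)| ≤ Real.log (2 * jap ξ) := by
  have h1 := jap_pos η
  have h2 := jap_pos ξ
  have h3 := jap_pos (η + ξ)
  have b1 := jap_add_le η ξ
  have b2 := jap_add_le (η + ξ) (-ξ)
  rw [add_neg_cancel_right, jap_neg] at b2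
  rw [abs_le, ← Real.log_inv]
  constructor
  · refine Real.log_le_log (by positivity) ?_
    rw [le_div_iff₀ h1, inv_mul_le_iff₀ (by positivity)]
    exact b2
  · refine Real.log_le_log (by positivity) ?_
    rw [div_le_iff₀ h1]
    exact b1

end GroupActions

/-! ### The operator ideal, its twist and the associated frame -/

section Frames

variable {q : ℕ} (J : NormedOperatorIdeal.{u}) {E F : SepHilb.{u}}
  (κ : GroupAction E) (κ' : GroupAction F)

lemma norm_sandwich_le {E₀ E F F₁ : SepHilb.{u}} (G : F →L[ℂ] F₁) (H : E₀ →L[ℂ] E)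
    (A : J.Comp E F) : ‖J.sandwich G H A‖ ≤ ‖G‖ * ‖A‖ * ‖H‖ := J.nrm_sandwich_le G H A

/-- The twist as a bounded operator. -/
def twistL (η : V q) : J.Comp E F →L[ℂ] J.Comp E F :=
  (twist J κ κ' η).mkContinuous (‖κ'.toHom (japPos η)⁻¹‖ * ‖κ.toHom (japPos η)‖) fun A =>
    (norm_sandwich_le J _ _ A).trans (le_of_eq (by ring))

lemma twistL_apply (η : V q) (A : J.Comp E F) : twistL J κ κ' η A = twist J κ κ' η A := rfl

lemma toOp_sandwich {E₀ E F F₁ : SepHilb.{u}} (G : F →L[ℂ] F₁) (H : E₀ →L[ℂ] E)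
    (A : J.Comp E F) : J.toOp (J.sandwich G H A) = G ∘L J.toOp A ∘L H := rfl

lemma toOp_injective : Function.Injective (J.toOp : J.Comp E F →ₗ[ℂ] (E →L[ℂ] F)) :=
  Subtype.val_injective

/-- The ideal property is applied to the composition of `A` with the rank-one map `z ↦ ⟨x, z⟩x`. The
composition has rank one, so its ideal norm is exactly `‖x‖ ‖Ax‖`. -/
lemma norm_toOp_apply_le (A : J.Comp E F) (x : E) : ‖J.toOp A x‖ ≤ ‖A‖ * ‖x‖ := by
  rcases eq_or_ne x 0 with rfl | hx
  · simp
  have h := norm_sandwich_le J (ContinuousLinearMap.id ℂ F) ((innerSL ℂ x).smulRight x) A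
  have e : J.sandwich (ContinuousLinearMap.id ℂ F) ((innerSL ℂ x).smulRight x) A
      = J.toOperatorIdeal.rankOne (innerSL ℂ x) (J.toOp A x) := by
    apply toOp_injective J
    ext z
    exact (J.toOp A).map_smul _ _
  have e2 : ‖J.sandwich (ContinuousLinearMap.id ℂ F) ((innerSL ℂ x).smulRight x) A‖
      = ‖x‖ * ‖J.toOp A x‖ := by
    rw [e]
    exact (J.nrm_rankOne _ _).trans (by rw [innerSL_apply_norm])
  rw [e2, ContinuousLinearMap.norm_smulRight_apply, innerSL_apply_norm] at h
  have hx' : 0 < ‖x‖ := norm_pos_iff.2 hx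
  have h3 : ‖ContinuousLinearMap.id ℂ F‖ * ‖A‖ ≤ ‖A‖ :=
    mul_le_of_le_one_left (norm_nonneg _) ContinuousLinearMap.norm_id_le
  refine le_of_mul_le_mul_left ?_ hx'
  calc ‖x‖ * ‖J.toOp A x‖ ≤ _ := h
    _ ≤ ‖A‖ * (‖x‖ * ‖x‖) := mul_le_mul_of_nonneg_right h3 (by positivity)
    _ = _ := by ring

/-- The evaluation `(A, x) ↦ A x`. -/
def evalB : J.Comp E F →L[ℂ] E →L[ℂ] F :=
  J.toOp.mkContinuous 1 fun A => by
    rw [one_mul]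
    exact ContinuousLinearMap.opNorm_le_bound _ (norm_nonneg _) (norm_toOp_apply_le J A)

lemma evalB_apply (A : J.Comp E F) (x : E) : evalB J A x = J.toOp A x := rfl

lemma norm_evalB_le (A : J.Comp E F) (x : E) : ‖evalB J A x‖ ≤ ‖A‖ * ‖x‖ :=
  norm_toOp_apply_le J A x

lemma twist_zero (A : J.Comp E F) : twist J κ κ' (0 : V q) A = A := by
  have h : japPos (0 : V q) = 1 := Subtype.ext jap_zero
  apply toOp_injective J
  rw [twist, toOp_sandwich, h, inv_one, map_one, map_one]
  rfl

/-- By the group property, twists at `η` and `η + ξ` differ by conjugation with the action of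
`⟨η+ξ⟩/⟨η⟩`, whose norm grows at most polynomially in `⟨ξ⟩`. -/
lemma twist_eq (η ξ : V q) (A : J.Comp E F) : twist J κ κ' η A
    = J.sandwich (κ'.toHom (japPos (η + ξ) / japPos η)) (κ.toHom (japPos (η + ξ) / japPos η)⁻¹)
      (twist J κ κ' (η + ξ) A) := by
  apply toOp_injective J
  rw [twist, twist, toOp_sandwich, toOp_sandwich, toOp_sandwich]
  have h1 : κ'.toHom (japPos η)⁻¹
      = κ'.toHom (japPos (η + ξ) / japPos η) ∘L κ'.toHom (japPos (η + ξ))⁻¹ := by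
    change _ = κ'.toHom _ * κ'.toHom _
    rw [← map_mul]
    congr 1
    rw [div_mul_eq_mul_div, mul_inv_cancel, one_div]
  have h2 : κ.toHom (japPos η)
      = κ.toHom (japPos (η + ξ)) ∘L κ.toHom (japPos (η + ξ) / japPos η)⁻¹ := by
    change _ = κ.toHom _ * κ.toHom _
    rw [← map_mul]
    congr 1
    rw [inv_div, mul_div_cancel]
  rw [h1, h2]
  rfl

/-- Temperedness of the twist follows from `twist_eq`, the polynomial growth of both actions and
`abs_log_jap_le`; that of the weight is Peetre's inequality. One pair of constants is taken large
enough for both. -/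
lemma exists_frame (q : ℕ) (k l : ℝ) : ∃ Γ : Frame q (J.Comp E F),
    (∀ η A, Γ.Θ η A = twist J κ κ' η A) ∧ ∀ y, Γ.W y = jap y.1 ^ k * jap y.2 ^ l := by
  obtain ⟨C, M, hC, hM, h⟩ := κ.exists_norm_le
  obtain ⟨C', M', hC', hM', h'⟩ := κ'.exists_norm_le
  set Γ₀ := Frame.weighted q (J.Comp E F) k l with hΓ₀
  have hΓM := Γ₀.M_nonneg
  have hΓC := Γ₀.one_le_C
  have hD : 1 ≤ C' * C * 2 ^ (M' + M) := one_le_mul_of_one_le_of_one_le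
    (one_le_mul_of_one_le_of_one_le hC' hC) (Real.one_le_rpow one_le_two (by positivity))
  refine ⟨{ Θ := twistL J κ κ', W := Γ₀.W, C := C' * C * 2 ^ (M' + M) * Γ₀.C, M := M' + M + Γ₀.M,
            one_le_C := one_le_mul_of_one_le_of_one_le hD hΓC
            M_nonneg := by positivity
            Θ_zero := by ext1 A; exact twist_zero J κ κ' A
            Θ_le := fun η ξ A => ?_
            W_pos := Γ₀.W_pos
            W_le := fun y x => ?_ }, fun η A => rfl, fun y => rfl⟩
  · rw [twistL_apply, twistL_apply, twist_eq J κ κ' η ξ A]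
    refine (norm_sandwich_le J _ _ _).trans ?_
    rw [mul_right_comm]
    refine mul_le_mul_of_nonneg_right ?_ (norm_nonneg _)
    have hx := jap_pos ξ
    have key : |Real.log (japPos (η + ξ) / japPos η : {r : ℝ // 0 < r})| ≤ Real.log (2 * jap ξ) :=
      abs_log_jap_le η ξ
    have key2 : |Real.log ((japPos (η + ξ) / japPos η)⁻¹ : {r : ℝ // 0 < r})|
        ≤ Real.log (2 * jap ξ) := by
      have e : (((japPos (η + ξ) / japPos η)⁻¹ : {r : ℝ // 0 < r}) : ℝ)
          = ((japPos (η + ξ) / japPos η : {r : ℝ // 0 < r}) : ℝ)⁻¹ := rfl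
      rw [e, Real.log_inv, abs_neg]
      exact key
    have ex : ∀ M : ℝ, Real.exp (M * Real.log (2 * jap ξ)) = 2 ^ M * jap ξ ^ M := fun M => by
      rw [← Real.mul_rpow two_pos.le hx.le, Real.rpow_def_of_pos (by positivity), mul_comm]
    have g1 := (h' (japPos (η + ξ) / japPos η)).trans (mul_le_mul_of_nonneg_left
      (Real.exp_le_exp.2 (mul_le_mul_of_nonneg_left key hM')) (zero_le_one.trans hC'))
    have g2 := (h (japPos (η + ξ) / japPos η)⁻¹).trans (mul_le_mul_of_nonneg_left
      (Real.exp_le_exp.2 (mul_le_mul_of_nonneg_left key2 hM)) (zero_le_one.trans hC))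
    rw [ex] at g1 g2
    have hpos : 0 ≤ C' * C * 2 ^ (M' + M) := zero_le_one.trans hD
    calc _ ≤ (C' * (2 ^ M' * jap ξ ^ M')) * (C * (2 ^ M * jap ξ ^ M)) :=
          mul_le_mul g1 g2 (norm_nonneg _) (by positivity)
      _ = C' * C * 2 ^ (M' + M) * 1 * jap ξ ^ (M' + M) := by
          rw [Real.rpow_add two_pos, Real.rpow_add hx]; ring
      _ ≤ _ := by
          refine mul_le_mul (mul_le_mul_of_nonneg_left hΓC hpos)
            (jap_rpow_mono _ (by linarith)) (jap_rpow_pos _ _).le (by positivity)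
  · refine (Γ₀.W_le y x).trans (mul_le_mul_of_nonneg_right ?_ (Γ₀.W_pos _).le)
    have hM0 : Γ₀.M ≤ M' + M + Γ₀.M := by linarith
    refine mul_le_mul (le_mul_of_one_le_left (zero_le_one.trans hΓC) hD)
      (mul_le_mul (jap_rpow_mono _ hM0) (jap_rpow_mono _ hM0) (jap_rpow_pos _ _).le
        (jap_rpow_pos _ _).le)
      (mul_nonneg (jap_rpow_pos _ _).le (jap_rpow_pos _ _).le) (by positivity)

/-- The frame with the twist of the group actions and the weight `⟨y⟩^k ⟨y'⟩^l`. -/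
def frame (q : ℕ) (k l : ℝ) : Frame q (J.Comp E F) := (exists_frame J κ κ' q k l).choose

lemma frame_Θ (k l : ℝ) (η : V q) (A : J.Comp E F) :
    (frame J κ κ' q k l).Θ η A = twist J κ κ' η A := (exists_frame J κ κ' q k l).choose_spec.1 η A

lemma frame_W (k l : ℝ) (y : V q × V q) :
    (frame J κ κ' q k l).W y = jap y.1 ^ k * jap y.2 ^ l :=
  (exists_frame J κ κ' q k l).choose_spec.2 y

end Frames

/-! ### Multi-indices and words -/

section MultiIndex

variable {q : ℕ} {ι X B : Type*} [NormedAddCommGroup X] [NormedSpace ℝ X]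
  [NormedAddCommGroup B] [NormedSpace ℂ B]

/-- The word in which each letter `j` occurs `α j` times. -/
def wd (α : Fin q → ℕ) : List (Fin q) :=
  (List.finRange q).foldr (fun j w => w ++ List.replicate (α j) j) []

lemma dl_replicate (v : ι → X) (n : ℕ) (i : ι) (f : X → B) :
    dl v (List.replicate n i) f = (fun (h : X → B) (x : X) => fderiv ℝ h x (v i))^[n] f := by
  induction n generalizing f with
  | zero => rfl
  | succ n ih => rw [List.replicate_succ, dl_cons, ih, Function.iterate_succ_apply]; rfl

lemma dl_map {κ : Type*} (v : ι → X) (g : κ → ι) (l : List κ) (f : X → B) :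
    dl v (l.map g) f = dl (fun k => v (g k)) l f := by
  induction l generalizing f with
  | nil => rfl
  | cons i l ih => rw [List.map_cons, dl_cons, ih]; rfl

lemma dl_wd (v : Fin q → X) (α : Fin q → ℕ) (f : X → B) : dl v (wd α) f = mderiv v α f := by
  unfold wd mderiv
  induction List.finRange q with
  | nil => rfl
  | cons j L ih => rw [List.foldr_cons, List.foldr_cons, dl_append, ih, dl_replicate]

lemma count_wd (α : Fin q → ℕ) (i : Fin q) : (wd α).count i = α i := by
  have h : ∀ L : List (Fin q), (L.foldr (fun j w => w ++ List.replicate (α j) j) []).count i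
      = (L.map fun j => if j = i then α j else 0).sum := by
    intro L
    induction L with
    | nil => rfl
    | cons j L ih =>
      rw [List.foldr_cons, List.count_append, ih, List.map_cons, List.sum_cons,
        List.count_replicate, add_comm]
      simp
  rw [wd, h, ← Fin.sum_univ_def]
  simp

lemma length_wd (α : Fin q → ℕ) : (wd α).length = len α := by
  have h : ∀ L : List (Fin q), (L.foldr (fun j w => w ++ List.replicate (α j) j) []).length
      = (L.map α).sum := by
    intro L
    induction L with
    | nil => rfl
    | cons j L ih =>
      rw [List.foldr_cons, List.length_append, ih, List.map_cons, List.sum_cons,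
        List.length_replicate, add_comm]
  rw [wd, h, ← Fin.sum_univ_def]
  rfl

/-- The word for `∂_y^β ∂_η^α`. -/
def wd2 (α β : Fin q → ℕ) : List (Fin q ⊕ Fin q) := (wd α).map Sum.inr ++ (wd β).map Sum.inl

/-- The word for `∂_y^β ∂_{y'}^γ ∂_η^α`. -/
def wd3 (α β γ : Fin q → ℕ) : List (Fin q ⊕ (Fin q ⊕ Fin q)) :=
  (wd α).map (fun j => Sum.inr (Sum.inr j)) ++ ((wd γ).map (fun j => Sum.inr (Sum.inl j))
    ++ (wd β).map Sum.inl)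

lemma length_wd2 (α β : Fin q → ℕ) : (wd2 α β).length = len α + len β := by
  simp [wd2, length_wd]

lemma length_wd3 (α β γ : Fin q → ℕ) : (wd3 α β γ).length = len α + (len γ + len β) := by
  simp [wd3, length_wd]

lemma count_map_eq_zero {κ : Type*} [DecidableEq ι] {g : κ → ι} {i : ι} (h : ∀ k, g k ≠ i)
    (l : List κ) : (l.map g).count i = 0 := by
  rw [List.count_eq_zero]
  intro hi
  obtain ⟨k, -, hk⟩ := List.mem_map.1 hi
  exact h k hk

/-- Up to order a word is given by the number of occurrences of each letter, that is, by
multi-indices. -/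
lemma exists_perm_wd2 (l : List (Fin q ⊕ Fin q)) : ∃ α β, l.Perm (wd2 α β) := by
  let _ : BEq (Fin q ⊕ Fin q) := instBEqOfDecidableEq
  refine ⟨fun j => l.count (Sum.inr j), fun j => l.count (Sum.inl j), List.perm_iff_count.2 ?_⟩
  rintro (j | j)
  · rw [wd2, List.count_append, count_map_eq_zero (by simp),
      List.count_map_of_injective _ _ Sum.inl_injective, count_wd, zero_add]
  · rw [wd2, List.count_append, count_map_eq_zero (g := Sum.inl) (by simp),
      List.count_map_of_injective _ _ Sum.inr_injective, count_wd, add_zero]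

lemma exists_perm_wd3 (l : List (Fin q ⊕ (Fin q ⊕ Fin q))) :
    ∃ α β γ, l.Perm (wd3 α β γ) := by
  let _ : BEq (Fin q ⊕ (Fin q ⊕ Fin q)) := instBEqOfDecidableEq
  refine ⟨fun j => l.count (Sum.inr (Sum.inr j)), fun j => l.count (Sum.inl j),
    fun j => l.count (Sum.inr (Sum.inl j)), List.perm_iff_count.2 ?_⟩
  have i1 : Function.Injective fun j : Fin q => (Sum.inr (Sum.inr j) : Fin q ⊕ (Fin q ⊕ Fin q)) :=
    Sum.inr_injective.comp Sum.inr_injective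
  have i2 : Function.Injective fun j : Fin q => (Sum.inr (Sum.inl j) : Fin q ⊕ (Fin q ⊕ Fin q)) :=
    Sum.inr_injective.comp Sum.inl_injective
  rintro (j | j | j)
  · rw [wd3, List.count_append, List.count_append, count_map_eq_zero (by simp),
      count_map_eq_zero (by simp), List.count_map_of_injective _ _ Sum.inl_injective, count_wd]
    simp
  · rw [wd3, List.count_append, List.count_append, count_map_eq_zero (by simp),
      count_map_eq_zero (g := Sum.inl) (by simp), List.count_map_of_injective _ _ i2, count_wd]
    simp
  · rw [wd3, List.count_append, List.count_append, count_map_eq_zero (g := Sum.inl) (by simp),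
      count_map_eq_zero (g := fun j => Sum.inr (Sum.inl j)) (by simp),
      List.count_map_of_injective _ _ i1, count_wd]
    simp

lemma dl_wd2 (α β : Fin q → ℕ) (f : V q × V q → B) :
    dl dir2 (wd2 α β) f = mderiv dirY β (mderiv dirEta α f) := by
  rw [wd2, dl_append, dl_map, dl_map, ← dl_wd, ← dl_wd]
  rfl

lemma dl_wd3 (α β γ : Fin q → ℕ) (f : V3 q → B) :
    dl dir3 (wd3 α β γ) f = mderiv dirY3 β (mderiv dirYp3 γ (mderiv dirEta3 α f)) := by
  rw [wd3, dl_append, dl_append, dl_map, dl_map, dl_map, ← dl_wd, ← dl_wd, ← dl_wd]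
  rfl

lemma prod_wd2 (ϱ δ : ℝ) (α β : Fin q → ℕ) (p : V q × V q) :
    ((wd2 α β).map fun i => wt2 ϱ δ i p).prod = jap p.2 ^ (-ϱ * len α + δ * len β) := by
  simp only [wd2, List.map_append, List.map_map, List.prod_append, Function.comp_def, wt2,
    Sum.elim_inl, Sum.elim_inr, List.map_const', List.prod_replicate, length_wd]
  rw [Real.rpow_add (jap_pos _), Real.rpow_mul (jap_pos _).le, Real.rpow_mul (jap_pos _).le,
    Real.rpow_natCast, Real.rpow_natCast]

lemma prod_wd3 (ϱ δ : ℝ) (α β γ : Fin q → ℕ) (p : V3 q) :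
    ((wd3 α β γ).map fun i => wt3 ϱ δ i p).prod
      = jap p.2.2 ^ (-ϱ * len α + δ * (len β + len γ)) := by
  simp only [wd3, List.map_append, List.map_map, List.prod_append, Function.comp_def, wt3, expo3,
    Sum.elim_inl, Sum.elim_inr, List.map_const', List.prod_replicate, length_wd]
  rw [mul_add, Real.rpow_add (jap_pos _), Real.rpow_add (jap_pos _), Real.rpow_mul (jap_pos _).le,
    Real.rpow_mul (jap_pos _).le, Real.rpow_mul (jap_pos _).le,
    Real.rpow_natCast, Real.rpow_natCast, Real.rpow_natCast]
  ring

/-- The multi-indices with entries at most `K`. -/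
def box (q K : ℕ) : Finset (Fin q → ℕ) := Fintype.piFinset fun _ => Finset.range (K + 1)

lemma mem_box_of_len_le {K : ℕ} {α : Fin q → ℕ} (h : len α ≤ K) : α ∈ box q K := by
  rw [box, Fintype.mem_piFinset]
  intro j
  rw [Finset.mem_range, Nat.lt_succ_iff]
  exact (Finset.single_le_sum (fun _ _ => Nat.zero_le _) (Finset.mem_univ j)).trans h

end MultiIndex

/-! ### The symbol classes of the statement -/

section SymbolClasses

variable {q : ℕ} {J : NormedOperatorIdeal.{u}} {E F : SepHilb.{u}}
  {κ : GroupAction E} {κ' : GroupAction F} {ϱ δ m μ R : ℝ} {K : ℕ}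

variable (κ κ') in
/-- The symbol estimates with constant `R` for at most `K` derivatives. -/
def SBd (ϱ δ m μ : ℝ) (K : ℕ) (R : ℝ) (a : V q × V q → J.Comp E F) : Prop :=
  Bd dir2 (wt2 ϱ δ) (fun p => (normSeminorm ℂ (J.Comp E F)).comp (twist J κ κ' p.2)) K
    (fun p => R * (jap p.1 ^ μ * jap p.2 ^ m)) a

lemma sbd_iff {a : V q × V q → J.Comp E F} (ha : ContDiff ℝ ∞ a) :
    SBd κ κ' ϱ δ m μ K R a ↔ ∀ α β : Fin q → ℕ, len α + len β ≤ K → ∀ y η : V q,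
      ‖twist J κ κ' η (mderiv dirY β (mderiv dirEta α a) (y, η))‖
        ≤ R * (jap y ^ μ * jap η ^ (m - ϱ * len α + δ * len β)) := by
  have e : ∀ (α β : Fin q → ℕ) (p : V q × V q),
      R * (jap p.1 ^ μ * jap p.2 ^ (m - ϱ * len α + δ * len β))
      = R * (jap p.1 ^ μ * jap p.2 ^ m) * ((wd2 α β).map fun i => wt2 ϱ δ i p).prod := by
    intro α β p
    rw [prod_wd2, show m - ϱ * len α + δ * len β = m + (-ϱ * len α + δ * len β) by ring,
      Real.rpow_add (jap_pos _)]
    ring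
  constructor
  · intro h α β hK y η
    have h1 := h (wd2 α β) (by rwa [length_wd2]) (y, η)
    rw [dl_wd2] at h1
    rw [e α β (y, η)]
    exact h1
  · intro h l hl p
    obtain ⟨α, β, hp⟩ := exists_perm_wd2 l
    rw [dl_perm ha _ hp, dl_wd2, (hp.map _).prod_eq]
    have h1 := h α β (by rwa [← length_wd2, ← hp.length_eq]) p.1 p.2
    rw [e α β p] at h1
    exact h1

lemma dbd_iff {k l : ℝ} {a : V3 q → J.Comp E F} (ha : ContDiff ℝ ∞ a) :
    DBd (frame J κ κ' q k l) ϱ δ K m R a ↔ ∀ α β γ : Fin q → ℕ, len α + (len γ + len β) ≤ K →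
      ∀ y y' η : V q,
      ‖twist J κ κ' η (mderiv dirY3 β (mderiv dirYp3 γ (mderiv dirEta3 α a)) (y, y', η))‖
        ≤ R * (jap y ^ k * jap y' ^ l * jap η ^ (m - ϱ * len α + δ * (len β + len γ))) := by
  have e : ∀ (α β γ : Fin q → ℕ) (p : V3 q),
      R * (jap p.1 ^ k * jap p.2.1 ^ l * jap p.2.2 ^ (m - ϱ * len α + δ * (len β + len γ)))
      = R * ((frame J κ κ' q k l).W (p.1, p.2.1) * jap p.2.2 ^ m)
        * ((wd3 α β γ).map fun i => wt3 ϱ δ i p).prod := by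
    intro α β γ p
    rw [prod_wd3, frame_W, show m - ϱ * len α + δ * (len β + len γ)
      = m + (-ϱ * len α + δ * (len β + len γ)) by ring, Real.rpow_add (jap_pos _)]
    ring
  constructor
  · intro h α β γ hK y y' η
    have h1 := h (wd3 α β γ) (by rwa [length_wd3]) (y, y', η)
    rw [dl_wd3, Frame.nrm_apply, frame_Θ] at h1
    rw [e α β γ (y, y', η)]
    exact h1
  · intro h l hl p
    obtain ⟨α, β, γ, hp⟩ := exists_perm_wd3 l
    rw [dl_perm ha _ hp, dl_wd3, (hp.map _).prod_eq, Frame.nrm_apply, frame_Θ]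
    have h1 := h α β γ (by rwa [← length_wd3, ← hp.length_eq]) p.1 p.2.1 p.2.2
    rw [e α β γ p] at h1
    exact h1

/-- Only finitely many multi-indices have length at most `K`, so their separate constants can be
replaced by a common one. -/
lemma isSymbol_iff {a : V q × V q → J.Comp E F} : IsSymbol J κ κ' ϱ δ m μ a ↔
    ContDiff ℝ ∞ a ∧ ∀ K, ∃ R, SBd κ κ' ϱ δ m μ K R a := by
  refine and_congr_right fun ha => ⟨fun h K => ?_, fun h α β => ?_⟩
  · choose C hC using h
    refine ⟨∑ k ∈ box q K ×ˢ box q K, |C k.1 k.2|, (sbd_iff ha).2 fun α β hK y η => ?_⟩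
    refine (hC α β y η).trans (mul_le_mul_of_nonneg_right ((le_abs_self _).trans ?_)
      (weight_pos _ _ _ _).le)
    exact Finset.single_le_sum (f := fun k : (Fin q → ℕ) × (Fin q → ℕ) => |C k.1 k.2|)
      (fun _ _ => abs_nonneg _) (a := (α, β)) (Finset.mem_product.2
        ⟨mem_box_of_len_le (by dsimp only; omega), mem_box_of_len_le (by dsimp only; omega)⟩)
  · obtain ⟨R, hR⟩ := h (len α + len β)
    exact ⟨R, (sbd_iff ha).1 hR α β le_rfl⟩

lemma isDoubleSymbol_iff {k l : ℝ} {a : V3 q → J.Comp E F} :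
    IsDoubleSymbol J κ κ' ϱ δ m k l a ↔ DSym (frame J κ κ' q k l) ϱ δ m a := by
  refine and_congr_right fun ha => ⟨fun h K => ?_, fun h α β γ => ?_⟩
  · choose C hC using h
    refine ⟨∑ k ∈ box q K ×ˢ (box q K ×ˢ box q K), |C k.1 k.2.1 k.2.2|,
      (dbd_iff ha).2 fun α β γ hK y y' η => ?_⟩
    refine (hC α β γ y y' η).trans (mul_le_mul_of_nonneg_right ((le_abs_self _).trans ?_)
      (mul_pos (weight_pos _ _ _ _) (jap_rpow_pos _ _)).le)
    exact Finset.single_le_sum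
      (f := fun k : (Fin q → ℕ) × (Fin q → ℕ) × (Fin q → ℕ) => |C k.1 k.2.1 k.2.2|)
      (fun _ _ => abs_nonneg _) (a := (α, β, γ)) (by
        rw [Finset.mem_product, Finset.mem_product]
        exact ⟨mem_box_of_len_le (by dsimp only; omega), mem_box_of_len_le (by dsimp only; omega),
          mem_box_of_len_le (by dsimp only; omega)⟩)
  · obtain ⟨R, hR⟩ := h (len α + (len γ + len β))
    exact ⟨R, (dbd_iff ha).1 hR α β γ le_rfl⟩

/-- The double symbol `a(y, η)`. -/
lemma SBd.lift {a : V q × V q → J.Comp E F} (ha : ContDiff ℝ ∞ a)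
    (h : SBd κ κ' ϱ δ m μ K R a) :
    DBd (frame J κ κ' q μ 0) ϱ δ K m R (fun p => a (p.1, p.2.2)) := by
  have := Bd.comp_affine (v' := dir3 (q := q)) (s' := wt3 ϱ δ)
    (N' := fun p => (frame J κ κ' q μ 0).nrm p.2.2) (0 : V q × V q)
    ((ContinuousLinearMap.fst ℝ (V q) (V q × V q)).prod
      ((ContinuousLinearMap.snd ℝ (V q) (V q)).comp (ContinuousLinearMap.snd ℝ (V q) (V q × V q))))
    (Sum.elim (fun i => Sum.elim (fun j => if i = j then 1 else 0) (fun _ => 0))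
      (Sum.elim (fun _ _ => 0) (fun i => Sum.elim (fun _ => 0) (fun j => if i = j then 1 else 0))))
    (by rintro (i | i | i) <;> simp [dir2, dir3, dirY3, dirYp3, dirEta3, dirY, dirEta, ite_smul])
    (Λ := 1) le_rfl (wt3_nonneg _ _)
    (by
      rintro (i | i | i) x
      · simp [apply_ite abs, wt3, wt2, expo3]
      · simpa using wt3_nonneg _ _ _ _
      · simp [apply_ite abs, wt3, wt2, expo3])
    (D := fun _ => 1) (fun _ => zero_le_one)
    (fun x b => by simp [Frame.nrm_apply, frame_Θ]) ha h
  refine Bd.mono_right (by simpa using this) (wt3_nonneg _ _) fun p => le_of_eq ?_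
  simp [frame_W]

lemma IsSymbol.lift {a : V q × V q → J.Comp E F} (h : IsSymbol J κ κ' ϱ δ m μ a) :
    DSym (frame J κ κ' q μ 0) ϱ δ m (fun p => a (p.1, p.2.2)) := by
  obtain ⟨ha, h⟩ := isSymbol_iff.1 h
  exact ⟨ha.comp (by fun_prop), fun K => (h K).imp fun _ hR => hR.lift ha⟩

/-- The restriction of a double symbol to `y' = y`. -/
lemma DBd.diag {Γ : Frame q (J.Comp E F)} (hΘ : ∀ η A, Γ.Θ η A = twist J κ κ' η A)
    (hW : ∀ y, Γ.W (y, y) = jap y ^ μ) {a : V3 q → J.Comp E F}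
    (ha : ContDiff ℝ ∞ a) (h : DBd Γ ϱ δ K m R a) :
    SBd κ κ' ϱ δ m μ K (2 ^ K * R) (fun p => a (p.1, p.1, p.2)) := by
  have := Bd.comp_affine (v' := dir2 (q := q)) (s' := wt2 ϱ δ)
    (N' := fun p => (normSeminorm ℂ (J.Comp E F)).comp (twist J κ κ' p.2)) (0 : V3 q)
    ((ContinuousLinearMap.fst ℝ (V q) (V q)).prod ((ContinuousLinearMap.fst ℝ (V q) (V q)).prod
      (ContinuousLinearMap.snd ℝ (V q) (V q))))
    (Sum.elim (fun i => Sum.elim (fun j => if i = j then 1 else 0)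
        (Sum.elim (fun j => if i = j then 1 else 0) (fun _ => 0)))
      (fun i => Sum.elim (fun _ => 0) (Sum.elim (fun _ => 0) (fun j => if i = j then 1 else 0))))
    (by rintro (i | i) <;> simp [dir2, dir3, dirY3, dirYp3, dirEta3, dirY, dirEta, ite_smul])
    (Λ := 2) one_le_two (wt2_nonneg _ _)
    (by
      rintro (i | i) x
      · simp [apply_ite abs, wt3, wt2, expo3, two_mul]
      · have := jap_rpow_pos x.2 (-ϱ)
        simp [apply_ite abs, wt3, wt2, expo3]
        linarith)
    (D := fun _ => 1) (fun _ => zero_le_one)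
    (fun x b => by simp [Frame.nrm_apply, hΘ]) ha h
  refine Bd.mono_right (by simpa using this) (wt2_nonneg _ _) fun p => le_of_eq ?_
  simp [hW]
  ring

lemma DSym.diag {Γ : Frame q (J.Comp E F)} (hΘ : ∀ η A, Γ.Θ η A = twist J κ κ' η A)
    (hW : ∀ y, Γ.W (y, y) = jap y ^ μ) {a : V3 q → J.Comp E F}
    (h : DSym Γ ϱ δ m a) : IsSymbol J κ κ' ϱ δ m μ (fun p => a (p.1, p.1, p.2)) := by
  refine isSymbol_iff.2 ⟨h.1.comp (by fun_prop), fun K => ?_⟩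
  obtain ⟨R, hR⟩ := h.2 K
  exact ⟨_, hR.diag hΘ hW h.1⟩

end SymbolClasses

/-! ### The terms of the asymptotic expansion -/

section Expansion

variable {q : ℕ} {B : Type*} [NormedAddCommGroup B] [NormedSpace ℂ B]

/-- The polynomial differential operator `P(∂)` applied to `a`. -/
def pdo (a : V3 q → B) : MvPolynomial (Fin q ⊕ (Fin q ⊕ Fin q)) ℂ →ₗ[ℂ] (V3 q → B) :=
  (MvPolynomial.basisMonomials (Fin q ⊕ (Fin q ⊕ Fin q)) ℂ).constr ℂ
    fun c => dl dir3 (Finsupp.toMultiset c).toList a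

lemma pdo_monomial (a : V3 q → B) (c : (Fin q ⊕ (Fin q ⊕ Fin q)) →₀ ℕ) (z : ℂ) :
    pdo a (MvPolynomial.monomial c z) = z • dl dir3 (Finsupp.toMultiset c).toList a := by
  have h : pdo a (MvPolynomial.monomial c 1) = dl dir3 (Finsupp.toMultiset c).toList a := by
    have := (MvPolynomial.basisMonomials (Fin q ⊕ (Fin q ⊕ Fin q)) ℂ).constr_basis ℂ
      (fun c => dl dir3 (Finsupp.toMultiset c).toList a) c
    rwa [MvPolynomial.coe_basisMonomials] at this
  rw [← h, ← map_smul, MvPolynomial.smul_monomial, smul_eq_mul, mul_one]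

lemma pdo_one (a : V3 q → B) : pdo a 1 = a := by
  rw [← MvPolynomial.C_1, MvPolynomial.C_apply, pdo_monomial]
  simp

/-- Partial derivatives of smooth functions commute, so multiplication by a variable corresponds to
a derivative irrespective of the order of letters. Powers of `𝓛_σ` can therefore be computed in a
commutative polynomial ring. -/
lemma pdo_X_mul {a : V3 q → B} (ha : ContDiff ℝ ∞ a)
    (P : MvPolynomial (Fin q ⊕ (Fin q ⊕ Fin q)) ℂ) :
    ContDiff ℝ ∞ (pdo a P) ∧ ∀ i, pdo a (MvPolynomial.X i * P) = dd (dir3 i) (pdo a P) := by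
  induction P using MvPolynomial.induction_on' with
  | monomial c z =>
    have h := contDiff_dl ha dir3 (Finsupp.toMultiset c).toList
    refine ⟨?_, fun i => ?_⟩
    · rw [pdo_monomial]
      exact h.const_smul z
    · have e := dd_const_smul h z (dir3 i)
      rw [MvPolynomial.X, MvPolynomial.monomial_mul, one_mul, pdo_monomial, pdo_monomial]
      refine Eq.trans ?_ e.symm
      have hp : (Finsupp.toMultiset (Finsupp.single i 1 + c)).toList.Perm
          (i :: (Finsupp.toMultiset c).toList) := by
        rw [← Multiset.coe_eq_coe, Multiset.coe_toList, ← Multiset.cons_coe, Multiset.coe_toList,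
          Finsupp.toMultiset_add, Finsupp.toMultiset_single, one_smul, Multiset.singleton_add]
      rw [dl_perm ha _ hp, dl_cons, dl_dd_comm ha]
      rfl
  | add P Q hP hQ =>
    refine ⟨?_, fun i => ?_⟩
    · rw [map_add]
      exact hP.1.add hQ.1
    · rw [mul_add, map_add, map_add, hP.2, hQ.2]
      exact (dd_add hP.1 hQ.1 _).symm

lemma pdo_prod_mul {a : V3 q → B} (ha : ContDiff ℝ ∞ a) (g : Fin q → Fin q ⊕ (Fin q ⊕ Fin q))
    (α : Fin q → ℕ) (P : MvPolynomial (Fin q ⊕ (Fin q ⊕ Fin q)) ℂ) :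
    pdo a ((∏ j, MvPolynomial.X (g j) ^ α j) * P) = mderiv (fun j => dir3 (g j)) α (pdo a P) := by
  have h1 : ∀ (i) (n : ℕ) (P : MvPolynomial (Fin q ⊕ (Fin q ⊕ Fin q)) ℂ),
      pdo a (MvPolynomial.X i ^ n * P)
      = (fun (h : V3 q → B) (x : V3 q) => fderiv ℝ h x (dir3 i))^[n] (pdo a P) := by
    intro i n P
    induction n with
    | zero => simp
    | succ n ih =>
      rw [pow_succ', mul_assoc, (pdo_X_mul ha _).2, ih, Function.iterate_succ_apply']
      rfl
  rw [Fin.prod_univ_def]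
  unfold mderiv
  induction List.finRange q with
  | nil => simp
  | cons j L ih => rw [List.map_cons, List.prod_cons, List.foldr_cons, mul_assoc, h1, ih]

open MvPolynomial in
/-- The symbol of the operator `lop σ`. -/
def lopPoly (q : ℕ) (σ : ℝ × ℝ) : MvPolynomial (Fin q ⊕ (Fin q ⊕ Fin q)) ℂ :=
  ∑ i : Fin q ⊕ Fin q, Sum.elim
    (fun j => C (-Complex.I * σ.1) * (X (Sum.inr (Sum.inr j)) * X (Sum.inl j)))
    (fun j => C (-Complex.I * σ.2) * (X (Sum.inr (Sum.inr j)) * X (Sum.inr (Sum.inl j)))) i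

lemma lop_pdo {a : V3 q → B} (ha : ContDiff ℝ ∞ a) (σ : ℝ × ℝ)
    (P : MvPolynomial (Fin q ⊕ (Fin q ⊕ Fin q)) ℂ) :
    lop σ (pdo a P) = pdo a (lopPoly q σ * P) := by
  have hP := (pdo_X_mul ha P).1
  have e : ∀ j : Fin q, dd (σ.1 • stdv j, σ.2 • stdv j, 0) (pdo a P)
      = pdo a ((σ.1 : ℂ) • (MvPolynomial.X (Sum.inl j) * P)
        + (σ.2 : ℂ) • (MvPolynomial.X (Sum.inr (Sum.inl j)) * P)) := by
    intro j
    have h1 : ((σ.1 • stdv j, σ.2 • stdv j, 0) : V3 q)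
        = σ.1 • dir3 (Sum.inl j) + σ.2 • dir3 (Sum.inr (Sum.inl j)) := by
      simp [dir3, dirY3, dirYp3]
    rw [h1, map_add, map_smul, map_smul, (pdo_X_mul ha P).2, (pdo_X_mul ha P).2]
    funext x
    rw [dd_add_dir, dd_smul_dir, dd_smul_dir]
    simp [Complex.coe_smul]
  have e2 : ∀ j : Fin q, dd (dirEta3 j) (dd (σ.1 • stdv j, σ.2 • stdv j, 0) (pdo a P))
      = pdo a (MvPolynomial.X (Sum.inr (Sum.inr j)) *
        ((σ.1 : ℂ) • (MvPolynomial.X (Sum.inl j) * P)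
        + (σ.2 : ℂ) • (MvPolynomial.X (Sum.inr (Sum.inl j)) * P))) := by
    intro j
    rw [e, (pdo_X_mul ha _).2]
    rfl
  have e3 : lop σ (pdo a P) = (-Complex.I) • ∑ j : Fin q, pdo a (MvPolynomial.X (Sum.inr (Sum.inr j)) *
        ((σ.1 : ℂ) • (MvPolynomial.X (Sum.inl j) * P)
        + (σ.2 : ℂ) • (MvPolynomial.X (Sum.inr (Sum.inl j)) * P))) := by
    funext x
    simp only [lop, e2, Pi.smul_apply, Finset.sum_apply]
  rw [e3, ← map_sum, ← map_smul]
  congr 1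
  simp only [lopPoly, Fintype.sum_sum_type, Sum.elim_inl, Sum.elim_inr, ← Finset.sum_add_distrib,
    Finset.smul_sum, Finset.sum_mul, MvPolynomial.smul_eq_C_mul, map_mul, map_neg]
  refine Finset.sum_congr rfl fun j _ => ?_
  ring

lemma lop_iterate {a : V3 q → B} (ha : ContDiff ℝ ∞ a) (σ : ℝ × ℝ) (k : ℕ) :
    (lop σ)^[k] a = pdo a (lopPoly q σ ^ k) := by
  induction k with
  | zero => simp [pdo_one]
  | succ k ih => rw [Function.iterate_succ_apply', ih, lop_pdo ha, pow_succ']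

-- The multinomial theorem for the `2q` summands of `𝓛_σ`. The exponents of the two halves are the
-- multi-indices `α` and `β` of the expansion.
open MvPolynomial in
lemma lopPoly_pow (σ : ℝ × ℝ) (k : ℕ) : lopPoly q σ ^ k
    = ∑ c ∈ Finset.piAntidiag (Finset.univ : Finset (Fin q ⊕ Fin q)) k,
      ((Nat.multinomial Finset.univ c : ℂ) * ((-Complex.I * σ.1) ^ len (fun j => c (Sum.inl j))
        * (-Complex.I * σ.2) ^ len (fun j => c (Sum.inr j)))) •
        ((∏ j, X (Sum.inr (Sum.inr j)) ^ (c (Sum.inl j) + c (Sum.inr j))) *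
          ((∏ j, X (Sum.inl j) ^ c (Sum.inl j)) *
            ((∏ j, X (Sum.inr (Sum.inl j)) ^ c (Sum.inr j)) * 1))) := by
  rw [lopPoly, Finset.sum_pow_eq_sum_piAntidiag]
  refine Finset.sum_congr rfl fun c _ => ?_
  simp only [Fintype.prod_sum_type, Sum.elim_inl, Sum.elim_inr, mul_pow, Finset.prod_mul_distrib,
    Finset.prod_pow_eq_pow_sum, pow_add, smul_eq_C_mul, map_mul, map_pow, len, map_natCast]
  ring

/-- The terms of the expansion for `E_σ`. -/
lemma sum_lop_iterate {a : V3 q → B} (ha : ContDiff ℝ ∞ a) (σ : ℝ × ℝ) (N : ℕ) :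
    ∑ k ∈ Finset.range N, (k ! : ℂ)⁻¹ • (lop σ)^[k] a
      = ∑ k ∈ pairsBelow q N, ((mfact k.1 * mfact k.2 : ℂ)⁻¹ *
        ((-Complex.I * σ.1) ^ len k.1 * (-Complex.I * σ.2) ^ len k.2)) •
        mderiv dirEta3 (k.1 + k.2) (mderiv dirY3 k.1 (mderiv dirYp3 k.2 a)) := by
  have hlen : ∀ α β : Fin q → ℕ, len (α + β) = len α + len β := fun α β => by
    simp [len, Finset.sum_add_distrib]
  have hm : ∀ k ∈ pairsBelow q N, len (k.1 + k.2) ∈ Finset.range N := fun k hk =>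
    Finset.mem_range.2 (Finset.mem_filter.1 hk).2
  -- Pairs are collected by `|α + β| = n`; each fibre is matched with the terms of the `n`-th power.
  rw [← Finset.sum_fiberwise_of_maps_to hm]
  refine Finset.sum_congr rfl fun n hn => ?_
  have hnN := Finset.mem_range.1 hn
  rw [lop_iterate ha, lopPoly_pow, map_sum, Finset.smul_sum]
  refine Finset.sum_bij' (fun c _ => (fun j => c (Sum.inl j), fun j => c (Sum.inr j)))
    (fun k _ => Sum.elim k.1 k.2) ?_ ?_ ?_ ?_ ?_
  · intro c hc
    have hc1 := (Finset.mem_piAntidiag.1 hc).1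
    rw [Fintype.sum_sum_type] at hc1
    have hl : len ((fun j => c (Sum.inl j)) + fun j => c (Sum.inr j)) = n := by
      rw [hlen]; exact hc1
    have hle : ∀ i, c i ≤ n := fun i => by
      rw [← (Finset.mem_piAntidiag.1 hc).1]
      exact Finset.single_le_sum (fun _ _ => Nat.zero_le _) (Finset.mem_univ i)
    refine Finset.mem_filter.2 ⟨Finset.mem_filter.2 ⟨Finset.mem_product.2 ⟨?_, ?_⟩, ?_⟩, hl⟩
    · exact Fintype.mem_piFinset.2 fun j => Finset.mem_range.2 ((hle _).trans_lt hnN)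
    · exact Fintype.mem_piFinset.2 fun j => Finset.mem_range.2 ((hle _).trans_lt hnN)
    · exact hl.trans_lt hnN
  · intro k hk
    have h1 := (Finset.mem_filter.1 hk).2
    rw [hlen] at h1
    refine Finset.mem_piAntidiag.2 ⟨?_, fun i _ => Finset.mem_univ i⟩
    rw [Fintype.sum_sum_type]
    exact h1
  · intro c _
    funext i
    rcases i with i | i <;> rfl
  · intro k _
    rfl
  · intro c hc
    have hc1 := (Finset.mem_piAntidiag.1 hc).1
    have hs := Nat.multinomial_spec Finset.univ c
    rw [hc1, Fintype.prod_sum_type] at hs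
    -- The multinomial coefficient is `n! / (α! β!)`, so dividing by `n!` leaves the required `1 /
    -- (α! β!)`.
    have hs' : ((mfact fun j => c (Sum.inl j) : ℕ) * (mfact fun j => c (Sum.inr j) : ℕ) : ℂ)
        * (Nat.multinomial Finset.univ c : ℂ) = (n ! : ℂ) := by
      exact_mod_cast hs
    have n1 : ((mfact fun j => c (Sum.inl j) : ℕ) : ℂ) ≠ 0 :=
      Nat.cast_ne_zero.2 (Finset.prod_ne_zero_iff.2 fun _ _ => Nat.factorial_ne_zero _)
    have n2 : ((mfact fun j => c (Sum.inr j) : ℕ) : ℂ) ≠ 0 :=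
      Nat.cast_ne_zero.2 (Finset.prod_ne_zero_iff.2 fun _ _ => Nat.factorial_ne_zero _)
    have n3 : (n ! : ℂ) ≠ 0 := Nat.cast_ne_zero.2 (Nat.factorial_ne_zero _)
    rw [map_smul, smul_smul, pdo_prod_mul ha, pdo_prod_mul ha, pdo_prod_mul ha, pdo_one, ← mul_assoc]
    congr 2
    rw [inv_mul_eq_div, div_eq_iff n3, ← hs']
    field_simp

end Expansion

/-- The two forms differ by signs only: `(-1)^{|α|}` from `-D_y` makes `τ` into `-τ`, and the powers
of `-i` come from the operators `D`. This is the coefficient in `sum_lop_iterate` for `σ = (-τ,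
1-τ)`. -/
lemma expansionTerm_eq {q : ℕ} {J : NormedOperatorIdeal.{u}} {E F : SepHilb.{u}} (τ : ℝ)
    {a : V3 q → J.Comp E F} (ha : ContDiff ℝ ∞ a) (α β : Fin q → ℕ) (p : V q × V q) :
    expansionTerm τ a α β p = ((mfact α * mfact β : ℂ)⁻¹ *
        ((-Complex.I * (-τ : ℝ)) ^ len α * (-Complex.I * (1 - τ : ℝ)) ^ len β)) •
        mderiv dirEta3 (α + β) (mderiv dirY3 α (mderiv dirYp3 β a)) (p.1, p.1, p.2) := by
  have h1 := contDiff_mderiv ha dirYp3 β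
  have h2 := contDiff_mderiv h1 dirY3 α
  have e1 : mD dirYp3 β a = (-Complex.I) ^ len β • mderiv dirYp3 β a := rfl
  have e2 : mD dirY3 α ((-Complex.I) ^ len β • mderiv dirYp3 β a)
      = (-Complex.I) ^ len α • mderiv dirY3 α ((-Complex.I) ^ len β • mderiv dirYp3 β a) := rfl
  rw [expansionTerm, e1, e2, mderiv_smul h1, smul_smul, smul_smul, mderiv_smul h2, Pi.smul_apply,
    ← Complex.coe_smul, smul_smul]
  congr 1
  push_cast
  rw [mul_pow, mul_pow, neg_pow (τ : ℂ)]
  ring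

/-! ### Reduction to `τ`-symbols -/

section Reduction

variable {q : ℕ} {J : NormedOperatorIdeal.{u}} {E F : SepHilb.{u}}
  {κ : GroupAction E} {κ' : GroupAction F} {ϱ δ m : ℝ}

lemma IsOp.unique {a : V3 q → J.Comp E F} {A A' : 𝓢(V q, E) →L[ℂ] 𝓢(V q, F)} (h : IsOp a A)
    (h' : IsOp a A') : A = A' := by
  ext u y
  rw [(h u y).2.2, (h' u y).2.2]

lemma opIntegrand_add (a b : V3 q → J.Comp E F) (u : 𝓢(V q, E)) (y η y' : V q) :
    opIntegrand (a + b) u y η y' = opIntegrand a u y η y' + opIntegrand b u y η y' := by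
  simp only [opIntegrand, Pi.add_apply, map_add, add_apply, smul_add]

lemma opIntegrand_smul (c : ℂ) (a : V3 q → J.Comp E F) (u : 𝓢(V q, E)) (y η y' : V q) :
    opIntegrand (c • a) u y η y' = c • opIntegrand a u y η y' := by
  simp only [opIntegrand, Pi.smul_apply, map_smul, smul_apply]
  rw [smul_comm]

lemma IsOp.add {a b : V3 q → J.Comp E F} {A A' : 𝓢(V q, E) →L[ℂ] 𝓢(V q, F)} (h : IsOp a A)
    (h' : IsOp b A') : IsOp (a + b) (A + A') := by
  intro u y
  obtain ⟨h1, h2, h3⟩ := h u y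
  obtain ⟨g1, g2, g3⟩ := h' u y
  have e : ∀ η, ∫ y', opIntegrand (a + b) u y η y'
      = (∫ y', opIntegrand a u y η y') + ∫ y', opIntegrand b u y η y' := fun η => by
    simp only [opIntegrand_add]
    exact integral_add (h1 η) (g1 η)
  refine ⟨fun η => ?_, ?_, ?_⟩
  · simp only [opIntegrand_add]
    exact (h1 η).add (g1 η)
  · simp only [e]
    exact h2.add g2
  · simp only [e]
    rw [integral_add h2 g2, smul_add, ← h3, ← g3]
    rfl

lemma IsOp.smul {a : V3 q → J.Comp E F} {A : 𝓢(V q, E) →L[ℂ] 𝓢(V q, F)} (h : IsOp a A) (c : ℂ) :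
    IsOp (c • a) (c • A) := by
  intro u y
  obtain ⟨h1, h2, h3⟩ := h u y
  have e : ∀ η, ∫ y', opIntegrand (c • a) u y η y' = c • ∫ y', opIntegrand a u y η y' := fun η => by
    simp only [opIntegrand_smul]
    exact integral_smul _ _
  refine ⟨fun η => ?_, ?_, ?_⟩
  · simp only [opIntegrand_smul]
    exact (h1 η).smul c
  · simp only [e]
    exact h2.smul c
  · simp only [e]
    rw [integral_smul, smul_comm, ← h3]
    rfl

variable [CompleteSpace (J.Comp E F)] (hϱ : 0 ≤ ϱ) (hδ : 0 ≤ δ) (hδ1 : δ < 1) (hδϱ : δ < ϱ)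
include hϱ hδ hδ1 hδϱ

/-- Every double symbol defines an operator, which is also the operator with the reduced symbol. -/
theorem DSym.exists_isOp {Γ : Frame q (J.Comp E F)} {a : V3 q → J.Comp E F}
    (ha : DSym Γ ϱ δ m a) (τ : ℝ) : ∃ A : 𝓢(V q, E) →L[ℂ] 𝓢(V q, F), IsOp a A ∧
      IsOpTau τ (fun p => EdgePsiDO.eop (pth (-τ, 1 - τ) 1) a (p.1, p.1, p.2)) A := by
  have hβ := norm_evalB_le (E := E) (F := F) J
  obtain ⟨A, hA⟩ := exists_op (evalB (E := E) (F := F) J) hβ hϱ hδ hδ1 hδϱ ha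
  refine ⟨A, fun u y => ?_, fun u y => ?_⟩
  · rw [hA]
    exact ha.op_formula (evalB (E := E) (F := F) J) hϱ hδ hδ1 hβ u y
  · have e : (fun p : V3 q => EdgePsiDO.eop (pth (-τ, 1 - τ) 1) a (EdgePsiDO.mix (1 - τ) τ p))
        = fun p : V3 q => EdgePsiDO.eop (pth (-τ, 1 - τ) 1) a
          (τ • p.2.1 + (1 - τ) • p.1, τ • p.2.1 + (1 - τ) • p.1, p.2.2) := by
      funext p
      rw [mix_apply, add_comm]
    rw [hA, ha.op_eq_op_tau (evalB (E := E) (F := F) J) hϱ hδ hδ1 hδϱ hβ τ u y]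
    have hb := (ha.eop hϱ hδ hδ1 hδϱ (-τ, 1 - τ)).mix (1 - τ) τ
    rw [e] at hb ⊢
    exact hb.op_formula (evalB (E := E) (F := F) J) hϱ hδ hδ1 hβ u y

omit [CompleteSpace (J.Comp E F)] hϱ hδ hδ1 hδϱ in
lemma frame_diag (k l : ℝ) (y : V q) : (frame J κ κ' q k l).W (y, y) = jap y ^ (k + l) := by
  rw [frame_W, Real.rpow_add (jap_pos _)]

/-- Double symbols can be reduced to `τ`-symbols, with asymptotic expansion. -/
theorem exists_reduction (τ : ℝ) {k l : ℝ} {a : V3 q → J.Comp E F}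
    (ha : IsDoubleSymbol J κ κ' ϱ δ m k l a) :
    ∃ b : V q × V q → J.Comp E F, IsSymbol J κ κ' ϱ δ m (k + l) b ∧
      (∀ y η : V q, ∃ L : J.Comp E F, HasOscIntegral
        (fun p : V q × V q => a (y - τ • p.1, y + (1 - τ) • p.1, η + p.2)) L ∧
        b (y, η) = ((2 * Real.pi) ^ q)⁻¹ • L) ∧
      (∃ A : 𝓢(V q, E) →L[ℂ] 𝓢(V q, F), IsOp a A ∧ IsOpTau τ b A) ∧
      ∀ N : ℕ, IsSymbol J κ κ' ϱ δ (m - (ϱ - δ) * N) (k + l)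
        (fun p => b p - ∑ k ∈ pairsBelow q N, expansionTerm τ a k.1 k.2 p) := by
  have hs := isDoubleSymbol_iff.1 ha
  refine ⟨fun p => eop (pth (-τ, 1 - τ) 1) a (p.1, p.1, p.2),
    (hs.eop hϱ hδ hδ1 hδϱ _).diag (frame_Θ J κ κ' k l) (frame_diag k l), fun y η => ?_,
    hs.exists_isOp hϱ hδ hδ1 hδϱ τ, fun N => ?_⟩
  · have h := (hs.isAmp hϱ hδ (pth (-τ, 1 - τ) 1) (y, y, η)).hasOsc hδ hδ1
    have e : (fun x : V q × V q => a ((y, y, η) + act (pth (-τ, 1 - τ) 1) x))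
        = fun p : V q × V q => a (y - τ • p.1, y + (1 - τ) • p.1, η + p.2) := by
      funext x
      simp [pth, sub_eq_add_neg]
    refine ⟨_, e ▸ h, ?_⟩
    simp only [eop]
    rw [e, Complex.coe_smul]
  · have h := (hs.rem hϱ hδ hδ1 hδϱ N (-τ, 1 - τ)).diag (frame_Θ J κ κ' k l) (frame_diag k l)
    refine cast (congrArg _ (funext fun p => ?_)) h
    rw [EdgePsiDO.rem]
    congr 1
    have h1 := congrFun (sum_lop_iterate ha.1 (-τ, 1 - τ) N) (p.1, p.1, p.2)
    rw [Finset.sum_apply, Finset.sum_apply] at h1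
    refine h1.trans (Finset.sum_congr rfl fun k _ => ?_)
    rw [expansionTerm_eq τ ha.1]
    rfl

/-- The double symbol of `Op_τ`. -/
def tauLift {B : Type*} (τ : ℝ) (a : V q × V q → B) (p : V3 q) : B :=
  a (τ • p.2.1 + (1 - τ) • p.1, p.2.2)

/-- The `τ'`-symbol of the operator with the `τ`-symbol `a`. -/
def changeTau {B : Type*} [NormedAddCommGroup B] [NormedSpace ℂ B] (τ τ' : ℝ) (a : V q × V q → B)
    (p : V q × V q) : B :=
  eop (pth (-τ', 1 - τ') 1) (tauLift τ a) (p.1, p.1, p.2)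

omit [CompleteSpace (J.Comp E F)] hϱ hδ hδ1 hδϱ

lemma tauLift_eq {B : Type*} (τ : ℝ) (a : V q × V q → B) :
    tauLift τ a = fun p => (fun p : V3 q => a (p.1, p.2.2)) (mix (1 - τ) τ p) := by
  funext p
  rw [tauLift, mix_apply, add_comm]

lemma SBd.tauLift {μ R : ℝ} {K : ℕ} {a : V q × V q → J.Comp E F} (ha : ContDiff ℝ ∞ a)
    (h : SBd κ κ' ϱ δ m μ K R a) (τ : ℝ) : DBd ((frame J κ κ' q μ 0).mix (1 - τ) τ) ϱ δ K m
      ((1 + 2 * |1 - τ| + 2 * |τ|) ^ K * R) (EdgePsiDO.tauLift τ a) := by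
  rw [tauLift_eq]
  exact (h.lift ha).mix (ha.comp (by fun_prop)) _ _

lemma IsSymbol.tauLift {μ : ℝ} {a : V q × V q → J.Comp E F} (h : IsSymbol J κ κ' ϱ δ m μ a)
    (τ : ℝ) : DSym ((frame J κ κ' q μ 0).mix (1 - τ) τ) ϱ δ m (EdgePsiDO.tauLift τ a) := by
  rw [tauLift_eq]
  exact h.lift.mix _ _

lemma frame_mix_diag (μ τ : ℝ) (y : V q) :
    ((frame J κ κ' q μ 0).mix (1 - τ) τ).W (y, y) = jap y ^ μ := by
  have e : (1 - τ) • y + τ • y = y := by rw [← add_smul, sub_add_cancel, one_smul]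
  simp only [Frame.mix, e]
  rw [frame_diag, add_zero]

lemma frame_mix_Θ (μ s t : ℝ) (η : V q) (A : J.Comp E F) :
    ((frame J κ κ' q μ 0).mix s t).Θ η A = twist J κ κ' η A := frame_Θ J κ κ' μ 0 η A

include hϱ hδ hδ1 hδϱ
variable [CompleteSpace (J.Comp E F)]

lemma IsSymbol.changeTau {μ : ℝ} {a : V q × V q → J.Comp E F} (h : IsSymbol J κ κ' ϱ δ m μ a)
    (τ τ' : ℝ) : IsSymbol J κ κ' ϱ δ m μ (EdgePsiDO.changeTau τ τ' a) :=
  ((h.tauLift τ).eop hϱ hδ hδ1 hδϱ _).diag (frame_mix_Θ μ _ _) (frame_mix_diag μ τ)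

/-- Finitely many seminorms of `a` control each seminorm of the new symbol; this is what makes the
topology on operators independent of `τ`. It is `rem_bound` for `N = 0`, restricted to the diagonal.
-/
lemma exists_changeTau_bound (q : ℕ) (m μ τ τ' : ℝ) (K' : ℕ) : ∃ (K : ℕ) (C : ℝ), 0 ≤ C ∧
    ∀ (a : V q × V q → J.Comp E F) (R : ℝ), IsSymbol J κ κ' ϱ δ m μ a →
      SBd κ κ' ϱ δ m μ K R a → SBd κ κ' ϱ δ m μ K' (C * R) (EdgePsiDO.changeTau τ τ' a) := by
  obtain ⟨K, C, hC0, hC⟩ := rem_bound hϱ hδ hδ1 hδϱ ((frame J κ κ' q μ 0).mix (1 - τ) τ)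
    (S := |τ'| + |1 - τ'|) (by positivity) 0 K' m
  refine ⟨K, 2 ^ K' * (C * (1 + 2 * |1 - τ| + 2 * |τ|) ^ K), by positivity, fun a R ha h => ?_⟩
  have h1 := hC _ _ (-τ', 1 - τ') (ha.tauLift τ) (h.tauLift ha.1 τ)
    (by rw [abs_neg]; exact le_add_of_nonneg_right (abs_nonneg _))
    (le_add_of_nonneg_left (abs_nonneg _))
  have e : rem 0 (-τ', 1 - τ') (EdgePsiDO.tauLift τ a)
      = eop (pth (-τ', 1 - τ') 1) (EdgePsiDO.tauLift τ a) := by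
    funext p; simp [rem]
  rw [e] at h1
  have h2 := h1.diag (frame_mix_Θ μ _ _) (frame_mix_diag μ τ)
    ((ha.tauLift τ).contDiff_eop hϱ hδ hδ1 _)
  have e2 : m - (ϱ - δ) * (0 : ℕ) = m := by simp
  rw [e2] at h2
  have e3 : 2 ^ K' * (C * ((1 + 2 * |1 - τ| + 2 * |τ|) ^ K * R))
      = 2 ^ K' * (C * (1 + 2 * |1 - τ| + 2 * |τ|) ^ K) * R := by ring
  rw [e3] at h2
  exact h2

lemma IsSymbol.exists_isOpTau {μ : ℝ} {a : V q × V q → J.Comp E F}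
    (h : IsSymbol J κ κ' ϱ δ m μ a) (τ τ' : ℝ) : ∃ A : 𝓢(V q, E) →L[ℂ] 𝓢(V q, F),
      IsOpTau τ a A ∧ IsOpTau τ' (EdgePsiDO.changeTau τ τ' a) A :=
  (h.tauLift τ).exists_isOp hϱ hδ hδ1 hδϱ τ'

end Reduction

/-! ### The symbol is determined by the operator -/

section Injectivity

variable {q : ℕ} {J : NormedOperatorIdeal.{u}} {E F : SepHilb.{u}}
  {κ : GroupAction E} {κ' : GroupAction F} {ϱ δ m : ℝ}

-- The function is the inverse Fourier transform of the test function times `e`. Rescaling by `2π`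
-- accounts for the two normalizations of the phase.
open scoped FourierTransform in
lemma exists_schwartz_fourier {B : Type*} [NormedAddCommGroup B] [NormedSpace ℂ B] [CompleteSpace B]
    (g : V q → ℝ) (hg : ContDiff ℝ ∞ g)
    (hc : HasCompactSupport g) (e : B) : ∃ u : 𝓢(V q, B), ∀ η : V q,
      ∫ x, Complex.exp (-(Complex.I * (inner ℝ x η : ℝ))) • u x = g η • e := by
  have hπ : (2 * Real.pi) ≠ 0 := by positivity
  have h1 : HasCompactSupport (fun ζ : V q => g ((2 * Real.pi) • ζ) • e) := by
    have := hc.comp_homeomorph (Homeomorph.smulOfNeZero (2 * Real.pi) hπ : V q ≃ₜ V q)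
    exact this.smul_right (f' := fun _ => e)
  have h2 : ContDiff ℝ ∞ (fun ζ : V q => g ((2 * Real.pi) • ζ) • e) :=
    (hg.comp (by fun_prop)).smul contDiff_const
  refine ⟨𝓕⁻ (h1.toSchwartzMap h2), fun η => ?_⟩
  have h3 := congrArg (fun f : 𝓢(V q, B) => f ((2 * Real.pi)⁻¹ • η))
    (FourierTransform.fourier_fourierInv_eq (E := 𝓢(V q, B)) (F := 𝓢(V q, B)) (h1.toSchwartzMap h2))
  simp only [SchwartzMap.fourier_coe, Real.fourier_eq'] at h3
  refine Eq.trans ?_ (h3.trans ?_)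
  · congr 1
    funext x
    congr 2
    rw [inner_smul_right]
    push_cast
    have : (Real.pi : ℂ) ≠ 0 := by exact_mod_cast Real.pi_ne_zero
    field_simp
  · change g ((2 * Real.pi) • (2 * Real.pi)⁻¹ • η) • e = _
    rw [smul_smul, mul_inv_cancel₀ hπ, one_smul]

/-- A simple symbol with `Op_0(b) = 0` vanishes. -/
lemma eq_zero_of_isOp_zero {b : V q × V q → J.Comp E F} (hb : Continuous b)
    (h : IsOp (fun p => b (p.1, p.2.2)) (0 : 𝓢(V q, E) →L[ℂ] 𝓢(V q, F))) : b = 0 := by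
  funext ⟨y, η⟩
  apply toOp_injective J
  ext e
  -- For fixed `y`, a `u` with Fourier transform `g(η)e` reduces the operator to the pairing of `g`
  -- with `e^{iyη}b(y, η)e`. All test functions `g` occur, so this continuous function of `η`
  -- vanishes.
  have key : ∀ g : V q → ℝ, ContDiff ℝ ∞ g → HasCompactSupport g →
      ∫ η : V q, g η • (Complex.exp (Complex.I * (inner ℝ y η : ℝ)) • evalB J (b (y, η)) e) = 0 := by
    intro g hg hc
    obtain ⟨u, hu⟩ := exists_schwartz_fourier g hg hc e
    have h1 := (h u y).2.2
    have h2 : ∀ η, ∫ y', opIntegrand (fun p : V3 q => b (p.1, p.2.2)) u y η y'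
        = g η • (Complex.exp (Complex.I * (inner ℝ y η : ℝ)) • evalB J (b (y, η)) e) := by
      intro η
      have h3 : ∀ y', opIntegrand (fun p : V3 q => b (p.1, p.2.2)) u y η y'
          = Complex.exp (Complex.I * (inner ℝ y η : ℝ)) • evalB J (b (y, η))
            (Complex.exp (-(Complex.I * (inner ℝ y' η : ℝ))) • u y') := by
        intro y'
        rw [map_smul, smul_smul, ← Complex.exp_add, opIntegrand, inner_sub_left, evalB_apply]
        congr 2
        push_cast
        ring
      simp only [h3]
      have hi : Integrable fun y' : V q =>
          Complex.exp (-(Complex.I * (inner ℝ y' η : ℝ))) • u y' := by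
        refine u.integrable.bdd_smul 1 (by fun_prop) (Eventually.of_forall fun y' => ?_)
        rw [Complex.norm_exp]
        simp
      rw [integral_smul, ContinuousLinearMap.integral_comp_comm _ hi, hu, smul_comm]
      congr 1
      rw [← Complex.coe_smul, map_smul, Complex.coe_smul]
    simp only [h2] at h1
    have h4 : ((2 * Real.pi) ^ q)⁻¹ ≠ 0 := by positivity
    exact (smul_eq_zero.1 h1.symm).resolve_left h4
  have hc : Continuous fun η : V q =>
      Complex.exp (Complex.I * (inner ℝ y η : ℝ)) • evalB J (b (y, η)) e := by
    have : Continuous fun η : V q => evalB J (b (y, η)) e :=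
      ((evalB J).continuous.comp (hb.comp (by fun_prop))).clm_apply continuous_const
    fun_prop
  have h5 := ae_eq_zero_of_integral_contDiff_smul_eq_zero hc.locallyIntegrable key
  have h6 := congrFun ((Continuous.ae_eq_iff_eq volume hc continuous_const).1 h5) η
  exact (smul_eq_zero.1 h6).resolve_left (Complex.exp_ne_zero _)

/-- A symbol with `Op_τ(a) = 0` vanishes. -/
theorem IsSymbol.eq_zero_of_isOpTau_zero [CompleteSpace (J.Comp E F)] (hϱ : 0 ≤ ϱ) (hδ : 0 ≤ δ)
    (hδ1 : δ < 1) (hδϱ : δ < ϱ) {μ τ : ℝ} {a : V q × V q → J.Comp E F}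
    (ha : IsSymbol J κ κ' ϱ δ m μ a)
    (h : IsOpTau τ a (0 : 𝓢(V q, E) →L[ℂ] 𝓢(V q, F))) : a = 0 := by
  obtain ⟨A, h1, h2⟩ := ha.exists_isOpTau hϱ hδ hδ1 hδϱ τ 0
  rw [IsOp.unique h1 h] at h2
  have h3 := eq_zero_of_isOp_zero (ha.changeTau hϱ hδ hδ1 hδϱ τ 0).1.continuous
    (by simpa [IsOpTau] using h2)
  have hs := ha.tauLift τ
  -- The integral at `(y, y', η)` involves `y` and `y'` only through `(1-τ)y + τy'`. Vanishing on
  -- the diagonal, which is the statement about the `0`-symbol, therefore implies vanishing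
  -- everywhere, as required for inverting `E_σ`.
  have h4 : eop (pth (0, 1) 1) (EdgePsiDO.tauLift τ a) = fun _ => 0 := by
    funext p
    have h5 := congrFun h3 ((1 - τ) • p.1 + τ • p.2.1, p.2.2)
    simp only [EdgePsiDO.changeTau, neg_zero, sub_zero, Pi.zero_apply] at h5
    rw [← h5, eop, eop]
    congr 2
    funext x
    simp only [EdgePsiDO.tauLift, act_apply, pth, Prod.fst_add, Prod.snd_add]
    congr 2
    simp only [mul_zero, zero_smul, add_zero, smul_add, smul_smul, mul_one, sub_smul, one_smul]
    module
  funext p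
  have h6 := hs.eop_neg_eop hϱ hδ hδ1 (0, 1) (p.1, p.1, p.2) hδϱ
  rw [h4] at h6
  have h7 : EdgePsiDO.tauLift τ a (p.1, p.1, p.2) = a p := by
    simp only [EdgePsiDO.tauLift]
    rw [← add_smul, add_sub_cancel, one_smul]
  rw [← h7, ← h6, eop]
  have h8 := osc_const_smul (q := q) hδ hδ1 (isAmp_const (δ := δ) (0 : J.Comp E F)) 0
  simp only [smul_zero, zero_smul] at h8
  rw [h8, smul_zero]
  rfl

end Injectivity

/-! ### The symbol spaces are Fréchet spaces -/

section Limits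

variable {ι X B : Type*} [NormedAddCommGroup X] [NormedSpace ℝ X]
  [NormedAddCommGroup B] [NormedSpace ℂ B]

lemma dl_sub {f g : X → B} (hf : ContDiff ℝ ∞ f) (hg : ContDiff ℝ ∞ g) (v : ι → X) (l : List ι) :
    dl v l (fun x => f x - g x) = fun x => dl v l f x - dl v l g x := by
  have e : (fun x => f x - g x) = fun x => f x + (-1 : ℂ) • g x := by
    funext x; rw [neg_one_smul, sub_eq_add_neg]
  have s : ContDiff ℝ ∞ (fun x => (-1 : ℂ) • g x) := hg.const_smul _
  rw [e, dl_add hf s, dl_const_smul hg]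
  funext x
  beta_reduce
  rw [neg_one_smul, sub_eq_add_neg]

variable [Fintype ι]

lemma fderiv_eq_sum {f : X → B} {v : ι → X} {c : ι → X →L[ℝ] ℝ}
    (hc : ∀ x, ∑ j, c j x • v j = x) (x : X) :
    fderiv ℝ f x = ∑ j, ContinuousLinearMap.smulRightL ℝ X B (c j) (dd (v j) f x) := by
  ext h
  conv_lhs => rw [← hc h, map_sum]
  simp [dd]

/-- If all derivatives along words form locally uniform Cauchy sequences, then the limit is smooth,
and its derivatives are the limits of the derivatives. -/
lemma exists_smooth_limit [DecidableEq ι] [CompleteSpace B] {v : ι → X} {c : ι → X →L[ℝ] ℝ}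
    (hc : ∀ x, ∑ j, c j x • v j = x) (hcv : ∀ i j, c i (v j) = if i = j then 1 else 0)
    {f : ℕ → X → B} (hf : ∀ n, ContDiff ℝ ∞ (f n))
    (G : List ι → X → ℝ) (hG : ∀ l, Continuous (G l)) (hG0 : ∀ l x, 0 ≤ G l x)
    (h : ∀ l, ∀ ε > 0, ∃ N, ∀ m ≥ N, ∀ n ≥ N, ∀ x,
      ‖dl v l (f m) x - dl v l (f n) x‖ ≤ ε * G l x) :
    ∃ g : X → B, ContDiff ℝ ∞ g ∧
      ∀ l x, Tendsto (fun n => dl v l (f n) x) atTop (𝓝 (dl v l g x)) := by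
  have hlim : ∀ l x, ∃ b, Tendsto (fun n => dl v l (f n) x) atTop (𝓝 b) := by
    intro l x
    refine cauchySeq_tendsto_of_complete (Metric.cauchySeq_iff.2 fun ε hε => ?_)
    have hp : 0 < 2 * (G l x + 1) := by linarith [hG0 l x]
    obtain ⟨N, hN⟩ := h l (ε / (2 * (G l x + 1))) (div_pos hε hp)
    refine ⟨N, fun m hm n hn => ?_⟩
    rw [dist_eq_norm]
    refine (hN m hm n hn x).trans_lt ?_
    rw [div_mul_eq_mul_div, div_lt_iff₀ hp]
    nlinarith [hG0 l x]
  choose g hg using hlim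
  have hunif : ∀ l, ∀ ε > 0, ∃ N, ∀ n ≥ N, ∀ x, ‖g l x - dl v l (f n) x‖ ≤ ε * G l x := by
    intro l ε hε
    obtain ⟨N, hN⟩ := h l ε hε
    refine ⟨N, fun n hn x => ?_⟩
    refine le_of_tendsto ((hg l x).sub_const (dl v l (f n) x)).norm ?_
    filter_upwards [eventually_ge_atTop N] with m hm
    exact hN m hm n hn x
  -- The weights are continuous, hence locally bounded, so weighted uniform convergence of the next
  -- derivatives is locally uniform and the limit may be differentiated termwise.
  have hder : ∀ l x, HasFDerivAt (g l)
      (∑ j, ContinuousLinearMap.smulRightL ℝ X B (c j) (g (l ++ [j]) x)) x := by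
    intro l x
    refine hasFDerivAt_of_tendstoLocallyUniformlyOn (s := Set.univ) (l := atTop) isOpen_univ
      (f := fun n => dl v l (f n))
      (f' := fun n x => ∑ j, ContinuousLinearMap.smulRightL ℝ X B (c j) (dl v (l ++ [j]) (f n) x))
      (g' := fun x => ∑ j, ContinuousLinearMap.smulRightL ℝ X B (c j) (g (l ++ [j]) x))
      ?_ (fun n x _ => ?_) (fun x _ => hg l x) (Set.mem_univ x)
    · rw [Metric.tendstoLocallyUniformlyOn_iff]
      intro ε hε x _
      set S : ℝ := ∑ j, ‖c j‖ * (G (l ++ [j]) x + 1) with hS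
      have hS0 : 0 ≤ S := Finset.sum_nonneg fun j _ =>
        mul_nonneg (norm_nonneg _) (by linarith [hG0 (l ++ [j]) x])
      have hε' : 0 < ε / (S + 1) := div_pos hε (by linarith)
      choose N hN using fun j => hunif (l ++ [j]) _ hε'
      refine ⟨{y | ∀ j, G (l ++ [j]) y < G (l ++ [j]) x + 1}, mem_nhdsWithin_of_mem_nhds ?_, ?_⟩
      · have : ∀ j, ∀ᶠ y in 𝓝 x, G (l ++ [j]) y < G (l ++ [j]) x + 1 := fun j =>
          (hG (l ++ [j])).continuousAt.eventually_lt continuousAt_const (by linarith)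
        exact eventually_all.2 this
      · filter_upwards [eventually_ge_atTop (∑ j, N j)] with n hn y hy
        rw [dist_eq_norm, ← Finset.sum_sub_distrib]
        have hle : ∀ j, ‖ContinuousLinearMap.smulRightL ℝ X B (c j) (g (l ++ [j]) y)
            - ContinuousLinearMap.smulRightL ℝ X B (c j) (dl v (l ++ [j]) (f n) y)‖
            ≤ ε / (S + 1) * (‖c j‖ * (G (l ++ [j]) x + 1)) := by
          intro j
          rw [← map_sub, ContinuousLinearMap.smulRightL_apply_apply,
            ContinuousLinearMap.norm_smulRight_apply]
          have h1 := hN j n ((Finset.single_le_sum (fun _ _ => Nat.zero_le _)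
            (Finset.mem_univ j)).trans hn) y
          have h2 := (hy j).le
          calc ‖c j‖ * _ ≤ ‖c j‖ * (ε / (S + 1) * (G (l ++ [j]) x + 1)) :=
                mul_le_mul_of_nonneg_left (h1.trans (mul_le_mul_of_nonneg_left h2 hε'.le))
                  (norm_nonneg _)
            _ = _ := by ring
        refine (norm_sum_le_of_le _ fun j _ => hle j).trans_lt ?_
        rw [← Finset.mul_sum, ← hS, div_mul_eq_mul_div, div_lt_iff₀ (by linarith)]
        nlinarith
    · have h1 := smooth_diff (contDiff_dl (hf n) v l) x
      have h2 := h1.hasFDerivAt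
      rw [fderiv_eq_sum hc] at h2
      simp only [dl_append]
      exact h2
  have hfd : ∀ l, fderiv ℝ (g l)
      = fun x => ∑ j, ContinuousLinearMap.smulRightL ℝ X B (c j) (g (l ++ [j]) x) :=
    fun l => funext fun x => (hder l x).fderiv
  have hsm : ∀ l, ContDiff ℝ ∞ (g l) := by
    have key : ∀ n : ℕ, ∀ l, ContDiff ℝ n (g l) := by
      intro n
      induction n with
      | zero =>
        exact fun l => contDiff_zero.2
          (continuous_iff_continuousAt.2 fun x => (hder l x).continuousAt)
      | succ n ih =>
        intro l
        have : ((n + 1 : ℕ) : WithTop ℕ∞) = (n : WithTop ℕ∞) + 1 := by norm_cast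
        rw [this, contDiff_succ_iff_fderiv]
        refine ⟨fun x => (hder l x).differentiableAt, by simp, ?_⟩
        rw [hfd]
        exact ContDiff.sum fun j _ => (ContinuousLinearMap.contDiff _).comp (ih _)
    exact fun l => contDiff_infty.2 fun n => key n l
  have hdl : ∀ l, dl v l (g []) = g l := by
    intro l
    induction l using List.reverseRecOn with
    | nil => rfl
    | append_singleton l j ih =>
      rw [dl_append, ih]
      funext x
      change fderiv ℝ (g l) x (v j) = _
      rw [hfd]
      simp [hcv]
  exact ⟨g [], hsm [], fun l x => by rw [hdl]; exact hg l x⟩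

end Limits

/-! ### Separation, completeness and metrizability of the symbol space -/

section SymbolSpace

variable {q : ℕ} (J : NormedOperatorIdeal.{u}) {E F : SepHilb.{u}}
  (κ : GroupAction E) (κ' : GroupAction F) (ϱ δ μ₁ μ₂ : ℝ)

lemma withSeminorms_symb : WithSeminorms (symbSeminorm J κ κ' ϱ δ μ₁ μ₂ q) := ⟨rfl⟩

variable {J κ κ' ϱ δ μ₁ μ₂}

/-- The sum of the seminorms for at most `K` derivatives. -/
def symbNorm (K : ℕ) (a : Symb J κ κ' q ϱ δ μ₁ μ₂) : ℝ :=
  ∑ k ∈ box q K ×ˢ box q K, symbSeminorm J κ κ' ϱ δ μ₁ μ₂ q k a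

lemma norm_twist_le_symbSeminorm (α β : Fin q → ℕ) (a : Symb J κ κ' q ϱ δ μ₁ μ₂) (y η : V q) :
    ‖twist J κ κ' η (mderiv dirY β (mderiv dirEta α a.fn) (y, η))‖
      ≤ symbSeminorm J κ κ' ϱ δ μ₁ μ₂ q (α, β) a
        * (jap y ^ μ₂ * jap η ^ (μ₁ - ϱ * len α + δ * len β)) := by
  have h := le_ciSup (bddAbove_symbRatio α β a) (y, η)
  exact (div_le_iff₀ (weight_pos _ _ _ _)).1 h

lemma sbd_symbNorm (K : ℕ) (a : Symb J κ κ' q ϱ δ μ₁ μ₂) :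
    SBd κ κ' ϱ δ μ₁ μ₂ K (symbNorm K a) a.fn := by
  refine (sbd_iff a.2.1).2 fun α β hK y η => (norm_twist_le_symbSeminorm α β a y η).trans
    (mul_le_mul_of_nonneg_right ?_ (weight_pos _ _ _ _).le)
  exact Finset.single_le_sum (f := fun k => symbSeminorm J κ κ' ϱ δ μ₁ μ₂ q k a)
    (fun _ _ => apply_nonneg _ _) (a := (α, β)) (Finset.mem_product.2
      ⟨mem_box_of_len_le (by dsimp only; omega), mem_box_of_len_le (by dsimp only; omega)⟩)

lemma symbSeminorm_le {R : ℝ} {α β : Fin q → ℕ} {a : Symb J κ κ' q ϱ δ μ₁ μ₂}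
    (h : SBd κ κ' ϱ δ μ₁ μ₂ (len α + len β) R a.fn) :
    symbSeminorm J κ κ' ϱ δ μ₁ μ₂ q (α, β) a ≤ R :=
  ciSup_le fun p => (div_le_iff₀ (weight_pos _ _ _ _)).2 ((sbd_iff a.2.1).1 h α β le_rfl p.1 p.2)

/-- Removing the twist costs a power of `⟨η⟩`. The resulting weight is continuous and does not
depend on the symbol, so Cauchy sequences converge locally uniformly with all derivatives. -/
lemma norm_dl_le_of_sbd {R : ℝ} {K : ℕ} {a : V q × V q → J.Comp E F}
    (h : SBd κ κ' ϱ δ μ₁ μ₂ K R a) {l : List (Fin q ⊕ Fin q)} (hl : l.length ≤ K) (p : V q × V q) :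
    ‖dl dir2 l a p‖ ≤ R * ((frame J κ κ' q 0 0).C * jap p.2 ^ (frame J κ κ' q 0 0).M
      * ((jap p.1 ^ μ₂ * jap p.2 ^ μ₁) * (l.map fun i => wt2 ϱ δ i p).prod)) := by
  have h1 := (frame J κ κ' q 0 0).norm_le p.2 (dl dir2 l a p)
  rw [frame_Θ] at h1
  refine h1.trans ?_
  have h2 : ‖twist J κ κ' p.2 (dl dir2 l a p)‖
      ≤ R * (jap p.1 ^ μ₂ * jap p.2 ^ μ₁) * (l.map fun i => wt2 ϱ δ i p).prod := h l hl p
  refine (mul_le_mul_of_nonneg_left h2 (mul_nonneg (frame J κ κ' q 0 0).C_pos.le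
    (jap_rpow_pos _ _).le)).trans (le_of_eq ?_)
  ring

/-- The seminorm without derivatives already separates points, because the norm is bounded by the
twisted norm up to a power of `⟨η⟩`. -/
lemma eq_zero_of_symbSeminorm {a : Symb J κ κ' q ϱ δ μ₁ μ₂}
    (h : symbSeminorm J κ κ' ϱ δ μ₁ μ₂ q (0, 0) a = 0) : a = 0 := by
  have hb : SBd κ κ' ϱ δ μ₁ μ₂ 0 0 a.fn := by
    refine (sbd_iff a.2.1).2 fun α β hK y η => ?_
    have hz : ∀ α : Fin q → ℕ, len α = 0 → α = 0 := fun α h => by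
      funext j
      exact (Finset.sum_eq_zero_iff.1 h) j (Finset.mem_univ j)
    obtain rfl := hz α (by omega)
    obtain rfl := hz β (by omega)
    rw [← h]
    exact norm_twist_le_symbSeminorm 0 0 a y η
  apply Subtype.ext
  funext p
  have := norm_dl_le_of_sbd hb (l := []) le_rfl p
  rw [zero_mul] at this
  exact norm_le_zero_iff.1 this

lemma sum_coord2 (x : V q × V q) : ∑ j : Fin q ⊕ Fin q, (Sum.elim
    (fun j => (EuclideanSpace.proj j : V q →L[ℝ] ℝ).comp (ContinuousLinearMap.fst ℝ (V q) (V q)))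
    (fun j => (EuclideanSpace.proj j : V q →L[ℝ] ℝ).comp (ContinuousLinearMap.snd ℝ (V q) (V q)))
    j : V q × V q →L[ℝ] ℝ) x • (dir2 j : V q × V q) = x := by
  rw [Fintype.sum_sum_type]
  refine Prod.ext ?_ ?_
  · simpa [dir2, dirY, dirEta, Prod.fst_sum] using sum_stdv x.1
  · simpa [dir2, dirY, dirEta, Prod.snd_sum] using sum_stdv x.2

lemma continuous_wt2_prod (ϱ δ : ℝ) (l : List (Fin q ⊕ Fin q)) :
    Continuous fun p : V q × V q => (l.map fun i => wt2 ϱ δ i p).prod := by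
  induction l with
  | nil => exact continuous_const
  | cons i l ih =>
    simp only [List.map_cons, List.prod_cons]
    refine Continuous.mul ?_ ih
    exact (continuous_jap.comp continuous_snd).rpow_const fun p => Or.inl (jap_pos _).ne'

lemma tendsto_symb {f : ℕ → Symb J κ κ' q ϱ δ μ₁ μ₂} {g : Symb J κ κ' q ϱ δ μ₁ μ₂}
    (h : ∀ K, ∀ ε > 0, ∃ N, ∀ n ≥ N, SBd κ κ' ϱ δ μ₁ μ₂ K ε (fun p => (f n).fn p - g.fn p)) :
    Tendsto f atTop (𝓝 g) := by
  refine ((withSeminorms_symb J κ κ' ϱ δ μ₁ μ₂).tendsto_nhds_atTop f _).2 ?_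
  rintro ⟨α, β⟩ ε hε
  obtain ⟨N, hN⟩ := h (len α + len β) (ε / 2) (half_pos hε)
  exact ⟨N, fun n hn => (symbSeminorm_le (a := f n - g) (hN n hn)).trans_lt (half_lt_self hε)⟩

/-- Cauchy sequences of symbols converge. -/
lemma exists_symb_limit [CompleteSpace (J.Comp E F)] (f : ℕ → Symb J κ κ' q ϱ δ μ₁ μ₂)
    (h : ∀ K, ∀ ε > 0, ∃ N, ∀ m ≥ N, ∀ n ≥ N, symbNorm K (f m - f n) ≤ ε) :
    ∃ g : Symb J κ κ' q ϱ δ μ₁ μ₂, Tendsto f atTop (𝓝 g) := by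
  have hsub : ∀ (m n : ℕ) (l : List (Fin q ⊕ Fin q)) (p : V q × V q),
      dl dir2 l (f m - f n).fn p = dl dir2 l (f m).fn p - dl dir2 l (f n).fn p := fun m n l p =>
    congrFun (dl_sub (f m).2.1 (f n).2.1 dir2 l) p
  set Γ := frame J κ κ' q 0 0
  have hjc : ∀ s : ℝ, Continuous fun y : V q => jap y ^ s := fun s =>
    continuous_jap.rpow_const fun p => Or.inl (jap_pos _).ne'
  have hw0 : ∀ (l : List (Fin q ⊕ Fin q)) (p : V q × V q),
      0 ≤ (l.map fun i => wt2 ϱ δ i p).prod := fun l p => List.prod_nonneg fun c hc => by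
    obtain ⟨i, -, rfl⟩ := List.mem_map.1 hc
    exact wt2_nonneg ϱ δ i p
  obtain ⟨g, hgs, hg⟩ := exists_smooth_limit sum_coord2
    (by
      rintro (i | i) (j | j)
      · simp [dir2, dirY, stdv]
      · simp [dir2, dirEta]
      · simp [dir2, dirY]
      · simp [dir2, dirEta, stdv])
    (f := fun n => (f n).fn) (fun n => (f n).2.1)
    (fun l p => Γ.C * jap p.2 ^ Γ.M
      * ((jap p.1 ^ μ₂ * jap p.2 ^ μ₁) * (l.map fun i => wt2 ϱ δ i p).prod))
    (fun l => (continuous_const.mul ((hjc _).comp continuous_snd)).mul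
      ((((hjc _).comp continuous_fst).mul ((hjc _).comp continuous_snd)).mul
        (continuous_wt2_prod ϱ δ l)))
    (fun l p => mul_nonneg (mul_nonneg Γ.C_pos.le (jap_rpow_pos _ _).le)
      (mul_nonneg (weight_pos _ _ _ _).le (hw0 l p)))
    (fun l ε hε => by
      obtain ⟨N, hN⟩ := h l.length ε hε
      refine ⟨N, fun m hm n hn p => ?_⟩
      have h1 := norm_dl_le_of_sbd (sbd_symbNorm l.length (f m - f n)) le_rfl p
      rw [hsub] at h1
      exact h1.trans (mul_le_mul_of_nonneg_right (hN m hm n hn)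
        (mul_nonneg (mul_nonneg Γ.C_pos.le (jap_rpow_pos _ _).le)
        (mul_nonneg (weight_pos _ _ _ _).le (hw0 l p)))))
  have hlim : ∀ K, ∀ ε > 0, ∃ N, ∀ n ≥ N,
      SBd κ κ' ϱ δ μ₁ μ₂ K ε (fun p => (f n).fn p - g p) := by
    intro K ε hε
    obtain ⟨N, hN⟩ := h K ε hε
    refine ⟨N, fun n hn l hl p => ?_⟩
    have sn : ContDiff ℝ ∞ (f n).fn := (f n).2.1
    rw [dl_sub sn hgs]
    -- At a fixed point the twist is a bounded operator, so the Cauchy estimate for `f n - f m`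
    -- survives the limit in `m`. This gives convergence in the symbol seminorms, not merely
    -- pointwise.
    have ht : Tendsto (fun m => ‖twistL J κ κ' p.2 (dl dir2 l (f n).fn p - dl dir2 l (f m).fn p)‖)
        atTop (𝓝 ‖twistL J κ κ' p.2 (dl dir2 l (f n).fn p - dl dir2 l g p)‖) :=
      (((twistL J κ κ' p.2).continuous.tendsto _).comp ((hg l p).const_sub _)).norm
    refine le_of_tendsto ht ?_
    filter_upwards [eventually_ge_atTop N] with m hm
    have h1 := sbd_symbNorm K (f n - f m) l hl p
    rw [hsub] at h1
    refine h1.trans (mul_le_mul_of_nonneg_right (mul_le_mul_of_nonneg_right (hN n hn m hm)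
      (weight_pos _ _ _ _).le) (hw0 l p))
  -- The limit is `f N - (f N - g)`, and both parts satisfy the symbol estimates.
  have hgS : IsSymbol J κ κ' ϱ δ μ₁ μ₂ g := by
    refine isSymbol_iff.2 ⟨hgs, fun K => ?_⟩
    obtain ⟨N, hN⟩ := hlim K 1 one_pos
    have h1 := sbd_symbNorm K (f N)
    have s1 : ContDiff ℝ ∞ (f N).fn := (f N).2.1
    have s2 : ContDiff ℝ ∞ (fun p => (f N).fn p - g p) := s1.sub hgs
    have h2 := Bd.const_smul s2 (hN N le_rfl) (-1 : ℂ)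
    have h3 := Bd.add s1 (s2.const_smul (-1 : ℂ)) h1 h2
    have e : (fun x => (f N).fn x + (-1 : ℂ) • ((f N).fn x - g x)) = g := by
      funext x; rw [neg_one_smul]; abel
    have h4 : Bd dir2 (wt2 ϱ δ) (fun p => (normSeminorm ℂ (J.Comp E F)).comp (twist J κ κ' p.2)) K
        (fun p => symbNorm K (f N) * (jap p.1 ^ μ₂ * jap p.2 ^ μ₁)
          + ‖(-1 : ℂ)‖ * (1 * (jap p.1 ^ μ₂ * jap p.2 ^ μ₁))) g := e ▸ h3
    refine ⟨symbNorm K (f N) + 1, Bd.mono_right h4 (wt2_nonneg _ _) fun p => le_of_eq ?_⟩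
    rw [norm_neg, norm_one]
    ring
  obtain ⟨G, rfl⟩ : ∃ G : Symb J κ κ' q ϱ δ μ₁ μ₂, G.fn = g := ⟨⟨g, hgS⟩, rfl⟩
  exact ⟨G, tendsto_symb hlim⟩

/-- There are countably many pairs of multi-indices, so the uniformity is countably generated. With
separation this gives metrizability, and completeness may be tested on sequences. -/
theorem isFrechet_symb [CompleteSpace (J.Comp E F)] : IsFrechet (Symb J κ κ' q ϱ δ μ₁ μ₂) := by
  have hp := withSeminorms_symb (q := q) J κ κ' ϱ δ μ₁ μ₂
  have tg := hp.topologicalAddGroup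
  have hfc := hp.firstCountableTopology
  have t1 : T1Space (Symb J κ κ' q ϱ δ μ₁ μ₂) := hp.T1_of_separating fun x hx =>
    ⟨(0, 0), fun h => hx (eq_zero_of_symbSeminorm h)⟩
  let _ : UniformSpace (Symb J κ κ' q ϱ δ μ₁ μ₂) := IsTopologicalAddGroup.rightUniformSpace _
  have ug : IsUniformAddGroup (Symb J κ κ' q ϱ δ μ₁ μ₂) := isUniformAddGroup_of_addCommGroup
  have cg : (uniformity (Symb J κ κ' q ϱ δ μ₁ μ₂)).IsCountablyGenerated :=
    IsUniformAddGroup.uniformity_countably_generated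
  refine ⟨tg, hp.continuousSMul, hp.toLocallyConvexSpace, UniformSpace.metrizableSpace, ?_⟩
  refine UniformSpace.complete_of_cauchySeq_tendsto fun f hf => exists_symb_limit f ?_
  intro K ε hε
  have hc : Continuous (symbNorm K : Symb J κ κ' q ϱ δ μ₁ μ₂ → ℝ) :=
    continuous_finsetSum _ fun k _ => hp.continuous_seminorm k
  have h0 : symbNorm K (0 : Symb J κ κ' q ϱ δ μ₁ μ₂) = 0 :=
    Finset.sum_eq_zero fun k _ => map_zero _
  have h1 := cauchySeq_iff_tendsto.1 hf
  rw [uniformity_eq_comap_nhds_zero, tendsto_comap_iff] at h1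
  have h2 := (hc.tendsto 0).comp h1
  rw [h0] at h2
  have h3 := h2.eventually (Iio_mem_nhds hε)
  rw [← prod_atTop_atTop_eq] at h3
  obtain ⟨N, hN⟩ := eventually_atTop_prod_self.1 (by rwa [prod_atTop_atTop_eq] at h3)
  exact ⟨N, fun m hm n hn => (hN n m hn hm).le⟩

end SymbolSpace

/-! ### The Fréchet space of operators -/

/-- Fréchet spaces can be transported along linear bijections. -/
lemma IsFrechet.coinduced {X Y : Type*} [AddCommGroup X] [Module ℂ X] [TopologicalSpace X]
    [AddCommGroup Y] [Module ℂ Y] (h : IsFrechet X) (e : X ≃ₗ[ℂ] Y) :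
    @IsFrechet Y _ _ (TopologicalSpace.coinduced e inferInstance) := by
  let _ : TopologicalSpace Y := TopologicalSpace.coinduced e inferInstance
  have c1 : Continuous e := continuous_coinduced_rng
  have c2 : Continuous e.symm := by
    rw [continuous_coinduced_dom]
    have : e.symm ∘ e = id := funext fun x => e.symm_apply_apply x
    rw [this]
    exact continuous_id
  obtain ⟨h1, h2, h3, h4, h5⟩ := h
  let φ' : X ≃ₜ Y := ⟨e.toEquiv, c1, c2⟩
  have g1 : IsTopologicalAddGroup Y :=
    { continuous_add := by
        have : Continuous fun p : Y × Y => e (e.symm p.1 + e.symm p.2) := by fun_prop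
        simpa using this
      continuous_neg := by
        have : Continuous fun p : Y => e (-e.symm p) := by fun_prop
        simpa using this }
  have g2 : ContinuousSMul ℂ Y :=
    { continuous_smul := by
        have : Continuous fun p : ℂ × Y => e (p.1 • e.symm p.2) := by fun_prop
        simpa using this }
  have g3 : LocallyConvexSpace ℝ Y := by
    have h6 := LocallyConvexSpace.induced (𝕜 := ℝ) (t := inferInstanceAs (TopologicalSpace X))
      ((e.symm : Y →ₗ[ℂ] X).restrictScalars ℝ)
    have h7 := φ'.symm.isInducing.eq_induced
    exact h7 ▸ h6
  have g4 : TopologicalSpace.MetrizableSpace Y := φ'.symm.isEmbedding.metrizableSpace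
  refine ⟨g1, g2, g3, g4, ?_⟩
  let _ : UniformSpace X := IsTopologicalAddGroup.rightUniformSpace X
  let _ : UniformSpace Y := IsTopologicalAddGroup.rightUniformSpace Y
  have u1 : IsUniformAddGroup X := isUniformAddGroup_of_addCommGroup
  have u2 : IsUniformAddGroup Y := isUniformAddGroup_of_addCommGroup
  let ψ : X ≃ᵤ Y := ⟨e.toEquiv, uniformContinuous_addMonoidHom_of_continuous (f := e) c1,
    uniformContinuous_addMonoidHom_of_continuous (f := e.symm) c2⟩
  exact ψ.completeSpace_iff.1 h5

lemma coinduced_comp_homeomorph {X Y : Type*} [TopologicalSpace X] (e : X ≃ₜ X) (f : X → Y) :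
    TopologicalSpace.coinduced (f ∘ e) inferInstance
      = TopologicalSpace.coinduced f (inferInstance : TopologicalSpace X) := by
  rw [← coinduced_compose, e.coinduced_eq]

section Operators

variable {q : ℕ} {J : NormedOperatorIdeal.{u}} {E F : SepHilb.{u}}
  {κ : GroupAction E} {κ' : GroupAction F} {ϱ δ μ₁ μ₂ : ℝ} [CompleteSpace (J.Comp E F)]

/-- The operator `Op_τ(a)`. -/
def opTau (hϱ : 0 ≤ ϱ) (hδ : 0 ≤ δ) (hδ1 : δ < 1) (hδϱ : δ < ϱ) (τ : ℝ)
    (a : Symb J κ κ' q ϱ δ μ₁ μ₂) : 𝓢(V q, E) →L[ℂ] 𝓢(V q, F) :=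
  (IsSymbol.exists_isOpTau hϱ hδ hδ1 hδϱ a.2 τ 0).choose

variable (hϱ : 0 ≤ ϱ) (hδ : 0 ≤ δ) (hδ1 : δ < 1) (hδϱ : δ < ϱ)

lemma isOpTau_opTau (τ : ℝ) (a : Symb J κ κ' q ϱ δ μ₁ μ₂) :
    IsOpTau τ a.fn (opTau hϱ hδ hδ1 hδϱ τ a) :=
  (IsSymbol.exists_isOpTau hϱ hδ hδ1 hδϱ a.2 τ 0).choose_spec.1

/-- The map `a ↦ Op_τ(a)`. -/
def opTauL (τ : ℝ) : Symb J κ κ' q ϱ δ μ₁ μ₂ →ₗ[ℂ] 𝓢(V q, E) →L[ℂ] 𝓢(V q, F) where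
  toFun := opTau hϱ hδ hδ1 hδϱ τ
  map_add' a b := IsOp.unique (isOpTau_opTau hϱ hδ hδ1 hδϱ τ (a + b))
    (IsOp.add (isOpTau_opTau hϱ hδ hδ1 hδϱ τ a) (isOpTau_opTau hϱ hδ hδ1 hδϱ τ b))
  map_smul' c a := IsOp.unique (isOpTau_opTau hϱ hδ hδ1 hδϱ τ (c • a))
    (IsOp.smul (isOpTau_opTau hϱ hδ hδ1 hδϱ τ a) c)

lemma opTauL_injective (τ : ℝ) : Function.Injective
    (opTauL hϱ hδ hδ1 hδϱ τ : Symb J κ κ' q ϱ δ μ₁ μ₂ →ₗ[ℂ] 𝓢(V q, E) →L[ℂ] 𝓢(V q, F)) := by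
  rw [injective_iff_map_eq_zero]
  intro a ha
  have h := isOpTau_opTau hϱ hδ hδ1 hδϱ τ a
  have e : opTau hϱ hδ hδ1 hδϱ τ a = 0 := ha
  rw [e] at h
  exact Subtype.ext (IsSymbol.eq_zero_of_isOpTau_zero hϱ hδ hδ1 hδϱ a.2 h)

/-- The passage from `τ`-symbols to `τ'`-symbols. -/
def changeTauS (τ τ' : ℝ) (a : Symb J κ κ' q ϱ δ μ₁ μ₂) : Symb J κ κ' q ϱ δ μ₁ μ₂ :=
  ⟨changeTau τ τ' a.fn, IsSymbol.changeTau hϱ hδ hδ1 hδϱ a.2 τ τ'⟩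

lemma opTauL_changeTauS (τ τ' : ℝ) (a : Symb J κ κ' q ϱ δ μ₁ μ₂) :
    opTauL hϱ hδ hδ1 hδϱ τ' (changeTauS hϱ hδ hδ1 hδϱ τ τ' a) = opTauL hϱ hδ hδ1 hδϱ τ a := by
  obtain ⟨A, h1, h2⟩ := IsSymbol.exists_isOpTau hϱ hδ hδ1 hδϱ a.2 τ τ'
  have e1 := IsOp.unique (isOpTau_opTau hϱ hδ hδ1 hδϱ τ a) h1
  have e2 := IsOp.unique (isOpTau_opTau hϱ hδ hδ1 hδϱ τ' (changeTauS hϱ hδ hδ1 hδϱ τ τ' a)) h2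
  exact e2.trans e1.symm

/-- Both sides define the same operator, and `Op_τ` is injective on symbols, so no computation with
oscillatory integrals is needed. -/
lemma changeTauS_changeTauS (τ τ' : ℝ) (a : Symb J κ κ' q ϱ δ μ₁ μ₂) :
    changeTauS hϱ hδ hδ1 hδϱ τ' τ (changeTauS hϱ hδ hδ1 hδϱ τ τ' a) = a :=
  opTauL_injective hϱ hδ hδ1 hδϱ τ (by rw [opTauL_changeTauS, opTauL_changeTauS])

/-- The passage from `τ`-symbols to `τ'`-symbols as a linear bijection. -/
def changeTauL (τ τ' : ℝ) : Symb J κ κ' q ϱ δ μ₁ μ₂ ≃ₗ[ℂ] Symb J κ κ' q ϱ δ μ₁ μ₂ where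
  toFun := changeTauS hϱ hδ hδ1 hδϱ τ τ'
  invFun := changeTauS hϱ hδ hδ1 hδϱ τ' τ
  left_inv := changeTauS_changeTauS hϱ hδ hδ1 hδϱ τ τ'
  right_inv := changeTauS_changeTauS hϱ hδ hδ1 hδϱ τ' τ
  map_add' a b := opTauL_injective hϱ hδ hδ1 hδϱ τ' (by
    simp only [map_add, opTauL_changeTauS])
  map_smul' c a := opTauL_injective hϱ hδ hδ1 hδϱ τ' (by
    simp only [map_smul, opTauL_changeTauS, RingHom.id_apply])

omit [CompleteSpace (J.Comp E F)] in
lemma symbNorm_le (K : ℕ) (a : Symb J κ κ' q ϱ δ μ₁ μ₂) :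
    symbNorm K a ≤ (box q K ×ˢ box q K).card
      * ((box q K ×ˢ box q K).sup (symbSeminorm J κ κ' ϱ δ μ₁ μ₂ q)) a := by
  have h2 := Finset.sum_le_card_nsmul (box q K ×ˢ box q K)
    (fun k => symbSeminorm J κ κ' ϱ δ μ₁ μ₂ q k a) _
    fun k hk => Seminorm.le_finset_sup_apply (p := symbSeminorm J κ κ' ϱ δ μ₁ μ₂ q) (x := a) hk
  rwa [nsmul_eq_mul] at h2

lemma exists_symbSeminorm_changeTau_le (τ τ' : ℝ) (α β : Fin q → ℕ) :
    ∃ s : Finset ((Fin q → ℕ) × (Fin q → ℕ)), ∃ C : ℝ, ∀ a : Symb J κ κ' q ϱ δ μ₁ μ₂,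
      symbSeminorm J κ κ' ϱ δ μ₁ μ₂ q (α, β) (changeTauS hϱ hδ hδ1 hδϱ τ τ' a)
        ≤ C * (s.sup (symbSeminorm J κ κ' ϱ δ μ₁ μ₂ q)) a := by
  obtain ⟨K, C, hC0, hC⟩ := exists_changeTau_bound (J := J) (κ := κ) (κ' := κ') hϱ hδ hδ1 hδϱ q μ₁ μ₂
    τ τ' (len α + len β)
  refine ⟨box q K ×ˢ box q K, C * (box q K ×ˢ box q K).card, fun a => ?_⟩
  have h1 := hC a.fn (symbNorm K a) a.2 (sbd_symbNorm K a)
  refine (symbSeminorm_le (a := changeTauS hϱ hδ hδ1 hδϱ τ τ' a) h1).trans ?_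
  rw [mul_assoc]
  exact mul_le_mul_of_nonneg_left (symbNorm_le K a) hC0

lemma continuous_changeTauL (τ τ' : ℝ) : Continuous
    (changeTauL hϱ hδ hδ1 hδϱ τ τ' : Symb J κ κ' q ϱ δ μ₁ μ₂ ≃ₗ[ℂ] Symb J κ κ' q ϱ δ μ₁ μ₂) := by
  have hp := withSeminorms_symb (q := q) J κ κ' ϱ δ μ₁ μ₂
  have tg := hp.topologicalAddGroup
  have hb : Seminorm.IsBounded (symbSeminorm J κ κ' ϱ δ μ₁ μ₂ q)
      (symbSeminorm J κ κ' ϱ δ μ₁ μ₂ q) (changeTauL (J := J) (κ := κ) (κ' := κ') (q := q) (μ₁ := μ₁)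
        (μ₂ := μ₂) hϱ hδ hδ1 hδϱ τ τ').toLinearMap :=
    Seminorm.IsBounded.of_real fun k =>
      exists_symbSeminorm_changeTau_le hϱ hδ hδ1 hδϱ τ τ' k.1 k.2
  exact hp.continuous_of_isBounded hp _ hb

/-- The linear bijections onto the space of operators. -/
theorem exists_psi (q : ℕ) (J : NormedOperatorIdeal.{u}) {E F : SepHilb.{u}} (κ : GroupAction E)
    (κ' : GroupAction F) [CompleteSpace (J.Comp E F)] (hϱ : 0 ≤ ϱ) (hδ : 0 ≤ δ) (hδ1 : δ < 1)
    (hδϱ : δ < ϱ) (μ₁ μ₂ : ℝ) :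
    ∃ Ψ : Submodule ℂ (𝓢(V q, E) →L[ℂ] 𝓢(V q, F)),
      (∀ τ : ℝ, (Ψ : Set (𝓢(V q, E) →L[ℂ] 𝓢(V q, F))) = psiClass J κ κ' q ϱ δ μ₁ μ₂ τ) ∧
      ∃ Q : ℝ → (Symb J κ κ' q ϱ δ μ₁ μ₂ ≃ₗ[ℂ] Ψ),
        (∀ (τ : ℝ) (a : Symb J κ κ' q ϱ δ μ₁ μ₂),
          IsOpTau τ a.fn (Q τ a : 𝓢(V q, E) →L[ℂ] 𝓢(V q, F))) ∧
        ∃ t : TopologicalSpace Ψ,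
          (∀ τ : ℝ, t = TopologicalSpace.coinduced (Q τ) inferInstance) ∧ @IsFrechet Ψ _ _ t := by
  set L : ℝ → (Symb J κ κ' q ϱ δ μ₁ μ₂ →ₗ[ℂ] 𝓢(V q, E) →L[ℂ] 𝓢(V q, F)) :=
    opTauL hϱ hδ hδ1 hδϱ with hL
  have hLop : ∀ τ a, IsOpTau τ a.fn (L τ a) := fun τ a => isOpTau_opTau hϱ hδ hδ1 hδϱ τ a
  have hchange : ∀ τ τ' a, L τ' (changeTauL hϱ hδ hδ1 hδϱ τ τ' a) = L τ a := fun τ τ' a =>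
    opTauL_changeTauS hϱ hδ hδ1 hδϱ τ τ' a
  -- The changes of symbol in both directions give the two inclusions.
  have hrange : ∀ τ, LinearMap.range (L τ) = LinearMap.range (L 0) := fun τ =>
    le_antisymm
      (by rintro _ ⟨a, rfl⟩; exact ⟨_, hchange τ 0 a⟩)
      (by rintro _ ⟨a, rfl⟩; exact ⟨_, hchange 0 τ a⟩)
  let Q : ℝ → (Symb J κ κ' q ϱ δ μ₁ μ₂ ≃ₗ[ℂ] LinearMap.range (L 0)) := fun τ =>
    (LinearEquiv.ofInjective (L τ) (opTauL_injective hϱ hδ hδ1 hδϱ τ)).trans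
      (LinearEquiv.ofEq _ _ (hrange τ))
  have hQ : ∀ τ a, (Q τ a : 𝓢(V q, E) →L[ℂ] 𝓢(V q, F)) = L τ a := fun τ a => rfl
  refine ⟨LinearMap.range (L 0), fun τ => ?_, Q, fun τ a => by rw [hQ]; exact hLop τ a,
    TopologicalSpace.coinduced (Q 0) inferInstance, fun τ => ?_, isFrechet_symb.coinduced (Q 0)⟩
  · rw [← hrange τ]
    ext A
    constructor
    · rintro ⟨a, rfl⟩
      exact ⟨a.fn, a.2, hLop τ a⟩
    · rintro ⟨a, ha, hA⟩
      exact ⟨⟨a, ha⟩, IsOp.unique (hLop τ ⟨a, ha⟩) hA⟩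
  -- The change from `0`-symbols to `τ`-symbols is a homeomorphism that intertwines `Q 0` with `Q
  -- τ`, so both transfer the same topology.
  · let e : Symb J κ κ' q ϱ δ μ₁ μ₂ ≃ₜ Symb J κ κ' q ϱ δ μ₁ μ₂ :=
      ⟨(changeTauL hϱ hδ hδ1 hδϱ 0 τ).toEquiv, continuous_changeTauL hϱ hδ hδ1 hδϱ 0 τ,
        continuous_changeTauL hϱ hδ hδ1 hδϱ τ 0⟩
    have he : (Q τ : Symb J κ κ' q ϱ δ μ₁ μ₂ → LinearMap.range (L 0)) ∘ e = Q 0 := by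
      funext a
      exact Subtype.ext (hchange 0 τ a)
    rw [← he]
    exact coinduced_comp_homeomorph e (Q τ)

end Operators

end EdgePsiDO

end

theorem mainTheorem1 (q : ℕ) (J : BanachOperatorIdeal.{u}) (E F : SepHilb.{u})
    (κ : GroupAction E) (κ' : GroupAction F)
    (ϱ δ : ℝ) (hδ : 0 ≤ δ) (hδϱ : δ < ϱ) (hϱ : ϱ ≤ 1) :
    (∀ (τ μ₁ μ₂ μ₃ : ℝ) (a : V q × V q × V q → J.Comp E F),
      IsDoubleSymbol J.toNormedOperatorIdeal κ κ' ϱ δ μ₁ μ₂ μ₃ a →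
      ∃ b : V q × V q → J.Comp E F,
        IsSymbol J.toNormedOperatorIdeal κ κ' ϱ δ μ₁ (μ₂ + μ₃) b ∧
        (∀ y η : V q, ∃ L : J.Comp E F,
          HasOscIntegral
            (fun p : V q × V q => a (y - τ • p.1, y + (1 - τ) • p.1, η + p.2)) L ∧
          b (y, η) = ((2 * Real.pi) ^ q)⁻¹ • L) ∧
        (∃ A : 𝓢(V q, E) →L[ℂ] 𝓢(V q, F), IsOp a A ∧ IsOpTau τ b A) ∧
        ∀ N : ℕ, IsSymbol J.toNormedOperatorIdeal κ κ' ϱ δ (μ₁ - (ϱ - δ) * N) (μ₂ + μ₃)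
          (fun p => b p - ∑ k ∈ pairsBelow q N, expansionTerm τ a k.1 k.2 p)) ∧
    (∀ μ₁ μ₂ : ℝ,
      ∃ Ψ : Submodule ℂ (𝓢(V q, E) →L[ℂ] 𝓢(V q, F)),
        (∀ τ : ℝ, (Ψ : Set (𝓢(V q, E) →L[ℂ] 𝓢(V q, F)))
          = psiClass J.toNormedOperatorIdeal κ κ' q ϱ δ μ₁ μ₂ τ) ∧
        ∃ Q : ℝ → (Symb J.toNormedOperatorIdeal κ κ' q ϱ δ μ₁ μ₂ ≃ₗ[ℂ] Ψ),
          (∀ (τ : ℝ) (a : Symb J.toNormedOperatorIdeal κ κ' q ϱ δ μ₁ μ₂),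
            IsOpTau τ a.fn (Q τ a : 𝓢(V q, E) →L[ℂ] 𝓢(V q, F))) ∧
          ∃ t : TopologicalSpace Ψ,
            (∀ τ : ℝ, t = TopologicalSpace.coinduced (Q τ) inferInstance) ∧
            @IsFrechet Ψ _ _ t) := by
  -- The bound `ϱ ≤ 1` serves to ensure `δ < 1`, the positivity of the gain in each integration by
  -- parts.
  have hδ1 : δ < 1 := hδϱ.trans_le hϱ
  have hϱ0 : 0 ≤ ϱ := hδ.trans hδϱ.le
  exact ⟨fun τ μ₁ μ₂ μ₃ a ha => exists_reduction hϱ0 hδ hδ1 hδϱ τ ha,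
    fun μ₁ μ₂ => exists_psi q J.toNormedOperatorIdeal κ κ' hϱ0 hδ hδ1 hδϱ μ₁ μ₂⟩
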